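/- Let $a\in\mathbb R\setminus\{0,\frac89\}$, $U(x)=\frac12x^2-\frac23x^3+\frac a4x^4$ and $H(x,y)=\frac12y^2+U(x)$. For polynomials $f,g\in\mathbb R[x,y]$ of degree at most three, not depending on $\varepsilon$, consider the perturbed system $$\dot x=H_y+\varepsilon f(x,y),\qquad \dot y=-H_x+\varepsilon g(x,y),\qquad \varepsilon>0 \text{ small.}$$ Let $\delta(h)\subset\{H=h\}$, $h\in\Sigma=\Sigma(a)$, be the ovals of the period annulus around the center at the origin, where $\Sigma=(0,h_s)$ with $0<h_s\le\infty$. Let $d(h,\varepsilon)=\varepsilon M_1(h)+\varepsilon^2M_2(h)+\cdots$ be the displacement function ($H$ at the first return minus $h$) on the part of the positive $x$-axis that meets these ovals, parametrized by the value $h$ of $H$. We speak of $M_k$ only for perturbations with $M_1=\dots=M_{k-1}\equiv0$ on $\Sigma$. Say that for the parameter $a$ the coefficient $M_k$ can produce $m$ limit cycles of energy less than $\rho$ if for some $f,g$ the function $M_k$ is not identically zero and has $m$ distinct zeros $h_1,\dots,h_m\in\Sigma\cap(0,\rho)$ such that, for every $\eta>0$ and all sufficiently small $\varepsilon>0$,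 the perturbed system has $m$ distinct limit cycles $C_1,\dots,C_m$, where $C_i$ has Hausdorff distance less than $\eta$ from $\delta(h_i)$. (1) For every $\rho>0$ there is $\delta_0>0$ such that for every $a\in(-\frac83-\delta_0,-\frac83)$ the coefficient $M_1$ can produce four limit cycles of energy less than $\rho$. (2) For every $\rho>0$ there is $\delta_0>0$ such that for every $a\in(-\frac89-\delta_0,-\frac89)$ the coefficient $M_2$ can produce six limit cycles of energy less than $\rho$. (3) Let $a\ne0,\frac89$ and $k\in\{1,2,3,4\}$, with $a\neq-\frac83$ if $k=1$ and $a\ne-\frac89$ if $k=2$. Then the functions $M_k$ on $\Sigma(a)$ form a real vector space of dimension $n_k$, or a finite union of real vector spaces of dimension $n_k$, where $n_1=4$, $n_2=6$, $n_3=5$, $n_4=1$, and the number of small limit cycles around the origin produced by $M_k$ is exactly $n_k-1$, in the following sense. (i) For every $\rho>0$ the coefficient $M_k$ can produce $n_k-1$ limit cycles of energy less than $\rho$ for the parameter $a$. (ii) There are $\rho>0$ and a neighbourhood of $a$ such that for every parameter $b$ in this neighbourhood and every perturbation with $M_k\not\equiv0$, the function $M_k$ has at most $n_k-1$ zeros in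 $\Sigma(b)\cap(0,\rho)$; moreover, for all $0<r_1\le r_2<\rho$ with $r_2\in\Sigma(b)$ and all sufficiently small $\varepsilon>0$, the perturbed system has at most $n_k-1$ limit cycles contained in $\bigcup_{r_1\le h\le r_2}\delta(h)$. -/

import Mathlib

open Set Filter Topology

namespace CubicPert

noncomputable section

/-- The univariate potential `U(x) = x²/2 - 2x³/3 + a x⁴/4`. -/
def potential (a x : ℝ) : ℝ := x ^ 2 / 2 - 2 / 3 * x ^ 3 + a / 4 * x ^ 4

/-- The Hamiltonian `H(x,y) = y²/2 + U(x)`. -/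
def ham (a : ℝ) (p : ℝ × ℝ) : ℝ := p.2 ^ 2 / 2 + potential a p.1

/-- The perturbed field `ẋ = H_y + ε f(x,y)`, `ẏ = -H_x + ε g(x,y)`. -/
def field (a : ℝ) (f g : MvPolynomial (Fin 2) ℝ) (ε : ℝ) (p : ℝ × ℝ) : ℝ × ℝ :=
  (p.2 + ε * MvPolynomial.eval ![p.1, p.2] f,
    -(p.1 - 2 * p.1 ^ 2 + a * p.1 ^ 3) + ε * MvPolynomial.eval ![p.1, p.2] g)

/-- The points `x > 0` for which `U' > 0` on `(0, x]` (recall `U'(t) = t (1 - 2 t + a t²)`): the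
positive half-axis up to the nearest critical point of `U`, if there is one. The segment
`crossSection a × {0}` is transversal to the unperturbed flow and meets every oval around the
origin in the period annulus of the origin exactly once. -/
def crossSection (a : ℝ) : Set ℝ := {x | 0 < x ∧ ∀ t ∈ Ioc 0 x, 0 < 1 - 2 * t + a * t ^ 2}

/-- The interval `Σ = (0, h_s)` (or `(0, ∞)` if `a > 1`) of energies of the ovals that form the
period annulus around the origin. -/
def levels (a : ℝ) : Set ℝ := potential a '' crossSection a

/-- The oval `δ(h)` around the origin: the points of `{H = h}` whose abscissa lies in the
connected component of `{U ≤ h}` that contains `0`. -/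
def oval (a h : ℝ) : Set (ℝ × ℝ) :=
  {p | ham a p = h ∧ ∀ s ∈ Icc (0 : ℝ) 1, potential a (s * p.1) ≤ h}

/-- `x₁` is the abscissa of the first return to the cross-section of the orbit of `X` that starts
at the point `(x₀, 0)` of the cross-section. -/
def IsFirstReturn (a : ℝ) (X : ℝ × ℝ → ℝ × ℝ) (x₀ x₁ : ℝ) : Prop :=
  x₀ ∈ crossSection a ∧ x₁ ∈ crossSection a ∧
    ∃ (T : ℝ) (γ : ℝ → ℝ × ℝ), 0 < T ∧
      (∀ t ∈ Icc 0 T, HasDerivWithinAt γ (X (γ t)) (Icc 0 T) t) ∧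
      γ 0 = (x₀, 0) ∧ γ T = (x₁, 0) ∧
      ∀ t ∈ Ioo 0 T, ¬ ((γ t).1 ∈ crossSection a ∧ (γ t).2 = 0)

/-- `v = d(h, ε)`: the displacement `H(first return) - h` of the field with parameter `ε`, on the
cross-section parametrized by the value `h` of the Hamiltonian. -/
def IsDisplacement (a : ℝ) (f g : MvPolynomial (Fin 2) ℝ) (ε h v : ℝ) : Prop :=
  ∃ x₀ x₁ : ℝ, IsFirstReturn a (field a f g ε) x₀ x₁ ∧
    potential a x₀ = h ∧ potential a x₁ - h = v

/-- The coefficients of `ε, …, ε^(k-1)` in the expansion of `d(h, ε)` vanish identically on `Σ`,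
and `M` is the coefficient `M_k` of `ε^k`. That is, for every `h ∈ Σ`,
`d(h, ε) = ε^k M(h) + o(ε^k)` as `ε → 0+`. -/
def IsCoeff (a : ℝ) (f g : MvPolynomial (Fin 2) ℝ) (k : ℕ) (M : levels a → ℝ) : Prop :=
  ∀ h : levels a, ∃ d : ℝ → ℝ,
    (∀ᶠ ε in 𝓝[>] (0 : ℝ), IsDisplacement a f g ε h (d ε)) ∧
    (fun ε => d ε - ε ^ k * M h) =o[𝓝[>] (0 : ℝ)] (fun ε => ε ^ k)

/-- All functions `M_k`: those of all cubic perturbations with `M_1 = … = M_(k-1) = 0`. -/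
def coeffSet (a : ℝ) (k : ℕ) : Set (levels a → ℝ) :=
  {M | ∃ f g : MvPolynomial (Fin 2) ℝ, f.totalDegree ≤ 3 ∧ g.totalDegree ≤ 3 ∧ IsCoeff a f g k M}

/-- The functions `M_k` form a vector space of dimension `n`, or a finite union of vector spaces
of dimension `n`. -/
def HasDimension (a : ℝ) (k n : ℕ) : Prop :=
  ∃ S : Set (Submodule ℝ (levels a → ℝ)), S.Finite ∧ S.Nonempty ∧
    (∀ V ∈ S, Module.finrank ℝ V = n) ∧ coeffSet a k = ⋃ V ∈ S, (V : Set (levels a → ℝ))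

/-- `C` is the orbit of a nonconstant periodic solution of `X`. -/
def IsPeriodicOrbit (X : ℝ × ℝ → ℝ × ℝ) (C : Set (ℝ × ℝ)) : Prop :=
  ∃ (γ : ℝ → ℝ × ℝ) (T : ℝ), 0 < T ∧ (∀ t, HasDerivAt γ (X (γ t)) t) ∧
    (∀ t, γ (t + T) = γ t) ∧ (∃ t, γ t ≠ γ 0) ∧ C = range γ

/-- A limit cycle is an isolated periodic orbit. -/
def IsLimitCycle (X : ℝ × ℝ → ℝ × ℝ) (C : Set (ℝ × ℝ)) : Prop :=
  IsPeriodicOrbit X C ∧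
    ∃ W : Set (ℝ × ℝ), IsOpen W ∧ C ⊆ W ∧ ∀ C', IsPeriodicOrbit X C' → C' ⊆ W → C' = C

/-- Some `M_k`, not identically zero, produces `m` limit cycles of energy less than `ρ` around the
origin: it has `m` distinct zeros `z i < ρ`, and for all sufficiently small `ε > 0` the perturbed
field has `m` distinct limit cycles, one close to each of the ovals `δ(z i)`. -/
def CanProduce (a : ℝ) (k m : ℕ) (ρ : ℝ) : Prop :=
  ∃ f g : MvPolynomial (Fin 2) ℝ, f.totalDegree ≤ 3 ∧ g.totalDegree ≤ 3 ∧
    ∃ M : levels a → ℝ, IsCoeff a f g k M ∧ M ≠ 0 ∧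
      ∃ z : Fin m → levels a, Function.Injective z ∧
        (∀ i, (z i : ℝ) < ρ ∧ M (z i) = 0) ∧
        ∀ η : ℝ, 0 < η → ∀ᶠ ε in 𝓝[>] (0 : ℝ),
          ∃ C : Fin m → Set (ℝ × ℝ), Function.Injective C ∧
            ∀ i, IsLimitCycle (field a f g ε) (C i) ∧
              Metric.hausdorffEDist (C i) (oval a (z i)) < ENNReal.ofReal η

/-- No `M_k` that is not identically zero produces more than `m` limit cycles of energy less than
`ρ`: it has at most `m` zeros `h < ρ`, and in every compact annulus filled with ovals of energies
in `[r₁, r₂] ⊆ Σ`, `r₂ < ρ`, the perturbed field has at most `m` limit cycles if `ε > 0` is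
sufficiently small. -/
def ProducesAtMost (a : ℝ) (k m : ℕ) (ρ : ℝ) : Prop :=
  ∀ f g : MvPolynomial (Fin 2) ℝ, f.totalDegree ≤ 3 → g.totalDegree ≤ 3 →
    ∀ M : levels a → ℝ, IsCoeff a f g k M → M ≠ 0 →
      {h : levels a | (h : ℝ) < ρ ∧ M h = 0}.encard ≤ m ∧
      ∀ r₁ r₂ : ℝ, 0 < r₁ → r₁ ≤ r₂ → r₂ < ρ → r₂ ∈ levels a →
        ∀ᶠ ε in 𝓝[>] (0 : ℝ),
          {C | IsLimitCycle (field a f g ε) C ∧ C ⊆ ⋃ h ∈ Icc r₁ r₂, oval a h}.encard ≤ m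

/-- The number of small limit cycles around the origin that the functions `M_k` produce, for the
Hamiltonian parameters close to `a`, equals `m`: there are never more than `m` of them, in a
neighbourhood of the origin that can be chosen uniformly for parameters near `a`, and `m` of them
occur at `a` in every neighbourhood of the origin. -/
def NumberOfSmallCycles (a : ℝ) (k m : ℕ) : Prop :=
  (∃ ρ > 0, ∀ᶠ b in 𝓝 a, ProducesAtMost b k m ρ) ∧ ∀ ρ > 0, CanProduce a k m ρ

end

end CubicPert

/-! In the coordinate `u = amp a x`, for which `U = u²/2`, the ovals become circles. In polar
coordinates `u = s cos θ`, `y = -s sin θ` a perturbed orbit is a radius function that solves an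
integral equation over one turn. The implicit function theorem in the Banach algebra of continuous
functions of the angle solves it, smoothly in the energy and in `ε` (`exists_radius`).

The coefficients come from Françoise's algorithm. With `ω = g dx - f dy`, orbits satisfy `dH = ε ω`.
Given a chain of relations `q_j ω = q_{j+1} dH + dQ_j`, the energy corrected by the terms `ε^(j+1)
Q_j` changes over one turn by exactly `ε^(k+1)` times the integral of `q_k ω` along the orbit
(`Chain.corr_sub`). Hence `M_{k+1}` is that integral over the ovals (`Chain.isCoeff`), and the fixed
points of the return map are the zeros of a smooth deformation of `M_{k+1}`
(`Chain.exists_localModel`).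

A cubic perturbation has the form `ω = d(Q - N) + q dH + (A + A3 y²/3) y dx` with `N' = q U'`
(`exists_NF`). The algorithm shows that `M_1`, `M_2`, `M_3` run through all integrals `∮ p(x) y dx`
with `deg p` at most `4`, `6`, `5` (`realizes_zero`, `realizes_one`, `realizes_two`), where the
multiples of `U'` give the only relations (`eq_of_mel_eq_zero`). The functions `M_4` are the
multiples of `∮ V V' y dx` for `V` in a finite list of divisors of `U'` (`exists_gen_three`,
`exists_perturbation_three`).

Zeros are counted near the equilibrium. One has `∮ F'(x) y dx = h · osc`, and the derivatives of
`osc` at `h = 0` are positive multiples of the odd derivatives of `F` with respect to `u`. If the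
`j`-th basis element is a function of `U` plus `x^(2j+1) R` with `R 0 ≠ 0`, the matrix of these
derivatives is triangular and invertible at the equilibrium. So it stays invertible nearby,
uniformly in the parameter, even when each row is evaluated at its own point (`exists_cheb`).
Rolle's theorem then bounds the zeros of `M_k` and those of its deformation. Conversely, small
multiples of elements of lower and lower order create sign changes. When the maximal number of zeros
is attained, they are simple (`Cheb.simple`) and persist as limit cycles (`exists_limitCycle`).

In degree `4` the last basis element `e4` loses its leading coefficient at `a = -8/3`; in degree `6`
the same happens to `e6` at `a = -8/9`. There an auxiliary odd power restores a Chebyshev system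
with one element more. On the side where the small leading coefficient and the next one have
opposite signs, `e4` or `e6` itself contributes one more zero (`Expands.exists_alt`). -/

open scoped ContDiff

namespace CubicPert

noncomputable section

/-! ### The action coordinate of the unperturbed system -/

/-- The factor `U'(x) / x`. -/
def slope (a x : ℝ) : ℝ := 1 - 2 * x + a * x ^ 2

/-- The factor `2 U(x) / x²`. -/
def wsq (a x : ℝ) : ℝ := 1 - 4 / 3 * x + a / 2 * x ^ 2

/-- The points `x` such that no critical point of `U` lies in `(0, |x|]`. -/
def basin (a : ℝ) : Set ℝ := {x | ∀ t ∈ Icc 0 |x|, 0 < slope a t}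

/-- The odd square root of `2 U`. -/
def amp (a x : ℝ) : ℝ := x * √(wsq a x)

/-- The inverse of `amp a` on the basin. -/
def absc (a v : ℝ) : ℝ := Function.invFunOn (amp a) (basin a) v

/-- The abscissa of the intersection of the oval of energy `h` with the cross-section. -/
def sec (a h : ℝ) : ℝ := absc a √(2 * h)

lemma basin_mono {a x y : ℝ} (hx : x ∈ basin a) (h : |y| ≤ |x|) : y ∈ basin a :=
  fun t ht => hx t ⟨ht.1, ht.2.trans h⟩

/-- Passing from `x` to `|x|` affects only the linear term `-2 x` and lowers it, so the values on
the right half of the symmetric basin decide. -/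
lemma slope_pos {a x : ℝ} (hx : x ∈ basin a) : 0 < slope a x := by
  have h := hx |x| ⟨abs_nonneg x, le_rfl⟩
  unfold slope at *
  rw [sq_abs] at h
  have := le_abs_self x
  linarith

lemma zero_mem_basin (a : ℝ) : (0 : ℝ) ∈ basin a := by
  intro t ht
  have : t = 0 := le_antisymm (by simpa using ht.2) ht.1
  simp [this, slope]

lemma crossSection_eq (a : ℝ) : crossSection a = basin a ∩ Ioi 0 := by
  ext x
  constructor
  · rintro ⟨h0, h⟩
    refine ⟨fun t ht => ?_, h0⟩
    rw [abs_of_pos h0] at ht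
    rcases eq_or_lt_of_le ht.1 with h1 | h1
    · simp [← h1, slope]
    · exact h t ⟨h1, ht.2⟩
  · rintro ⟨h, h0⟩
    have h0' : 0 < x := h0
    exact ⟨h0, fun t ht => h t ⟨ht.1.le, by rw [abs_of_pos h0']; exact ht.2⟩⟩

/-- Simpson's rule is exact here: `wsq a x = (slope a x + 2 * slope a (x / 2)) / 3`. -/
lemma wsq_pos {a x : ℝ} (hx : x ∈ basin a) : 0 < wsq a x := by
  have h1 := slope_pos hx
  have h2 := slope_pos (basin_mono (y := x / 2) hx (by
    rw [abs_div, abs_two]; linarith [abs_nonneg x]))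
  unfold slope at h1 h2
  unfold wsq
  nlinarith

lemma potential_eq {a x : ℝ} (hx : x ∈ basin a) : potential a x = amp a x ^ 2 / 2 := by
  have := Real.sq_sqrt (wsq_pos hx).le
  rw [amp, mul_pow, this]
  unfold potential wsq
  ring

lemma hasStrictDerivAt_wsq (a x : ℝ) : HasStrictDerivAt (wsq a) (-(4 / 3) + a * x) x := by
  unfold wsq
  have := (((hasStrictDerivAt_id x).const_mul (4 / 3)).const_sub 1).add
    (((hasStrictDerivAt_id x).pow 2).const_mul (a / 2))
  convert! this using 1
  simp; ring

lemma hasDerivAt_amp {a x : ℝ} (hx : x ∈ basin a) :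
    HasDerivAt (amp a) (slope a x / √(wsq a x)) x := by
  have hw := wsq_pos hx
  have h := (hasDerivAt_id x).mul ((hasStrictDerivAt_wsq a x).hasDerivAt.sqrt hw.ne')
  convert! h using 1
  have h1 := Real.sq_sqrt hw.le
  have h2 := Real.sqrt_pos.2 hw
  simp only [id]
  field_simp
  rw [h1]
  unfold slope wsq
  ring

lemma convex_basin (a : ℝ) : Convex ℝ (basin a) := by
  apply OrdConnected.convex
  refine ⟨fun x hx y hy z hz => ?_⟩
  rcases le_total |x| |y| with h | h
  · refine basin_mono hy (abs_le.2 ⟨?_, hz.2.trans (le_abs_self y)⟩)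
    have := neg_abs_le x
    linarith [hz.1]
  · refine basin_mono hx (abs_le.2 ⟨(neg_abs_le x).trans hz.1, ?_⟩)
    have := le_abs_self y
    linarith [hz.2]

lemma strictMonoOn_amp (a : ℝ) : StrictMonoOn (amp a) (basin a) := by
  apply strictMonoOn_of_deriv_pos (convex_basin a)
  · exact fun x hx => (hasDerivAt_amp hx).continuousAt.continuousWithinAt
  · intro x hx
    have hx := interior_subset hx
    rw [(hasDerivAt_amp hx).deriv]
    exact div_pos (slope_pos hx) (Real.sqrt_pos.2 (wsq_pos hx))

lemma absc_amp {a x : ℝ} (hx : x ∈ basin a) : absc a (amp a x) = x :=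
  (strictMonoOn_amp a).injOn.leftInvOn_invFunOn hx

lemma absc_zero (a : ℝ) : absc a 0 = 0 := by
  have := absc_amp (zero_mem_basin a)
  simpa [amp] using this

/-- Rescaling `t` to `[0, 1]` makes the range of the quantifier independent of `x`; compactness of
that range then gives a neighbourhood in both variables. -/
lemma isOpen_basin : IsOpen {z : ℝ × ℝ | z.2 ∈ basin z.1} := by
  have : {z : ℝ × ℝ | z.2 ∈ basin z.1} =
      {z : ℝ × ℝ | ∀ t ∈ Icc (0 : ℝ) 1, 0 < slope z.1 (t * |z.2|)} := by
    ext z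
    simp only [basin, mem_ofPred_eq]
    constructor
    · intro h t ht
      exact h _ ⟨mul_nonneg ht.1 (abs_nonneg _), mul_le_of_le_one_left (abs_nonneg _) ht.2⟩
    · intro h t ht
      rcases eq_or_lt_of_le (abs_nonneg z.2) with h0 | h0
      · have : t = 0 := le_antisymm (by rw [h0]; exact ht.2) ht.1
        simp [this, slope]
      · have := h (t / |z.2|) ⟨div_nonneg ht.1 h0.le, (div_le_one h0).2 ht.2⟩
        rwa [div_mul_cancel₀ _ h0.ne'] at this
  rw [this, isOpen_iff_mem_nhds]
  intro z hz
  have : ∀ᶠ w in 𝓝 z, ∀ t ∈ Icc (0 : ℝ) 1, 0 < slope w.1 (t * |w.2|) := by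
    refine isCompact_Icc.eventually_forall_of_forall_eventually fun t ht => ?_
    have hc : ContinuousAt (fun w : (ℝ × ℝ) × ℝ => slope w.1.1 (w.2 * |w.1.2|)) (z, t) := by
      unfold slope; fun_prop
    exact hc.eventually (lt_mem_nhds (hz t ht))
  exact this

lemma isOpen_basin_fst (a : ℝ) : IsOpen (basin a) :=
  isOpen_basin.preimage (f := fun x : ℝ => (a, x)) (by fun_prop)

lemma amp_pos {a x : ℝ} (hx : x ∈ basin a) (h : 0 < x) : 0 < amp a x :=
  mul_pos h (Real.sqrt_pos.2 (wsq_pos hx))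

/-- Values of `amp` fill a symmetric interval. -/
lemma exists_amp_eq {a x v : ℝ} (hx : x ∈ basin a) (h0 : 0 ≤ x) (hv : |v| ≤ amp a x) :
    ∃ y, |y| ≤ x ∧ amp a y = v := by
  -- `wsq` is at least as large at `-x` as at `x`, so the left half of the well reaches the
  -- amplitude `amp a x` within the distance `x`.
  have hneg : amp a (-x) ≤ -amp a x := by
    unfold amp
    have : √(wsq a x) ≤ √(wsq a (-x)) := Real.sqrt_le_sqrt (by unfold wsq; nlinarith)
    nlinarith
  have hsub : Icc (-x) x ⊆ basin a := fun y hy =>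
    basin_mono hx (by rw [abs_of_nonneg h0]; exact abs_le.2 hy)
  have hc : ContinuousOn (amp a) (Icc (-x) x) := fun y hy =>
    (hasDerivAt_amp (hsub hy)).continuousAt.continuousWithinAt
  obtain ⟨y, hy, rfl⟩ := intermediate_value_Icc (by linarith) hc
    ⟨hneg.trans (abs_le.1 hv).1, (abs_le.1 hv).2⟩
  exact ⟨y, abs_le.2 hy, rfl⟩

/-- The inverse function theorem for `(b, x) ↦ (b, amp b x)`, whose differential is triangular with
the nonzero entry `slope / √wsq`. The parameter is included because later estimates must be uniform
in it. The local inverse agrees with `absc` since it takes values in the basin, where `amp` is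
injective. -/
lemma contDiffAt_absc {a x : ℝ} (hx : x ∈ basin a) (n : ℕ∞) :
    ContDiffAt ℝ n (fun z : ℝ × ℝ => absc z.1 z.2) (a, amp a x) := by
  -- The inverse function theorem needs a positive order; order `0` follows from order `1`.
  wlog hn : n ≠ 0 generalizing n
  · push Not at hn
    subst hn
    exact (this 1 (by simp)).of_le (by simp)
  have hn' : (n : WithTop ℕ∞) ≠ 0 := by exact_mod_cast hn
  let F : ℝ × ℝ → ℝ × ℝ := fun z => (z.1, amp z.1 z.2)
  have hw := wsq_pos hx
  have hF : ContDiffAt ℝ n F (a, x) := by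
    refine contDiffAt_fst.prodMk (contDiffAt_snd.mul (ContDiffAt.sqrt ?_ hw.ne'))
    unfold wsq
    fun_prop
  have hd : 0 < slope a x / √(wsq a x) := div_pos (slope_pos hx) (Real.sqrt_pos.2 hw)
  set d := slope a x / √(wsq a x) with hd_def
  set L := fderiv ℝ (fun z : ℝ × ℝ => amp z.1 z.2) (a, x) with hL
  have hamp : ContDiffAt ℝ n (fun z : ℝ × ℝ => amp z.1 z.2) (a, x) := hF.snd
  have hampd : HasFDerivAt (fun z : ℝ × ℝ => amp z.1 z.2) L (a, x) :=
    (hamp.differentiableAt hn').hasFDerivAt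
  have hL2 : L (0, 1) = d := by
    have h1 : HasDerivAt (fun y : ℝ => ((a, y) : ℝ × ℝ)) (0, 1) x :=
      (hasDerivAt_const x a).prodMk (hasDerivAt_id x)
    have h2 := hampd.comp_hasDerivAt x h1
    exact h2.unique (hasDerivAt_amp hx)
  have hLz : ∀ z : ℝ × ℝ, L z = L (1, 0) * z.1 + d * z.2 := by
    intro z
    have : z = z.1 • ((1, 0) : ℝ × ℝ) + z.2 • ((0, 1) : ℝ × ℝ) := by ext <;> simp
    conv_lhs => rw [this]
    rw [map_add, map_smul, map_smul, hL2, smul_eq_mul, smul_eq_mul]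
    ring
  let e : (ℝ × ℝ) ≃L[ℝ] (ℝ × ℝ) := ContinuousLinearEquiv.equivOfInverse
    ((ContinuousLinearMap.fst ℝ ℝ ℝ).prod L)
    ((ContinuousLinearMap.fst ℝ ℝ ℝ).prod
      (d⁻¹ • (ContinuousLinearMap.snd ℝ ℝ ℝ - L (1, 0) • ContinuousLinearMap.fst ℝ ℝ ℝ)))
    (fun z => by
      ext
      · simp
      · simp [hLz z, hd.ne'])
    (fun z => by
      ext
      · simp
      · have := hLz (z.1, d⁻¹ * (z.2 - L (1, 0) * z.1))
        simp only [ContinuousLinearMap.prod_apply, ContinuousLinearMap.coe_fst',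
          smul_apply, sub_apply,
          ContinuousLinearMap.coe_snd', smul_eq_mul]
        rw [this]
        field_simp
        ring)
  have hF' : HasFDerivAt F (e : (ℝ × ℝ) →L[ℝ] (ℝ × ℝ)) (a, x) :=
    hasFDerivAt_fst.prodMk hampd
  have hli := hF.to_localInverse hF' hn'
  have hc0 : hF.localInverse hF' hn' (F (a, x)) = (a, x) := hF.localInverse_apply_image hF' hn'
  have hb : ∀ᶠ w in 𝓝 (F (a, x)), (hF.localInverse hF' hn' w).2 ∈
      basin (hF.localInverse hF' hn' w).1 :=
    hli.continuousAt.eventually (by rw [hc0]; exact isOpen_basin.mem_nhds hx)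
  have hr : ∀ᶠ w in 𝓝 (F (a, x)), F (hF.localInverse hF' hn' w) = w :=
    (hF.hasStrictFDerivAt' hF' hn').eventually_right_inverse
  refine (hli.snd).congr_of_eventuallyEq ?_
  filter_upwards [hb, hr] with w hw1 hw2
  have h1 : (F (hF.localInverse hF' hn' w)).1 = w.1 := by rw [hw2]
  have h2 : (F (hF.localInverse hF' hn' w)).2 = w.2 := by rw [hw2]
  simp only [F] at h1 h2
  rw [h1] at h2 hw1
  rw [← h2, absc_amp hw1]

lemma hasDerivAt_absc {a x : ℝ} (hx : x ∈ basin a) :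
    HasDerivAt (absc a) (√(wsq a x) / slope a x) (amp a x) := by
  have hd : DifferentiableAt ℝ (absc a) (amp a x) := by
    have h := (contDiffAt_absc hx 1).differentiableAt (by simp)
    exact h.comp (amp a x) (f := fun v : ℝ => ((a, v) : ℝ × ℝ)) (by fun_prop)
  have h1 := hd.hasDerivAt.comp x (hasDerivAt_amp hx)
  have h2 : HasDerivAt (absc a ∘ amp a) 1 x := by
    refine (hasDerivAt_id x).congr_of_eventuallyEq ?_
    filter_upwards [(isOpen_basin_fst a).mem_nhds hx] with y hy
    exact absc_amp hy
  have h3 := h1.unique h2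
  have h4 := slope_pos hx
  have h5 := Real.sqrt_pos.2 (wsq_pos hx)
  have : deriv (absc a) (amp a x) = √(wsq a x) / slope a x := by
    field_simp at h3 ⊢
    linarith
  rw [← this]
  exact hd.hasDerivAt

/-- The values of `amp` on the basin. -/
def vals (a : ℝ) : Set ℝ := amp a '' basin a

lemma absc_mem {a v : ℝ} (hv : v ∈ vals a) : absc a v ∈ basin a := by
  obtain ⟨x, hx, rfl⟩ := hv
  rwa [absc_amp hx]

lemma amp_absc {a v : ℝ} (hv : v ∈ vals a) : amp a (absc a v) = v := by
  obtain ⟨x, hx, rfl⟩ := hv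
  rw [absc_amp hx]

lemma contDiffAt_absc' {a v : ℝ} (hv : v ∈ vals a) (n : ℕ∞) : ContDiffAt ℝ n (absc a) v := by
  obtain ⟨x, hx, rfl⟩ := hv
  exact (contDiffAt_absc hx n).comp (amp a x) (f := fun v : ℝ => ((a, v) : ℝ × ℝ)) (by fun_prop)

/-- The value `v = amp a x` lies strictly between the values of `amp` at two points around `x`.
These inequalities survive small changes of `a` and `v`, and the intermediate value theorem finds a
preimage. -/
lemma isOpen_vals2 : IsOpen {z : ℝ × ℝ | z.2 ∈ vals z.1} := by
  rw [isOpen_iff_mem_nhds]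
  rintro ⟨a, v⟩ ⟨x, hx, hxv⟩
  dsimp only at hx hxv
  subst hxv
  obtain ⟨r, hr, hr2⟩ := Metric.isOpen_iff.1 (isOpen_basin_fst a) x hx
  have h1 : x - r / 2 ∈ basin a := hr2 (by
    rw [Metric.mem_ball, Real.dist_eq, abs_lt]; constructor <;> linarith)
  have h2 : x + r / 2 ∈ basin a := hr2 (by
    rw [Metric.mem_ball, Real.dist_eq, abs_lt]; constructor <;> linarith)
  have hm := strictMonoOn_amp a
  have hc : ∀ y ∈ basin a, ContinuousAt (fun z : ℝ × ℝ => amp z.1 y) (a, amp a x) := by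
    intro y _
    unfold amp wsq
    fun_prop
  have hbm : ∀ y ∈ basin a, ∀ᶠ z : ℝ × ℝ in 𝓝 (a, amp a x), y ∈ basin z.1 := fun y hy =>
    (show ContinuousAt (fun z : ℝ × ℝ => ((z.1, y) : ℝ × ℝ)) (a, amp a x) by fun_prop).eventually
      (isOpen_basin.mem_nhds hy)
  have e1 : ∀ᶠ z : ℝ × ℝ in 𝓝 (a, amp a x), amp z.1 (x - r / 2) < z.2 :=
    (hc _ h1).eventually_lt continuousAt_snd (hm h1 hx (by linarith))
  have e2 : ∀ᶠ z : ℝ × ℝ in 𝓝 (a, amp a x), z.2 < amp z.1 (x + r / 2) :=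
    continuousAt_snd.eventually_lt (hc _ h2) (hm hx h2 (by linarith))
  filter_upwards [e1, e2, hbm _ h1, hbm _ h2] with z z1 z2 z3 z4
  have hsub : Icc (x - r / 2) (x + r / 2) ⊆ basin z.1 := (convex_basin z.1).ordConnected.out z3 z4
  have hco : ContinuousOn (amp z.1) (Icc (x - r / 2) (x + r / 2)) := fun y hy =>
    (hasDerivAt_amp (hsub hy)).continuousAt.continuousWithinAt
  obtain ⟨y, hy, hy2⟩ := intermediate_value_Icc (by linarith) hco ⟨z1.le, z2.le⟩
  exact ⟨y, hsub hy, hy2⟩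

lemma isOpen_vals (a : ℝ) : IsOpen (vals a) :=
  isOpen_vals2.preimage (f := fun x : ℝ => (a, x)) (by fun_prop)

lemma zero_mem_vals (a : ℝ) : (0 : ℝ) ∈ vals a := ⟨0, zero_mem_basin a, by simp [amp]⟩

/-! ### Energies and ovals -/

lemma sec_potential {a x : ℝ} (hx : x ∈ crossSection a) : sec a (potential a x) = x := by
  rw [crossSection_eq] at hx
  have h := amp_pos hx.1 hx.2
  rw [sec, potential_eq hx.1, mul_div_cancel₀ _ (two_ne_zero), Real.sqrt_sq h.le, absc_amp hx.1]

lemma amp_of_potential {a x : ℝ} (hx : x ∈ crossSection a) :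
    amp a x = √(2 * potential a x) := by
  rw [crossSection_eq] at hx
  have h := amp_pos hx.1 hx.2
  rw [potential_eq hx.1, mul_div_cancel₀ _ (two_ne_zero), Real.sqrt_sq h.le]

lemma sec_mem {a h : ℝ} (hh : h ∈ levels a) : sec a h ∈ crossSection a := by
  obtain ⟨x, hx, rfl⟩ := hh
  rwa [sec_potential hx]

lemma potential_sec {a h : ℝ} (hh : h ∈ levels a) : potential a (sec a h) = h := by
  obtain ⟨x, hx, rfl⟩ := hh
  rw [sec_potential hx]

lemma amp_sec {a h : ℝ} (hh : h ∈ levels a) : amp a (sec a h) = √(2 * h) := by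
  rw [amp_of_potential (sec_mem hh), potential_sec hh]

lemma levels_pos {a h : ℝ} (hh : h ∈ levels a) : 0 < h := by
  obtain ⟨x, hx, rfl⟩ := hh
  rw [crossSection_eq] at hx
  rw [potential_eq hx.1]
  have := amp_pos hx.1 hx.2
  positivity

lemma mem_vals_of_abs_le {a h v : ℝ} (hh : h ∈ levels a) (hv : |v| ≤ √(2 * h)) : v ∈ vals a := by
  have hs := sec_mem hh
  rw [crossSection_eq] at hs
  rw [← amp_sec hh] at hv
  obtain ⟨y, hy, rfl⟩ := exists_amp_eq hs.1 (le_of_lt hs.2) hv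
  exact ⟨y, basin_mono hs.1 (hy.trans (le_abs_self _)), rfl⟩

lemma mem_levels_of_sqrt {a v : ℝ} (h0 : 0 < v) (hv : v ∈ vals a) : v ^ 2 / 2 ∈ levels a := by
  obtain ⟨x, hx, rfl⟩ := hv
  refine ⟨x, ?_, potential_eq hx⟩
  rw [crossSection_eq]
  refine ⟨hx, ?_⟩
  by_contra hn
  have : x ≤ 0 := not_lt.1 hn
  have h1 := Real.sqrt_nonneg (wsq a x)
  unfold amp at h0
  nlinarith

lemma mem_levels_iff {a h : ℝ} : h ∈ levels a ↔ 0 < h ∧ √(2 * h) ∈ vals a := by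
  constructor
  · intro hh
    exact ⟨levels_pos hh, mem_vals_of_abs_le hh (abs_of_nonneg (Real.sqrt_nonneg _)).le⟩
  · rintro ⟨h0, hv⟩
    have := mem_levels_of_sqrt (Real.sqrt_pos.2 (by positivity)) hv
    rwa [Real.sq_sqrt (by positivity), mul_div_cancel_left₀ _ two_ne_zero] at this

lemma isOpen_levels2 : IsOpen {z : ℝ × ℝ | z.2 ∈ levels z.1} := by
  simp only [mem_levels_iff]
  refine IsOpen.inter (isOpen_lt continuous_const continuous_snd) ?_
  exact isOpen_vals2.preimage (f := fun z : ℝ × ℝ => (z.1, √(2 * z.2))) (by fun_prop)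

lemma isOpen_levels (a : ℝ) : IsOpen (levels a) :=
  isOpen_levels2.preimage (f := fun x : ℝ => (a, x)) (by fun_prop)

lemma levels_of_le {a h h' : ℝ} (hh : h ∈ levels a) (h0 : 0 < h') (h1 : h' ≤ h) :
    h' ∈ levels a :=
  mem_levels_iff.2 ⟨h0, mem_vals_of_abs_le hh (by
    rw [abs_of_nonneg (Real.sqrt_nonneg _)]; exact Real.sqrt_le_sqrt (by linarith))⟩

lemma ham_eq {a : ℝ} {p : ℝ × ℝ} (hp : p.1 ∈ basin a) :
    ham a p = (amp a p.1 ^ 2 + p.2 ^ 2) / 2 := by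
  rw [ham, potential_eq hp]; ring

lemma basin_of_abs_le_sec {a h x : ℝ} (hh : h ∈ levels a) (hx : |x| ≤ sec a h) : x ∈ basin a := by
  have hs := sec_mem hh
  rw [crossSection_eq] at hs
  exact basin_mono hs.1 (hx.trans (le_abs_self _))

/-- A point of the basin strip whose energy is a level lies over the segment that the oval spans. -/
lemma abs_le_sec {a h x : ℝ} (hh : h ∈ levels a) (hx : x ∈ basin a) (hU : potential a x ≤ h) :
    |x| ≤ sec a h := by
  have hs := sec_mem hh
  rw [crossSection_eq] at hs
  have hxb : |x| ∈ basin a := basin_mono hx (by simp)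
  by_contra hlt
  push Not at hlt
  have h1 := strictMonoOn_amp a hs.1 hxb hlt
  have h2 := amp_pos hs.1 hs.2
  -- Only the cubic term feels the sign of `x`, and it is lower at `|x|`.
  have h3 : potential a |x| ≤ potential a x := by
    have := le_abs_self x
    have h4 : x ^ 3 ≤ |x| ^ 3 := by rw [← abs_pow]; exact le_abs_self _
    have h5 : |x| ^ 4 = x ^ 4 := by rw [← abs_pow, abs_of_nonneg (by positivity)]
    unfold potential
    rw [sq_abs, h5]
    linarith
  rw [potential_eq hxb] at h3
  have h6 := potential_sec hh
  rw [potential_eq hs.1] at h6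
  nlinarith

/-- If `|p.1|` exceeded `sec a h`, the segment from `0` to `p.1` would contain a point slightly
beyond `sec a h` in absolute value, still in the basin and of potential at most `h`, against
`abs_le_sec`. Conversely `amp` is monotone along the segment, so its square is largest at the end.
-/
lemma mem_oval_iff {a h : ℝ} (hh : h ∈ levels a) {p : ℝ × ℝ} :
    p ∈ oval a h ↔ p.1 ∈ basin a ∧ ham a p = h := by
  have hs := sec_mem hh
  have hs' := hs
  rw [crossSection_eq] at hs
  have hsp : 0 < sec a h := hs.2
  constructor
  · rintro ⟨h1, h2⟩
    refine ⟨?_, h1⟩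
    refine basin_of_abs_le_sec hh ?_
    by_contra hlt
    push Not at hlt
    have hb : ∀ᶠ t in 𝓝[>] (sec a h), t ∈ basin a ∧ t < |p.1| := by
      filter_upwards [nhdsWithin_le_nhds ((isOpen_basin_fst a).mem_nhds hs.1),
        nhdsWithin_le_nhds (Iio_mem_nhds hlt)] with t h1 h2 using ⟨h1, h2⟩
    obtain ⟨t, ⟨ht1, ht2⟩, ht3⟩ := (hb.and self_mem_nhdsWithin).exists
    have ht3' : sec a h < t := ht3
    have ht0 : 0 < t := hsp.trans ht3'
    have hp0 : 0 < |p.1| := ht0.trans ht2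
    have h3 := h2 (t / |p.1|) ⟨by positivity, (div_le_one hp0).2 ht2.le⟩
    have hxx : |t / |p.1| * p.1| = t := by
      rw [abs_mul, abs_div, abs_abs, div_mul_cancel₀ _ hp0.ne', abs_of_pos ht0]
    have := abs_le_sec hh (basin_mono ht1 (by rw [hxx]; exact le_abs_self t)) h3
    rw [hxx] at this
    linarith
  · rintro ⟨h1, h2⟩
    refine ⟨h2, fun s hs1 => ?_⟩
    have hb : s * p.1 ∈ basin a := basin_mono h1 (by
      rw [abs_mul, abs_of_nonneg hs1.1]; exact mul_le_of_le_one_left (abs_nonneg _) hs1.2)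
    rw [ham_eq h1] at h2
    rw [potential_eq hb]
    have hm := (strictMonoOn_amp a).monotoneOn
    have h0 : amp a 0 = 0 := by simp [amp]
    rcases le_total 0 p.1 with hp | hp
    · have e1 := hm (zero_mem_basin a) hb (mul_nonneg hs1.1 hp)
      have e2 := hm hb h1 (mul_le_of_le_one_left hp hs1.2)
      nlinarith [sq_nonneg p.2]
    · have e1 := hm hb (zero_mem_basin a) (mul_nonpos_of_nonneg_of_nonpos hs1.1 hp)
      have e2 := hm h1 hb (by nlinarith [hs1.2])
      nlinarith [sq_nonneg p.2]

/-- The point of polar angle `θ` (in the action coordinate) and radius `s`. -/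
def pt (a s θ : ℝ) : ℝ × ℝ := (absc a (s * Real.cos θ), -(s * Real.sin θ))

lemma ham_pt {a s θ : ℝ} (hv : s * Real.cos θ ∈ vals a) : ham a (pt a s θ) = s ^ 2 / 2 := by
  rw [ham_eq (absc_mem hv), pt, amp_absc hv]
  have := Real.sin_sq_add_cos_sq θ
  linear_combination s ^ 2 / 2 * this

lemma mul_cos_mem {a h s θ : ℝ} (hh : h ∈ levels a) (hs : |s| ≤ √(2 * h)) :
    s * Real.cos θ ∈ vals a := by
  refine mem_vals_of_abs_le hh (le_trans ?_ hs)
  rw [abs_mul]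
  exact mul_le_of_le_one_right (abs_nonneg _) (Real.abs_cos_le_one θ)

lemma exists_polar {u v s : ℝ} (hs : 0 ≤ s) (h : u ^ 2 + v ^ 2 = s ^ 2) :
    ∃ θ ∈ Icc 0 (2 * Real.pi), u = s * Real.cos θ ∧ v = -(s * Real.sin θ) := by
  have hpi := Real.pi_pos
  have key : ∃ φ ∈ Ioc (-Real.pi) Real.pi, u = s * Real.cos φ ∧ -v = s * Real.sin φ := by
    refine ⟨Complex.arg ⟨u, -v⟩, Complex.arg_mem_Ioc _, ?_⟩
    have hn : ‖(⟨u, -v⟩ : ℂ)‖ = s := by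
      rw [Complex.norm_def, Complex.normSq_mk, ← Real.sqrt_sq hs]
      congr 1
      linear_combination h
    have h1 := Complex.norm_mul_cos_arg ⟨u, -v⟩
    have h2 := Complex.norm_mul_sin_arg ⟨u, -v⟩
    rw [hn] at h1 h2
    exact ⟨h1.symm, h2.symm⟩
  obtain ⟨φ, hφ, h1, h2⟩ := key
  rcases le_or_gt 0 φ with h0 | h0
  · exact ⟨φ, ⟨h0, by linarith [hφ.2]⟩, h1, by linarith⟩
  · exact ⟨φ + 2 * Real.pi, ⟨by linarith [hφ.1], by linarith⟩, by
      rw [Real.cos_add_two_pi]; exact h1, by rw [Real.sin_add_two_pi]; linarith⟩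

lemma oval_eq_image {a h : ℝ} (hh : h ∈ levels a) :
    oval a h = pt a √(2 * h) '' Icc 0 (2 * Real.pi) := by
  have h0 := levels_pos hh
  have hsq : √(2 * h) ^ 2 = 2 * h := Real.sq_sqrt (by positivity)
  ext p
  rw [mem_oval_iff hh]
  constructor
  · rintro ⟨h1, h2⟩
    rw [ham_eq h1] at h2
    obtain ⟨θ, hθ, e1, e2⟩ := exists_polar (u := amp a p.1) (v := p.2) (Real.sqrt_nonneg (2 * h))
      (by rw [hsq]; linarith)
    refine ⟨θ, hθ, ?_⟩
    rw [pt, ← e1, ← e2, absc_amp h1]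
  · rintro ⟨θ, -, rfl⟩
    have hv : √(2 * h) * Real.cos θ ∈ vals a :=
      mul_cos_mem hh (abs_of_nonneg (Real.sqrt_nonneg _)).le
    refine ⟨absc_mem hv, ?_⟩
    rw [ham_pt hv, hsq]; ring

/-! ### Superposition operators on spaces of continuous functions -/

section Nemytskii

variable {K : Type*} [TopologicalSpace K]

/-- The superposition operator `σ ↦ φ ∘ σ` (zero where `φ ∘ σ` is not continuous). -/
def nem (φ : ℝ → ℝ) (σ : C(K, ℝ)) : C(K, ℝ) :=
  open Classical in if h : Continuous (fun t => φ (σ t)) then ⟨_, h⟩ else 0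

lemma nem_apply {φ : ℝ → ℝ} {Ω : Set ℝ} (hΩ : IsOpen Ω) (hφ : ContinuousOn φ Ω) {σ : C(K, ℝ)}
    (hσ : ∀ t, σ t ∈ Ω) (t : K) : nem φ σ t = φ (σ t) := by
  have h : Continuous (fun t => φ (σ t)) :=
    continuous_iff_continuousAt.2 fun t =>
      ContinuousAt.comp (hφ.continuousAt (hΩ.mem_nhds (hσ t))) σ.continuous.continuousAt
  simp [nem, h]

variable [CompactSpace K]

lemma eventually_forall_mem {Ω : Set ℝ} (hΩ : IsOpen Ω) {σ : C(K, ℝ)} (hσ : ∀ t, σ t ∈ Ω) :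
    ∀ᶠ τ : C(K, ℝ) in 𝓝 σ, ∀ t, τ t ∈ Ω := by
  have := ContinuousMap.isOpen_setOfPred_mapsTo (X := K) (Y := ℝ) isCompact_univ hΩ
  filter_upwards [this.mem_nhds (fun t _ => hσ t)] with τ hτ t using hτ (mem_univ t)

/-- Strict differentiability of `φ` at each value of `σ`, made uniform by the compactness of `K`,
bounds the remainder in the supremum norm. -/
lemma hasFDerivAt_nem {φ : ℝ → ℝ} {Ω : Set ℝ} (hΩ : IsOpen Ω) (hφ : ContDiffOn ℝ ∞ φ Ω)
    {σ : C(K, ℝ)} (hσ : ∀ t, σ t ∈ Ω) :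
    HasFDerivAt (nem φ) (ContinuousLinearMap.mul ℝ C(K, ℝ) (nem (deriv φ) σ)) σ := by
  have hφ' : ContDiffOn ℝ ∞ (deriv φ) Ω := by
    apply hφ.deriv_of_isOpen hΩ (by simp)
  rw [hasFDerivAt_iff_isLittleO, Asymptotics.isLittleO_iff]
  intro c hc
  have key : ∀ x ∈ Ω, ∀ᶠ z : ℝ × ℝ in 𝓝 (x, x),
      |φ z.2 - φ z.1 - deriv φ z.1 * (z.2 - z.1)| ≤ c * |z.2 - z.1| := by
    intro x hx
    have h1 : ContDiffAt ℝ ∞ φ x := hφ.contDiffAt (hΩ.mem_nhds hx)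
    have h2 := (h1.hasStrictDerivAt (by simp)).isLittleO
    rw [Asymptotics.isLittleO_iff] at h2
    have h3 := h2 (half_pos hc)
    have h4 : ContinuousAt (deriv φ) x := hφ'.continuousOn.continuousAt (hΩ.mem_nhds hx)
    have h5 : ∀ᶠ z : ℝ × ℝ in 𝓝 (x, x), |deriv φ z.1 - deriv φ x| < c / 2 := by
      have : ContinuousAt (fun z : ℝ × ℝ => |deriv φ z.1 - deriv φ x|) (x, x) := by
        refine (ContinuousAt.sub ?_ continuousAt_const).abs
        exact ContinuousAt.comp (f := Prod.fst) (x := (x, x)) h4 continuousAt_fst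
      exact this.eventually (gt_mem_nhds (by simpa using half_pos hc))
    have hsw : Tendsto (fun z : ℝ × ℝ => (z.2, z.1)) (𝓝 (x, x)) (𝓝 (x, x)) :=
      (continuous_swap.tendsto (x, x))
    filter_upwards [hsw.eventually h3, h5] with z h6 h7
    simp only [Real.norm_eq_abs] at h6
    have e : φ z.2 - φ z.1 - deriv φ z.1 * (z.2 - z.1) =
        (φ z.2 - φ z.1 - (ContinuousLinearMap.toSpanSingleton ℝ (deriv φ x)) (z.2 - z.1))
          - (deriv φ z.1 - deriv φ x) * (z.2 - z.1) := by
      simp; ring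
    rw [e]
    refine (abs_sub _ _).trans ?_
    rw [abs_mul]
    nlinarith [abs_nonneg (z.2 - z.1)]
  have huni : ∀ᶠ τ : C(K, ℝ) in 𝓝 σ, ∀ t ∈ (univ : Set K),
      |φ (τ t) - φ (σ t) - deriv φ (σ t) * (τ t - σ t)| ≤ c * |τ t - σ t| := by
    refine isCompact_univ.eventually_forall_of_forall_eventually fun t _ => ?_
    have hc : ContinuousAt (fun z : C(K, ℝ) × K => (σ z.2, z.1 z.2)) (σ, t) := by fun_prop
    exact hc.eventually (key (σ t) (hσ t))
  filter_upwards [huni, eventually_forall_mem hΩ hσ] with τ h1 h2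
  rw [ContinuousMap.norm_le _ (by positivity)]
  intro t
  simp only [ContinuousMap.sub_apply, ContinuousLinearMap.mul_apply', ContinuousMap.mul_apply,
    nem_apply hΩ hφ.continuousOn hσ, nem_apply hΩ hφ.continuousOn h2,
    nem_apply hΩ hφ'.continuousOn hσ, Real.norm_eq_abs]
  refine (h1 t (mem_univ t)).trans ?_
  gcongr
  simpa using ContinuousMap.norm_coe_le_norm (τ - σ) t

/-- The derivative is multiplication by the superposition operator of `deriv φ`: a bounded linear
function of an operator of the same kind. This gives an induction on the order. -/
lemma contDiffAt_nem {φ : ℝ → ℝ} {Ω : Set ℝ} (hΩ : IsOpen Ω) (hφ : ContDiffOn ℝ ∞ φ Ω)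
    {σ : C(K, ℝ)} (hσ : ∀ t, σ t ∈ Ω) : ContDiffAt ℝ ∞ (nem φ : C(K, ℝ) → C(K, ℝ)) σ := by
  rw [contDiffAt_infty]
  intro n
  induction n generalizing φ σ with
  | zero =>
    rw [Nat.cast_zero, contDiffAt_zero]
    refine ⟨_, eventually_forall_mem hΩ hσ, fun τ hτ => ?_⟩
    exact (hasFDerivAt_nem hΩ hφ hτ).continuousAt.continuousWithinAt
  | succ n ih =>
    rw [Nat.cast_succ, contDiffAt_succ_iff_hasFDerivAt]
    refine ⟨fun σ => ContinuousLinearMap.mul ℝ C(K, ℝ) (nem (deriv φ) σ),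
      ⟨_, eventually_forall_mem hΩ hσ, fun τ hτ => hasFDerivAt_nem hΩ hφ hτ⟩, ?_⟩
    exact (ContinuousLinearMap.contDiff _).contDiffAt.comp σ
      (ih (hφ.deriv_of_isOpen hΩ (by simp)) hσ)

end Nemytskii

/-! ### The Banach algebra of continuous functions of the angle -/

lemma two_pi_nonneg : (0 : ℝ) ≤ 2 * Real.pi := Real.two_pi_pos.le

/-- Continuous functions of the angle `θ ∈ [0, 2π]`. -/
abbrev Ang := C(Icc (0 : ℝ) (2 * Real.pi), ℝ)

/-- The cosine as an element of `Ang`. -/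
def cosA : Ang := ⟨fun t => Real.cos t, by fun_prop⟩

/-- The sine as an element of `Ang`. -/
def sinA : Ang := ⟨fun t => Real.sin t, by fun_prop⟩

/-- Continuous extension of `σ` to the real line. -/
def ext (σ : Ang) : ℝ → ℝ := IccExtend two_pi_nonneg σ

lemma continuous_ext (σ : Ang) : Continuous (ext σ) := σ.continuous.Icc_extend'

lemma ext_of_mem (σ : Ang) {θ : ℝ} (h : θ ∈ Icc 0 (2 * Real.pi)) : ext σ θ = σ ⟨θ, h⟩ :=
  IccExtend_of_mem _ _ h

lemma norm_ext_le (σ : Ang) (θ : ℝ) : ‖ext σ θ‖ ≤ ‖σ‖ := ContinuousMap.norm_coe_le_norm σ _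

/-- The primitive that vanishes at `0`. -/
def prim : Ang →L[ℝ] Ang :=
  LinearMap.mkContinuous
    { toFun := fun σ => ⟨fun t => ∫ x in (0 : ℝ)..t, ext σ x,
        (intervalIntegral.continuous_primitive
          (fun _ _ => (continuous_ext σ).intervalIntegrable _ _) 0).comp continuous_subtype_val⟩
      map_add' := fun σ τ => by
        ext t
        simp only [ContinuousMap.add_apply, ContinuousMap.coe_mk]
        rw [← intervalIntegral.integral_add ((continuous_ext σ).intervalIntegrable _ _)
          ((continuous_ext τ).intervalIntegrable _ _)]
        rfl
      map_smul' := fun c σ => by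
        ext t
        simp only [ContinuousMap.smul_apply, ContinuousMap.coe_mk, RingHom.id_apply, smul_eq_mul]
        rw [← intervalIntegral.integral_const_mul]
        rfl } (2 * Real.pi) (fun σ => by
      refine (ContinuousMap.norm_le _ (mul_nonneg two_pi_nonneg (norm_nonneg σ))).2 fun t => ?_
      have := intervalIntegral.norm_integral_le_of_norm_le_const (a := (0 : ℝ)) (b := t)
        (fun x _ => norm_ext_le σ x)
      refine this.trans ?_
      rw [sub_zero, abs_of_nonneg t.2.1, mul_comm]
      exact mul_le_mul_of_nonneg_right t.2.2 (norm_nonneg σ))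

lemma prim_apply (σ : Ang) (t : Icc (0 : ℝ) (2 * Real.pi)) :
    prim σ t = ∫ x in (0 : ℝ)..t, ext σ x := rfl

/-- The integral over a full turn. -/
def tot : Ang →L[ℝ] ℝ :=
  (ContinuousMap.evalCLM ℝ (⟨2 * Real.pi, two_pi_nonneg, le_rfl⟩ : Icc (0 : ℝ) (2 * Real.pi))).comp
    prim

lemma tot_apply (σ : Ang) : tot σ = ∫ x in (0 : ℝ)..(2 * Real.pi), ext σ x := rfl

/-- Evaluation of a polynomial at a pair of functions. -/
def pev (p : MvPolynomial (Fin 2) ℝ) (x y : Ang) : Ang := MvPolynomial.aeval ![x, y] p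

lemma pev_apply (p : MvPolynomial (Fin 2) ℝ) (x y : Ang) (t : Icc (0 : ℝ) (2 * Real.pi)) :
    pev p x y t = MvPolynomial.eval ![x t, y t] p := by
  unfold pev
  induction p using MvPolynomial.induction_on with
  | C c => simp
  | add p q hp hq => simp [hp, hq]
  | mul_X p i hp =>
    simp only [map_mul, ContinuousMap.mul_apply, hp, MvPolynomial.aeval_X, MvPolynomial.eval_X]
    fin_cases i <;> rfl

lemma contDiff_pev (p : MvPolynomial (Fin 2) ℝ) {n : WithTop ℕ∞} :
    ContDiff ℝ n (fun z : Ang × Ang => pev p z.1 z.2) := by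
  unfold pev
  induction p using MvPolynomial.induction_on with
  | C c => simpa using contDiff_const
  | add p q hp hq => simpa using hp.add hq
  | mul_X p i hp =>
    simp only [map_mul, MvPolynomial.aeval_X]
    refine hp.mul ?_
    fin_cases i
    · exact contDiff_fst
    · exact contDiff_snd

/-! ### The perturbed system in polar action coordinates -/

/-- Abscissa along the curve with radius function `σ`. -/
def curX (a : ℝ) (σ : Ang) : Ang := nem (absc a) (σ * cosA)

/-- Ordinate along the curve with radius function `σ`. -/
def curY (σ : Ang) : Ang := -(σ * sinA)

/-- `dx/du` along the curve with radius function `σ`. -/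
def curW (a : ℝ) (σ : Ang) : Ang := nem (deriv (absc a)) (σ * cosA)

/-- `σ` times the angular speed. -/
def den (a : ℝ) (f g : MvPolynomial (Fin 2) ℝ) (z : ℝ × Ang) : Ang :=
  z.2 - z.1 • (pev f (curX a z.2) (curY z.2) * sinA +
    cosA * pev g (curX a z.2) (curY z.2) * curW a z.2)

/-- The reciprocal of the angular speed. -/
def lam (a : ℝ) (f g : MvPolynomial (Fin 2) ℝ) (z : ℝ × Ang) : Ang :=
  z.2 * nem (fun x => x⁻¹) (den a f g z)

/-- `ε Φ` is the derivative of the radius with respect to the angle. -/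
def Phi (a : ℝ) (f g : MvPolynomial (Fin 2) ℝ) (z : ℝ × Ang) : Ang :=
  (pev f (curX a z.2) (curY z.2) * cosA -
    sinA * pev g (curX a z.2) (curY z.2) * curW a z.2) * lam a f g z

/-- The derivative of the time with respect to the angle. -/
def kap (a : ℝ) (f g : MvPolynomial (Fin 2) ℝ) (z : ℝ × Ang) : Ang := lam a f g z * curW a z.2

/-- The pairs `(ε, σ)` for which the polar coordinates make sense along the curve. -/
def good (a : ℝ) (f g : MvPolynomial (Fin 2) ℝ) : Set (ℝ × Ang) :=
  {z | (∀ t, (z.2 * cosA) t ∈ vals a) ∧ ∀ t, den a f g z t ≠ 0}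

lemma contDiffOn_absc (a : ℝ) : ContDiffOn ℝ ∞ (absc a) (vals a) := fun _ hv =>
  (contDiffAt_absc' hv ⊤).contDiffWithinAt

lemma contDiffOn_deriv_absc (a : ℝ) : ContDiffOn ℝ ∞ (deriv (absc a)) (vals a) :=
  (contDiffOn_absc a).deriv_of_isOpen (isOpen_vals a) (by simp)

lemma contDiffOn_inv : ContDiffOn ℝ ∞ (fun x : ℝ => x⁻¹) {0}ᶜ := fun _ hx =>
  (contDiffAt_inv ℝ hx).contDiffWithinAt

section

variable {a : ℝ} {f g : MvPolynomial (Fin 2) ℝ}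

lemma curX_apply {σ : Ang} (h : ∀ t, (σ * cosA) t ∈ vals a) (t) :
    curX a σ t = absc a (σ t * Real.cos t) :=
  nem_apply (isOpen_vals a) (contDiffOn_absc a).continuousOn h t

lemma curW_apply {σ : Ang} (h : ∀ t, (σ * cosA) t ∈ vals a) (t) :
    curW a σ t = deriv (absc a) (σ t * Real.cos t) :=
  nem_apply (isOpen_vals a) (contDiffOn_deriv_absc a).continuousOn h t

lemma contDiffAt_curX {σ : Ang} (h : ∀ t, (σ * cosA) t ∈ vals a) : ContDiffAt ℝ ∞ (curX a) σ :=
  (contDiffAt_nem (isOpen_vals a) (contDiffOn_absc a) h).comp σ (f := fun σ : Ang => σ * cosA)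
    (contDiffAt_id.mul contDiffAt_const)

lemma contDiffAt_curW {σ : Ang} (h : ∀ t, (σ * cosA) t ∈ vals a) : ContDiffAt ℝ ∞ (curW a) σ :=
  (contDiffAt_nem (isOpen_vals a) (contDiffOn_deriv_absc a) h).comp σ
    (f := fun σ : Ang => σ * cosA) (contDiffAt_id.mul contDiffAt_const)

lemma contDiffAt_curY {σ : Ang} : ContDiffAt ℝ ∞ curY σ :=
  (contDiffAt_id.mul contDiffAt_const).neg

lemma contDiffAt_pev_cur (p : MvPolynomial (Fin 2) ℝ) {σ : Ang}
    (h : ∀ t, (σ * cosA) t ∈ vals a) :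
    ContDiffAt ℝ ∞ (fun σ => pev p (curX a σ) (curY σ)) σ := by
  have h1 : ContDiffAt ℝ ∞ (fun z : Ang × Ang => pev p z.1 z.2) (curX a σ, curY σ) :=
    (contDiff_pev p).contDiffAt
  have h2 : ContDiffAt ℝ ∞ (fun σ => (curX a σ, curY σ)) σ :=
    (contDiffAt_curX h).prodMk contDiffAt_curY
  exact ContDiffAt.comp (g := fun z : Ang × Ang => pev p z.1 z.2)
    (f := fun σ => (curX a σ, curY σ)) σ h1 h2

lemma contDiffAt_snd' {E : Type*} [NormedAddCommGroup E] [NormedSpace ℝ E] {F : Ang → E}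
    {z : ℝ × Ang} (h : ContDiffAt ℝ ∞ F z.2) : ContDiffAt ℝ ∞ (fun z : ℝ × Ang => F z.2) z :=
  h.comp z contDiffAt_snd

lemma contDiffAt_den {z : ℝ × Ang} (h : ∀ t, (z.2 * cosA) t ∈ vals a) :
    ContDiffAt ℝ ∞ (den a f g) z := by
  have h1 := contDiffAt_snd' (contDiffAt_pev_cur f h)
  have h2 := contDiffAt_snd' (contDiffAt_pev_cur g h)
  have h3 := contDiffAt_snd' (contDiffAt_curW h)
  exact contDiffAt_snd.sub (contDiffAt_fst.smul ((h1.mul contDiffAt_const).add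
    ((contDiffAt_const.mul h2).mul h3)))

lemma contDiffAt_lam {z : ℝ × Ang} (h : z ∈ good a f g) : ContDiffAt ℝ ∞ (lam a f g) z :=
  contDiffAt_snd.mul ((contDiffAt_nem isOpen_compl_singleton contDiffOn_inv
    (fun t => by simpa using h.2 t)).comp z (contDiffAt_den h.1))

lemma contDiffAt_Phi {z : ℝ × Ang} (h : z ∈ good a f g) : ContDiffAt ℝ ∞ (Phi a f g) z := by
  have h1 := contDiffAt_snd' (contDiffAt_pev_cur f h.1)
  have h2 := contDiffAt_snd' (contDiffAt_pev_cur g h.1)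
  have h3 := contDiffAt_snd' (contDiffAt_curW h.1)
  exact ((h1.mul contDiffAt_const).sub ((contDiffAt_const.mul h2).mul h3)).mul (contDiffAt_lam h)

lemma contDiffAt_kap {z : ℝ × Ang} (h : z ∈ good a f g) : ContDiffAt ℝ ∞ (kap a f g) z :=
  (contDiffAt_lam h).mul (contDiffAt_snd' (contDiffAt_curW h.1))

lemma good_mem_nhds {z : ℝ × Ang} (h : z ∈ good a f g) : good a f g ∈ 𝓝 z := by
  have h1 : ContinuousAt (fun z : ℝ × Ang => z.2 * cosA) z := by fun_prop
  have h2 := h1.eventually (eventually_forall_mem (isOpen_vals a) h.1)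
  have h3 := (contDiffAt_den (f := f) (g := g) h.1).continuousAt.eventually
    (eventually_forall_mem isOpen_compl_singleton (fun t => by simpa using h.2 t))
  filter_upwards [h2, h3] with w h4 h5 using ⟨h4, fun t => by simpa using h5 t⟩

lemma lam_apply {z : ℝ × Ang} (h : z ∈ good a f g) (t) :
    lam a f g z t = z.2 t / den a f g z t := by
  rw [lam, ContinuousMap.mul_apply, nem_apply isOpen_compl_singleton contDiffOn_inv.continuousOn
    (fun t => by simpa using h.2 t), div_eq_mul_inv]

/-- The constant function. -/
def cst (s : ℝ) : Ang := ContinuousMap.const _ s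

lemma good_cst {h : ℝ} (hh : h ∈ levels a) : ((0 : ℝ), cst √(2 * h)) ∈ good a f g := by
  constructor
  · intro t
    exact mul_cos_mem hh (abs_of_nonneg (Real.sqrt_nonneg _)).le
  · intro t
    have := levels_pos hh
    simp only [den, cst, zero_smul, sub_zero, ContinuousMap.const_apply]
    positivity

/-- Solutions of the perturbed system in polar coordinates, with initial energy `h`, depend
smoothly on `h` and on `ε`. -/
theorem exists_radius (f g : MvPolynomial (Fin 2) ℝ) {h : ℝ} (hh : h ∈ levels a) :
    ∃ S : ℝ × ℝ → Ang, ContDiffAt ℝ ∞ S (h, 0) ∧ S (h, 0) = cst √(2 * h) ∧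
      (∀ᶠ z in 𝓝 (h, (0 : ℝ)), S z = cst √(2 * z.1) + z.2 • prim (Phi a f g (z.2, S z))) ∧
      ∀ᶠ h' in 𝓝 h, S (h', 0) = cst √(2 * h') := by
  have h0 := levels_pos hh
  have hcst : ContDiff ℝ ∞ cst := by
    have : cst = fun s => s • (1 : Ang) := by
      ext s t; simp [cst]
    rw [this]
    exact contDiff_id.smul contDiff_const
  have hsq : ContDiffAt ℝ ∞ (fun h' : ℝ => √(2 * h')) h :=
    ContDiffAt.sqrt (by fun_prop) (by positivity)
  -- The zeros of `F` are the radius functions with initial energy `w.1.1` for the perturbation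
  -- parameter `w.1.2`.
  let F : (ℝ × ℝ) × Ang → Ang := fun w =>
    w.2 - cst √(2 * w.1.1) - w.1.2 • prim (Phi a f g (w.1.2, w.2))
  set u : (ℝ × ℝ) × Ang := ((h, 0), cst √(2 * h)) with hu
  have hF : ContDiffAt ℝ ∞ F u := by
    refine (contDiffAt_snd.sub ?_).sub (contDiffAt_fst.snd.smul ?_)
    · exact hcst.contDiffAt.comp u (hsq.comp u (f := fun w : (ℝ × ℝ) × Ang => w.1.1)
        contDiffAt_fst.fst)
    · refine prim.contDiff.contDiffAt.comp u ?_
      exact (contDiffAt_Phi (good_cst hh)).comp u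
        (f := fun w : (ℝ × ℝ) × Ang => (w.1.2, w.2)) (contDiffAt_fst.snd.prodMk contDiffAt_snd)
  have hne : (∞ : WithTop ℕ∞) ≠ 0 := by simp
  -- At `ε = 0` the equation reads `σ = const`, so the partial derivative in `σ` is the identity.
  have hinv : fderiv ℝ F u ∘L .inr ℝ (ℝ × ℝ) Ang = ContinuousLinearMap.id ℝ Ang := by
    have h1 : HasFDerivAt F (fderiv ℝ F u) u := (hF.differentiableAt hne).hasFDerivAt
    have h2 : HasFDerivAt (fun σ : Ang => ((((h, 0) : ℝ × ℝ), σ) : (ℝ × ℝ) × Ang))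
        (.inr ℝ (ℝ × ℝ) Ang) (cst √(2 * h)) := hasFDerivAt_prodMk_right _ _
    have h3 := h1.comp (cst √(2 * h)) h2
    refine h3.unique ?_
    have : (F ∘ fun σ : Ang => ((((h, 0) : ℝ × ℝ), σ) : (ℝ × ℝ) × Ang)) =
        fun σ => σ - cst √(2 * h) := by
      ext1 σ; simp [F]
    rw [this]
    exact (hasFDerivAt_id _).sub_const _
  have hif : (fderiv ℝ F u ∘L .inr ℝ (ℝ × ℝ) Ang).IsInvertible := by
    rw [hinv]; exact ⟨ContinuousLinearEquiv.refl ℝ Ang, rfl⟩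
  have hFu : F u = 0 := by simp [F, u]
  refine ⟨hF.implicitFunction hne hif, hF.contDiffAt_implicitFunction hne hif,
    hF.implicitFunction_apply_self hne hif, ?_, ?_⟩
  · filter_upwards [hF.eventually_apply_implicitFunction hne hif] with z hz
    rw [hFu] at hz
    simp only [F] at hz
    rw [sub_sub, sub_eq_zero] at hz
    exact hz
  -- For `ε = 0` the constants solve the equation, and local uniqueness identifies them with the
  -- branch.
  · have h1 := hF.eventually_apply_eq_iff_implicitFunction hne hif
    have h2 : ContinuousAt (fun h' : ℝ => ((((h', 0) : ℝ × ℝ), cst √(2 * h')) : (ℝ × ℝ) × Ang)) h :=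
      (by fun_prop : ContinuousAt (fun h' : ℝ => ((h', 0) : ℝ × ℝ)) h).prodMk
        (hcst.continuous.continuousAt.comp hsq.continuousAt)
    filter_upwards [h2.eventually h1] with h' h3
    refine h3.1 ?_
    rw [hFu]; simp [F]

end

/-! ### Solutions of the perturbed system -/

lemma contDiff_eval (p : MvPolynomial (Fin 2) ℝ) {n : WithTop ℕ∞} :
    ContDiff ℝ n (fun z : ℝ × ℝ => MvPolynomial.eval ![z.1, z.2] p) := by
  induction p using MvPolynomial.induction_on with
  | C c => simpa using contDiff_const
  | add p q hp hq => simpa using hp.add hq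
  | mul_X p i hp =>
    simp only [map_mul, MvPolynomial.eval_X]
    refine hp.mul ?_
    fin_cases i
    · exact contDiff_fst
    · exact contDiff_snd

lemma contDiff_field (a : ℝ) (f g : MvPolynomial (Fin 2) ℝ) (ε : ℝ) {n : WithTop ℕ∞} :
    ContDiff ℝ n (field a f g ε) := by
  unfold field
  have h1 := contDiff_eval f (n := n)
  have h2 := contDiff_eval g (n := n)
  fun_prop

/-- Solutions of a smooth autonomous system are unique. -/
lemma eqOn_of_solutions {V : ℝ × ℝ → ℝ × ℝ} (hV : ContDiff ℝ 1 V) {γ₁ γ₂ : ℝ → ℝ × ℝ} {T : ℝ}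
    (h1 : ∀ t ∈ Icc 0 T, HasDerivWithinAt γ₁ (V (γ₁ t)) (Icc 0 T) t)
    (h2 : ∀ t ∈ Icc 0 T, HasDerivWithinAt γ₂ (V (γ₂ t)) (Icc 0 T) t)
    (h0 : γ₁ 0 = γ₂ 0) : EqOn γ₁ γ₂ (Icc 0 T) := by
  have c1 : ContinuousOn γ₁ (Icc 0 T) := fun t ht => (h1 t ht).continuousWithinAt
  have c2 : ContinuousOn γ₂ (Icc 0 T) := fun t ht => (h2 t ht).continuousWithinAt
  -- A ball that contains both arcs: the field is Lipschitz there, though not necessarily globally.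
  obtain ⟨R, hR⟩ := ((isCompact_Icc.image_of_continuousOn c1).union
    (isCompact_Icc.image_of_continuousOn c2)).isBounded.subset_closedBall 0
  obtain ⟨K, hK⟩ := ContDiffOn.exists_lipschitzOnWith (s := Metric.closedBall (0 : ℝ × ℝ) R)
    (hV.contDiffOn (s := Metric.closedBall (0 : ℝ × ℝ) R)) one_ne_zero
    (convex_closedBall _ _) (isCompact_closedBall _ _)
  have hr : ∀ (γ : ℝ → ℝ × ℝ), (∀ t ∈ Icc 0 T, HasDerivWithinAt γ (V (γ t)) (Icc 0 T) t) →
      ∀ t ∈ Ico 0 T, HasDerivWithinAt γ (V (γ t)) (Ici t) t := by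
    intro γ hγ t ht
    refine (hγ t (Ico_subset_Icc_self ht)).mono_of_mem_nhdsWithin ?_
    filter_upwards [Ico_mem_nhdsGE ht.2] with x hx using ⟨ht.1.trans hx.1, hx.2.le⟩
  exact ODE_solution_unique_of_mem_Icc_right (v := fun _ => V) (K := K)
    (s := fun _ => Metric.closedBall 0 R) (fun _ _ => hK) c1 (hr γ₁ h1)
    (fun t ht => hR (Or.inl ⟨t, Ico_subset_Icc_self ht, rfl⟩)) c2 (hr γ₂ h2)
    (fun t ht => hR (Or.inr ⟨t, Ico_subset_Icc_self ht, rfl⟩)) h0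

/-- `γ` on `[0, T]` is the arc from `(x₀, 0)` to its first return `(x₁, 0)`. -/
def ReturnArc (a : ℝ) (X : ℝ × ℝ → ℝ × ℝ) (x₀ x₁ T : ℝ) (γ : ℝ → ℝ × ℝ) : Prop :=
  x₀ ∈ crossSection a ∧ x₁ ∈ crossSection a ∧ 0 < T ∧
    (∀ t ∈ Icc 0 T, HasDerivWithinAt γ (X (γ t)) (Icc 0 T) t) ∧
    γ 0 = (x₀, 0) ∧ γ T = (x₁, 0) ∧
    ∀ t ∈ Ioo 0 T, ¬ ((γ t).1 ∈ crossSection a ∧ (γ t).2 = 0)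

lemma isFirstReturn_iff {a : ℝ} {X : ℝ × ℝ → ℝ × ℝ} {x₀ x₁ : ℝ} :
    IsFirstReturn a X x₀ x₁ ↔ ∃ T γ, ReturnArc a X x₀ x₁ T γ :=
  ⟨fun ⟨h1, h2, T, γ, h3⟩ => ⟨T, γ, h1, h2, h3⟩, fun ⟨T, γ, h1, h2, h3⟩ => ⟨h1, h2, T, γ, h3⟩⟩

/-- By uniqueness of solutions the arcs agree on the shorter time interval. The shorter arc ends on
the cross-section, which the longer one avoids at interior times. -/
lemma ReturnArc.unique {a : ℝ} {V : ℝ × ℝ → ℝ × ℝ} (hV : ContDiff ℝ 1 V) {x₀ x₁ x₂ T₁ T₂ : ℝ}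
    {γ₁ γ₂ : ℝ → ℝ × ℝ} (h1 : ReturnArc a V x₀ x₁ T₁ γ₁) (h2 : ReturnArc a V x₀ x₂ T₂ γ₂) :
    x₁ = x₂ ∧ T₁ = T₂ ∧ EqOn γ₁ γ₂ (Icc 0 T₁) := by
  wlog hT : T₁ ≤ T₂ generalizing x₁ x₂ T₁ T₂ γ₁ γ₂
  · obtain ⟨e1, e2, e3⟩ := this h2 h1 (le_of_not_ge hT)
    exact ⟨e1.symm, e2.symm, e2 ▸ e3.symm⟩
  obtain ⟨-, k1, k2, k3, k4, k5, k6⟩ := h1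
  obtain ⟨-, l1, l2, l3, l4, l5, l6⟩ := h2
  have hsub : Icc 0 T₁ ⊆ Icc 0 T₂ := Icc_subset_Icc_right hT
  have heq := eqOn_of_solutions hV k3 (fun t ht => (l3 t (hsub ht)).mono hsub) (k4.trans l4.symm)
  have hT1 := heq (right_mem_Icc.2 k2.le)
  have hTT : T₁ = T₂ := by
    by_contra hne
    refine l6 T₁ ⟨k2, lt_of_le_of_ne hT hne⟩ ?_
    rw [← hT1, k5]
    exact ⟨k1, rfl⟩
  refine ⟨?_, hTT, heq⟩
  rw [k5] at hT1
  rw [hTT, l5] at hT1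
  exact congrArg Prod.fst hT1

lemma IsFirstReturn.unique {a : ℝ} {V : ℝ × ℝ → ℝ × ℝ} (hV : ContDiff ℝ 1 V) {x₀ x₁ x₂ : ℝ}
    (h1 : IsFirstReturn a V x₀ x₁) (h2 : IsFirstReturn a V x₀ x₂) : x₁ = x₂ := by
  rw [isFirstReturn_iff] at h1 h2
  obtain ⟨_, _, h1⟩ := h1
  obtain ⟨_, _, h2⟩ := h2
  exact (h1.unique hV h2).1

/-! ### Change of time -/

/-- A curve whose velocity is a positive multiple of a vector field is a solution up to a change of
time. -/
lemma exists_time_change {L m : ℝ} (hL : 0 < L) (hm : 0 < m) {κ : ℝ → ℝ} (hκ : Continuous κ)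
    (hpos : ∀ x, m ≤ κ x) {c : ℝ → ℝ × ℝ} {V : ℝ × ℝ → ℝ × ℝ}
    (hc : ∀ θ ∈ Icc 0 L, HasDerivAt c (κ θ • V (c θ)) θ) :
    ∃ (T : ℝ) (τ : ℝ → ℝ), 0 < T ∧ StrictMono τ ∧ Continuous τ ∧ τ 0 = 0 ∧ τ T = L ∧
      ∀ t ∈ Icc 0 T, HasDerivAt (fun t => c (τ t)) (V (c (τ t))) t := by
  -- The elapsed time as a function of the angle. The lower bound `m` makes it a bijection of the
  -- whole line; its inverse is the angle as a function of time.
  let s : ℝ → ℝ := fun θ => ∫ x in (0 : ℝ)..θ, κ x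
  have hs : ∀ θ, HasDerivAt s (κ θ) θ := fun θ => intervalIntegral.integral_hasDerivAt_right
    (hκ.intervalIntegrable _ _) (hκ.stronglyMeasurableAtFilter _ _) hκ.continuousAt
  have hs0 : s 0 = 0 := intervalIntegral.integral_same
  have hmono : StrictMono s := strictMono_of_deriv_pos fun θ => by
    rw [(hs θ).deriv]; exact hm.trans_le (hpos θ)
  have hmono2 : Monotone fun θ => s θ - m * θ := by
    apply monotone_of_deriv_nonneg
    · exact fun θ => ((hs θ).sub ((hasDerivAt_id θ).const_mul m)).differentiableAt
    · intro θ
      have := ((hs θ).sub ((hasDerivAt_id θ).const_mul m)).deriv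
      simp only [id, mul_one] at this
      have h3 := hpos θ
      change 0 ≤ deriv (s - fun y => m * id y) θ
      rw [HasDerivAt.deriv ((hs θ).sub ((hasDerivAt_id θ).const_mul m))]
      linarith
  have hscont : Continuous s := continuous_iff_continuousAt.2 fun θ => (hs θ).continuousAt
  have htop : Tendsto s atTop atTop := by
    refine tendsto_atTop_mono' atTop (f₁ := fun θ => m * θ) ?_ (tendsto_id.const_mul_atTop hm)
    filter_upwards [eventually_ge_atTop 0] with θ hθ
    have := hmono2 hθ
    simp only [hs0, mul_zero, sub_zero] at this
    linarith
  have hbot : Tendsto s atBot atBot := by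
    refine tendsto_atBot_mono' (f₂ := s) atBot ?_ (tendsto_id.const_mul_atBot hm)
    filter_upwards [eventually_le_atBot 0] with θ hθ
    have := hmono2 hθ
    simp only [hs0, mul_zero, sub_zero] at this
    change s θ ≤ m * θ
    linarith
  let e := hmono.orderIsoOfSurjective s (hscont.surjective htop hbot)
  have he : ∀ t, s (e.symm t) = t := fun t => e.apply_symm_apply t
  have he' : ∀ θ, e.symm (s θ) = θ := fun θ => e.symm_apply_apply θ
  refine ⟨s L, e.symm, ?_, e.symm.strictMono, e.symm.continuous, ?_, he' L, ?_⟩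
  · rw [← hs0]; exact hmono hL
  · have := he' 0
    rwa [hs0] at this
  · intro t ht
    have hτ : e.symm t ∈ Icc 0 L := by
      constructor
      · rw [← he' 0, hs0]; exact e.symm.monotone ht.1
      · rw [← he' L]; exact e.symm.monotone ht.2
    have hκ0 : κ (e.symm t) ≠ 0 := (hm.trans_le (hpos _)).ne'
    have h1 : HasDerivAt e.symm (κ (e.symm t))⁻¹ t :=
      HasDerivAt.of_local_left_inverse e.symm.continuous.continuousAt (hs _) hκ0
        (Eventually.of_forall he)
    have h2 := (hc _ hτ).scomp t h1
    rw [smul_smul, inv_mul_cancel₀ hκ0, one_smul] at h2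
    exact h2

/-! ### The curve of a polar solution -/

section

variable {a : ℝ} {f g : MvPolynomial (Fin 2) ℝ}

/-- The data of a solution in polar coordinates: starting radius `s`, parameter and radius function
`(ε, σ)`, with `σ` and the angular speed positive. -/
structure PolarSol (a : ℝ) (f g : MvPolynomial (Fin 2) ℝ) (s ε : ℝ) (σ : Ang) : Prop where
  mem : ((ε, σ) : ℝ × Ang) ∈ good a f g
  pos : ∀ t, 0 < σ t
  den_pos : ∀ t, 0 < den a f g (ε, σ) t
  eq : σ = cst s + ε • prim (Phi a f g (ε, σ))

/-- The radius of a polar solution as a function on the line. -/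
def rad (a : ℝ) (f g : MvPolynomial (Fin 2) ℝ) (s ε : ℝ) (σ : Ang) (θ : ℝ) : ℝ :=
  s + ε * ∫ x in (0 : ℝ)..θ, ext (Phi a f g (ε, σ)) x

variable {s ε : ℝ} {σ : Ang}

lemma PolarSol.rad_eq (h : PolarSol a f g s ε σ) (t : Icc (0 : ℝ) (2 * Real.pi)) :
    rad a f g s ε σ t = σ t := by
  conv_rhs => rw [h.eq]
  simp [rad, cst, prim_apply]

lemma hasDerivAt_rad (θ : ℝ) :
    HasDerivAt (rad a f g s ε σ) (ε * ext (Phi a f g (ε, σ)) θ) θ := by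
  have hc := continuous_ext (Phi a f g (ε, σ))
  exact ((intervalIntegral.integral_hasDerivAt_right (hc.intervalIntegrable _ _)
    (hc.stronglyMeasurableAtFilter _ _) hc.continuousAt).const_mul ε).const_add s

/-- The curve of a polar solution. -/
def curve (a : ℝ) (f g : MvPolynomial (Fin 2) ℝ) (s ε : ℝ) (σ : Ang) (θ : ℝ) : ℝ × ℝ :=
  pt a (rad a f g s ε σ θ) θ

lemma PolarSol.mem_vals (h : PolarSol a f g s ε σ) (t : Icc (0 : ℝ) (2 * Real.pi)) :
    σ t * Real.cos t ∈ vals a := h.mem.1 t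

/-- The identity is `U'(x) dx/du = u`, the derivative of `U = u² / 2`. -/
lemma deriv_absc_eq {v : ℝ} (hv : v ∈ vals a) : 0 < deriv (absc a) v ∧
    absc a v * slope a (absc a v) * deriv (absc a) v = v := by
  obtain ⟨x, hx, rfl⟩ := hv
  rw [(hasDerivAt_absc hx).deriv, absc_amp hx]
  have h1 := slope_pos hx
  have h2 := Real.sqrt_pos.2 (wsq_pos hx)
  refine ⟨div_pos h2 h1, ?_⟩
  unfold amp
  field_simp

lemma PolarSol.curve_eq (h : PolarSol a f g s ε σ) (t : Icc (0 : ℝ) (2 * Real.pi)) :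
    curve a f g s ε σ t = (curX a σ t, curY σ t) := by
  rw [curve, h.rad_eq, pt, curX_apply h.mem.1]
  simp [curY, sinA]

lemma PolarSol.kap_apply (h : PolarSol a f g s ε σ) (t : Icc (0 : ℝ) (2 * Real.pi)) :
    kap a f g (ε, σ) t = σ t / den a f g (ε, σ) t * deriv (absc a) (σ t * Real.cos t) := by
  rw [kap, ContinuousMap.mul_apply, lam_apply h.mem, curW_apply h.mem.1]

lemma PolarSol.kap_pos (h : PolarSol a f g s ε σ) (t : Icc (0 : ℝ) (2 * Real.pi)) :
    0 < kap a f g (ε, σ) t := by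
  rw [h.kap_apply]
  exact mul_pos (div_pos (h.pos t) (h.den_pos t)) (deriv_absc_eq (h.mem_vals t)).1

/-- The factor `kap` is `dt/dθ`. Once the denominator `den` is cleared, the components reduce to
`sin² + cos² = 1` and, for the second one, also to `U'(x) dx/du = u`. -/
lemma PolarSol.hasDerivAt_curve (h : PolarSol a f g s ε σ) {θ : ℝ}
    (hθ : θ ∈ Icc 0 (2 * Real.pi)) :
    HasDerivAt (curve a f g s ε σ)
      (ext (kap a f g (ε, σ)) θ • field a f g ε (curve a f g s ε σ θ)) θ := by
  let t : Icc (0 : ℝ) (2 * Real.pi) := ⟨θ, hθ⟩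
  have hr := hasDerivAt_rad (a := a) (f := f) (g := g) (s := s) (ε := ε) (σ := σ) θ
  have hrt : rad a f g s ε σ θ = σ t := h.rad_eq t
  have hv : σ t * Real.cos θ ∈ vals a := h.mem_vals t
  have hX : HasDerivAt (absc a) (deriv (absc a) (σ t * Real.cos θ))
      (rad a f g s ε σ θ * Real.cos θ) := by
    rw [hrt]
    exact ((contDiffAt_absc' hv 1).differentiableAt (by simp)).hasDerivAt
  have h1 := hX.comp θ (hr.mul (Real.hasDerivAt_cos θ))
  have h2 := (hr.mul (Real.hasDerivAt_sin θ)).neg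
  refine (h1.prodMk h2).congr_deriv ?_
  have hc : curve a f g s ε σ θ = (curX a σ t, curY σ t) := h.curve_eq t
  rw [ext_of_mem _ hθ, ext_of_mem _ hθ, hc]
  have hk := h.kap_apply t
  have hd := h.den_pos t
  obtain ⟨hD1, hD2⟩ := deriv_absc_eq hv
  have hXa : curX a σ t = absc a (σ t * Real.cos θ) := curX_apply h.mem.1 t
  have hWa : curW a σ t = deriv (absc a) (σ t * Real.cos θ) := curW_apply h.mem.1 t
  have hYa : curY σ t = -(σ t * Real.sin θ) := rfl
  have hden : den a f g (ε, σ) t = σ t - ε * (MvPolynomial.eval ![curX a σ t, curY σ t] f *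
      Real.sin θ + Real.cos θ * MvPolynomial.eval ![curX a σ t, curY σ t] g *
        deriv (absc a) (σ t * Real.cos θ)) := by
    simp [den, pev_apply, sinA, cosA, hWa, t, mul_add]
  have hPhi : Phi a f g (ε, σ) t = (MvPolynomial.eval ![curX a σ t, curY σ t] f * Real.cos θ -
      Real.sin θ * MvPolynomial.eval ![curX a σ t, curY σ t] g *
        deriv (absc a) (σ t * Real.cos θ)) * (σ t / den a f g (ε, σ) t) := by
    simp [Phi, pev_apply, sinA, cosA, hWa, t, lam_apply h.mem]
  have hk' : kap a f g (ε, σ) t =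
      σ t / den a f g (ε, σ) t * deriv (absc a) (σ t * Real.cos θ) := hk
  change _ = kap a f g (ε, σ) t • _
  rw [hk', hrt]
  change (deriv (absc a) (σ t * Real.cos θ) * (ε * Phi a f g (ε, σ) t * Real.cos θ +
    σ t * -Real.sin θ), -(ε * Phi a f g (ε, σ) t * Real.sin θ + σ t * Real.cos θ)) = _
  rw [hPhi]
  unfold field
  simp only
  rw [hYa] at hden ⊢
  rw [← hXa] at hD2
  set F := MvPolynomial.eval ![curX a σ t, -(σ t * Real.sin θ)] f
  set G := MvPolynomial.eval ![curX a σ t, -(σ t * Real.sin θ)] g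
  set D := deriv (absc a) (σ t * Real.cos θ)
  set δ := den a f g (ε, σ) t
  set x := curX a σ t
  have hsc := Real.sin_sq_add_cos_sq θ
  set S := Real.sin θ
  set C := Real.cos θ
  unfold slope at hD2
  rw [Prod.smul_mk, smul_eq_mul, smul_eq_mul]
  refine Prod.ext ?_ ?_
  · simp only
    field_simp
    rw [hden]
    linear_combination ε * F * hsc * σ t
  · simp only
    field_simp
    rw [hden]
    linear_combination σ t * hD2 + σ t * ε * D * G * hsc

end

/-! ### The return map -/

section

variable {a : ℝ} {f g : MvPolynomial (Fin 2) ℝ} {s ε : ℝ} {σ : Ang}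

/-- The end point of the interval of angles. -/
def angEnd : Icc (0 : ℝ) (2 * Real.pi) := ⟨2 * Real.pi, two_pi_nonneg, le_rfl⟩

/-- The initial point of the interval of angles. -/
def angStart : Icc (0 : ℝ) (2 * Real.pi) := ⟨0, le_rfl, two_pi_nonneg⟩

/-- The energy at the end of the curve with radius function `σ`. -/
def endE (σ : Ang) : ℝ := σ angEnd ^ 2 / 2

lemma PolarSol.start_eq (h : PolarSol a f g s ε σ) : σ angStart = s := by
  rw [← h.rad_eq]; simp [rad, angStart]

lemma PolarSol.start_pos (h : PolarSol a f g s ε σ) : 0 < s := h.start_eq ▸ h.pos _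

lemma mem_crossSection_absc {v : ℝ} (h0 : 0 < v) (hv : v ∈ vals a) :
    absc a v ∈ crossSection a := by
  have := sec_mem (mem_levels_of_sqrt h0 hv)
  rwa [sec, mul_div_cancel₀ _ two_ne_zero, Real.sqrt_sq h0.le] at this

lemma PolarSol.end_mem (h : PolarSol a f g s ε σ) : endE σ ∈ levels a := by
  refine mem_levels_of_sqrt (h.pos _) ?_
  have := h.mem_vals angEnd
  simpa [angEnd] using this

lemma sec_endE (h : PolarSol a f g s ε σ) : sec a (endE σ) = absc a (σ angEnd) := by
  rw [sec, endE, mul_div_cancel₀ _ two_ne_zero, Real.sqrt_sq (h.pos _).le]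

lemma curve_start :
    curve a f g s ε σ 0 = (absc a s, 0) := by
  simp [curve, pt, rad]

lemma PolarSol.curve_end (h : PolarSol a f g s ε σ) :
    curve a f g s ε σ (2 * Real.pi) = (sec a (endE σ), 0) := by
  rw [sec_endE h]
  have := h.rad_eq angEnd
  simp only [angEnd] at this
  simp [curve, pt, this, angEnd]

lemma PolarSol.exists_returnArc (h : PolarSol a f g s ε σ) :
    ∃ T γ, ReturnArc a (field a f g ε) (absc a s) (sec a (endE σ)) T γ ∧
      γ '' Icc 0 T = curve a f g s ε σ '' Icc 0 (2 * Real.pi) := by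
  obtain ⟨t₀, -, ht₀⟩ := isCompact_univ.exists_isMinOn ⟨angStart, mem_univ _⟩
    (kap a f g (ε, σ)).continuous.continuousOn
  have hmin : ∀ x, kap a f g (ε, σ) t₀ ≤ ext (kap a f g (ε, σ)) x := fun x => ht₀ (mem_univ _)
  obtain ⟨T, τ, hT, hmono, hcont, h0, hL, hder⟩ := exists_time_change Real.two_pi_pos
    (h.kap_pos t₀) (continuous_ext _) hmin (fun θ hθ => h.hasDerivAt_curve hθ)
  refine ⟨T, fun t => curve a f g s ε σ (τ t), ⟨?_, ?_, hT, ?_, ?_, ?_, ?_⟩, ?_⟩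
  · have h1 := h.mem_vals angStart
    rw [h.start_eq] at h1
    exact mem_crossSection_absc h.start_pos (by simpa [angStart] using h1)
  · exact sec_mem h.end_mem
  · exact fun t ht => (hder t ht).hasDerivWithinAt
  · simp only [h0]; exact curve_start
  · simp only [hL]; exact h.curve_end
  -- Inside the arc `y` vanishes only at the angle `π`, where `u < 0`, so the point is off the
  -- cross-section.
  · intro t ht
    have e1 : 0 < τ t := h0 ▸ hmono ht.1
    have e2 : τ t < 2 * Real.pi := hL ▸ hmono ht.2
    have hm : τ t ∈ Icc 0 (2 * Real.pi) := ⟨e1.le, e2.le⟩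
    have hr := h.rad_eq ⟨τ t, hm⟩
    have hp := h.pos ⟨τ t, hm⟩
    have hv := h.mem_vals ⟨τ t, hm⟩
    simp only at hr hv
    simp only [curve, pt, hr]
    generalize σ ⟨τ t, hm⟩ = v at hp hv ⊢
    rintro ⟨k1, k2⟩
    have hs : Real.sin (τ t) = 0 := by
      have := neg_eq_zero.1 k2
      exact (mul_eq_zero.1 this).resolve_left hp.ne'
    have hpi : τ t = Real.pi := by
      obtain ⟨n, hn⟩ := Real.sin_eq_zero_iff.1 hs
      rw [← hn] at e1 e2
      have hpi := Real.pi_pos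
      have n0 : 0 < n := by
        have : (0 : ℝ) < n := pos_of_mul_pos_left e1 hpi.le
        exact_mod_cast this
      have n2 : n < 2 := by
        have : (n : ℝ) < 2 := lt_of_mul_lt_mul_right e2 hpi.le
        exact_mod_cast this
      have : n = 1 := by omega
      rw [← hn, this]; simp
    rw [hpi, Real.cos_pi] at hv k1
    rw [crossSection_eq] at k1
    have := amp_pos k1.1 k1.2
    rw [amp_absc hv] at this
    linarith
  · change (curve a f g s ε σ ∘ τ) '' Icc 0 T = _
    rw [image_comp]
    congr 1
    ext x
    constructor
    · rintro ⟨t, ht, rfl⟩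
      rw [← h0, ← hL]
      exact ⟨hmono.monotone ht.1, hmono.monotone ht.2⟩
    · intro hx
      exact intermediate_value_Icc hT.le hcont.continuousOn (by rwa [h0, hL])

/-- The integral of `p` with respect to the time along the curve with radius function `σ`. -/
def flux (a : ℝ) (f g p : MvPolynomial (Fin 2) ℝ) (z : ℝ × Ang) : ℝ :=
  tot (pev p (curX a z.2) (curY z.2) * kap a f g z)

lemma contDiffAt_flux (p : MvPolynomial (Fin 2) ℝ) {z : ℝ × Ang} (h : z ∈ good a f g) :
    ContDiffAt ℝ ∞ (flux a f g p) z :=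
  tot.contDiff.contDiffAt.comp z ((contDiffAt_snd' (contDiffAt_pev_cur p h.1)).mul
    (contDiffAt_kap h))

lemma hasDerivAt_eval {x y : ℝ → ℝ} {x' y' t : ℝ} (hx : HasDerivAt x x' t) (hy : HasDerivAt y y' t)
    (p : MvPolynomial (Fin 2) ℝ) :
    HasDerivAt (fun t => MvPolynomial.eval ![x t, y t] p)
      (MvPolynomial.eval ![x t, y t] (MvPolynomial.pderiv 0 p) * x' +
        MvPolynomial.eval ![x t, y t] (MvPolynomial.pderiv 1 p) * y') t := by
  induction p using MvPolynomial.induction_on with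
  | C c => simpa using hasDerivAt_const t c
  | add p q hp hq =>
    simp only [map_add]
    exact (hp.add hq).congr_deriv (by ring)
  | mul_X p i hp =>
    simp only [map_mul, MvPolynomial.eval_X, Derivation.leibniz, map_add, smul_eq_mul]
    fin_cases i
    · exact (hp.mul hx).congr_deriv (by simp [MvPolynomial.pderiv_X]; ring)
    · exact (hp.mul hy).congr_deriv (by simp [MvPolynomial.pderiv_X]; ring)

/-- The polynomial `U'(x)`. -/
def dU (a : ℝ) : MvPolynomial (Fin 2) ℝ :=
  MvPolynomial.X 0 - 2 * MvPolynomial.X 0 ^ 2 + MvPolynomial.C a * MvPolynomial.X 0 ^ 3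

/-- The derivative of `H` along the perturbation. -/
def omg (a : ℝ) (f g : MvPolynomial (Fin 2) ℝ) : MvPolynomial (Fin 2) ℝ :=
  g * MvPolynomial.X 1 + f * dU a

lemma eval_dU (x y : ℝ) : MvPolynomial.eval ![x, y] (dU a) = x - 2 * x ^ 2 + a * x ^ 3 := by
  simp [dU]

lemma PolarSol.hasDerivAt_eval_curve (h : PolarSol a f g s ε σ)
    (Q : MvPolynomial (Fin 2) ℝ) {θ : ℝ} (hθ : θ ∈ Icc 0 (2 * Real.pi)) :
    HasDerivAt (fun θ => MvPolynomial.eval ![(curve a f g s ε σ θ).1, (curve a f g s ε σ θ).2] Q)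
      (ext (pev (MvPolynomial.pderiv 0 Q * (MvPolynomial.X 1 + MvPolynomial.C ε * f) +
        MvPolynomial.pderiv 1 Q * (MvPolynomial.C ε * g - dU a)) (curX a σ) (curY σ) *
          kap a f g (ε, σ)) θ) θ := by
  have hd := h.hasDerivAt_curve hθ
  have h1 : HasDerivAt (fun θ => (curve a f g s ε σ θ).1) _ θ := hd.fst
  have h2 : HasDerivAt (fun θ => (curve a f g s ε σ θ).2) _ θ := hd.snd
  refine (hasDerivAt_eval h1 h2 Q).congr_deriv ?_
  have hc : curve a f g s ε σ θ = (curX a σ ⟨θ, hθ⟩, curY σ ⟨θ, hθ⟩) := h.curve_eq ⟨θ, hθ⟩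
  rw [ext_of_mem _ hθ, ext_of_mem _ hθ, hc, ContinuousMap.mul_apply, pev_apply]
  simp [field, eval_dU]
  ring

/-- The fundamental theorem of calculus over one turn: the polynomial under `flux` is the derivative
of `Q` along the perturbed field. -/
lemma PolarSol.sub_eq (h : PolarSol a f g s ε σ) (Q : MvPolynomial (Fin 2) ℝ) :
    MvPolynomial.eval ![sec a (endE σ), 0] Q - MvPolynomial.eval ![absc a s, 0] Q =
      flux a f g (MvPolynomial.pderiv 0 Q * (MvPolynomial.X 1 + MvPolynomial.C ε * f) +
        MvPolynomial.pderiv 1 Q * (MvPolynomial.C ε * g - dU a)) (ε, σ) := by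
  rw [flux, tot_apply]
  have h1 := intervalIntegral.integral_eq_sub_of_hasDerivAt
    (f := fun θ => MvPolynomial.eval ![(curve a f g s ε σ θ).1, (curve a f g s ε σ θ).2] Q)
    (fun θ hθ => h.hasDerivAt_eval_curve Q (by rwa [uIcc_of_le two_pi_nonneg] at hθ))
    ((continuous_ext _).intervalIntegrable 0 (2 * Real.pi))
  rw [h1, h.curve_end, curve_start]

lemma flux_add (p q : MvPolynomial (Fin 2) ℝ) (z : ℝ × Ang) :
    flux a f g (p + q) z = flux a f g p z + flux a f g q z := by
  simp [flux, pev, add_mul]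

lemma flux_C_mul (c : ℝ) (p : MvPolynomial (Fin 2) ℝ) (z : ℝ × Ang) :
    flux a f g (MvPolynomial.C c * p) z = c * flux a f g p z := by
  have : pev (MvPolynomial.C c * p) (curX a z.2) (curY z.2) * kap a f g z =
      c • (pev p (curX a z.2) (curY z.2) * kap a f g z) := by
    simp only [pev, map_mul, MvPolynomial.aeval_C, Algebra.smul_def, mul_assoc]
  rw [flux, this, map_smul, smul_eq_mul, flux]

/-- A chain of relative decompositions `q_j ω = q_{j+1} dH + dQ_j`, `j < k`, `q_0 = 1`, where
`ω = g dx - f dy`. -/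
structure Chain (a : ℝ) (f g : MvPolynomial (Fin 2) ℝ) (k : ℕ)
    (q Q : ℕ → MvPolynomial (Fin 2) ℝ) : Prop where
  zero : q 0 = 1
  dx : ∀ j < k, MvPolynomial.pderiv 0 (Q j) = q j * g - q (j + 1) * dU a
  dy : ∀ j < k, MvPolynomial.pderiv 1 (Q j) = -(q j * f) - q (j + 1) * MvPolynomial.X 1

/-- The value of a polynomial at the point of the cross-section of energy `h`. -/
def onSec (a : ℝ) (Q : MvPolynomial (Fin 2) ℝ) (h : ℝ) : ℝ := MvPolynomial.eval ![sec a h, 0] Q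

/-- The energy, corrected by the terms `ε^(j+1) Q_j`, on the cross-section. -/
def corr (a : ℝ) (Q : ℕ → MvPolynomial (Fin 2) ℝ) (k : ℕ) (ε h : ℝ) : ℝ :=
  h - ∑ j ∈ Finset.range k, ε ^ (j + 1) * onSec a (Q j) h

/-- Along an orbit `dQ_j = q_j ω - q_{j+1} dH`, and `dH = ε ω`. The time derivative of `ω` is `omg`,
without any term in `ε`, because the two products `ε f g` cancel. -/
lemma Chain.step {k : ℕ} {q Q : ℕ → MvPolynomial (Fin 2) ℝ} (c : Chain a f g k q Q) {j : ℕ}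
    (hj : j < k) {h' : ℝ} (h : PolarSol a f g √(2 * h') ε σ) :
    onSec a (Q j) (endE σ) - onSec a (Q j) h' =
      flux a f g (q j * omg a f g) (ε, σ) - ε * flux a f g (q (j + 1) * omg a f g) (ε, σ) := by
  have h1 := h.sub_eq (Q j)
  rw [onSec, onSec, sec, ← sec, ← flux_C_mul]
  rw [show sec a h' = absc a √(2 * h') from rfl, h1, c.dx j hj, c.dy j hj, eq_sub_iff_add_eq,
    ← flux_add]
  congr 1
  unfold omg
  ring

/-- A telescoping argument that starts from `dH = ε ω`: each link trades `ε^(n+1) q_n ω` for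
`ε^(n+1) dQ_n`, which the corrected energy absorbs, and a term of the next order in `ε`. -/
lemma Chain.corr_sub {k : ℕ} {q Q : ℕ → MvPolynomial (Fin 2) ℝ} (c : Chain a f g k q Q) {h' : ℝ}
    (hl : h' ∈ levels a) (h : PolarSol a f g √(2 * h') ε σ) :
    corr a Q k ε (endE σ) - corr a Q k ε h' =
      ε ^ (k + 1) * flux a f g (q k * omg a f g) (ε, σ) := by
  have key : ∀ n ≤ k, corr a Q n ε (endE σ) - corr a Q n ε h' =
      ε ^ (n + 1) * flux a f g (q n * omg a f g) (ε, σ) := by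
    intro n
    induction n with
    | zero =>
      intro _
      have h1 := h.sub_eq (MvPolynomial.C (1 / 2) * MvPolynomial.X 1 ^ 2 +
        (MvPolynomial.C (1 / 2) * MvPolynomial.X 0 ^ 2 - MvPolynomial.C (2 / 3) *
          MvPolynomial.X 0 ^ 3 + MvPolynomial.C (a / 4) * MvPolynomial.X 0 ^ 4))
      have e2 : ∀ x, MvPolynomial.eval ![x, 0] (MvPolynomial.C (1 / 2) * MvPolynomial.X 1 ^ 2 +
        (MvPolynomial.C (1 / 2) * MvPolynomial.X 0 ^ 2 - MvPolynomial.C (2 / 3) *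
          MvPolynomial.X 0 ^ 3 + MvPolynomial.C (a / 4) * MvPolynomial.X 0 ^ 4)) =
            potential a x := by
        intro x; simp [potential]; ring
      rw [e2, e2, potential_sec h.end_mem] at h1
      rw [show absc a √(2 * h') = sec a h' from rfl, potential_sec hl] at h1
      simp only [corr, Finset.range_zero, Finset.sum_empty, sub_zero, zero_add, pow_one]
      rw [h1, ← flux_C_mul, c.zero, one_mul]
      congr 1
      apply MvPolynomial.funext
      intro v
      simp [omg, dU, MvPolynomial.pderiv_X, Derivation.leibniz_pow]
      ring
    | succ n ih =>
      intro hn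
      have h1 := ih (by omega)
      have h2 := c.step (show n < k by omega) h
      simp only [corr, Finset.sum_range_succ] at h1 ⊢
      linear_combination h1 - ε ^ (n + 1) * h2
  exact key k le_rfl

/-- The energy at the first return. -/
def retE (a : ℝ) (f g : MvPolynomial (Fin 2) ℝ) (ε h : ℝ) : ℝ :=
  open Classical in if H : ∃ h₁ ∈ levels a, IsFirstReturn a (field a f g ε) (sec a h) (sec a h₁)
    then H.choose else 0

lemma sec_injOn : InjOn (sec a) (levels a) := fun h₁ H1 h₂ H2 e => by
  rw [← potential_sec H1, e, potential_sec H2]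

lemma retE_eq {h h₁ : ℝ} (hl : h₁ ∈ levels a)
    (H : IsFirstReturn a (field a f g ε) (sec a h) (sec a h₁)) : retE a f g ε h = h₁ := by
  have H' : ∃ h₁ ∈ levels a, IsFirstReturn a (field a f g ε) (sec a h) (sec a h₁) := ⟨h₁, hl, H⟩
  rw [retE, dif_pos H']
  have := H'.choose_spec
  exact sec_injOn this.1 hl (IsFirstReturn.unique (contDiff_field a f g ε) this.2 H)

lemma PolarSol.retE_eq {h' : ℝ} (h : PolarSol a f g √(2 * h') ε σ) :
    retE a f g ε h' = endE σ := by
  obtain ⟨T, γ, h1, -⟩ := h.exists_returnArc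
  exact CubicPert.retE_eq h.end_mem (isFirstReturn_iff.2 ⟨T, γ, h1⟩)

/-- The time integral of a polynomial along the oval of energy `h`. -/
def Lam (a h : ℝ) (p : MvPolynomial (Fin 2) ℝ) : ℝ :=
  ∫ θ in (0 : ℝ)..(2 * Real.pi),
    MvPolynomial.eval ![(pt a √(2 * h) θ).1, (pt a √(2 * h) θ).2] p *
      deriv (absc a) (√(2 * h) * Real.cos θ)

lemma flux_zero (f g p : MvPolynomial (Fin 2) ℝ) {h : ℝ} (hh : h ∈ levels a) :
    flux a f g p (0, cst √(2 * h)) = Lam a h p := by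
  have hg := good_cst (f := f) (g := g) hh
  have h0 := levels_pos hh
  rw [flux, tot_apply, Lam]
  refine intervalIntegral.integral_congr fun θ hθ => ?_
  rw [uIcc_of_le two_pi_nonneg] at hθ
  simp only
  rw [ext_of_mem _ hθ, ContinuousMap.mul_apply, pev_apply, curX_apply hg.1, kap,
    ContinuousMap.mul_apply, lam_apply hg, curW_apply hg.1]
  have : (0 : ℝ) < √(2 * h) := by positivity
  generalize √(2 * h) = s at this ⊢
  simp [den, cst, curY, pt, sinA, div_self this.ne']

/-- The local description of the return map and of the coefficient function near the energy `h`,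
for all small `ε > 0`. -/
structure LocalModel (a : ℝ) (f g : MvPolynomial (Fin 2) ℝ) (M : ℝ → ℝ) (μ : ℝ → ℝ → ℝ) (h : ℝ)
    (S : ℝ × ℝ → Ang) (R m : ℝ × ℝ → ℝ) : Prop where
  smooth_S : ContDiffAt ℝ ∞ S (h, 0)
  smooth_R : ContDiffAt ℝ ∞ R (h, 0)
  smooth_m : ContDiffAt ℝ ∞ m (h, 0)
  S_zero : ∀ᶠ h' in 𝓝 h, S (h', 0) = cst √(2 * h')
  R_zero : ∀ᶠ h' in 𝓝 h, R (h', 0) = h'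
  m_zero : ∀ᶠ h' in 𝓝 h, m (h', 0) = M h'
  polar : ∀ᶠ z in 𝓝 (h, (0 : ℝ)), z.1 ∈ levels a ∧ PolarSol a f g √(2 * z.1) z.2 (S z) ∧
    endE (S z) = R z ∧ retE a f g z.2 z.1 = R z
  fixed : ∀ᶠ z in 𝓝 (h, (0 : ℝ)), 0 < z.2 → μ z.1 z.2 = m z ∧ (R z = z.1 ↔ m z = 0)

lemma contDiffAt_sec {h : ℝ} (hh : h ∈ levels a) : ContDiffAt ℝ ∞ (sec a) h := by
  have h0 := levels_pos hh
  exact (contDiffAt_absc' (mem_levels_iff.1 hh).2 ⊤).comp h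
    (ContDiffAt.sqrt (by fun_prop) (by positivity))

lemma contDiffAt_onSec (Q : MvPolynomial (Fin 2) ℝ) {h : ℝ} (hh : h ∈ levels a) :
    ContDiffAt ℝ ∞ (onSec a Q) h :=
  ContDiffAt.comp (g := fun z : ℝ × ℝ => MvPolynomial.eval ![z.1, z.2] Q)
    (f := fun h => (sec a h, (0 : ℝ))) h (contDiff_eval Q).contDiffAt
    ((contDiffAt_sec hh).prodMk contDiffAt_const)

/-- The corrections are `O(ε)` in the Lipschitz sense. For small `ε` the corrected energy is
therefore injective near `h`, and its increments control those of the energy. -/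
lemma exists_lipschitz_corr (Q : ℕ → MvPolynomial (Fin 2) ℝ) (k : ℕ) {h : ℝ}
    (hh : h ∈ levels a) : ∃ C, 0 ≤ C ∧ ∀ᶠ w : (ℝ × ℝ) × ℝ in 𝓝 ((h, h), (0 : ℝ)),
      |corr a Q k w.2 w.1.1 - corr a Q k w.2 w.1.2 - (w.1.1 - w.1.2)| ≤
        |w.2| * C * |w.1.1 - w.1.2| := by
  have h1 : ∀ j, ∃ K : NNReal, ∃ t ∈ 𝓝 h, LipschitzOnWith K (onSec a (Q j)) t := fun j =>
    ((contDiffAt_onSec (Q j) hh).of_le (by simp)).exists_lipschitzOnWith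
  choose K t ht hK using h1
  refine ⟨∑ j ∈ Finset.range k, (K j : ℝ), Finset.sum_nonneg fun j _ => (K j).2, ?_⟩
  have h2 : ∀ᶠ x in 𝓝 h, ∀ j ∈ Finset.range k, x ∈ t j :=
    (Finset.range k).eventually_all.2 fun j _ => ht j
  have t1 : Tendsto (fun w : (ℝ × ℝ) × ℝ => w.1.1) (𝓝 ((h, h), 0)) (𝓝 h) :=
    (continuous_fst.comp continuous_fst).tendsto _
  have t2 : Tendsto (fun w : (ℝ × ℝ) × ℝ => w.1.2) (𝓝 ((h, h), 0)) (𝓝 h) :=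
    (continuous_snd.comp continuous_fst).tendsto _
  have t3 : Tendsto (fun w : (ℝ × ℝ) × ℝ => |w.2|) (𝓝 ((h, h), 0)) (𝓝 |0|) :=
    (continuous_abs.comp continuous_snd).tendsto _
  filter_upwards [t1.eventually h2, t2.eventually h2,
    t3.eventually (gt_mem_nhds (show |(0 : ℝ)| < 1 by simp))] with w w1 w2 w3
  have e : corr a Q k w.2 w.1.1 - corr a Q k w.2 w.1.2 - (w.1.1 - w.1.2) =
      -∑ j ∈ Finset.range k, w.2 ^ (j + 1) * (onSec a (Q j) w.1.1 - onSec a (Q j) w.1.2) := by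
    simp only [corr, mul_sub, Finset.sum_sub_distrib]; ring
  rw [e, abs_neg, mul_assoc, Finset.sum_mul, Finset.mul_sum]
  refine (Finset.abs_sum_le_sum_abs _ _).trans (Finset.sum_le_sum fun j hj => ?_)
  rw [abs_mul, abs_pow, pow_succ]
  have l1 := (hK j).dist_le_mul _ (w1 j hj) _ (w2 j hj)
  rw [Real.dist_eq, Real.dist_eq] at l1
  have l2 : |w.2| ^ j ≤ 1 := pow_le_one₀ (abs_nonneg _) w3.le
  calc |w.2| ^ j * |w.2| * |onSec a (Q j) w.1.1 - onSec a (Q j) w.1.2|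
      ≤ 1 * |w.2| * (K j * |w.1.1 - w.1.2|) := by gcongr
    _ = _ := by ring

lemma eventually_polarSol {h : ℝ} (hh : h ∈ levels a) {S : ℝ × ℝ → Ang}
    (hS : ContinuousAt S (h, 0)) (h0 : S (h, 0) = cst √(2 * h))
    (heq : ∀ᶠ z in 𝓝 (h, (0 : ℝ)), S z = cst √(2 * z.1) + z.2 • prim (Phi a f g (z.2, S z))) :
    ∀ᶠ z in 𝓝 (h, (0 : ℝ)), z.1 ∈ levels a ∧ PolarSol a f g √(2 * z.1) z.2 (S z) := by
  have hpos := levels_pos hh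
  have hp : (0 : ℝ) < √(2 * h) := by positivity
  have hg := good_cst (f := f) (g := g) hh
  have hz : ContinuousAt (fun z : ℝ × ℝ => (z.2, S z)) (h, 0) := continuousAt_snd.prodMk hS
  have hg' : ((h, (0 : ℝ)).2, S (h, (0 : ℝ))) ∈ good a f g := by rw [h0]; exact hg
  have e1 := hz.eventually (good_mem_nhds hg')
  have e2 := hS.eventually (eventually_forall_mem (isOpen_Ioi (a := (0 : ℝ))) (fun t => by
    rw [h0]; exact hp))
  have hden : ContinuousAt (fun z : ℝ × ℝ => den a f g (z.2, S z)) (h, 0) :=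
    (contDiffAt_den (f := f) (g := g) hg'.1).continuousAt.comp
      (f := fun z : ℝ × ℝ => (z.2, S z)) hz
  have e3 := hden.eventually (eventually_forall_mem (isOpen_Ioi (a := (0 : ℝ))) (fun t => by
      simpa [h0, den, cst] using hpos))
  have e4 : ∀ᶠ z : ℝ × ℝ in 𝓝 (h, (0 : ℝ)), z.1 ∈ levels a :=
    continuousAt_fst.eventually ((isOpen_levels a).mem_nhds hh)
  filter_upwards [e1, e2, e3, e4, heq] with z z1 z2 z3 z4 z5
  exact ⟨z4, z1, z2, z3, z5⟩

/-- Compares the exact formula `Chain.corr_sub` with the true displacement. The error is a small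
multiple of the displacement itself, so both zeros and leading orders can be transferred. -/
lemma Chain.exists_bound {k : ℕ} {q Q : ℕ → MvPolynomial (Fin 2) ℝ} (c : Chain a f g k q Q)
    {h : ℝ} (hh : h ∈ levels a) {S : ℝ × ℝ → Ang}
    (hS : ContinuousAt S (h, 0)) (h0 : S (h, 0) = cst √(2 * h))
    (hp : ∀ᶠ z in 𝓝 (h, (0 : ℝ)), z.1 ∈ levels a ∧ PolarSol a f g √(2 * z.1) z.2 (S z)) :
    ∃ C, 0 ≤ C ∧ ∀ᶠ z in 𝓝 (h, (0 : ℝ)),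
      |z.2 ^ (k + 1) * flux a f g (q k * omg a f g) (z.2, S z) - (endE (S z) - z.1)| ≤
        |z.2| * C * |endE (S z) - z.1| := by
  obtain ⟨C, hC, hC2⟩ := exists_lipschitz_corr Q k hh
  refine ⟨C, hC, ?_⟩
  have hend : ContinuousAt (fun z => endE (S z)) (h, 0) := by
    unfold endE
    have : ContinuousAt (fun z => S z angEnd) (h, 0) :=
      (ContinuousMap.evalCLM ℝ angEnd : Ang →L[ℝ] ℝ).continuous.continuousAt.comp hS
    fun_prop
  have hpos := levels_pos hh
  have hend0 : endE (S (h, 0)) = h := by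
    rw [h0, endE, cst, ContinuousMap.const_apply, Real.sq_sqrt (by positivity)]; ring
  have ht : Tendsto (fun z : ℝ × ℝ => ((endE (S z), z.1), z.2)) (𝓝 (h, 0)) (𝓝 ((h, h), 0)) := by
    have := (hend.prodMk (continuousAt_fst (p := (h, (0 : ℝ))))).prodMk continuousAt_snd
    rw [ContinuousAt, hend0] at this
    exact this
  filter_upwards [ht.eventually hC2, hp] with z z1 z2
  rw [← c.corr_sub z2.1 z2.2]
  exact z1

/-- The function whose zeros are the fixed points of the return map. -/
def melFun (a : ℝ) (f g : MvPolynomial (Fin 2) ℝ) (Q : ℕ → MvPolynomial (Fin 2) ℝ) (k : ℕ)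
    (h ε : ℝ) : ℝ :=
  (corr a Q k ε (retE a f g ε h) - corr a Q k ε h) / ε ^ (k + 1)

/-- The function `m` is the flux of `q_k ω` along the perturbed orbit. It is smooth up to `ε = 0`,
where it becomes the Abelian integral. As soon as `|ε| C < 1`, the estimate of `Chain.exists_bound`
makes `R = h` equivalent to `m = 0`. -/
theorem Chain.exists_localModel {k : ℕ} {q Q : ℕ → MvPolynomial (Fin 2) ℝ}
    (c : Chain a f g k q Q) {h : ℝ} (hh : h ∈ levels a) :
    ∃ S R m, LocalModel a f g (fun h => Lam a h (q k * omg a f g)) (melFun a f g Q k) h S R m := by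
  obtain ⟨S, hS, h0, heq, hz⟩ := exists_radius f g hh
  have hp := eventually_polarSol hh hS.continuousAt h0 heq
  obtain ⟨C, hC, hb⟩ := c.exists_bound hh hS.continuousAt h0 hp
  have hg' : ((h, (0 : ℝ)).2, S (h, (0 : ℝ))) ∈ good a f g := by rw [h0]; exact good_cst hh
  have hlev : ∀ᶠ h' in 𝓝 h, h' ∈ levels a := (isOpen_levels a).mem_nhds hh
  refine ⟨S, fun z => endE (S z), fun z => flux a f g (q k * omg a f g) (z.2, S z), hS, ?_, ?_, hz,
    ?_, ?_, ?_, ?_⟩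
  · have h1 : ContDiffAt ℝ ∞ (fun z => S z angEnd) (h, 0) :=
      ContDiffAt.comp (g := (ContinuousMap.evalCLM ℝ angEnd : Ang →L[ℝ] ℝ)) (h, (0 : ℝ))
        (ContinuousLinearMap.contDiff _).contDiffAt hS
    unfold endE
    exact (h1.pow 2).div_const 2
  · exact (contDiffAt_flux _ hg').comp (f := fun z : ℝ × ℝ => (z.2, S z)) (h, (0 : ℝ))
      (contDiffAt_snd.prodMk hS)
  · filter_upwards [hz, hlev] with h' h1 h2
    have := levels_pos h2
    rw [h1, endE, cst, ContinuousMap.const_apply, Real.sq_sqrt (by positivity)]; ring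
  · filter_upwards [hz, hlev] with h' h1 h2
    rw [h1, flux_zero f g _ h2]
  · filter_upwards [hp] with z hz
    exact ⟨hz.1, hz.2, rfl, hz.2.retE_eq⟩
  · have hsm : ∀ᶠ z : ℝ × ℝ in 𝓝 (h, (0 : ℝ)), |z.2| * C < 1 := by
      have : ContinuousAt (fun z : ℝ × ℝ => |z.2| * C) (h, 0) := by fun_prop
      exact this.eventually (gt_mem_nhds (by simp))
    filter_upwards [hp, hb, hsm] with z z1 z2 z3 z4
    constructor
    · rw [melFun, z1.2.retE_eq, c.corr_sub z1.1 z1.2]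
      field_simp
    · constructor
      · intro e
        rw [e, sub_self, abs_zero, mul_zero, sub_zero] at z2
        have := abs_nonpos_iff.1 z2
        exact (mul_eq_zero.1 this).resolve_left (by positivity)
      · intro e
        rw [e, mul_zero, zero_sub, abs_neg] at z2
        by_contra hne
        have : 0 < |endE (S z) - z.1| := abs_pos.2 (sub_ne_zero.2 hne)
        nlinarith

/-- By `Chain.exists_bound` the displacement is `ε^(k+1) m (1 + O(ε))`, and `m` is continuous at `ε
= 0`. -/
theorem Chain.isCoeff {k : ℕ} {q Q : ℕ → MvPolynomial (Fin 2) ℝ} (c : Chain a f g k q Q) :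
    IsCoeff a f g (k + 1) (fun h => Lam a h (q k * omg a f g)) := by
  rintro ⟨h, hh⟩
  obtain ⟨S, hS, h0, heq, hz⟩ := exists_radius f g hh
  have hp := eventually_polarSol hh hS.continuousAt h0 heq
  obtain ⟨C, hC, hb⟩ := c.exists_bound hh hS.continuousAt h0 hp
  have hg' : ((h, (0 : ℝ)).2, S (h, (0 : ℝ))) ∈ good a f g := by rw [h0]; exact good_cst hh
  have ht : Tendsto (fun ε : ℝ => (h, ε)) (𝓝[>] 0) (𝓝 (h, 0)) :=
    tendsto_nhdsWithin_of_tendsto_nhds (Continuous.tendsto (by fun_prop) 0)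
  refine ⟨fun ε => endE (S (h, ε)) - h, ?_, ?_⟩
  · filter_upwards [ht.eventually hp] with ε h1
    obtain ⟨T, γ, h2, -⟩ := h1.2.exists_returnArc
    exact ⟨sec a h, sec a (endE (S (h, ε))), isFirstReturn_iff.2 ⟨T, γ, h2⟩, potential_sec hh, by
      rw [potential_sec h1.2.end_mem]⟩
  · simp only
    have hm : ContinuousAt (fun z : ℝ × ℝ => flux a f g (q k * omg a f g) (z.2, S z)) (h, 0) :=
      (contDiffAt_flux _ hg').continuousAt.comp (f := fun z : ℝ × ℝ => (z.2, S z))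
        (continuousAt_snd.prodMk hS.continuousAt)
    have hm0 : flux a f g (q k * omg a f g) ((h, (0 : ℝ)).2, S (h, (0 : ℝ))) =
        Lam a h (q k * omg a f g) := by rw [h0, flux_zero f g _ hh]
    have hm1 := hm.tendsto.comp ht
    simp only [hm0, Function.comp_def] at hm1
    set m : ℝ → ℝ := fun ε => flux a f g (q k * omg a f g) (ε, S (h, ε)) with hm_def
    set L := Lam a h (q k * omg a f g) with hL
    rw [Asymptotics.isLittleO_iff]
    intro η hη
    have e1 : ∀ᶠ ε in 𝓝[>] (0 : ℝ), |m ε - L| < η / 2 := by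
      have := (hm1.sub_const L).abs
      simp only [sub_self, abs_zero] at this
      exact this.eventually (gt_mem_nhds (half_pos hη))
    have e2 : ∀ᶠ ε in 𝓝[>] (0 : ℝ), |ε| * C < 1 / 2 ∧ 2 * (|ε| * C * |m ε|) < η / 2 := by
      have h1 : Tendsto (fun ε : ℝ => |ε| * C) (𝓝[>] 0) (𝓝 0) :=
        tendsto_nhdsWithin_of_tendsto_nhds (by
          have : Continuous fun ε : ℝ => |ε| * C := by fun_prop
          simpa using this.tendsto 0)
      have h2 := (h1.mul hm1.abs).const_mul 2
      rw [zero_mul, mul_zero] at h2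
      exact (h1.eventually (gt_mem_nhds (by norm_num))).and
        (h2.eventually (gt_mem_nhds (half_pos hη)))
    filter_upwards [ht.eventually hb, e1, e2, self_mem_nhdsWithin] with ε h1 h2 h3 h4
    have hε : 0 < ε := h4
    have h1' : |ε ^ (k + 1) * m ε - (endE (S (h, ε)) - h)| ≤
        |ε| * C * |endE (S (h, ε)) - h| := h1
    set d := endE (S (h, ε)) - h
    have hE : 0 < ε ^ (k + 1) := by positivity
    -- The error term is absorbed on the left, since `|ε| C < 1 / 2`.
    have h5 : |d| ≤ 2 * (ε ^ (k + 1) * |m ε|) := by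
      have : |d| ≤ ε ^ (k + 1) * |m ε| + |ε| * C * |d| := by
        have := abs_sub_abs_le_abs_sub d (ε ^ (k + 1) * m ε)
        rw [abs_sub_comm d (ε ^ (k + 1) * m ε), abs_mul, abs_of_pos hE] at this
        linarith
      nlinarith [abs_nonneg d, h3.1]
    rw [Real.norm_eq_abs, Real.norm_eq_abs, abs_of_pos hE]
    have h6 : |d - ε ^ (k + 1) * L| ≤ |ε ^ (k + 1) * m ε - d| + ε ^ (k + 1) * |m ε - L| := by
      have e : d - ε ^ (k + 1) * L = -(ε ^ (k + 1) * m ε - d) + ε ^ (k + 1) * (m ε - L) := by ring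
      rw [e]
      refine (abs_add_le _ _).trans ?_
      rw [abs_neg, abs_mul, abs_of_pos hE]
    have h7 : |ε| * C * |d| ≤ ε ^ (k + 1) * (2 * (|ε| * C * |m ε|)) := by
      have : 0 ≤ |ε| * C := by positivity
      nlinarith
    have h8 := mul_le_mul_of_nonneg_left h3.2.le hE.le
    have h9 := mul_le_mul_of_nonneg_left h2.le hE.le
    linarith

/-- Coefficients are unique, and those of lower order than a coefficient vanish. -/
lemma IsCoeff.unique {k : ℕ} {M M' : levels a → ℝ} (h : IsCoeff a f g k M)
    (h' : IsCoeff a f g k M') : M = M' := by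
  funext x
  obtain ⟨d, hd1, hd2⟩ := h x
  obtain ⟨d', hd1', hd2'⟩ := h' x
  have heq : d =ᶠ[𝓝[>] (0 : ℝ)] d' := by
    filter_upwards [hd1, hd1'] with ε h1 h2
    obtain ⟨x₀, x₁, r1, r2, r3⟩ := h1
    obtain ⟨y₀, y₁, s1, s2, s3⟩ := h2
    have e0 : x₀ = y₀ := by
      rw [← sec_potential r1.1, ← sec_potential s1.1, r2, s2]
    subst e0
    rw [← r3, ← s3, IsFirstReturn.unique (contDiff_field a f g ε) r1 s1]
  have h2 : (fun ε => d' ε - ε ^ k * M x) =o[𝓝[>] (0 : ℝ)] fun ε => ε ^ k :=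
    hd2.congr' (heq.mono fun ε e => by simp only [e]) EventuallyEq.rfl
  have h3 := h2.sub hd2'
  have h4 : (fun ε : ℝ => ε ^ k * (M' x - M x)) =o[𝓝[>] (0 : ℝ)] fun ε => ε ^ k :=
    h3.congr_left fun ε => by ring
  by_contra hne
  have hc : M' x - M x ≠ 0 := sub_ne_zero.2 (Ne.symm hne)
  rw [Asymptotics.isLittleO_iff] at h4
  obtain ⟨ε, h5, h6⟩ := ((h4 (half_pos (abs_pos.2 hc))).and self_mem_nhdsWithin).exists
  have hε : 0 < ε ^ k := pow_pos h6 k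
  rw [Real.norm_eq_abs, Real.norm_eq_abs, abs_mul, abs_of_pos hε] at h5
  have := abs_pos.2 hc
  nlinarith

lemma IsCoeff.of_succ {k : ℕ} {M : levels a → ℝ} (h : IsCoeff a f g (k + 1) M) :
    IsCoeff a f g k 0 := by
  intro x
  obtain ⟨d, hd1, hd2⟩ := h x
  refine ⟨d, hd1, ?_⟩
  have h1 : (fun ε : ℝ => ε ^ (k + 1)) =o[𝓝[>] (0 : ℝ)] fun ε => ε ^ k :=
    (Asymptotics.isLittleO_pow_pow (Nat.lt_succ_self k)).mono nhdsWithin_le_nhds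
  have h2 := (hd2.trans h1).add (h1.const_mul_left (M x))
  refine h2.congr_left fun ε => ?_
  simp only [Pi.zero_apply]
  ring

end

/-! ### Partial derivatives with respect to the first variable -/

/-- The partial derivative with respect to the first variable. -/
def pd (m : ℝ × ℝ → ℝ) (z : ℝ × ℝ) : ℝ := fderiv ℝ m z (1, 0)

lemma contDiffAt_pd {m : ℝ × ℝ → ℝ} {z : ℝ × ℝ} (h : ContDiffAt ℝ ∞ m z) :
    ContDiffAt ℝ ∞ (pd m) z :=
  (h.fderiv_right (m := ∞) (by simp)).clm_apply contDiffAt_const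

lemma contDiffAt_iterate_pd {m : ℝ × ℝ → ℝ} {z : ℝ × ℝ} (h : ContDiffAt ℝ ∞ m z) (i : ℕ) :
    ContDiffAt ℝ ∞ (pd^[i] m) z := by
  induction i generalizing m with
  | zero => exact h
  | succ i ih => exact ih (contDiffAt_pd h)

lemma eventually_contDiffAt {m : ℝ × ℝ → ℝ} {z : ℝ × ℝ} (h : ContDiffAt ℝ ∞ m z) (n : ℕ) :
    ∀ᶠ w in 𝓝 z, ContDiffAt ℝ n m w :=
  (h.of_le (by exact_mod_cast le_top)).eventually (by simp)

lemma hasDerivAt_pd {m : ℝ × ℝ → ℝ} {w : ℝ × ℝ} (h : DifferentiableAt ℝ m w) :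
    HasDerivAt (fun x => m (x, w.2)) (pd m w) w.1 := by
  have h1 : HasDerivAt (fun x : ℝ => ((x, w.2) : ℝ × ℝ)) (1, 0) w.1 :=
    (hasDerivAt_id _).prodMk (hasDerivAt_const _ _)
  exact h.hasFDerivAt.comp_hasDerivAt w.1 h1

lemma eventually_hasDerivAt_pd {m : ℝ × ℝ → ℝ} {z : ℝ × ℝ} (h : ContDiffAt ℝ ∞ m z) :
    ∀ᶠ w in 𝓝 z, HasDerivAt (fun x => m (x, w.2)) (pd m w) w.1 := by
  filter_upwards [eventually_contDiffAt h 1] with w hw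
  exact hasDerivAt_pd (hw.differentiableAt (by simp))

lemma eventually_slice {p : ℝ × ℝ → Prop} {z : ℝ × ℝ} (h : ∀ᶠ w in 𝓝 z, p w) :
    ∀ᶠ w in 𝓝 z, ∀ᶠ x in 𝓝 w.1, p (x, w.2) := by
  filter_upwards [h.eventually_nhds] with w hw
  have : Tendsto (fun x : ℝ => (x, w.2)) (𝓝 w.1) (𝓝 w) := by
    have hc : Continuous fun x : ℝ => ((x, w.2) : ℝ × ℝ) := by fun_prop
    exact hc.tendsto w.1
  exact this.eventually hw

/-- The joint derivatives are continuous in `(h, ε)`, while Rolle's theorem is applied to slices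
with `ε` fixed; this passes from one to the other. -/
lemma eventually_iteratedDeriv {m : ℝ × ℝ → ℝ} {z : ℝ × ℝ} (h : ContDiffAt ℝ ∞ m z) (i : ℕ) :
    ∀ᶠ w in 𝓝 z, iteratedDeriv i (fun x => m (x, w.2)) w.1 = pd^[i] m w := by
  induction i generalizing m with
  | zero => simp
  | succ i ih =>
    filter_upwards [ih (contDiffAt_pd h), eventually_slice (eventually_hasDerivAt_pd h)]
      with w h1 h2
    rw [iteratedDeriv_succ']
    have : deriv (fun x => m (x, w.2)) =ᶠ[𝓝 w.1] fun x => pd m (x, w.2) := by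
      filter_upwards [h2] with x hx using hx.deriv
    rw [Filter.EventuallyEq.iteratedDeriv_eq i this, h1]
    rfl

/-! ### Periodic orbits -/

/-- Only the multiples of `T` need care. There the right derivative at `0` and the left derivative
at `T`, shifted back by `T`, coincide because `γ 0 = γ T`. -/
lemma exists_periodic_extension {V : ℝ × ℝ → ℝ × ℝ} {T : ℝ} (hT : 0 < T) {γ : ℝ → ℝ × ℝ}
    (hd : ∀ t ∈ Icc 0 T, HasDerivWithinAt γ (V (γ t)) (Icc 0 T) t) (h0 : γ 0 = γ T) :
    ∃ δ : ℝ → ℝ × ℝ, (∀ t, HasDerivAt δ (V (δ t)) t) ∧ (∀ t, δ (t + T) = δ t) ∧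
      EqOn δ γ (Icc 0 T) := by
  let δ : ℝ → ℝ × ℝ := fun t => γ (toIcoMod hT 0 t)
  have hper : ∀ t, δ (t + T) = δ t := fun t => by simp [δ]
  have hIco : ∀ t ∈ Ico 0 T, δ t = γ t := fun t ht => by
    simp only [δ]
    rw [(toIcoMod_eq_self hT).2 (by simpa using ht)]
  have heq : EqOn δ γ (Icc 0 T) := by
    intro t ht
    rcases eq_or_lt_of_le ht.2 with h | h
    · rw [h, ← h0, ← hIco 0 ⟨le_rfl, hT⟩, ← hper 0, zero_add]
    · exact hIco t ⟨ht.1, h⟩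
  have hd' : ∀ t ∈ Icc 0 T, HasDerivWithinAt δ (V (δ t)) (Icc 0 T) t := fun t ht => by
    rw [heq ht]
    exact (hd t ht).congr heq (heq ht)
  have hmain : ∀ t ∈ Ico 0 T, HasDerivAt δ (V (δ t)) t := by
    intro t ht
    rcases eq_or_lt_of_le ht.1 with h | h
    · subst h
      have hr : HasDerivWithinAt δ (V (δ 0)) (Ici 0) 0 :=
        (hd' 0 ⟨le_rfl, hT.le⟩).mono_of_mem_nhdsWithin (Icc_mem_nhdsGE hT)
      have hl : HasDerivWithinAt δ (V (δ 0)) (Iic 0) 0 := by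
        have h1 : HasDerivWithinAt δ (V (δ T)) (Iic T) T :=
          (hd' T ⟨hT.le, le_rfl⟩).mono_of_mem_nhdsWithin (Icc_mem_nhdsLE hT)
        have h2 : HasDerivWithinAt (fun t : ℝ => t + T) 1 (Iic 0) 0 :=
          ((hasDerivAt_id 0).add_const T).hasDerivWithinAt
        rw [show T = (fun t : ℝ => t + T) 0 by simp] at h1
        have h3 := h1.scomp (0 : ℝ) h2 (fun x hx => by
          have : x ≤ 0 := hx
          simpa using this)
        rw [one_smul] at h3
        have e : (δ ∘ fun t : ℝ => t + T) = δ := funext hper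
        rw [e] at h3
        rwa [show δ ((fun t : ℝ => t + T) 0) = δ 0 from hper 0] at h3
      have := hl.union hr
      rwa [Iic_union_Ici, hasDerivWithinAt_univ] at this
    · exact (hd' t ⟨ht.1, ht.2.le⟩).hasDerivAt (Icc_mem_nhds h ht.2)
  refine ⟨δ, fun t => ?_, hper, heq⟩
  have hmem : toIcoMod hT 0 t ∈ Ico 0 T := by simpa using toIcoMod_mem_Ico hT 0 t
  have h1 := hmain _ hmem
  set c : ℝ := toIcoDiv hT 0 t • T with hc
  have h2 : toIcoMod hT 0 t = t - c := rfl
  have hsh : ∀ x, δ (x - c) = δ x := fun x => by simp [δ, c]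
  rw [h2] at h1
  have h3 : HasDerivAt (fun x => δ (x - c)) (V (δ (t - c))) t := h1.comp_sub_const t c
  simp only [hsh] at h3
  exact h3

lemma periodic_add_nat {γ : ℝ → ℝ × ℝ} {T : ℝ} (hp : ∀ t, γ (t + T) = γ t) (n : ℕ) (t : ℝ) :
    γ (t + n * T) = γ t := by
  induction n with
  | zero => simp
  | succ n ih => rw [Nat.cast_succ, add_mul, one_mul, ← add_assoc, hp, ih]

/-- Two periodic orbits with a common point coincide. -/
lemma periodicOrbit_eq {V : ℝ × ℝ → ℝ × ℝ} (hV : ContDiff ℝ 1 V) {C C' : Set (ℝ × ℝ)}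
    (h : IsPeriodicOrbit V C) (h' : IsPeriodicOrbit V C') {p : ℝ × ℝ} (hp : p ∈ C)
    (hp' : p ∈ C') : C = C' := by
  have key : ∀ {C C' : Set (ℝ × ℝ)}, IsPeriodicOrbit V C → IsPeriodicOrbit V C' → p ∈ C →
      p ∈ C' → C ⊆ C' := by
    rintro _ _ ⟨γ, T, hT, hd, hper, -, rfl⟩ ⟨γ', T', hT', hd', hper', -, rfl⟩ ⟨t, ht⟩ ⟨t', ht'⟩
    rintro _ ⟨x, rfl⟩
    -- Whole periods are added until the target time lies after the time of the common point, as
    -- uniqueness is available forward in time.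
    obtain ⟨n, hn⟩ := exists_nat_gt ((t - x) / T)
    have hn' : 0 ≤ x + n * T - t := by
      rw [div_lt_iff₀ hT] at hn; linarith
    set L := x + n * T - t with hL
    have h1 : ∀ s ∈ Icc 0 L, HasDerivWithinAt (fun s => γ (s + t)) (V (γ (s + t))) (Icc 0 L) s :=
      fun s _ => ((hd (s + t)).comp_add_const s t).hasDerivWithinAt
    have h2 : ∀ s ∈ Icc 0 L, HasDerivWithinAt (fun s => γ' (s + t')) (V (γ' (s + t'))) (Icc 0 L) s :=
      fun s _ => ((hd' (s + t')).comp_add_const s t').hasDerivWithinAt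
    have h3 := eqOn_of_solutions hV h1 h2 (by simp [ht, ht']) (right_mem_Icc.2 hn')
    simp only [hL, sub_add_cancel] at h3
    rw [periodic_add_nat hper] at h3
    exact ⟨_, h3.symm⟩
  exact (key h h' hp hp').antisymm (key h' h hp' hp)

section

variable {a : ℝ} {f g : MvPolynomial (Fin 2) ℝ}

lemma PolarSol.isPeriodicOrbit {h' ε : ℝ} {σ : Ang} (h : PolarSol a f g √(2 * h') ε σ)
    (he : endE σ = h') :
    IsPeriodicOrbit (field a f g ε) (curve a f g √(2 * h') ε σ '' Icc 0 (2 * Real.pi)) := by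
  obtain ⟨T, γ, ⟨h1, h2, h3, h4, h5, h6, h7⟩, h8⟩ := h.exists_returnArc
  have h56 : γ 0 = γ T := by rw [h5, h6, he]; rfl
  obtain ⟨δ, d1, d2, d3⟩ := exists_periodic_extension h3 h4 h56
  have hC : curve a f g √(2 * h') ε σ '' Icc 0 (2 * Real.pi) = range δ := by
    rw [← h8, ← d3.image_eq]
    have := Function.Periodic.image_Icc d2 h3 0
    rw [zero_add] at this
    exact this
  refine ⟨δ, T, h3, d1, d2, ?_, hC⟩
  -- A constant orbit would put the point of angle `π`, where `u < 0`, on the cross-section.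
  by_contra hcon
  push Not at hcon
  have hpi : Real.pi ∈ Icc 0 (2 * Real.pi) := ⟨Real.pi_pos.le, by linarith [Real.pi_pos]⟩
  have hm : curve a f g √(2 * h') ε σ Real.pi ∈ range δ := hC ▸ ⟨_, hpi, rfl⟩
  obtain ⟨t, ht⟩ := hm
  have hv := h.mem_vals ⟨Real.pi, hpi⟩
  simp only [Real.cos_pi, mul_neg, mul_one] at hv
  have h9 : (curve a f g √(2 * h') ε σ Real.pi).1 = sec a h' := by
    rw [← ht, hcon t, d3 (left_mem_Icc.2 h3.le), h5]; rfl
  rw [h.curve_eq ⟨Real.pi, hpi⟩, curX_apply h.mem.1] at h9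
  simp only [Real.cos_pi, mul_neg, mul_one] at h9
  have h10 : 0 < amp a (sec a h') := by
    change absc a _ ∈ crossSection a at h1
    rw [crossSection_eq] at h1
    exact amp_pos h1.1 h1.2
  rw [← h9, amp_absc hv] at h10
  linarith [h.pos ⟨Real.pi, hpi⟩]

/-! ### The annulus between two ovals -/

/-- The closed annulus filled with the ovals of energies in `[r₁, r₂]`. -/
def annulus (a r₁ r₂ : ℝ) : Set (ℝ × ℝ) := {p | p.1 ∈ basin a ∧ ham a p ∈ Icc r₁ r₂}

lemma iUnion_oval {r₁ r₂ : ℝ} (h1 : 0 < r₁) (h2 : r₂ ∈ levels a) :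
    ⋃ h ∈ Icc r₁ r₂, oval a h = annulus a r₁ r₂ := by
  ext p
  simp only [mem_iUnion, exists_prop]
  constructor
  · rintro ⟨h, hh, hp⟩
    rw [mem_oval_iff (levels_of_le h2 (h1.trans_le hh.1) hh.2)] at hp
    exact ⟨hp.1, by rw [hp.2]; exact hh⟩
  · rintro ⟨h3, h4⟩
    exact ⟨ham a p, h4, (mem_oval_iff (levels_of_le h2 (h1.trans_le h4.1) h4.2)).2 ⟨h3, rfl⟩⟩

lemma annulus_eq_image {r₁ r₂ : ℝ} (h1 : 0 < r₁) (h2 : r₂ ∈ levels a) :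
    annulus a r₁ r₂ =
      (fun z : ℝ × ℝ => pt a √(2 * z.1) z.2) '' (Icc r₁ r₂ ×ˢ Icc 0 (2 * Real.pi)) := by
  rw [← iUnion_oval h1 h2]
  ext p
  simp only [mem_iUnion, exists_prop]
  constructor
  · rintro ⟨h, hh, hp⟩
    rw [oval_eq_image (levels_of_le h2 (h1.trans_le hh.1) hh.2)] at hp
    obtain ⟨θ, hθ, rfl⟩ := hp
    exact ⟨(h, θ), ⟨hh, hθ⟩, rfl⟩
  · rintro ⟨⟨h, θ⟩, ⟨hh, hθ⟩, rfl⟩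
    refine ⟨h, hh, ?_⟩
    rw [oval_eq_image (levels_of_le h2 (h1.trans_le hh.1) hh.2)]
    exact ⟨θ, hθ, rfl⟩

lemma isCompact_annulus {r₁ r₂ : ℝ} (h1 : 0 < r₁) (h2 : r₂ ∈ levels a) :
    IsCompact (annulus a r₁ r₂) := by
  rw [annulus_eq_image h1 h2]
  refine (isCompact_Icc.prod isCompact_Icc).image_of_continuousOn fun z hz => ?_
  have hl := levels_of_le h2 (h1.trans_le hz.1.1) hz.1.2
  have hv : √(2 * z.1) * Real.cos z.2 ∈ vals a :=
    mul_cos_mem hl (abs_of_nonneg (Real.sqrt_nonneg _)).le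
  have hc : ContinuousAt (absc a) (√(2 * z.1) * Real.cos z.2) :=
    (contDiffAt_absc' hv 1).continuousAt
  have hm : ContinuousAt (fun z : ℝ × ℝ => √(2 * z.1) * Real.cos z.2) z := by fun_prop
  refine ContinuousAt.continuousWithinAt (ContinuousAt.prodMk
    (ContinuousAt.comp (f := fun z : ℝ × ℝ => √(2 * z.1) * Real.cos z.2) hc hm) ?_)
  fun_prop

/-- The angular momentum of the field, negative where it turns clockwise. -/
def turn (a : ℝ) (f g : MvPolynomial (Fin 2) ℝ) (ε : ℝ) (p : ℝ × ℝ) : ℝ :=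
  p.1 * (field a f g ε p).2 - p.2 * (field a f g ε p).1

lemma ham_zero_left (y : ℝ) : ham a (0, y) = y ^ 2 / 2 := by simp [ham, potential]

lemma turn_zero_neg {p : ℝ × ℝ} (hb : p.1 ∈ basin a) (hp : 0 < ham a p) :
    turn a f g 0 p < 0 := by
  have h1 := slope_pos hb
  have e : turn a f g 0 p = -(p.1 ^ 2 * slope a p.1 + p.2 ^ 2) := by
    simp only [turn, field, slope]; ring
  rw [e, neg_lt_zero]
  by_cases h : p.1 = 0
  · have : p = (0, p.2) := Prod.ext h rfl
    rw [this, ham_zero_left] at hp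
    nlinarith [mul_nonneg (sq_nonneg p.1) h1.le]
  · have := mul_pos (pow_pos (abs_pos.2 h) 2) h1
    rw [sq_abs] at this
    nlinarith [sq_nonneg p.2]

lemma eventually_turn_neg {r₁ r₂ : ℝ} (h1 : 0 < r₁) (h2 : r₂ ∈ levels a) :
    ∀ᶠ ε in 𝓝 (0 : ℝ), ∀ p ∈ annulus a r₁ r₂, turn a f g ε p < 0 := by
  refine (isCompact_annulus h1 h2).eventually_forall_of_forall_eventually fun p hp => ?_
  have hc : ContinuousAt (fun z : ℝ × (ℝ × ℝ) => turn a f g z.1 z.2) (0, p) := by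
    have e1 := (contDiff_eval f (n := 0)).continuous
    have e2 := (contDiff_eval g (n := 0)).continuous
    have e3 : Continuous fun z : ℝ × (ℝ × ℝ) => MvPolynomial.eval ![z.2.1, z.2.2] f :=
      e1.comp continuous_snd
    have e4 : Continuous fun z : ℝ × (ℝ × ℝ) => MvPolynomial.eval ![z.2.1, z.2.2] g :=
      e2.comp continuous_snd
    unfold turn field
    fun_prop
  exact hc.eventually (gt_mem_nhds (turn_zero_neg hp.1 (h1.trans_le hp.2.1)))

/-- A periodic orbit in an annulus where the field turns clockwise meets the positive half-axis. -/
lemma exists_mem_axis {r₁ r₂ ε T : ℝ}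
    (hturn : ∀ p ∈ annulus a r₁ r₂, turn a f g ε p < 0) {γ : ℝ → ℝ × ℝ} (hT : 0 < T)
    (hd : ∀ t, HasDerivAt γ (field a f g ε (γ t)) t) (hper : ∀ t, γ (t + T) = γ t)
    (hsub : ∀ t, γ t ∈ annulus a r₁ r₂) : ∃ t, 0 ≤ (γ t).1 ∧ (γ t).2 = 0 := by
  by_contra hcon
  push Not at hcon
  -- If the curve avoids the closed positive half-axis, its negative stays in the slit plane and has
  -- a continuous argument. That argument is periodic, hence has a maximum, but its derivative has
  -- the sign of `turn`, which is negative.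
  let w : ℝ → ℂ := fun t => ⟨-(γ t).1, -(γ t).2⟩
  have hw : ∀ t, w t ∈ Complex.slitPlane := by
    intro t
    rw [Complex.mem_slitPlane_iff]
    by_cases hy : (γ t).2 = 0
    · left
      have : (γ t).1 < 0 := by
        by_contra hx
        exact hcon t (not_lt.1 hx) hy
      simpa [w] using this
    · right; simpa [w] using hy
  have hwd : ∀ t, HasDerivAt w ⟨-(field a f g ε (γ t)).1, -(field a f g ε (γ t)).2⟩ t := by
    intro t
    have d1 : HasDerivAt (fun t => (γ t).1) (field a f g ε (γ t)).1 t := (hd t).fst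
    have d2 : HasDerivAt (fun t => (γ t).2) (field a f g ε (γ t)).2 t := (hd t).snd
    have n1 : HasDerivAt (fun t => -(γ t).1) (-(field a f g ε (γ t)).1) t := d1.neg
    have n2 : HasDerivAt (fun t => -(γ t).2) (-(field a f g ε (γ t)).2) t := d2.neg
    have e1 := n1.ofReal_comp
    have e2 := n2.ofReal_comp.mul_const Complex.I
    have e3 := e1.add e2
    convert! e3 using 1
    · ext s
      exact (Complex.mk_eq_add_mul_I _ _)
    · exact Complex.mk_eq_add_mul_I _ _
  have hld : ∀ t, HasDerivAt (fun t => (Complex.log (w t)).im)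
      ((⟨-(field a f g ε (γ t)).1, -(field a f g ε (γ t)).2⟩ : ℂ) / w t).im t := by
    intro t
    have := ((hwd t).clog_real (hw t))
    exact Complex.imCLM.hasFDerivAt.comp_hasDerivAt t this
  have hc : Continuous fun t => (Complex.log (w t)).im :=
    continuous_iff_continuousAt.2 fun t => (hld t).continuousAt
  obtain ⟨t₀, -, ht₀⟩ := (isCompact_Icc (a := (0 : ℝ)) (b := T)).exists_isMaxOn
    ⟨0, left_mem_Icc.2 hT.le⟩ hc.continuousOn
  have hmax : ∀ t, (Complex.log (w t)).im ≤ (Complex.log (w t₀)).im := by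
    intro t
    have hP : Function.Periodic (fun t => (Complex.log (w t)).im) T := fun t => by
      simp only [w, hper]
    obtain ⟨y, hy, e⟩ := hP.exists_mem_Ico₀ hT t
    rw [e]
    exact ht₀ ⟨hy.1, hy.2.le⟩
  have hz := IsLocalMax.hasDerivAt_eq_zero (Eventually.of_forall hmax) (hld t₀)
  have hne : w t₀ ≠ 0 := Complex.slitPlane_ne_zero (hw t₀)
  have hns : 0 < Complex.normSq (w t₀) := Complex.normSq_pos.2 hne
  rw [Complex.div_im] at hz
  have hz' := hturn _ (hsub t₀)
  unfold turn at hz'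
  simp only [w] at hz hns
  field_simp at hz
  linarith

lemma mem_crossSection_of_annulus {r₁ r₂ : ℝ} (h1 : 0 < r₁) {p : ℝ × ℝ}
    (hp : p ∈ annulus a r₁ r₂) (hx : 0 ≤ p.1) (hy : p.2 = 0) :
    p.1 ∈ crossSection a ∧ ∃ h ∈ Icc r₁ r₂, p = (sec a h, 0) := by
  have hpos : 0 < p.1 := by
    refine lt_of_le_of_ne hx fun h => ?_
    have : p = (0, 0) := Prod.ext h.symm hy
    have h3 := hp.2.1
    rw [this, ham_zero_left] at h3
    norm_num at h3
    linarith
  have hc : p.1 ∈ crossSection a := by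
    rw [crossSection_eq]; exact ⟨hp.1, hpos⟩
  refine ⟨hc, ham a p, hp.2, Prod.ext ?_ hy⟩
  simp only [ham, hy]
  norm_num
  exact (sec_potential hc).symm

lemma annulus_sec_mem {r₁ r₂ h : ℝ} (hl : h ∈ levels a) (hp : (sec a h, (0 : ℝ)) ∈ annulus a r₁ r₂) :
    h ∈ Icc r₁ r₂ := by
  have := hp.2
  rw [ham] at this
  simp only at this
  rw [potential_sec hl] at this
  norm_num at this
  exact this

/-- Each crossing of the cross-section by a periodic orbit in the annulus is the first return of
another one. -/
lemma exists_previous_crossing {r₁ r₂ ε T : ℝ} (h1 : 0 < r₁)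
    (hturn : ∀ p ∈ annulus a r₁ r₂, turn a f g ε p < 0) {γ : ℝ → ℝ × ℝ} (hT : 0 < T)
    (hd : ∀ t, HasDerivAt γ (field a f g ε (γ t)) t) (hper : ∀ t, γ (t + T) = γ t)
    (hsub : ∀ t, γ t ∈ annulus a r₁ r₂) {t : ℝ} (ht : 0 ≤ (γ t).1 ∧ (γ t).2 = 0) :
    ∃ t', (0 ≤ (γ t').1 ∧ (γ t').2 = 0) ∧
      IsFirstReturn a (field a f g ε) (γ t').1 (γ t).1 := by
  have hcont : Continuous γ := continuous_iff_continuousAt.2 fun s => (hd s).continuousAt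
  have hx : 0 < (γ t).1 := by
    have := (mem_crossSection_of_annulus h1 (hsub t) ht.1 ht.2).1
    rw [crossSection_eq] at this
    exact this.2
  have hy : (field a f g ε (γ t)).2 ≠ 0 := by
    intro h0
    have := hturn _ (hsub t)
    rw [turn, h0, ht.2] at this
    simp at this
  have hne : ∀ᶠ s in 𝓝[≠] t, (γ s).2 ≠ 0 := by
    have d2 : HasDerivAt (fun t => (γ t).2) (field a f g ε (γ t)).2 t := (hd t).snd
    have := d2.eventually_ne (c := (γ t).2) hy
    rwa [ht.2] at this
  rw [eventually_nhdsWithin_iff, Metric.eventually_nhds_iff] at hne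
  obtain ⟨δ, hδ, hne⟩ := hne
  -- Crossings from one period back until shortly before `t`; the crossing at `t` is isolated
  -- because the field is transversal there. The latest element of `K` is the previous crossing.
  let K : Set ℝ := Icc (t - T) (t - min δ T / 2) ∩ {s | 0 ≤ (γ s).1 ∧ (γ s).2 = 0}
  have hmin : 0 < min δ T := lt_min hδ hT
  have hK : IsCompact K := by
    refine isCompact_Icc.inter_right (IsClosed.inter ?_ ?_)
    · exact isClosed_le continuous_const (continuous_fst.comp hcont)
    · exact isClosed_eq (continuous_snd.comp hcont) continuous_const
  have hγT : γ (t - T) = γ t := by rw [← hper (t - T), sub_add_cancel]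
  have hKn : K.Nonempty := ⟨t - T, ⟨le_rfl, by linarith [min_le_right δ T]⟩, by
    change 0 ≤ (γ (t - T)).1 ∧ (γ (t - T)).2 = 0
    rw [hγT]; exact ht⟩
  obtain ⟨t', ht'K, ht'max⟩ := hK.exists_isGreatest hKn
  refine ⟨t', ht'K.2, ?_⟩
  have hlt : t' < t := by linarith [ht'K.1.2]
  rw [isFirstReturn_iff]
  refine ⟨t - t', fun s => γ (s + t'), (mem_crossSection_of_annulus h1 (hsub t') ht'K.2.1
    ht'K.2.2).1, (mem_crossSection_of_annulus h1 (hsub t) ht.1 ht.2).1, by linarith,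
    fun s _ => ((hd (s + t')).comp_add_const s t').hasDerivWithinAt, ?_, ?_, ?_⟩
  · change γ (0 + t') = _
    rw [zero_add]; exact Prod.ext rfl ht'K.2.2
  · change γ (t - t' + t') = _
    rw [sub_add_cancel]; exact Prod.ext rfl ht.2
  · rintro s ⟨hs0, hs1⟩ ⟨hs2, hs3⟩
    have hs4 : 0 ≤ (γ (s + t')).1 := hs2.1.le
    rcases le_or_gt (s + t') (t - min δ T / 2) with hle | hgt
    · have := ht'max (a := s + t') ⟨⟨by linarith [ht'K.1.1], hle⟩, hs4, hs3⟩
      linarith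
    · refine hne (y := s + t') ?_ ?_ hs3
      · rw [Real.dist_eq, abs_lt]
        constructor <;> linarith [min_le_left δ T]
      · have : s + t' < t := by linarith
        exact this.ne

/-- A periodic orbit in the annulus crosses the cross-section at a fixed point of the return map, if
the latter is monotone. -/
lemma exists_fixed_of_periodic {r₁ r₂ ε : ℝ} (h1 : 0 < r₁) (h2 : r₂ ∈ levels a)
    (hturn : ∀ p ∈ annulus a r₁ r₂, turn a f g ε p < 0)
    (hmono : MonotoneOn (retE a f g ε) (Icc r₁ r₂))
    (hret : ∀ h ∈ Icc r₁ r₂, retE a f g ε h ∈ levels a ∧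
      IsFirstReturn a (field a f g ε) (sec a h) (sec a (retE a f g ε h)))
    {C : Set (ℝ × ℝ)} (hC : IsPeriodicOrbit (field a f g ε) C) (hsub : C ⊆ annulus a r₁ r₂) :
    ∃ h ∈ Icc r₁ r₂, (sec a h, (0 : ℝ)) ∈ C ∧ retE a f g ε h = h := by
  obtain ⟨γ, T, hT, hd, hper, -, rfl⟩ := hC
  have hsub' : ∀ t, γ t ∈ annulus a r₁ r₂ := fun t => hsub ⟨t, rfl⟩
  have hlev : ∀ h ∈ Icc r₁ r₂, h ∈ levels a := fun h hh => levels_of_le h2 (h1.trans_le hh.1) hh.2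
  have hcont : Continuous γ := continuous_iff_continuousAt.2 fun s => (hd s).continuousAt
  have hcomp : IsCompact (range γ) := by
    have := Function.Periodic.image_Icc hper hT 0
    rw [← this]
    exact isCompact_Icc.image hcont
  -- The energies of all crossings. At the greatest one, `h`, the return has energy at most `h`. On
  -- the other hand `h` is itself the return of some `h' ≤ h`, so monotonicity gives the opposite
  -- inequality.
  let E : Set ℝ := Icc r₁ r₂ ∩ (fun h => (sec a h, (0 : ℝ))) ⁻¹' (range γ)
  have hE : IsCompact E := by
    refine isCompact_Icc.of_isClosed_subset ?_ inter_subset_left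
    refine ContinuousOn.preimage_isClosed_of_isClosed (fun h hh => ?_) isClosed_Icc
      hcomp.isClosed
    exact ((contDiffAt_sec (hlev h hh)).continuousAt.prodMk
      continuousAt_const).continuousWithinAt
  obtain ⟨t, ht⟩ := exists_mem_axis hturn hT hd hper hsub'
  have hEn : E.Nonempty := by
    obtain ⟨h, hh, e⟩ := (mem_crossSection_of_annulus h1 (hsub' t) ht.1 ht.2).2
    exact ⟨h, hh, t, e⟩
  obtain ⟨h, ⟨hh, t₀, ht₀⟩, hmax⟩ := hE.exists_isGreatest hEn
  refine ⟨h, hh, ⟨t₀, ht₀⟩, le_antisymm ?_ ?_⟩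
  · obtain ⟨hl, hr⟩ := hret h hh
    rw [isFirstReturn_iff] at hr
    obtain ⟨T₁, γ₁, -, -, k3, k4, k5, k6, -⟩ := hr
    have := eqOn_of_solutions (contDiff_field a f g ε) k4 (γ₂ := fun s => γ (s + t₀))
      (fun s _ => ((hd (s + t₀)).comp_add_const s t₀).hasDerivWithinAt)
      (by rw [k5]; simp only [zero_add]; exact ht₀.symm) (right_mem_Icc.2 k3.le)
    rw [k6] at this
    have hm : (sec a (retE a f g ε h), (0 : ℝ)) ∈ range γ := ⟨_, this.symm⟩
    exact hmax ⟨annulus_sec_mem hl (hsub hm), hm⟩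
  · obtain ⟨t', ht', hr⟩ := exists_previous_crossing h1 hturn hT hd hper hsub' (t := t₀)
      (by rw [ht₀]; exact ⟨(sec_mem (hlev h hh)).1.le, rfl⟩)
    obtain ⟨h', hh', e⟩ := (mem_crossSection_of_annulus h1 (hsub' t') ht'.1 ht'.2).2
    rw [e, ht₀] at hr
    have e2 := retE_eq (hlev h hh) hr
    have := hmono hh' hh (hmax ⟨hh', t', e⟩)
    rwa [e2] at this

end

/-! ### Limit cycles of a perturbation with given local models -/

section

variable {a : ℝ} {f g : MvPolynomial (Fin 2) ℝ} {M : ℝ → ℝ} {μ : ℝ → ℝ → ℝ}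

lemma eventually_segment {p : ℝ → ℝ → Prop} {r₁ r₂ : ℝ}
    (h : ∀ x ∈ Icc r₁ r₂, ∀ᶠ z in 𝓝 (x, (0 : ℝ)), p z.1 z.2) :
    ∀ᶠ ε in 𝓝 (0 : ℝ), ∀ x ∈ Icc r₁ r₂, p x ε := by
  refine isCompact_Icc.eventually_forall_of_forall_eventually
    (P := fun ε x => p x ε) fun x hx => ?_
  have : Tendsto (fun z : ℝ × ℝ => (z.2, z.1)) (𝓝 ((0 : ℝ), x)) (𝓝 (x, (0 : ℝ))) :=
    (continuous_snd.prodMk continuous_fst).tendsto _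
  exact this.eventually (h x hx)

/-- At `ε = 0` the return map is the identity, so its derivative in `h` stays positive nearby. The
local functions `R` and `m` are traded for `retE` and `μ`, which do not depend on the base point, so
that the local statements can be glued over a compact interval. -/
lemma LocalModel.eventually_return {h : ℝ} {S R m} (L : LocalModel a f g M μ h S R m) :
    ∀ᶠ z in 𝓝 (h, (0 : ℝ)), (∃ D > 0, HasDerivAt (retE a f g z.2) D z.1) ∧
      retE a f g z.2 z.1 ∈ levels a ∧
      IsFirstReturn a (field a f g z.2) (sec a z.1) (sec a (retE a f g z.2 z.1)) ∧
      (0 < z.2 → (retE a f g z.2 z.1 = z.1 ↔ μ z.1 z.2 = 0)) := by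
  have h1 : pd R (h, 0) = 1 := by
    have e1 := hasDerivAt_pd (L.smooth_R.differentiableAt (by simp))
    have e2 : HasDerivAt (fun x => R (x, (0 : ℝ))) 1 h :=
      (hasDerivAt_id h).congr_of_eventuallyEq L.R_zero
    exact e1.unique e2
  have h2 : ∀ᶠ z in 𝓝 (h, (0 : ℝ)), 0 < pd R z :=
    (contDiffAt_pd L.smooth_R).continuousAt.eventually (lt_mem_nhds (by rw [h1]; norm_num))
  filter_upwards [h2, eventually_hasDerivAt_pd L.smooth_R, eventually_slice L.polar, L.polar,
    L.fixed] with z z1 z2 z3 z4 z5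
  obtain ⟨T, γ, e1, -⟩ := z4.2.1.exists_returnArc
  refine ⟨⟨_, z1, z2.congr_of_eventuallyEq ?_⟩, ?_, ?_, fun hz => ?_⟩
  · filter_upwards [z3] with x hx using hx.2.2.2
  · rw [z4.2.2.2, ← z4.2.2.1]; exact z4.2.1.end_mem
  · rw [z4.2.2.2, ← z4.2.2.1]; exact isFirstReturn_iff.2 ⟨T, γ, e1⟩
  · rw [z4.2.2.2, (z5 hz).2, (z5 hz).1]

/-- The first return map in an annulus for all small positive `ε`. -/
lemma eventually_return (hM : ∀ h ∈ levels a, ∃ S R m, LocalModel a f g M μ h S R m) {r₁ r₂ : ℝ}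
    (h1 : 0 < r₁) (h2 : r₂ ∈ levels a) : ∀ᶠ ε in 𝓝[>] (0 : ℝ),
      MonotoneOn (retE a f g ε) (Icc r₁ r₂) ∧
      (∀ p ∈ annulus a r₁ r₂, turn a f g ε p < 0) ∧
      (∀ h ∈ Icc r₁ r₂, retE a f g ε h ∈ levels a ∧
        IsFirstReturn a (field a f g ε) (sec a h) (sec a (retE a f g ε h))) ∧
      (∀ h ∈ Icc r₁ r₂, retE a f g ε h = h ↔ μ h ε = 0) := by
  have key := eventually_segment (p := fun x ε => (∃ D > 0, HasDerivAt (retE a f g ε) D x) ∧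
      retE a f g ε x ∈ levels a ∧
      IsFirstReturn a (field a f g ε) (sec a x) (sec a (retE a f g ε x)) ∧
      (0 < ε → (retE a f g ε x = x ↔ μ x ε = 0))) (r₁ := r₁) (r₂ := r₂) (fun x hx => by
    obtain ⟨S, R, m, L⟩ := hM x (levels_of_le h2 (h1.trans_le hx.1) hx.2)
    exact L.eventually_return)
  filter_upwards [nhdsWithin_le_nhds key, nhdsWithin_le_nhds (eventually_turn_neg h1 h2),
    self_mem_nhdsWithin] with ε h3 h4 h5
  refine ⟨?_, h4, fun h hh => ⟨(h3 h hh).2.1, (h3 h hh).2.2.1⟩, fun h hh => (h3 h hh).2.2.2 h5⟩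
  refine monotoneOn_of_deriv_nonneg (convex_Icc _ _) (fun x hx => ?_) (fun x hx => ?_)
    fun x hx => ?_
  · obtain ⟨D, -, hD⟩ := (h3 x hx).1
    exact hD.continuousAt.continuousWithinAt
  · obtain ⟨D, -, hD⟩ := (h3 x (interior_subset hx)).1
    exact hD.differentiableAt.differentiableWithinAt
  · obtain ⟨D, h0, hD⟩ := (h3 x (interior_subset hx)).1
    rw [hD.deriv]; exact h0.le

lemma eventually_periodic (hM : ∀ h ∈ levels a, ∃ S R m, LocalModel a f g M μ h S R m) {r₁ r₂ : ℝ}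
    (h1 : 0 < r₁) (h2 : r₂ ∈ levels a) : ∀ᶠ ε in 𝓝[>] (0 : ℝ), ∀ C,
      IsPeriodicOrbit (field a f g ε) C → C ⊆ annulus a r₁ r₂ →
        ∃ h ∈ Icc r₁ r₂, (sec a h, (0 : ℝ)) ∈ C ∧ μ h ε = 0 := by
  filter_upwards [eventually_return hM h1 h2] with ε ⟨e1, e2, e3, e4⟩ C hC hsub
  obtain ⟨h, hh, k1, k2⟩ := exists_fixed_of_periodic h1 h2 e2 e1 e3 hC hsub
  exact ⟨h, hh, k1, (e4 h hh).1 k2⟩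

/-- Near a simple zero of `M` there is a limit cycle. -/
lemma exists_limitCycle (hM : ∀ h ∈ levels a, ∃ S R m, LocalModel a f g M μ h S R m) {z D : ℝ}
    (hz : z ∈ levels a) (h0 : M z = 0) (hD : HasDerivAt M D z) (hD0 : D ≠ 0) {η r : ℝ}
    (hη : 0 < η) (hr : 0 < r) : ∀ᶠ ε in 𝓝[>] (0 : ℝ), ∃ C, IsLimitCycle (field a f g ε) C ∧
      Metric.hausdorffEDist C (oval a z) < ENNReal.ofReal η ∧
      C ⊆ {p | p.1 ∈ basin a ∧ |ham a p - z| < r} := by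
  obtain ⟨S, R, m, L⟩ := hM z hz
  have hzpos := levels_pos hz
  have hS0 : S (z, 0) = cst √(2 * z) := L.S_zero.self_of_nhds
  have hg := (good_cst (f := f) (g := g) hz).1
  -- closeness of the curves
  have hcx : ContinuousAt (fun w => curX a (S w)) (z, (0 : ℝ)) := by
    have := (contDiffAt_curX hg).continuousAt
    rw [← hS0] at this
    exact ContinuousAt.comp (g := curX a) (f := S) this L.smooth_S.continuousAt
  have hcy : ContinuousAt (fun w => curY (S w)) (z, (0 : ℝ)) := by
    have h1 := L.smooth_S.continuousAt
    unfold curY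
    fun_prop
  have k1 : ∀ᶠ w in 𝓝 (z, (0 : ℝ)), dist (curX a (S w)) (curX a (cst √(2 * z))) < η / 2 := by
    have := Metric.tendsto_nhds.1 hcx (η / 2) (by positivity)
    simp only [hS0] at this
    exact this
  have k2 : ∀ᶠ w in 𝓝 (z, (0 : ℝ)), dist (curY (S w)) (curY (cst √(2 * z))) < η / 2 := by
    have := Metric.tendsto_nhds.1 hcy (η / 2) (by positivity)
    simp only [hS0] at this
    exact this
  -- sign of the derivative
  have hpd : pd m (z, 0) = D := by
    have e1 := hasDerivAt_pd (L.smooth_m.differentiableAt (by simp))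
    exact e1.unique (hD.congr_of_eventuallyEq L.m_zero)
  have k3 : ∀ᶠ w in 𝓝 (z, (0 : ℝ)), 0 < D * pd m w := by
    have : ContinuousAt (fun w => D * pd m w) (z, (0 : ℝ)) :=
      continuousAt_const.mul (contDiffAt_pd L.smooth_m).continuousAt
    refine this.eventually (lt_mem_nhds ?_)
    simp only [hpd]
    exact mul_self_pos.2 hD0
  have k4 := eventually_hasDerivAt_pd L.smooth_m
  have k6 : ∀ᶠ w in 𝓝 (z, (0 : ℝ)), ContinuousAt m w := by
    filter_upwards [eventually_contDiffAt L.smooth_m 0] with w hw using hw.continuousAt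
  have kall := (k1.and k2).and ((k3.and (k4.and k6)).and (L.polar.and L.fixed))
  rw [Metric.eventually_nhds_iff] at kall
  obtain ⟨δ₀, hδ₀, kall⟩ := kall
  -- The window `[z - δ, z + δ]` must fit in the domain of the local model, in the requested range
  -- `r`, and in the positive energies.
  let δ := min (δ₀ / 2) (min (r / 2) (z / 2))
  have hδ : 0 < δ := by positivity
  have hd1 : δ ≤ δ₀ / 2 := min_le_left _ _
  have hd2 : δ ≤ r / 2 := (min_le_right _ _).trans (min_le_left _ _)
  have hd3 : δ ≤ z / 2 := (min_le_right _ _).trans (min_le_right _ _)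
  have kall' : ∀ h ∈ Icc (z - δ) (z + δ), ∀ ε, |ε| < δ₀ → dist (h, ε) (z, (0 : ℝ)) < δ₀ := by
    intro h hh ε hε
    rw [Prod.dist_eq, max_lt_iff, Real.dist_eq, Real.dist_eq, sub_zero]
    refine ⟨?_, hε⟩
    rw [abs_lt]
    constructor <;> linarith [hh.1, hh.2]
  -- The factor `D` makes the function increasing whatever the sign of `D`, so `m` has at most one
  -- zero in the window.
  have hstrict : ∀ ε, |ε| < δ₀ → StrictMonoOn (fun h => D * m (h, ε)) (Icc (z - δ) (z + δ)) := by
    intro ε hε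
    have hd : ∀ h ∈ Icc (z - δ) (z + δ),
        HasDerivAt (fun h => D * m (h, ε)) (D * pd m (h, ε)) h := fun h hh =>
      (kall (kall' h hh ε hε)).2.1.2.1.const_mul D
    refine strictMonoOn_of_deriv_pos (convex_Icc _ _)
      (fun x hx => (hd x hx).continuousAt.continuousWithinAt) fun x hx => ?_
    rw [(hd x (interior_subset hx)).deriv]
    exact (kall (kall' x (interior_subset hx) ε hε)).2.1.1
  have hzm : z ∈ Icc (z - δ) (z + δ) := ⟨by linarith, by linarith⟩
  have hlo : z - δ ∈ Icc (z - δ) (z + δ) := ⟨le_rfl, by linarith⟩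
  have hhi : z + δ ∈ Icc (z - δ) (z + δ) := ⟨by linarith, le_rfl⟩
  have hm0 : m (z, 0) = 0 := by rw [L.m_zero.self_of_nhds, h0]
  have hst0 := hstrict 0 (by simpa using hδ₀)
  have hR : ∀ h ∈ Icc (z - δ) (z + δ), ∀ ε, |ε| < δ₀ → 0 < ε → μ h ε = m (h, ε) ∧
      (m (h, ε) = 0 → retE a f g ε h = h) := by
    intro h hh ε hε he
    have := (kall (kall' h hh ε hε)).2.2
    refine ⟨(this.2 he).1, fun hm => ?_⟩
    rw [this.1.2.2.2]
    exact (this.2 he).2.2 hm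
  have hlev : z + δ ∈ levels a :=
    (kall (kall' _ hhi 0 (by simpa using hδ₀))).2.2.1.1
  have hr1 : 0 < z - δ := by linarith
  -- the radius stays close to the initial one
  have k5 : ∀ᶠ w in 𝓝 (z, (0 : ℝ)), ∀ t, |S w t ^ 2 / 2 - z| < δ := by
    have h1 := L.smooth_S.continuousAt
    have h2 : ContinuousAt (fun w => ‖(2⁻¹ : ℝ) • (S w * S w) - cst z‖) (z, (0 : ℝ)) := by
      fun_prop
    have h3 : ‖(2⁻¹ : ℝ) • (S (z, 0) * S (z, 0)) - cst z‖ = 0 := by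
      rw [hS0, norm_eq_zero]
      ext t
      simp only [cst, ContinuousMap.sub_apply, ContinuousMap.smul_apply, ContinuousMap.mul_apply,
        ContinuousMap.const_apply, smul_eq_mul, ContinuousMap.zero_apply]
      rw [Real.mul_self_sqrt (by positivity)]
      ring
    filter_upwards [h2.eventually (gt_mem_nhds (h3.trans_lt hδ))] with w hw t
    refine lt_of_le_of_lt ?_ hw
    have := ContinuousMap.norm_coe_le_norm ((2⁻¹ : ℝ) • (S w * S w) - cst z) t
    rw [Real.norm_eq_abs] at this
    convert! this using 2
    simp only [cst, ContinuousMap.sub_apply, ContinuousMap.smul_apply, ContinuousMap.mul_apply,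
        ContinuousMap.const_apply, smul_eq_mul]
    ring
  rw [Metric.eventually_nhds_iff] at k5
  obtain ⟨δ₁, hδ₁, k5⟩ := k5
  -- The zero is sought in a smaller window, where the starting data are so close to `(z, 0)` that
  -- the whole orbit stays in the larger one.
  let d := min δ (δ₁ / 2)
  have hd0 : 0 < d := by positivity
  have hdδ : d ≤ δ := min_le_left _ _
  have hdδ₁ : d ≤ δ₁ / 2 := min_le_right _ _
  have hlo' : z - d ∈ Icc (z - δ) (z + δ) := ⟨by linarith, by linarith⟩
  have hhi' : z + d ∈ Icc (z - δ) (z + δ) := ⟨by linarith, by linarith⟩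
  have s1 : D * m (z - d, 0) < 0 := by
    have := hst0 hlo' hzm (by linarith)
    simpa [hm0] using this
  have s2 : 0 < D * m (z + d, 0) := by
    have := hst0 hzm hhi' (by linarith)
    simpa [hm0] using this
  have hcont : ∀ h ∈ Icc (z - δ) (z + δ), ContinuousAt (fun ε => D * m (h, ε)) 0 := by
    intro h hh
    have h1 : ContinuousAt m (h, (0 : ℝ)) := (kall (kall' h hh 0 (by simpa using hδ₀))).2.1.2.2
    have h2 : ContinuousAt (fun ε : ℝ => (h, ε)) 0 := by fun_prop
    exact continuousAt_const.mul (ContinuousAt.comp (g := m) (f := fun ε : ℝ => (h, ε)) h1 h2)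
  have q1 := (hcont _ hlo').eventually (gt_mem_nhds s1)
  have q2 := (hcont _ hhi').eventually (lt_mem_nhds s2)
  have q3 : ∀ᶠ ε in 𝓝 (0 : ℝ), |ε| < min δ₀ δ₁ := by
    have : ContinuousAt (fun ε : ℝ => |ε|) 0 := by fun_prop
    exact this.eventually (gt_mem_nhds (by simpa using ⟨hδ₀, hδ₁⟩))
  filter_upwards [nhdsWithin_le_nhds q1, nhdsWithin_le_nhds q2, nhdsWithin_le_nhds q3,
    self_mem_nhdsWithin, eventually_periodic hM hr1 hlev] with ε p1 p2 p3 p4 p5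
  have p3' : |ε| < δ₀ := p3.trans_le (min_le_left _ _)
  have hst := hstrict ε p3'
  have hmc : ContinuousOn (fun h => D * m (h, ε)) (Icc (z - d) (z + d)) := fun h hh =>
    (((kall (kall' h ⟨by linarith [hh.1], by linarith [hh.2]⟩ ε p3')).2.1.2.1.const_mul
      D).continuousAt).continuousWithinAt
  obtain ⟨h, hh, hmh⟩ := intermediate_value_Icc (by linarith) hmc ⟨p1.le, p2.le⟩
  have hmh' : m (h, ε) = 0 := (mul_eq_zero.1 hmh).resolve_left hD0
  have hhI : h ∈ Icc (z - δ) (z + δ) := ⟨by linarith [hh.1], by linarith [hh.2]⟩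
  obtain ⟨⟨c1, c2⟩, -, ⟨-, hpol, hend, hret⟩, -⟩ := kall (kall' h hhI ε p3')
  have hfix : endE (S (h, ε)) = h := by
    rw [hend, ← hret]; exact (hR h hhI ε p3' p4).2 hmh'
  have hrad : ∀ t, |S (h, ε) t ^ 2 / 2 - z| < δ := by
    refine k5 ?_
    rw [Prod.dist_eq, max_lt_iff, Real.dist_eq, Real.dist_eq, sub_zero]
    refine ⟨?_, p3.trans_le (min_le_right _ _)⟩
    rw [abs_lt]
    constructor <;> linarith [hh.1, hh.2]
  have hper := hpol.isPeriodicOrbit hfix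
  have hsub : curve a f g √(2 * h) ε (S (h, ε)) '' Icc 0 (2 * Real.pi) ⊆
      {p | p.1 ∈ basin a ∧ |ham a p - z| < δ} := by
    rintro _ ⟨θ, hθ, rfl⟩
    have hv := hpol.mem_vals ⟨θ, hθ⟩
    have e := hpol.rad_eq ⟨θ, hθ⟩
    simp only at hv e
    constructor
    · simp only [curve, pt, e]; exact absc_mem hv
    · rw [curve, e, ham_pt hv]; exact hrad _
  refine ⟨_, ⟨hper, {p | p.1 ∈ basin a ∧ |ham a p - z| < δ}, ?_, hsub, fun C' hC' hsub' => ?_⟩, ?_,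
    hsub.trans fun p hp => ⟨hp.1, hp.2.trans (by linarith)⟩⟩
  · refine IsOpen.inter ((isOpen_basin_fst a).preimage continuous_fst) ?_
    have : IsOpen {p : ℝ × ℝ | |ham a p - z| < δ} :=
      isOpen_lt (by unfold ham potential; fun_prop) continuous_const
    exact this
  · have hann : ∀ {C}, C ⊆ {p | p.1 ∈ basin a ∧ |ham a p - z| < δ} →
        C ⊆ annulus a (z - δ) (z + δ) := fun hC p hp => by
      have := abs_lt.1 (hC hp).2
      exact ⟨(hC hp).1, by linarith, by linarith⟩
    -- Every periodic orbit in the window meets the cross-section at the energy of a zero of `m`,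
    -- and there is only one; hence the orbit is isolated.
    have huniq : ∀ C, IsPeriodicOrbit (field a f g ε) C → C ⊆ annulus a (z - δ) (z + δ) →
        (sec a h, (0 : ℝ)) ∈ C := by
      intro C hC hCs
      obtain ⟨h', hh', k1, k2⟩ := p5 C hC hCs
      have : h' = h := by
        refine hst.injOn hh' hhI ?_
        simp only [hmh']
        rw [← (hR h' hh' ε p3' p4).1, k2]
      rwa [this] at k1
    exact periodicOrbit_eq (contDiff_field a f g ε) hC' hper (huniq _ hC' (hann hsub'))
      (huniq _ hper (hann hsub))
  · have hclose : ∀ θ ∈ Icc 0 (2 * Real.pi), edist (curve a f g √(2 * h) ε (S (h, ε)) θ)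
        (pt a √(2 * z) θ) ≤ ENNReal.ofReal (η / 2) := by
      intro θ hθ
      rw [edist_dist]
      refine ENNReal.ofReal_le_ofReal ?_
      have e1 : pt a √(2 * z) θ = (curX a (cst √(2 * z)) ⟨θ, hθ⟩, curY (cst √(2 * z)) ⟨θ, hθ⟩) := by
        rw [pt, curX_apply hg]
        simp [cst, curY, sinA]
      rw [hpol.curve_eq ⟨θ, hθ⟩, e1, Prod.dist_eq]
      exact max_le ((ContinuousMap.dist_apply_le_dist _).trans c1.le)
        ((ContinuousMap.dist_apply_le_dist _).trans c2.le)
    refine lt_of_le_of_lt (Metric.hausdorffEDist_le_of_mem_edist (r := ENNReal.ofReal (η / 2))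
      ?_ ?_) ((ENNReal.ofReal_lt_ofReal_iff hη).2 (by linarith))
    · rintro _ ⟨θ, hθ, rfl⟩
      exact ⟨_, by rw [oval_eq_image hz]; exact ⟨θ, hθ, rfl⟩, hclose θ hθ⟩
    · intro p hp
      rw [oval_eq_image hz] at hp
      obtain ⟨θ, hθ, rfl⟩ := hp
      exact ⟨_, ⟨θ, hθ, rfl⟩, by rw [edist_comm]; exact hclose θ hθ⟩

/-- Rolle's theorem for a function with given derivatives of all orders. -/
lemma exists_zero_of_zeros {D : ℕ → ℝ → ℝ} {I : Set ℝ} (hI : I.OrdConnected)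
    {n : ℕ} (hD : ∀ i < n, ∀ x ∈ I, HasDerivAt (D i) (D (i + 1) x) x) {x : Fin n → ℝ}
    (hx : StrictMono x) (hxI : ∀ i, x i ∈ I) (h0 : ∀ i, D 0 (x i) = 0) (i : Fin n) :
    ∃ ξ ∈ I, D i ξ = 0 := by
  induction n generalizing D with
  | zero => exact i.elim0
  | succ n ih =>
    refine Fin.cases ⟨x 0, hxI 0, h0 0⟩ (fun j => ?_) i
    have key : ∀ j : Fin n, ∃ c ∈ Ioo (x j.castSucc) (x j.succ), D 1 c = 0 := fun j =>
      exists_hasDerivAt_eq_zero (hx j.castSucc_lt_succ)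
        (fun y hy => (hD 0 (by omega) y (hI.out (hxI _) (hxI _) hy)).continuousAt.continuousWithinAt)
        (by rw [h0, h0])
        fun y hy => hD 0 (by omega) y (hI.out (hxI _) (hxI _) ⟨hy.1.le, hy.2.le⟩)
    choose c hc hc0 using key
    refine ih (D := fun i => D (i + 1)) (fun i hi x hx => hD _ (by omega) x hx) (x := c) ?_ (fun j =>
      hI.out (hxI _) (hxI _) ⟨(hc j).1.le, (hc j).2.le⟩) hc0 j
    intro j k hjk
    calc c j < x j.succ := (hc j).2
      _ ≤ x k.castSucc := hx.monotone (by
        rw [Fin.le_def]; simpa using hjk)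
      _ < c k := (hc k).1

/-- With `n + 1` zeros, iterated use of Rolle's theorem would give a zero of each `D i`, `i ≤ n`, at
a point of its own. This is why the hypothesis speaks of different points `ξ i`. -/
lemma encard_zeros_le {D : ℕ → ℝ → ℝ} {I : Set ℝ} (hI : I.OrdConnected)
    {n : ℕ} (hD : ∀ i ≤ n, ∀ x ∈ I, HasDerivAt (D i) (D (i + 1) x) x)
    (hn : ∀ ξ : Fin (n + 1) → ℝ, (∀ i, ξ i ∈ I) → ∃ i : Fin (n + 1), D i (ξ i) ≠ 0) :
    {x | x ∈ I ∧ D 0 x = 0}.encard ≤ n := by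
  by_contra hlt
  rw [not_le] at hlt
  obtain ⟨t, ht, hc⟩ := exists_subset_encard_eq (Order.add_one_le_of_lt hlt)
  have hfin : t.Finite := finite_of_encard_eq_coe (k := n + 1) (by rw [hc]; rfl)
  have hcard : hfin.toFinset.card = n + 1 := by
    have := hfin.encard_eq_coe_toFinset_card
    rw [hc] at this
    exact_mod_cast this.symm
  have hmem : ∀ i, hfin.toFinset.orderEmbOfFin hcard i ∈ t := fun i =>
    hfin.mem_toFinset.1 (Finset.orderEmbOfFin_mem _ _ i)
  have := exists_zero_of_zeros hI (fun i hi => hD i (by omega)) (hfin.toFinset.orderEmbOfFin hcard).strictMono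
    (fun i => (ht (hmem i)).1) (fun i => (ht (hmem i)).2)
  choose ξ hξ hξ0 using this
  obtain ⟨i, hi⟩ := hn ξ hξ
  exact hi (hξ0 i)

/-- If the derivatives of `M(h)/h` of the orders `0, …, n` have no common zero (even at different
points), then there are at most `n` limit cycles in the annulus. -/
lemma eventually_encard_le (hM : ∀ h ∈ levels a, ∃ S R m, LocalModel a f g M μ h S R m)
    {r₁ r₂ : ℝ} (h1 : 0 < r₁) (h2 : r₂ ∈ levels a) {n : ℕ} {D : ℕ → ℝ → ℝ} {J : Set ℝ}
    (hJ : IsOpen J) (hIJ : Icc r₁ r₂ ⊆ J) (hD0 : ∀ h ∈ J, M h = h * D 0 h)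
    (hD : ∀ i, ∀ x ∈ J, HasDerivAt (D i) (D (i + 1) x) x)
    (hn : ∀ ξ : Fin (n + 1) → ℝ, (∀ i, ξ i ∈ Icc r₁ r₂) → ∃ i : Fin (n + 1), D i (ξ i) ≠ 0) :
    ∀ᶠ ε in 𝓝[>] (0 : ℝ),
      {C | IsLimitCycle (field a f g ε) C ∧ C ⊆ ⋃ h ∈ Icc r₁ r₂, oval a h}.encard ≤ n := by
  -- Division by `h` preserves the zeros, and the derivatives of the quotient are the ones under
  -- control.
  let φ : ℝ → ℝ → ℝ := fun ε h => μ h ε / h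
  have hDi : ∀ i, ∀ x ∈ J, iteratedDeriv i (D 0) x = D i x := by
    intro i
    induction i with
    | zero => simp
    | succ i ih =>
      intro x hx
      rw [iteratedDeriv_succ]
      have : iteratedDeriv i (D 0) =ᶠ[𝓝 x] D i := by
        filter_upwards [hJ.mem_nhds hx] with y hy using ih y hy
      rw [this.deriv_eq, (hD i x hx).deriv]
  have hloc : ∀ x ∈ Icc r₁ r₂, ∃ N : ℝ × ℝ → ℝ, ContDiffAt ℝ ∞ N (x, 0) ∧
      (∀ᶠ z in 𝓝 (x, (0 : ℝ)), 0 < z.2 → ∀ᶠ y in 𝓝 z.1, φ z.2 y = N (y, z.2)) ∧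
      ∀ i, pd^[i] N (x, 0) = D i x := by
    intro x hx
    obtain ⟨S, R, m, L⟩ := hM x (levels_of_le h2 (h1.trans_le hx.1) hx.2)
    have hx0 : x ≠ 0 := (h1.trans_le hx.1).ne'
    have hN : ContDiffAt ℝ ∞ (fun z : ℝ × ℝ => m z / z.1) (x, 0) :=
      L.smooth_m.div contDiffAt_fst hx0
    refine ⟨_, hN, ?_, fun i => ?_⟩
    · filter_upwards [eventually_slice L.fixed] with z hz h0
      filter_upwards [hz] with y hy
      simp only [φ]
      rw [(hy h0).1]
    · have e1 := (eventually_iteratedDeriv hN i).self_of_nhds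
      rw [← e1, ← hDi i x (hIJ hx)]
      refine Filter.EventuallyEq.iteratedDeriv_eq i ?_
      filter_upwards [L.m_zero, hJ.mem_nhds (hIJ hx), lt_mem_nhds (h1.trans_le hx.1)]
        with y hy hyJ hy0
      rw [hy, hD0 y hyJ]
      field_simp
  have hdiff : ∀ᶠ ε in 𝓝 (0 : ℝ), ∀ x ∈ Icc r₁ r₂, 0 < ε → ∀ i ≤ n,
      HasDerivAt (iteratedDeriv i (φ ε)) (iteratedDeriv (i + 1) (φ ε) x) x := by
    refine eventually_segment (p := fun x ε => 0 < ε → ∀ i ≤ n,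
      HasDerivAt (iteratedDeriv i (φ ε)) (iteratedDeriv (i + 1) (φ ε) x) x) fun x hx => ?_
    obtain ⟨N, hN, hφ, -⟩ := hloc x hx
    filter_upwards [eventually_contDiffAt hN (n + 1), hφ] with z hz1 hz2 hε i hi
    have h3 : ContDiffAt ℝ (n + 1 : ℕ) (φ z.2) z.1 := by
      refine ContDiffAt.congr_of_eventuallyEq ?_ (hz2 hε)
      exact ContDiffAt.comp (g := N) (f := fun y : ℝ => (y, z.2)) z.1 hz1
        (contDiffAt_id.prodMk contDiffAt_const)
    have h4 : DifferentiableAt ℝ (iteratedDeriv i (φ z.2)) z.1 :=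
      (ContDiffAt.differentiableAt_iteratedFDeriv h3 (m := i)
        (by exact_mod_cast Nat.lt_succ_of_le hi)).continuousMultilinear_apply_const _
    rw [iteratedDeriv_succ]
    exact h4.hasDerivAt
  -- The tuples `ξ` form a compact cube. At each tuple some derivative is nonzero for `ε = 0`, and
  -- continuity carries this to all tuples and all small `ε > 0`.
  have hne : ∀ᶠ ε in 𝓝 (0 : ℝ), ∀ ξ ∈ Set.pi univ (fun _ : Fin (n + 1) => Icc r₁ r₂), 0 < ε →
      ∃ i : Fin (n + 1), iteratedDeriv i (φ ε) (ξ i) ≠ 0 := by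
    refine (isCompact_univ_pi fun _ => isCompact_Icc).eventually_forall_of_forall_eventually
      (P := fun (ε : ℝ) (ξ : Fin (n + 1) → ℝ) => 0 < ε →
        ∃ i : Fin (n + 1), iteratedDeriv i (φ ε) (ξ i) ≠ 0) fun ξ hξ => ?_
    obtain ⟨i, hi⟩ := hn ξ (fun i => hξ i (mem_univ _))
    obtain ⟨N, hN, hφ, hp⟩ := hloc (ξ i) (hξ i (mem_univ _))
    have hc : ∀ᶠ z in 𝓝 (ξ i, (0 : ℝ)), pd^[i] N z ≠ 0 :=
      (contDiffAt_iterate_pd hN i).continuousAt.eventually_ne (by rw [hp]; exact hi)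
    have ht : Tendsto (fun w : ℝ × (Fin (n + 1) → ℝ) => (w.2 i, w.1)) (𝓝 (0, ξ))
        (𝓝 (ξ i, (0 : ℝ))) := by
      have hcc : Continuous fun w : ℝ × (Fin (n + 1) → ℝ) => (w.2 i, w.1) := by fun_prop
      exact hcc.tendsto _
    filter_upwards [ht.eventually (hc.and (hφ.and (eventually_iteratedDeriv hN i)))]
      with w ⟨w1, w2, w3⟩ hw
    refine ⟨i, ?_⟩
    rw [Filter.EventuallyEq.iteratedDeriv_eq i (w2 hw), w3]
    exact w1
  filter_upwards [nhdsWithin_le_nhds hdiff, nhdsWithin_le_nhds hne, self_mem_nhdsWithin,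
    eventually_periodic hM h1 h2] with ε p1 p2 p3 p4
  rw [iUnion_oval h1 h2]
  have hz : {x | x ∈ Icc r₁ r₂ ∧ φ ε x = 0}.encard ≤ n := by
    have := encard_zeros_le (D := fun i => iteratedDeriv i (φ ε)) (n := n)
      (I := Icc r₁ r₂) ordConnected_Icc (fun i hi x hx => p1 x hx p3 i hi)
      (fun ξ hξ => p2 ξ (fun i _ => hξ i) p3)
    simpa using this
  -- Each orbit is sent to the energy of one of its crossings at a zero; orbits with the same image
  -- share a point and coincide.
  choose! c c1 c2 c3 using p4
  refine le_trans (encard_le_encard_of_injOn (f := c) ?_ ?_) hz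
  · rintro C ⟨hC, hCs⟩
    exact ⟨c1 C hC.1 hCs, by simp only [φ]; rw [c3 C hC.1 hCs, zero_div]⟩
  · rintro C ⟨hC, hCs⟩ C' ⟨hC', hCs'⟩ e
    refine periodicOrbit_eq (contDiff_field a f g ε) hC.1 hC'.1 (c2 C hC.1 hCs) ?_
    rw [e]
    exact c2 C' hC'.1 hCs'

end

/-! ### Abelian integrals as integrals over the angle -/

section

open scoped Polynomial

variable {a : ℝ}

/-- The points `√(2h) cos θ` are within `√(2h)` of `0`, so one neighbourhood serves all angles. -/
lemma eventually_cos {a : ℝ} {p : ℝ × ℝ → Prop} (hp : ∀ᶠ z in 𝓝 ((0 : ℝ), a), p z) :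
    ∀ᶠ z in 𝓝 ((0 : ℝ), a), ∀ θ, p (√(2 * z.1) * Real.cos θ, z.2) := by
  rw [Metric.eventually_nhds_iff] at hp
  obtain ⟨δ, hδ, hp⟩ := hp
  have h1 : ∀ᶠ z : ℝ × ℝ in 𝓝 ((0 : ℝ), a), dist (√(2 * z.1), z.2) ((0 : ℝ), a) < δ := by
    have hc : Continuous fun z : ℝ × ℝ => (√(2 * z.1), z.2) := by fun_prop
    have := hc.tendsto ((0 : ℝ), a)
    simp only [mul_zero, Real.sqrt_zero] at this
    exact (Metric.tendsto_nhds.1 this) δ hδ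
  filter_upwards [h1] with z hz θ
  refine hp (lt_of_le_of_lt ?_ hz)
  rw [Prod.dist_eq, Prod.dist_eq]
  refine max_le_max ?_ le_rfl
  simp only [Real.dist_eq, sub_zero, abs_mul]
  exact mul_le_of_le_one_right (abs_nonneg _) (Real.abs_cos_le_one θ)

/-- Continuity of an integral over the angle at the equilibrium. -/
lemma continuousAt_integral_cos {a : ℝ} {g : ℝ × ℝ → ℝ} {w : ℝ → ℝ} (hw : Continuous w)
    (hg : ∀ᶠ z in 𝓝 ((0 : ℝ), a), ContinuousAt g z) :
    ContinuousAt (fun z : ℝ × ℝ => ∫ θ in (0 : ℝ)..(2 * Real.pi),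
      g (√(2 * z.1) * Real.cos θ, z.2) * w θ) ((0 : ℝ), a) := by
  have hg0 := hg.self_of_nhds
  have hb : ∀ᶠ z in 𝓝 ((0 : ℝ), a), |g z| ≤ |g (0, a)| + 1 := by
    filter_upwards [hg0.abs.eventually (gt_mem_nhds (lt_add_one |g (0, a)|))] with z hz
    exact hz.le
  refine intervalIntegral.tendsto_integral_filter_of_dominated_convergence
    (fun θ => (|g (0, a)| + 1) * |w θ|) ?_ ?_ ?_ ?_
  · filter_upwards [eventually_cos hg] with z hz
    refine Continuous.aestronglyMeasurable (Continuous.mul ?_ hw)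
    refine continuous_iff_continuousAt.2 fun θ => ?_
    exact ContinuousAt.comp (g := g) (f := fun θ => (√(2 * z.1) * Real.cos θ, z.2)) (hz θ)
      (by fun_prop)
  · filter_upwards [eventually_cos hb] with z hz
    refine Eventually.of_forall fun θ _ => ?_
    rw [Real.norm_eq_abs, abs_mul]
    exact mul_le_mul_of_nonneg_right (hz θ) (abs_nonneg _)
  · exact (continuous_const.mul hw.abs).intervalIntegrable _ _
  · refine Eventually.of_forall fun θ _ => ?_
    have hc : Continuous fun z : ℝ × ℝ => (√(2 * z.1) * Real.cos θ, z.2) := by fun_prop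
    have ht := hc.tendsto ((0 : ℝ), a)
    have h0 : (√(2 * ((0 : ℝ), a).1) * Real.cos θ, ((0 : ℝ), a).2) = ((0 : ℝ), a) := by simp
    have : Tendsto g (𝓝 (√(2 * ((0 : ℝ), a).1) * Real.cos θ, ((0 : ℝ), a).2))
        (𝓝 (g (√(2 * ((0 : ℝ), a).1) * Real.cos θ, ((0 : ℝ), a).2))) := by
      rw [h0]; exact hg0
    exact (this.comp ht).mul_const _

/-- The derivatives with respect to the energy of the integral `2 ∫ φ'(√(2h) cos θ) sin² θ dθ`. -/
def osc (φ : ℝ → ℝ) (i : ℕ) (h : ℝ) : ℝ :=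
  2 / Nat.doubleFactorial (2 * i + 1) * ∫ θ in (0 : ℝ)..(2 * Real.pi),
    iteratedDeriv (2 * i + 1) φ (√(2 * h) * Real.cos θ) * Real.sin θ ^ (2 * i + 2)

lemma contDiffOn_iteratedDeriv {φ : ℝ → ℝ} {Ω : Set ℝ} (hΩ : IsOpen Ω) (hφ : ContDiffOn ℝ ∞ φ Ω)
    (n : ℕ) : ContDiffOn ℝ ∞ (iteratedDeriv n φ) Ω := by
  induction n with
  | zero => simpa using hφ
  | succ n ih =>
    rw [iteratedDeriv_succ]
    exact ih.deriv_of_isOpen hΩ (by simp)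

lemma mul_cos_mem' {h : ℝ} (hh : h ∈ levels a) (θ : ℝ) : √(2 * h) * Real.cos θ ∈ vals a :=
  mul_cos_mem hh (abs_of_nonneg (Real.sqrt_nonneg _)).le

lemma continuous_comp_cos {P : ℝ → ℝ} (hP : ContinuousOn P (vals a)) {h : ℝ} (hh : h ∈ levels a) :
    Continuous fun θ => P (√(2 * h) * Real.cos θ) :=
  hP.comp_continuous (by fun_prop) (mul_cos_mem' hh)

lemma hasDerivAt_comp_cos {P : ℝ → ℝ} (hP : ContDiffOn ℝ ∞ P (vals a)) {h : ℝ}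
    (hh : h ∈ levels a) (θ : ℝ) :
    HasDerivAt (fun θ => P (√(2 * h) * Real.cos θ))
      (deriv P (√(2 * h) * Real.cos θ) * (√(2 * h) * -Real.sin θ)) θ := by
  have h1 : DifferentiableAt ℝ P (√(2 * h) * Real.cos θ) :=
    ((hP.contDiffAt ((isOpen_vals a).mem_nhds (mul_cos_mem' hh θ))).differentiableAt (by simp))
  exact h1.hasDerivAt.comp θ ((Real.hasDerivAt_cos θ).const_mul _)

/-- Differentiation in `h` produces `P' cos θ / √(2h)`. Integrating `cos θ sin^(2m) θ` by parts
yields another factor `√(2h)`, which cancels the singularity at `h = 0` at the price of a second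
derivative of `P`. -/
lemma hasDerivAt_integral_cos {P : ℝ → ℝ} (hP : ContDiffOn ℝ ∞ P (vals a)) {h : ℝ}
    (hh : h ∈ levels a) (m : ℕ) :
    HasDerivAt (fun h => ∫ θ in (0 : ℝ)..(2 * Real.pi),
        P (√(2 * h) * Real.cos θ) * Real.sin θ ^ (2 * m))
      (1 / (2 * m + 1) * ∫ θ in (0 : ℝ)..(2 * Real.pi),
        deriv (deriv P) (√(2 * h) * Real.cos θ) * Real.sin θ ^ (2 * m + 2)) h := by
  have h0 := levels_pos hh
  have hs : 0 < √(2 * h) := Real.sqrt_pos.2 (by positivity)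
  have hP1 : ContDiffOn ℝ ∞ (deriv P) (vals a) := hP.deriv_of_isOpen (isOpen_vals a) (by simp)
  have hP2 : ContDiffOn ℝ ∞ (deriv (deriv P)) (vals a) :=
    hP1.deriv_of_isOpen (isOpen_vals a) (by simp)
  have hmem : ∀ {k}, k ∈ levels a → ∀ t, (√(2 * k) • cosA) t ∈ vals a := fun hk t =>
    mul_cos_mem' hk t
  have hrep : ∀ {k}, k ∈ levels a → ∀ {p : ℝ → ℝ}, ContinuousOn p (vals a) → ∀ w : Ang,
      tot (nem p (√(2 * k) • cosA) * w) = ∫ θ in (0 : ℝ)..(2 * Real.pi),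
        p (√(2 * k) * Real.cos θ) * ext w θ := by
    intro k hk p hp w
    rw [tot_apply]
    refine intervalIntegral.integral_congr fun θ hθ => ?_
    rw [uIcc_of_le two_pi_nonneg] at hθ
    rw [ext_of_mem _ hθ, ext_of_mem _ hθ, ContinuousMap.mul_apply,
      nem_apply (isOpen_vals a) hp (hmem hk)]
    rfl
  have hext : ∀ n : ℕ, ∀ θ ∈ Icc (0 : ℝ) (2 * Real.pi), ext (sinA ^ n) θ = Real.sin θ ^ n := by
    intro n θ hθ
    rw [ext_of_mem _ hθ]
    simp [sinA]
  have d1 : HasDerivAt (fun h => √(2 * h)) (1 / √(2 * h)) h := by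
    have := ((hasDerivAt_id h).const_mul (2 : ℝ)).sqrt (by simp only [id]; positivity)
    simp only [id] at this
    convert! this using 1
    field_simp
  have d2 : HasDerivAt (fun h => √(2 * h) • cosA) ((1 / √(2 * h)) • cosA) h := d1.smul_const cosA
  have d3 := (hasFDerivAt_nem (isOpen_vals a) hP (hmem hh)).comp_hasDerivAt h d2
  have d4 := tot.hasFDerivAt.comp_hasDerivAt h (d3.mul_const (sinA ^ (2 * m)))
  have d5 : HasDerivAt (fun h => ∫ θ in (0 : ℝ)..(2 * Real.pi),
        P (√(2 * h) * Real.cos θ) * Real.sin θ ^ (2 * m))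
      (1 / √(2 * h) * ∫ θ in (0 : ℝ)..(2 * Real.pi), deriv P (√(2 * h) * Real.cos θ) *
        (Real.cos θ * Real.sin θ ^ (2 * m))) h := by
    refine (d4.congr_deriv ?_).congr_of_eventuallyEq ?_
    · have e : (ContinuousLinearMap.mul ℝ Ang) (nem (deriv P) (√(2 * h) • cosA))
          ((1 / √(2 * h)) • cosA) * sinA ^ (2 * m) =
          (1 / √(2 * h)) • (nem (deriv P) (√(2 * h) • cosA) * (cosA * sinA ^ (2 * m))) := by
        simp only [ContinuousLinearMap.mul_apply']
        rw [mul_smul_comm, smul_mul_assoc, mul_assoc]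
      rw [e, map_smul, smul_eq_mul, hrep hh hP1.continuousOn]
      congr 1
      refine intervalIntegral.integral_congr fun θ hθ => ?_
      rw [uIcc_of_le two_pi_nonneg] at hθ
      rw [ext_of_mem _ hθ]
      simp [sinA, cosA]
    · filter_upwards [(isOpen_levels a).mem_nhds hh] with k hk
      simp only [Function.comp]
      rw [hrep hk hP.continuousOn]
      refine intervalIntegral.integral_congr fun θ hθ => ?_
      rw [uIcc_of_le two_pi_nonneg] at hθ
      simp only [hext _ θ hθ]
  refine d5.congr_deriv ?_
  have c1 := continuous_comp_cos hP1.continuousOn hh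
  have c2 := continuous_comp_cos hP2.continuousOn hh
  have ibp : ∫ θ in (0 : ℝ)..(2 * Real.pi), ((2 * m + 1) * (deriv P (√(2 * h) * Real.cos θ) *
      (Real.cos θ * Real.sin θ ^ (2 * m))) - √(2 * h) * (deriv (deriv P) (√(2 * h) * Real.cos θ) *
        Real.sin θ ^ (2 * m + 2))) = 0 := by
    have hd : ∀ θ ∈ uIcc 0 (2 * Real.pi), HasDerivAt
        (fun θ => deriv P (√(2 * h) * Real.cos θ) * Real.sin θ ^ (2 * m + 1))
        ((2 * m + 1) * (deriv P (√(2 * h) * Real.cos θ) *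
      (Real.cos θ * Real.sin θ ^ (2 * m))) - √(2 * h) * (deriv (deriv P) (√(2 * h) * Real.cos θ) *
        Real.sin θ ^ (2 * m + 2))) θ := by
      intro θ _
      refine ((hasDerivAt_comp_cos hP1 hh θ).mul ((Real.hasDerivAt_sin θ).pow _)).congr_deriv ?_
      simp only [Nat.add_sub_cancel, Pi.pow_apply]
      push_cast
      ring
    rw [intervalIntegral.integral_eq_sub_of_hasDerivAt hd]
    · simp
    · exact Continuous.intervalIntegrable (by fun_prop) _ _
  rw [intervalIntegral.integral_sub (Continuous.intervalIntegrable (by fun_prop) _ _)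
    (Continuous.intervalIntegrable (by fun_prop) _ _), intervalIntegral.integral_const_mul,
    intervalIntegral.integral_const_mul] at ibp
  generalize (∫ θ in (0 : ℝ)..(2 * Real.pi), deriv P (√(2 * h) * Real.cos θ) *
    (Real.cos θ * Real.sin θ ^ (2 * m))) = I₁ at ibp ⊢
  generalize (∫ θ in (0 : ℝ)..(2 * Real.pi), deriv (deriv P) (√(2 * h) * Real.cos θ) *
    Real.sin θ ^ (2 * m + 2)) = I₂ at ibp ⊢
  field_simp
  linear_combination ibp

/-- The factor `1 / (2 i + 3)` of the integration by parts updates the double factorial. -/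
lemma hasDerivAt_osc {φ : ℝ → ℝ} (hφ : ContDiffOn ℝ ∞ φ (vals a)) {h : ℝ} (hh : h ∈ levels a)
    (i : ℕ) : HasDerivAt (osc φ i) (osc φ (i + 1) h) h := by
  have h1 := (hasDerivAt_integral_cos (contDiffOn_iteratedDeriv (isOpen_vals a) hφ (2 * i + 1)) hh
    (i + 1)).const_mul (2 / ((Nat.doubleFactorial (2 * i + 1) : ℕ) : ℝ))
  have e : 2 * (i + 1) + 1 = 2 * i + 1 + 2 := by ring
  have e2 : iteratedDeriv (2 * i + 1 + 2) φ = deriv (deriv (iteratedDeriv (2 * i + 1) φ)) := by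
    rw [iteratedDeriv_succ, iteratedDeriv_succ]
  refine h1.congr_deriv ?_
  rw [osc, e, Nat.doubleFactorial_add_two, e2]
  generalize (∫ θ in (0 : ℝ)..(2 * Real.pi), deriv (deriv (iteratedDeriv (2 * i + 1) φ))
    (√(2 * h) * Real.cos θ) * Real.sin θ ^ (2 * (i + 1) + 2)) = I
  have := Nat.doubleFactorial_pos (2 * i + 1)
  push_cast
  field_simp
  ring

lemma integral_linear {φ ψ : ℝ → ℝ} (hφ : Continuous φ) (hψ : Continuous ψ) (c : ℝ) :
    ∫ θ in (0 : ℝ)..(2 * Real.pi), (φ θ + c * ψ θ) =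
      (∫ θ in (0 : ℝ)..(2 * Real.pi), φ θ) + c * ∫ θ in (0 : ℝ)..(2 * Real.pi), ψ θ := by
  have := intervalIntegral.integral_add (hφ.intervalIntegrable 0 (2 * Real.pi))
    ((continuous_const.mul hψ).intervalIntegrable (μ := MeasureTheory.volume) 0 (2 * Real.pi))
    (g := fun θ => c * ψ θ)
  rw [this, intervalIntegral.integral_const_mul]

lemma osc_sum {ι : Type*} {s : Finset ι} {φ : ι → ℝ → ℝ}
    (hφ : ∀ j ∈ s, ContDiffOn ℝ ∞ (φ j) (vals a)) (c : ι → ℝ) {h : ℝ} (hh : h ∈ levels a) (i : ℕ) :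
    osc (fun u => ∑ j ∈ s, c j * φ j u) i h = ∑ j ∈ s, c j * osc (φ j) i h := by
  have key : ∀ v ∈ vals a, iteratedDeriv (2 * i + 1) (fun u => ∑ j ∈ s, c j * φ j u) v =
      ∑ j ∈ s, c j * iteratedDeriv (2 * i + 1) (φ j) v := by
    intro v hv
    have hd : ∀ j ∈ s, ContDiffAt ℝ (2 * i + 1 : ℕ) (φ j) v := fun j hj =>
      ((hφ j hj).contDiffAt ((isOpen_vals a).mem_nhds hv)).of_le
        (WithTop.coe_le_coe.2 le_top)
    rw [iteratedDeriv_fun_sum fun j hj => contDiffAt_const.mul (hd j hj)]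
    refine Finset.sum_congr rfl fun j hj => ?_
    rw [iteratedDeriv_const_mul_field]
  have h1 : ∀ θ, iteratedDeriv (2 * i + 1) (fun u => ∑ j ∈ s, c j * φ j u)
      (√(2 * h) * Real.cos θ) * Real.sin θ ^ (2 * i + 2) =
      ∑ j ∈ s, c j * (iteratedDeriv (2 * i + 1) (φ j) (√(2 * h) * Real.cos θ) *
        Real.sin θ ^ (2 * i + 2)) := by
    intro θ
    rw [key _ (mul_cos_mem' hh θ), Finset.sum_mul]
    exact Finset.sum_congr rfl fun j _ => by ring
  simp only [osc, h1]
  rw [intervalIntegral.integral_finsetSum fun j hj => Continuous.intervalIntegrable ?_ _ _]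
  · rw [Finset.mul_sum]
    refine Finset.sum_congr rfl fun j _ => ?_
    rw [intervalIntegral.integral_const_mul]
    ring
  · have := continuous_comp_cos
      (contDiffOn_iteratedDeriv (isOpen_vals a) (hφ j hj) (2 * i + 1)).continuousOn hh
    fun_prop

/-- A univariate polynomial as a polynomial in `x, y`. -/
def up (p : ℝ[X]) : MvPolynomial (Fin 2) ℝ := Polynomial.aeval (MvPolynomial.X 0) p

lemma eval_up (x y : ℝ) (p : ℝ[X]) : MvPolynomial.eval ![x, y] (up p) = p.eval x := by
  unfold up
  induction p using Polynomial.induction_on' with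
  | add p q hp hq => simp [hp, hq]
  | monomial n c => simp [Polynomial.aeval_monomial]

/-- The integral `∮ p(x) y dx` as a time integral. -/
def mel (a : ℝ) (p : ℝ[X]) (h : ℝ) : ℝ := Lam a h (up p * MvPolynomial.X 1 ^ 2)

/-- A polynomial in the action coordinate. -/
def pol (a : ℝ) (F : ℝ[X]) (u : ℝ) : ℝ := F.eval (absc a u)

lemma contDiffOn_pol (F : ℝ[X]) : ContDiffOn ℝ ∞ (pol a F) (vals a) := fun v hv =>
  ((F.contDiff_aeval (𝕜 := ℝ) ∞).contDiffAt.comp v (contDiffAt_absc' hv ⊤)).contDiffWithinAt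

lemma hasDerivAt_pol (F : ℝ[X]) {v : ℝ} (hv : v ∈ vals a) :
    HasDerivAt (pol a F) (F.derivative.eval (absc a v) * deriv (absc a) v) v :=
  (F.hasDerivAt (absc a v)).comp v
    ((contDiffAt_absc' hv 1).differentiableAt (by simp)).hasDerivAt

/-- On the oval `y² = 2 h sin² θ`, and `F'(x) dx/du` is the derivative of `F` in the action
coordinate. -/
lemma mel_eq_osc (F : ℝ[X]) {h : ℝ} (hh : h ∈ levels a) :
    mel a F.derivative h = h * osc (pol a F) 0 h := by
  have h0 := levels_pos hh
  rw [mel, Lam, osc]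
  simp only [mul_zero, zero_add, iteratedDeriv_one, Nat.doubleFactorial, Nat.cast_one, div_one]
  rw [← mul_assoc, ← intervalIntegral.integral_const_mul]
  refine intervalIntegral.integral_congr fun θ _ => ?_
  simp only [pt, map_mul, map_pow, eval_up, MvPolynomial.eval_X, (hasDerivAt_pol F
    (mul_cos_mem' hh θ)).deriv, Matrix.cons_val_one, Matrix.cons_val_zero]
  have := Real.sq_sqrt (show (0 : ℝ) ≤ 2 * h by positivity)
  linear_combination (Polynomial.eval (absc a (√(2 * h) * Real.cos θ)) F.derivative *
    deriv (absc a) (√(2 * h) * Real.cos θ) * Real.sin θ ^ 2) * this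

/-- The formula of `mel_eq_osc` integrated by parts. No derivative of `F` is left, so the parity of
`F` in `u` can be exploited. -/
lemma mel_eq_cos (F : ℝ[X]) {h : ℝ} (hh : h ∈ levels a) :
    mel a F.derivative h =
      √(2 * h) * ∫ θ in (0 : ℝ)..(2 * Real.pi), pol a F (√(2 * h) * Real.cos θ) * Real.cos θ := by
  have h0 := levels_pos hh
  rw [mel_eq_osc F hh, osc]
  simp only [mul_zero, zero_add, iteratedDeriv_one, Nat.doubleFactorial, Nat.cast_one, div_one]
  have hP1 : ContDiffOn ℝ ∞ (deriv (pol a F)) (vals a) :=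
    (contDiffOn_pol F).deriv_of_isOpen (isOpen_vals a) (by simp)
  have c0 := continuous_comp_cos (contDiffOn_pol F).continuousOn hh
  have c1 := continuous_comp_cos hP1.continuousOn hh
  have hd : ∀ θ ∈ uIcc 0 (2 * Real.pi), HasDerivAt
      (fun θ => pol a F (√(2 * h) * Real.cos θ) * Real.sin θ)
      (pol a F (√(2 * h) * Real.cos θ) * Real.cos θ +
        -√(2 * h) * (deriv (pol a F) (√(2 * h) * Real.cos θ) * Real.sin θ ^ 2)) θ := by
    intro θ _
    refine ((hasDerivAt_comp_cos (contDiffOn_pol F) hh θ).mul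
      (Real.hasDerivAt_sin θ)).congr_deriv ?_
    ring
  have := intervalIntegral.integral_eq_sub_of_hasDerivAt hd
    (Continuous.intervalIntegrable (by fun_prop) _ _)
  rw [integral_linear (by fun_prop) (by fun_prop)] at this
  simp only [Real.sin_two_pi, Real.sin_zero, mul_zero, sub_zero] at this
  have h2 := Real.sq_sqrt (show (0 : ℝ) ≤ 2 * h by positivity)
  linear_combination -√(2 * h) * this - (∫ θ in (0 : ℝ)..(2 * Real.pi),
    deriv (pol a F) (√(2 * h) * Real.cos θ) * Real.sin θ ^ 2) * h2

lemma Lam_add {h : ℝ} (hh : h ∈ levels a) (p q : MvPolynomial (Fin 2) ℝ) :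
    Lam a h (p + q) = Lam a h p + Lam a h q := by
  rw [← flux_zero 0 0 _ hh, flux_add, flux_zero _ _ _ hh, flux_zero _ _ _ hh]

lemma Lam_C_mul {h : ℝ} (hh : h ∈ levels a) (c : ℝ) (p : MvPolynomial (Fin 2) ℝ) :
    Lam a h (MvPolynomial.C c * p) = c * Lam a h p := by
  rw [← flux_zero 0 0 _ hh, flux_C_mul, flux_zero _ _ _ hh]

/-- The integral of the derivative along the unperturbed field vanishes. -/
lemma Lam_bracket {h : ℝ} (hh : h ∈ levels a) (Q : MvPolynomial (Fin 2) ℝ) :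
    Lam a h (MvPolynomial.pderiv 0 Q * MvPolynomial.X 1 - MvPolynomial.pderiv 1 Q * dU a) = 0 := by
  have h0 := levels_pos hh
  have hs : 0 < √(2 * h) := Real.sqrt_pos.2 (by positivity)
  have hp : PolarSol a 0 0 √(2 * h) 0 (cst √(2 * h)) :=
    ⟨good_cst hh, fun t => hs, fun t => by simpa [den, cst] using hs, by simp⟩
  have h1 := hp.sub_eq Q
  have he : endE (cst √(2 * h)) = h := by
    simp only [endE, cst, ContinuousMap.const_apply]
    rw [Real.sq_sqrt (by positivity)]; ring
  rw [flux_zero _ _ _ hh, he, sec, sub_self] at h1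
  rw [h1]
  congr 1
  simp
  ring

/-- The reflection `θ ↦ 2π - θ` fixes `x` and `dx/du` and reverses `y`. -/
lemma Lam_odd {h : ℝ} {p : MvPolynomial (Fin 2) ℝ}
    (hp : ∀ x y, MvPolynomial.eval ![x, -y] p = -MvPolynomial.eval ![x, y] p) : Lam a h p = 0 := by
  have h1 := intervalIntegral.integral_comp_sub_left (a := 0) (b := 2 * Real.pi)
    (fun θ => MvPolynomial.eval ![(pt a √(2 * h) θ).1, (pt a √(2 * h) θ).2] p *
      deriv (absc a) (√(2 * h) * Real.cos θ)) (2 * Real.pi)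
  simp only [pt, Real.cos_two_pi_sub, Real.sin_two_pi_sub, mul_neg, sub_self, sub_zero, neg_neg,
    hp, neg_mul] at h1
  rw [intervalIntegral.integral_neg] at h1
  rw [Lam]
  simp only [pt, hp, neg_mul]
  rw [intervalIntegral.integral_neg]
  linarith

lemma up_add (p q : ℝ[X]) : up (p + q) = up p + up q := map_add _ _ _

lemma up_mul (p q : ℝ[X]) : up (p * q) = up p * up q := map_mul _ _ _

lemma up_C (c : ℝ) : up (Polynomial.C c) = MvPolynomial.C c := by simp [up]

lemma mel_add (p q : ℝ[X]) {h : ℝ} (hh : h ∈ levels a) :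
    mel a (p + q) h = mel a p h + mel a q h := by
  rw [mel, up_add, add_mul, Lam_add hh, mel, mel]

lemma mel_C_mul (c : ℝ) (p : ℝ[X]) {h : ℝ} (hh : h ∈ levels a) :
    mel a (Polynomial.C c * p) h = c * mel a p h := by
  rw [mel, up_mul, up_C, mul_assoc, Lam_C_mul hh, mel]

end

/-! ### Expansions at the equilibrium -/

section

open scoped Polynomial

variable {a : ℝ}

lemma contDiffAt_deriv {r : ℝ → ℝ} {x : ℝ} (hr : ContDiffAt ℝ ∞ r x) :
    ContDiffAt ℝ ∞ (deriv r) x :=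
  (hr.fderiv_right (m := ∞) (by simp)).clm_apply contDiffAt_const

lemma iteratedDeriv_pow_mul {r : ℝ → ℝ} (hr : ContDiffAt ℝ ∞ r 0) (m : ℕ) :
    (∀ i < m, iteratedDeriv i (fun u => u ^ m * r u) 0 = 0) ∧
      iteratedDeriv m (fun u => u ^ m * r u) 0 = m.factorial * r 0 := by
  induction m generalizing r with
  | zero => simp
  | succ m ih =>
    have hd : deriv (fun u => u ^ (m + 1) * r u) =ᶠ[𝓝 0]
        fun u => u ^ m * ((m + 1) * r u + u * deriv r u) := by
      filter_upwards [(hr.of_le (m := 1) (by simp)).eventually (by simp)] with u hu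
      have h1 := (((hasDerivAt_id u).pow (m + 1)).mul
        ((hu.differentiableAt (by simp)).hasDerivAt)).deriv
      have e : (fun u => u ^ (m + 1) * r u) = (id ^ (m + 1) : ℝ → ℝ) * r := rfl
      rw [e, h1]
      simp
      ring
    have hr' : ContDiffAt ℝ ∞ (fun u => ((m : ℝ) + 1) * r u + u * deriv r u) 0 :=
      (contDiffAt_const.mul hr).add (contDiffAt_id.mul (contDiffAt_deriv hr))
    obtain ⟨i1, i2⟩ := ih hr'
    refine ⟨fun i hi => ?_, ?_⟩
    · cases i with
      | zero => simp
      | succ i =>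
        rw [iteratedDeriv_succ', Filter.EventuallyEq.iteratedDeriv_eq i hd]
        exact i1 i (by omega)
    · rw [iteratedDeriv_succ', Filter.EventuallyEq.iteratedDeriv_eq m hd, i2, Nat.factorial_succ]
      push_cast
      ring

lemma iteratedDeriv_even {φ : ℝ → ℝ} (h : ∀ u, φ (-u) = φ u) (i : ℕ) :
    iteratedDeriv (2 * i + 1) φ 0 = 0 := by
  have h1 := iteratedDeriv_comp_neg (2 * i + 1) φ 0
  simp only [h, neg_zero, smul_eq_mul] at h1
  rw [pow_succ, pow_mul] at h1
  norm_num at h1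
  linarith

lemma integral_pow_pos {w : ℝ → ℝ} (hw : Continuous w) (h1 : ∃ c ∈ Icc 0 (2 * Real.pi), w c ≠ 0)
    (i : ℕ) : 0 < ∫ θ in (0 : ℝ)..(2 * Real.pi), w θ ^ (2 * i + 2) := by
  obtain ⟨c, hc, hc0⟩ := h1
  have he : ∀ θ, w θ ^ (2 * i + 2) = (w θ ^ 2) ^ (i + 1) := fun θ => by rw [← pow_mul]; ring_nf
  refine intervalIntegral.integral_pos Real.two_pi_pos (by fun_prop) (fun θ _ => ?_) ⟨c, hc, ?_⟩
  · rw [he]; positivity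
  · rw [he]; positivity

lemma integral_sin_pos (i : ℕ) : 0 < ∫ θ in (0 : ℝ)..(2 * Real.pi), Real.sin θ ^ (2 * i + 2) :=
  integral_pow_pos Real.continuous_sin ⟨Real.pi / 2, ⟨by positivity, by linarith [Real.pi_pos]⟩,
    by simp⟩ i

lemma integral_cos_pos (i : ℕ) : 0 < ∫ θ in (0 : ℝ)..(2 * Real.pi), Real.cos θ ^ (2 * i + 2) :=
  integral_pow_pos Real.continuous_cos ⟨0, ⟨le_rfl, two_pi_nonneg⟩, by simp⟩ i

lemma osc_zero (φ : ℝ → ℝ) (i : ℕ) : osc φ i 0 = 2 / (Nat.doubleFactorial (2 * i + 1) : ℕ) *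
    ((∫ θ in (0 : ℝ)..(2 * Real.pi), Real.sin θ ^ (2 * i + 2)) *
      iteratedDeriv (2 * i + 1) φ 0) := by
  simp only [osc, mul_zero, Real.sqrt_zero, zero_mul, intervalIntegral.integral_const_mul]
  ring

/-- The ratio `x / u` of the abscissa and the action coordinate. -/
def wfac (a u : ℝ) : ℝ := 1 / √(wsq a (absc a u))

lemma absc_eq_mul {u : ℝ} (hu : u ∈ vals a) : absc a u = u * wfac a u := by
  have h1 := Real.sqrt_pos.2 (wsq_pos (absc_mem hu))
  have h2 := amp_absc hu
  rw [amp] at h2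
  rw [wfac, mul_one_div, eq_div_iff h1.ne', h2]

lemma contDiffAt_absc_zero (a : ℝ) :
    ContDiffAt ℝ ∞ (fun z : ℝ × ℝ => absc z.2 z.1) ((0 : ℝ), a) := by
  have h1 := contDiffAt_absc (zero_mem_basin a) ⊤
  rw [show amp a 0 = 0 by simp [amp]] at h1
  exact ContDiffAt.comp (g := fun z : ℝ × ℝ => absc z.1 z.2) (f := fun z : ℝ × ℝ => (z.2, z.1))
    ((0 : ℝ), a) h1 (by fun_prop)

lemma wsq_zero (a : ℝ) : wsq a 0 = 1 := by simp [wsq]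

lemma wfac_zero (a : ℝ) : wfac a 0 = 1 := by simp [wfac, absc_zero, wsq_zero]

lemma contDiffAt_wfac_zero (a : ℝ) :
    ContDiffAt ℝ ∞ (fun z : ℝ × ℝ => wfac z.2 z.1) ((0 : ℝ), a) := by
  have h1 : ContDiffAt ℝ ∞ (fun z : ℝ × ℝ => wsq z.2 (absc z.2 z.1)) ((0 : ℝ), a) := by
    have := contDiffAt_absc_zero a
    unfold wsq
    fun_prop
  have h2 : wsq a (absc a 0) = 1 := by rw [absc_zero, wsq_zero]
  unfold wfac
  refine contDiffAt_const.div (h1.sqrt ?_) ?_ <;> simp only [h2] <;> norm_num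

/-- `F` is the sum of a function of `U` and an odd term of order `2 j + 1`. -/
def HasOrder (a : ℝ) (F : ℝ[X]) (j : ℕ) : Prop :=
  ∃ P R : ℝ → ℝ, ContDiff ℝ ∞ P ∧ ContDiff ℝ ∞ R ∧ R 0 ≠ 0 ∧
    ∀ x, F.eval x = P (potential a x) + x ^ (2 * j + 1) * R x

/-- In the action coordinate `U = u² / 2` and `x = u * wfac a u`, so the first term becomes even in
`u`. -/
lemma pol_eq {F : ℝ[X]} {P R : ℝ → ℝ} {j : ℕ}
    (h : ∀ x, F.eval x = P (potential a x) + x ^ (2 * j + 1) * R x) {u : ℝ} (hu : u ∈ vals a) :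
    pol a F u = P (u ^ 2 / 2) + u ^ (2 * j + 1) * (wfac a u ^ (2 * j + 1) * R (absc a u)) := by
  rw [pol, h, potential_eq (absc_mem hu), amp_absc hu]
  congr 1
  conv_lhs => rw [absc_eq_mul hu]
  rw [mul_pow, ← absc_eq_mul hu, mul_assoc]

/-- The even function `P (u² / 2)` has no odd derivatives at `0`. The rest starts with `R 0 *
u^(2j+1)`, because `wfac a 0 = 1`. -/
lemma iteratedDeriv_pol {F : ℝ[X]} {j : ℕ} (h : HasOrder a F j) :
    (∀ i < j, iteratedDeriv (2 * i + 1) (pol a F) 0 = 0) ∧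
      iteratedDeriv (2 * j + 1) (pol a F) 0 ≠ 0 := by
  obtain ⟨P, R, hP, hR, hR0, hF⟩ := h
  have hev : pol a F =ᶠ[𝓝 0] fun u => P (u ^ 2 / 2) + u ^ (2 * j + 1) *
      (wfac a u ^ (2 * j + 1) * R (absc a u)) := by
    filter_upwards [(isOpen_vals a).mem_nhds (zero_mem_vals a)] with u hu using pol_eq hF hu
  have hsl : ContDiff ℝ ∞ fun u : ℝ => (u, a) := by fun_prop
  have hw : ContDiffAt ℝ ∞ (wfac a) 0 :=
    ContDiffAt.comp (g := fun z : ℝ × ℝ => wfac z.2 z.1) (f := fun u : ℝ => (u, a)) 0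
      (contDiffAt_wfac_zero a) hsl.contDiffAt
  have hX : ContDiffAt ℝ ∞ (absc a) 0 := contDiffAt_absc' (zero_mem_vals a) ⊤
  have hr : ContDiffAt ℝ ∞ (fun u => wfac a u ^ (2 * j + 1) * R (absc a u)) 0 :=
    (hw.pow _).mul (hR.contDiffAt.comp 0 hX)
  have hPe : ContDiff ℝ ∞ fun u : ℝ => P (u ^ 2 / 2) := hP.comp (by fun_prop)
  have hadd : ∀ i, iteratedDeriv (2 * i + 1) (pol a F) 0 = iteratedDeriv (2 * i + 1)
      (fun u => u ^ (2 * j + 1) * (wfac a u ^ (2 * j + 1) * R (absc a u))) 0 := by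
    intro i
    have h1 : ContDiffAt ℝ (2 * i + 1 : ℕ) (fun u : ℝ => P (u ^ 2 / 2)) 0 :=
      hPe.contDiffAt.of_le (WithTop.coe_le_coe.2 le_top)
    have h2 : ContDiffAt ℝ (2 * i + 1 : ℕ)
        (fun u => u ^ (2 * j + 1) * (wfac a u ^ (2 * j + 1) * R (absc a u))) 0 :=
      ((contDiffAt_id.pow _).mul hr).of_le (WithTop.coe_le_coe.2 le_top)
    rw [Filter.EventuallyEq.iteratedDeriv_eq _ hev, iteratedDeriv_fun_add h1 h2,
      iteratedDeriv_even (fun u => by simp), zero_add]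
  obtain ⟨i1, i2⟩ := iteratedDeriv_pow_mul hr (2 * j + 1)
  refine ⟨fun i hi => ?_, ?_⟩
  · rw [hadd, i1 _ (by omega)]
  · rw [hadd, i2, wfac_zero, absc_zero]
    have := Nat.factorial_ne_zero (2 * j + 1)
    simp [hR0, this]

/-- The energy enters only through `√(2h) cos θ`, inside a function that is smooth jointly in `u`
and the parameter. Hence continuity reaches `h = 0`. -/
lemma continuousAt_osc {B : ℝ → ℝ[X]} (hB : ContDiff ℝ ∞ fun z : ℝ × ℝ => (B z.1).eval z.2)
    (a : ℝ) (i : ℕ) :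
    ContinuousAt (fun z : ℝ × ℝ => osc (pol z.2 (B z.2)) i z.1) ((0 : ℝ), a) := by
  have hΦ : ContDiffAt ℝ ∞ (fun z : ℝ × ℝ => pol z.2 (B z.2) z.1) ((0 : ℝ), a) :=
    ContDiffAt.comp (g := fun z : ℝ × ℝ => (B z.1).eval z.2)
      (f := fun z : ℝ × ℝ => (z.2, absc z.2 z.1)) ((0 : ℝ), a) hB.contDiffAt
      (contDiffAt_snd.prodMk (contDiffAt_absc_zero a))
  have h1 := eventually_iteratedDeriv hΦ (2 * i + 1)
  have h2 : ∀ᶠ z in 𝓝 ((0 : ℝ), a), ContinuousAt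
      (pd^[2 * i + 1] (fun z : ℝ × ℝ => pol z.2 (B z.2) z.1)) z := by
    filter_upwards [eventually_contDiffAt (contDiffAt_iterate_pd hΦ (2 * i + 1)) 0] with z hz
      using hz.continuousAt
  have h3 := (continuousAt_integral_cos (w := fun θ => Real.sin θ ^ (2 * i + 2)) (by fun_prop)
    h2).const_mul (2 / ((Nat.doubleFactorial (2 * i + 1) : ℕ) : ℝ))
  refine h3.congr ?_
  filter_upwards [eventually_cos h1] with z hz
  rw [osc]
  congr 1
  refine intervalIntegral.integral_congr fun θ _ => ?_
  rw [← hz θ]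

lemma exists_levels (a : ℝ) : ∃ ρ > 0, ∀ᶠ b in 𝓝 a, Ioo 0 ρ ⊆ levels b := by
  have h1 : ∀ᶠ z : ℝ × ℝ in 𝓝 ((0 : ℝ), a), z.1 ∈ vals z.2 := by
    have := isOpen_vals2.mem_nhds (x := (a, (0 : ℝ))) (zero_mem_vals a)
    have hsw : Tendsto (fun z : ℝ × ℝ => (z.2, z.1)) (𝓝 ((0 : ℝ), a)) (𝓝 (a, (0 : ℝ))) :=
      continuous_swap.tendsto ((0 : ℝ), a)
    exact hsw this
  have h2 := eventually_cos h1
  rw [nhds_prod_eq, Filter.Eventually, Filter.mem_prod_iff] at h2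
  obtain ⟨s, hs, t, ht, hst⟩ := h2
  obtain ⟨ρ, hρ, hs⟩ := Metric.mem_nhds_iff.1 hs
  refine ⟨ρ, hρ, ?_⟩
  filter_upwards [ht] with b hb h hh
  have := hst (mk_mem_prod (hs (show h ∈ Metric.ball 0 ρ by
    rw [Metric.mem_ball, dist_zero_right, Real.norm_of_nonneg hh.1.le]; exact hh.2)) hb) 0
  simp only [Real.cos_zero, mul_one] at this
  exact mem_levels_iff.2 ⟨hh.1, this⟩

/-- The derivatives of `mel(h) / h` of the orders `0, …, n - 1` have no common zero, even at
different points. -/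
def Cheb (b ρ : ℝ) (n : ℕ) (F : ℝ[X]) : Prop :=
  ∀ ξ : Fin n → ℝ, (∀ i, ξ i ∈ Ioo 0 ρ) → ∃ i : Fin n, osc (pol b F) i (ξ i) ≠ 0

/-- A family of primitives with the orders `0, …, n - 1` spans a Chebyshev system near the
equilibrium, uniformly for parameters near `a`. -/
theorem exists_cheb {n : ℕ} {B : Fin n → ℝ → ℝ[X]}
    (hB : ∀ j, ContDiff ℝ ∞ fun z : ℝ × ℝ => (B j z.1).eval z.2) (ho : ∀ j, HasOrder a (B j a) j) :
    ∃ ρ > 0, ∀ᶠ b in 𝓝 a, Ioo 0 ρ ⊆ levels b ∧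
      ∀ c : Fin n → ℝ, c ≠ 0 → Cheb b ρ n (∑ j, Polynomial.C (c j) * B j b) := by
  -- Each row is evaluated at its own point, so that a nonzero determinant excludes zeros of the
  -- successive derivatives even at different points.
  let D : (Fin n → ℝ) × ℝ → Matrix (Fin n) (Fin n) ℝ := fun z =>
    Matrix.of fun i j => osc (pol z.2 (B j z.2)) i (z.1 i)
  have hD : ContinuousAt (fun z => (D z).det) ((0 : Fin n → ℝ), a) := by
    have h1 : ContinuousAt D ((0 : Fin n → ℝ), a) := by
      refine continuousAt_pi.2 fun i => continuousAt_pi.2 fun j => ?_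
      have h2 := continuousAt_osc (hB j) a i
      exact ContinuousAt.comp (g := fun z : ℝ × ℝ => osc (pol z.2 (B j z.2)) i z.1)
        (f := fun z : (Fin n → ℝ) × ℝ => (z.1 i, z.2)) h2 (by fun_prop)
    have h3 : Continuous fun M : Matrix (Fin n) (Fin n) ℝ => M.det := continuous_id.matrix_det
    exact ContinuousAt.comp (g := fun M : Matrix (Fin n) (Fin n) ℝ => M.det) h3.continuousAt h1
  -- At the equilibrium the matrix is triangular: row `i` is a nonzero multiple of the derivative of
  -- order `2i + 1`, which kills the basis elements of order above `i` and not the one of order `i`.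
  have hD0 : (D ((0 : Fin n → ℝ), a)).det ≠ 0 := by
    rw [Matrix.det_of_isLowerTriangular]
    · refine Finset.prod_ne_zero_iff.2 fun i _ => ?_
      change osc (pol a (B i a)) i 0 ≠ 0
      rw [osc_zero]
      have h1 := Nat.doubleFactorial_pos (2 * (i : ℕ) + 1)
      have h2 := integral_sin_pos i
      have h3 := (iteratedDeriv_pol (ho i)).2
      have h4 : (2 : ℝ) / ((Nat.doubleFactorial (2 * (i : ℕ) + 1) : ℕ) : ℝ) ≠ 0 := by positivity
      exact mul_ne_zero h4 (mul_ne_zero h2.ne' h3)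
    · intro i j hij
      have hij' : i < j := hij
      change osc (pol a (B j a)) i 0 = 0
      rw [osc_zero, (iteratedDeriv_pol (ho j)).1 i hij', mul_zero, mul_zero]
  have hev := hD.eventually_ne hD0
  rw [nhds_prod_eq, Filter.Eventually, Filter.mem_prod_iff] at hev
  obtain ⟨s, hs, t, ht, hst⟩ := hev
  obtain ⟨ρ₁, hρ₁, hs⟩ := Metric.mem_nhds_iff.1 hs
  obtain ⟨ρ₂, hρ₂, hlev⟩ := exists_levels a
  refine ⟨min ρ₁ ρ₂, lt_min hρ₁ hρ₂, ?_⟩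
  filter_upwards [ht, hlev] with b hb hl
  have hl' : Ioo 0 (min ρ₁ ρ₂) ⊆ levels b := (Ioo_subset_Ioo_right (min_le_right _ _)).trans hl
  refine ⟨hl', fun c hc ξ hξ => ?_⟩
  by_contra hcon
  push Not at hcon
  have hξs : ξ ∈ Metric.ball (0 : Fin n → ℝ) ρ₁ := by
    rw [mem_ball_zero_iff, pi_norm_lt_iff hρ₁]
    intro i
    rw [Real.norm_of_nonneg (hξ i).1.le]
    exact (hξ i).2.trans_le (min_le_left _ _)
  have hdet : (D (ξ, b)).det ≠ 0 := hst (mk_mem_prod (hs hξs) hb)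
  refine hc (Matrix.eq_zero_of_mulVec_eq_zero hdet ?_)
  funext i
  have h1 := hcon i
  have h2 : pol b (∑ j, Polynomial.C (c j) * B j b) = fun u => ∑ j, c j * pol b (B j b) u := by
    funext u
    simp [pol, Polynomial.eval_finsetSum]
  rw [h2, osc_sum (fun j _ => contDiffOn_pol _) c (hl' (hξ i))] at h1
  simp only [Matrix.mulVec, dotProduct, Pi.zero_apply]
  rw [← h1]
  exact Finset.sum_congr rfl fun j _ => mul_comm _ _

lemma mel_sum {ι : Type*} (s : Finset ι) (c : ι → ℝ) (p : ι → ℝ[X]) {h : ℝ} (hh : h ∈ levels a) :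
    mel a (∑ j ∈ s, Polynomial.C (c j) * p j) h = ∑ j ∈ s, c j * mel a (p j) h := by
  classical
  induction s using Finset.induction_on with
  | empty =>
    have := mel_C_mul 0 (0 : ℝ[X]) hh
    simpa using this
  | insert i s hi ih =>
    rw [Finset.sum_insert hi, Finset.sum_insert hi, mel_add _ _ hh, mel_C_mul _ _ hh, ih]

/-- The contribution of the odd term to the integral. -/
lemma mel_expand {F : ℝ[X]} {P R : ℝ → ℝ} {j : ℕ} (hP : Continuous P) (hR : Continuous R)
    (hF : ∀ x, F.eval x = P (potential a x) + x ^ (2 * j + 1) * R x) {h : ℝ} (hh : h ∈ levels a) :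
    mel a F.derivative h = h ^ (j + 1) * (2 ^ (j + 1) * ∫ θ in (0 : ℝ)..(2 * Real.pi),
      (wfac a (√(2 * h) * Real.cos θ) ^ (2 * j + 1) * R (absc a (√(2 * h) * Real.cos θ))) *
        Real.cos θ ^ (2 * j + 2)) := by
  have h0 := levels_pos hh
  set s := √(2 * h) with hs
  have hs2 : s ^ 2 = 2 * h := Real.sq_sqrt (by positivity)
  have hXc : Continuous fun θ => absc a (s * Real.cos θ) :=
    continuous_comp_cos (fun v hv => (contDiffAt_absc' hv 0).continuousAt.continuousWithinAt) hh
  have hwc : Continuous fun θ => wfac a (s * Real.cos θ) := by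
    unfold wfac wsq
    refine continuous_const.div (by fun_prop) fun θ => ?_
    exact (Real.sqrt_pos.2 (wsq_pos (absc_mem (mul_cos_mem' hh θ)))).ne'
  have hRc : Continuous fun θ => R (absc a (s * Real.cos θ)) := hR.comp hXc
  -- The integrand is even in `u` times `cos θ`, so the half-turn `θ ↦ θ + π` reverses its sign.
  have hev : ∫ θ in (0 : ℝ)..(2 * Real.pi), P ((s * Real.cos θ) ^ 2 / 2) * Real.cos θ = 0 := by
    have hper : Function.Periodic (fun θ => P ((s * Real.cos θ) ^ 2 / 2) * Real.cos θ)
        (2 * Real.pi) := fun θ => by simp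
    have h1 := hper.intervalIntegral_add_eq 0 Real.pi
    have h2 := intervalIntegral.integral_comp_add_right (a := 0) (b := 2 * Real.pi)
      (fun θ => P ((s * Real.cos θ) ^ 2 / 2) * Real.cos θ) Real.pi
    simp only [Real.cos_add_pi, mul_neg, even_two, Even.neg_pow,
      intervalIntegral.integral_neg, zero_add] at h1 h2
    rw [add_comm (2 * Real.pi)] at h2
    rw [← h1] at h2
    linarith
  rw [mel_eq_cos F hh, ← hs]
  have e : ∀ θ, pol a F (s * Real.cos θ) * Real.cos θ =
      P ((s * Real.cos θ) ^ 2 / 2) * Real.cos θ + s ^ (2 * j + 1) *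
        ((wfac a (s * Real.cos θ) ^ (2 * j + 1) * R (absc a (s * Real.cos θ))) *
          Real.cos θ ^ (2 * j + 2)) := fun θ => by
    rw [pol_eq hF (mul_cos_mem' hh θ)]; ring
  simp only [e]
  rw [integral_linear (by fun_prop) (by fun_prop), hev, zero_add, ← mul_assoc, ← mul_assoc,
    ← mul_pow, mul_comm h 2, ← hs2]
  ring

/-- One factor `A`, continuous up to `h = 0` jointly in the parameter, serves all `F` and `P` with
the given odd term. At the equilibrium it is a positive multiple of `R a 0`. -/
lemma exists_expansion {R : ℝ → ℝ → ℝ} (hR : Continuous fun z : ℝ × ℝ => R z.1 z.2) (a : ℝ) (j : ℕ) :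
    ∃ A : ℝ × ℝ → ℝ, ContinuousAt A ((0 : ℝ), a) ∧ (∃ W > 0, A (0, a) = W * R a 0) ∧
      ∀ b, ∀ h ∈ levels b, ∀ (F : ℝ[X]) (P : ℝ → ℝ), Continuous P →
        (∀ x, F.eval x = P (potential b x) + x ^ (2 * j + 1) * R b x) →
          mel b F.derivative h = h ^ (j + 1) * A (h, b) := by
  have hg : ∀ᶠ z in 𝓝 ((0 : ℝ), a), ContinuousAt (fun z : ℝ × ℝ =>
      wfac z.2 z.1 ^ (2 * j + 1) * R z.2 (absc z.2 z.1)) z := by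
    filter_upwards [eventually_contDiffAt (contDiffAt_absc_zero a) 0,
      eventually_contDiffAt (contDiffAt_wfac_zero a) 0] with z h1 h2
    refine (h2.continuousAt.pow _).mul ?_
    exact ContinuousAt.comp (g := fun z : ℝ × ℝ => R z.1 z.2)
      (f := fun z : ℝ × ℝ => (z.2, absc z.2 z.1)) hR.continuousAt
      (continuousAt_snd.prodMk h1.continuousAt)
  refine ⟨_, (continuousAt_integral_cos (w := fun θ => Real.cos θ ^ (2 * j + 2)) (by fun_prop)
    hg).const_mul (2 ^ (j + 1)), ⟨2 ^ (j + 1) * ∫ θ in (0 : ℝ)..(2 * Real.pi),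
      Real.cos θ ^ (2 * j + 2), ?_, ?_⟩, ?_⟩
  · have := integral_cos_pos j
    positivity
  · simp only [mul_zero, Real.sqrt_zero, zero_mul, wfac_zero, absc_zero, one_pow, one_mul]
    rw [intervalIntegral.integral_const_mul]
    ring
  · intro b h hh F P hP hF
    have hRb : Continuous (R b) := hR.comp (by fun_prop : Continuous fun x : ℝ => (b, x))
    exact mel_expand hP hRb hF hh

lemma continuous_mel (F : ℝ[X]) : ContinuousOn (mel a F.derivative) (levels a) := fun h hh => by
  have h1 := (hasDerivAt_osc (contDiffOn_pol F) hh 0).continuousAt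
  have h2 : ContinuousAt (fun h => h * osc (pol a F) 0 h) h := continuousAt_id.mul h1
  refine (h2.congr ?_).continuousWithinAt
  filter_upwards [(isOpen_levels a).mem_nhds hh] with k hk
  exact (mel_eq_osc F hk).symm

/-- The leading term of the integral at the equilibrium. -/
lemma HasOrder.tendsto {F : ℝ[X]} {j : ℕ} (h : HasOrder a F j) :
    ∃ c ≠ 0, Tendsto (fun h => mel a F.derivative h / h ^ (j + 1)) (𝓝[>] 0) (𝓝 c) := by
  obtain ⟨P, R, hP, hR, hR0, hF⟩ := h
  obtain ⟨A, hA, ⟨W, hW, hA0⟩, hAm⟩ := exists_expansion (R := fun _ => R)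
    (hR.continuous.comp continuous_snd) a j
  refine ⟨A (0, a), by rw [hA0]; exact mul_ne_zero hW.ne' hR0, ?_⟩
  have h1 : Tendsto (fun h : ℝ => A (h, a)) (𝓝[>] 0) (𝓝 (A (0, a))) := by
    have hc : Tendsto (fun h : ℝ => (h, a)) (𝓝[>] 0) (𝓝 (0, a)) :=
      ((by fun_prop : Continuous fun h : ℝ => (h, a)).tendsto 0).mono_left nhdsWithin_le_nhds
    exact hA.tendsto.comp hc
  obtain ⟨ρ, hρ, hl⟩ := exists_levels a
  refine h1.congr' ?_
  filter_upwards [Ioo_mem_nhdsGT hρ] with h hh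
  rw [hAm a h (hl.self_of_nhds hh) F P hP.continuous hF, mul_div_cancel_left₀]
  exact pow_ne_zero _ hh.1.ne'

end

/-! ### Zeros of the coefficients and limit cycles -/

section

open scoped Polynomial

variable {a : ℝ} {f g : MvPolynomial (Fin 2) ℝ}

/-- The coefficient of order `k` of the perturbation is `∮ F'(x) y dx`, and its zeros control the
limit cycles. -/
structure IsMel (a : ℝ) (f g : MvPolynomial (Fin 2) ℝ) (k : ℕ) (F : ℝ[X]) : Prop where
  isCoeff : IsCoeff a f g k fun h => mel a F.derivative h
  model : ∃ M μ, (∀ h ∈ levels a, M h = mel a F.derivative h) ∧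
    ∀ h ∈ levels a, ∃ S R m, LocalModel a f g M μ h S R m

lemma Chain.isMel {k : ℕ} {q Q : ℕ → MvPolynomial (Fin 2) ℝ} (c : Chain a f g k q Q) {F : ℝ[X]}
    (hF : ∀ h ∈ levels a, Lam a h (q k * omg a f g) = mel a F.derivative h) :
    IsMel a f g (k + 1) F := by
  refine ⟨?_, _, _, hF, fun h hh => c.exists_localModel hh⟩
  have := c.isCoeff
  convert! this using 1
  funext h
  exact (hF h h.2).symm

lemma Cheb.encard_le {b ρ : ℝ} {n : ℕ} {F : ℝ[X]} (h : Cheb b ρ (n + 1) F)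
    (hl : Ioo 0 ρ ⊆ levels b) :
    {h : levels b | (h : ℝ) < ρ ∧ mel b F.derivative h = 0}.encard ≤ n := by
  have h1 := encard_zeros_le (D := osc (pol b F)) ordConnected_Ioo
    (fun i _ x hx => hasDerivAt_osc (contDiffOn_pol F) (hl hx) i) h
  refine le_trans (encard_le_encard_of_injOn (f := Subtype.val) ?_
    Subtype.val_injective.injOn) h1
  rintro ⟨x, hx⟩ ⟨hx1, hx2⟩
  refine ⟨⟨levels_pos hx, hx1⟩, ?_⟩
  have h2 := mel_eq_osc F hx
  simp only at hx2
  rw [hx2] at h2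
  exact (mul_eq_zero.1 h2.symm).resolve_left (levels_pos hx).ne'

lemma producesAtMost_of {b ρ : ℝ} {k n : ℕ} (hl : Ioo 0 ρ ⊆ levels b)
    (H : ∀ f g : MvPolynomial (Fin 2) ℝ, f.totalDegree ≤ 3 → g.totalDegree ≤ 3 →
      ∀ M, IsCoeff b f g k M → M ≠ 0 → ∃ F, IsMel b f g k F ∧ Cheb b ρ (n + 1) F) :
    ProducesAtMost b k n ρ := by
  intro f g hf hg M hM hM0
  obtain ⟨F, hF, hc⟩ := H f g hf hg M hM hM0
  obtain rfl := hM.unique hF.isCoeff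
  refine ⟨hc.encard_le hl, fun r₁ r₂ h1 _ h3 h4 => ?_⟩
  obtain ⟨M, μ, hMel, hmod⟩ := hF.model
  refine eventually_encard_le hmod h1 h4 (isOpen_levels b) (D := osc (pol b F))
    (fun h hh => levels_of_le h4 (h1.trans_le hh.1) hh.2) (fun h hh => ?_)
    (fun i x hx => hasDerivAt_osc (contDiffOn_pol F) hx i) fun ξ hξ =>
      hc ξ fun i => ⟨h1.trans_le (hξ i).1, (hξ i).2.trans_lt h3⟩
  rw [hMel h hh, mel_eq_osc F hh]

/-- If the integral vanished on all levels, so would all derivatives of `osc` on `(0, ρ)`, and a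
constant tuple `ξ` would contradict `Cheb`. -/
lemma Cheb.exists_ne_zero {b ρ : ℝ} {n : ℕ} {F : ℝ[X]} (h : Cheb b ρ (n + 1) F) (hρ : 0 < ρ)
    (hl : Ioo 0 ρ ⊆ levels b) : ∃ h ∈ levels b, mel b F.derivative h ≠ 0 := by
  by_contra hcon
  push Not at hcon
  have h0 : ∀ i, ∀ x ∈ Ioo 0 ρ, osc (pol b F) i x = 0 := by
    intro i
    induction i with
    | zero =>
      intro x hx
      have := hcon x (hl hx)
      rw [mel_eq_osc F (hl hx)] at this
      exact (mul_eq_zero.1 this).resolve_left hx.1.ne'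
    | succ i ih =>
      intro x hx
      have h1 := hasDerivAt_osc (contDiffOn_pol F) (hl hx) i
      have h2 : osc (pol b F) i =ᶠ[𝓝 x] fun _ => 0 := by
        filter_upwards [Ioo_mem_nhds hx.1 hx.2] with y hy using ih y hy
      exact h1.unique ((hasDerivAt_const x (0 : ℝ)).congr_of_eventuallyEq h2)
  obtain ⟨i, hi⟩ := h (fun _ => ρ / 2) fun _ => ⟨by linarith, by linarith⟩
  exact hi (h0 _ _ ⟨by linarith, by linarith⟩)

/-- If `osc` has as many zeros as a Chebyshev system allows, then they are simple. -/
lemma Cheb.simple {b ρ : ℝ} {m : ℕ} {F : ℝ[X]} (h : Cheb b ρ (m + 2) F)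
    (hl : Ioo 0 ρ ⊆ levels b) {z : Fin (m + 1) → ℝ} (hz : StrictMono z)
    (hzI : ∀ i, z i ∈ Ioo 0 ρ) (h0 : ∀ i, osc (pol b F) 0 (z i) = 0) (i : Fin (m + 1)) :
    osc (pol b F) 1 (z i) ≠ 0 := by
  intro hi
  have hd : ∀ i, ∀ x ∈ Ioo 0 ρ, HasDerivAt (osc (pol b F) i) (osc (pol b F) (i + 1) x) x :=
    fun i x hx => hasDerivAt_osc (contDiffOn_pol F) (hl hx) i
  -- The first derivative has at most `m` zeros: a known zero of the function itself fills the entry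
  -- `0` of the Chebyshev condition and leaves the higher orders.
  have h1 := encard_zeros_le (D := fun i => osc (pol b F) (i + 1)) (n := m) ordConnected_Ioo
    (fun i _ x hx => hd (i + 1) x hx) (fun ξ hξ => by
      obtain ⟨j, hj⟩ := h (Fin.cons (z 0) ξ)
        (Fin.cases (hzI 0) (fun j => by simpa using hξ j))
      refine Fin.cases (fun hj => ?_) (fun j hj => ?_) j hj
      · simp [h0] at hj
      · exact ⟨j, by simpa using hj⟩)
  have key : ∀ j : Fin m, ∃ c ∈ Ioo (z j.castSucc) (z j.succ), osc (pol b F) 1 c = 0 := fun j =>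
    exists_hasDerivAt_eq_zero (hz j.castSucc_lt_succ)
      (fun y hy => (hd 0 y (ordConnected_Ioo.out (hzI _) (hzI _) hy)).continuousAt.continuousWithinAt)
      (by rw [h0, h0])
      fun y hy => hd 0 y (ordConnected_Ioo.out (hzI _) (hzI _) ⟨hy.1.le, hy.2.le⟩)
  choose c hc hc0 using key
  have hcz : ∀ j, z i ≠ c j := by
    intro j e
    have e1 := (hc j).1
    have e2 := (hc j).2
    rw [← e] at e1 e2
    have e3 := hz.lt_iff_lt.1 e1
    have e4 := hz.lt_iff_lt.1 e2
    rw [Fin.lt_def] at e3 e4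
    simp at e3 e4
    omega
  have hcinj : Function.Injective c := by
    have : StrictMono c := fun j k hjk =>
      calc c j < z j.succ := (hc j).2
        _ ≤ z k.castSucc := hz.monotone (by rw [Fin.le_def]; simpa using hjk)
        _ < c k := (hc k).1
    exact this.injective
  -- Rolle's theorem already gives `m` zeros strictly between consecutive `z j`; a double zero `z i`
  -- would be one more.
  have h2 : (insert (z i) (range c)).encard = m + 1 := by
    rw [encard_insert_of_notMem (by rintro ⟨j, hj⟩; exact hcz j hj.symm), ← image_univ,
      hcinj.injOn.encard_image, encard_univ, ENat.card_eq_coe_fintype_card, Fintype.card_fin]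
  have h3 : insert (z i) (range c) ⊆ {x | x ∈ Ioo 0 ρ ∧ osc (pol b F) (0 + 1) x = 0} := by
    rintro x (rfl | ⟨j, rfl⟩)
    · exact ⟨hzI i, hi⟩
    · exact ⟨ordConnected_Ioo.out (hzI _) (hzI _) ⟨(hc j).1.le, (hc j).2.le⟩, hc0 j⟩
  have h4 := (encard_le_encard h3).trans h1
  rw [h2] at h4
  exact absurd h4 (by rw [not_le]; exact_mod_cast Nat.lt_succ_self m)

/-- `φ` changes its sign at least `n` times in `(0, r)`. -/
def Alt (φ : ℝ → ℝ) (r : ℝ) (n : ℕ) : Prop :=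
  ∃ (t : Fin (n + 1) → ℝ) (σ : ℝ), StrictMono t ∧ (∀ i, t i ∈ Ioo 0 r) ∧
    ∀ i : Fin (n + 1), 0 < σ * (-1) ^ (i : ℕ) * φ (t i)

/-- The `n` sign changes give `n` zeros. As a Chebyshev system of `n + 1` elements allows no more,
they are simple, and each of them carries a limit cycle. -/
theorem canProduce_of {k n : ℕ} {F : ℝ[X]} {ρ ρ₀ : ℝ} (hf : f.totalDegree ≤ 3)
    (hg : g.totalDegree ≤ 3) (hF : IsMel a f g k F) (hl : Ioo 0 ρ₀ ⊆ levels a)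
    (hc : Cheb a ρ₀ (n + 1) F) (halt : Alt (mel a F.derivative) (min ρ ρ₀) n) :
    CanProduce a k n ρ := by
  obtain ⟨t, σ, ht, htI, hts⟩ := halt
  have htl : ∀ i, t i ∈ levels a := fun i => hl ⟨(htI i).1, (htI i).2.trans_le (min_le_right _ _)⟩
  have hσ : σ ≠ 0 := by
    rintro rfl
    have := hts 0
    simp at this
  have key : ∀ i : Fin n, ∃ z ∈ Ioo (t i.castSucc) (t i.succ), mel a F.derivative z = 0 := by
    intro i
    have h1 := hts i.castSucc
    have h2 := hts i.succ
    simp only [Fin.val_castSucc, Fin.val_succ, pow_succ] at h1 h2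
    have hlt := ht i.castSucc_lt_succ
    have hcont : ContinuousOn (fun h => σ * (-1) ^ (i : ℕ) * mel a F.derivative h)
        (Icc (t i.castSucc) (t i.succ)) := by
      refine continuousOn_const.mul ((continuous_mel F).mono fun x hx => ?_)
      exact levels_of_le (htl i.succ) ((htI _).1.trans_le hx.1) hx.2
    obtain ⟨z, hz, hz0⟩ := intermediate_value_Ioo' hlt.le hcont
      (show (0 : ℝ) ∈ Ioo _ _ from ⟨by linarith, h1⟩)
    refine ⟨z, hz, (mul_eq_zero.1 hz0).resolve_left ?_⟩
    exact mul_ne_zero hσ (pow_ne_zero _ (by norm_num))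
  choose z hz hz0 using key
  have hzI : ∀ i, z i ∈ Ioo 0 ρ₀ := fun i => ⟨(htI _).1.trans (hz i).1,
    (hz i).2.trans ((htI _).2.trans_le (min_le_right _ _))⟩
  have hzmono : StrictMono z := fun j k hjk =>
    calc z j < t j.succ := (hz j).2
      _ ≤ t k.castSucc := ht.monotone (by rw [Fin.le_def]; simpa using hjk)
      _ < z k := (hz k).1
  have hosc : ∀ i, osc (pol a F) 0 (z i) = 0 := fun i => by
    have := hz0 i
    rw [mel_eq_osc F (hl (hzI i))] at this
    exact (mul_eq_zero.1 this).resolve_left (hzI i).1.ne'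
  have hsimple : ∀ i, osc (pol a F) 1 (z i) ≠ 0 := by
    cases n with
    | zero => exact fun i => i.elim0
    | succ m => exact hc.simple hl hzmono hzI hosc
  obtain ⟨M, μ, hMel, hmod⟩ := hF.model
  have hder : ∀ i, HasDerivAt M (z i * osc (pol a F) 1 (z i)) (z i) := by
    intro i
    have h1 := (hasDerivAt_id (z i)).mul (hasDerivAt_osc (contDiffOn_pol F) (hl (hzI i)) 0)
    simp only [hosc, id, zero_add, mul_zero] at h1
    refine h1.congr_of_eventuallyEq ?_
    filter_upwards [(isOpen_levels a).mem_nhds (hl (hzI i))] with x hx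
    rw [hMel x hx, mel_eq_osc F hx]
    rfl
  refine ⟨f, g, hf, hg, _, hF.isCoeff, ?_, fun i => ⟨z i, hl (hzI i)⟩, ?_, fun i => ⟨?_, hz0 i⟩, ?_⟩
  · intro h
    have h1 := congrFun h ⟨t 0, htl 0⟩
    have h2 := hts 0
    simp only [Pi.zero_apply] at h1
    rw [h1] at h2
    simp at h2
  · intro i j hij
    exact hzmono.injective (by simpa using hij)
  · exact (hz i).2.trans ((htI _).2.trans_le (min_le_left _ _))
  · intro η hη
    have hall : ∀ i, ∀ᶠ ε in 𝓝[>] (0 : ℝ), ∃ C, IsLimitCycle (field a f g ε) C ∧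
        Metric.hausdorffEDist C (oval a (z i)) < ENNReal.ofReal η ∧
        C ⊆ {p | p.1 ∈ basin a ∧ |ham a p - z i| < min (z i - t i.castSucc) (t i.succ - z i)} :=
      fun i => exists_limitCycle hmod (hl (hzI i)) (by rw [hMel _ (hl (hzI i)), hz0]) (hder i)
        (mul_ne_zero (hzI i).1.ne' (hsimple i)) hη
        (lt_min (by linarith [(hz i).1]) (by linarith [(hz i).2]))
    filter_upwards [eventually_all.2 hall] with ε hε
    choose C hC1 hC2 hC3 using hε
    refine ⟨C, ?_, fun i => ⟨hC1 i, hC2 i⟩⟩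
    -- Each cycle keeps its energy between consecutive test points. These windows are disjoint, so
    -- the cycles are distinct.
    have hwin : ∀ i, ∀ p ∈ C i, ham a p ∈ Ioo (t i.castSucc) (t i.succ) := by
      intro i p hp
      have := (hC3 i hp).2
      rw [lt_min_iff, abs_lt, abs_lt] at this
      exact ⟨by linarith [this.1.1], by linarith [this.2.2]⟩
    have hne : ∀ i, (C i).Nonempty := by
      intro i
      obtain ⟨⟨γ, T, -, -, -, -, e⟩, -⟩ := hC1 i
      rw [e]
      exact ⟨γ 0, 0, rfl⟩
    intro i j hij
    obtain ⟨p, hp⟩ := hne i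
    have h1 := hwin i p hp
    have h2 := hwin j p (hij ▸ hp)
    have h3 := ht.lt_iff_lt.1 (h1.1.trans h2.2)
    have h4 := ht.lt_iff_lt.1 (h2.1.trans h1.2)
    rw [Fin.lt_def] at h3 h4
    simp at h3 h4
    exact Fin.ext (by omega)

/-- A small multiple of a function that dominates `φ` at `0` adds a change of sign. -/
lemma Alt.step {φ ψ : ℝ → ℝ} {r c : ℝ} {n j : ℕ} (h : Alt φ r n)
    (hφ : Tendsto (fun h => φ h / h ^ j) (𝓝[>] 0) (𝓝 0))
    (hψ : Tendsto (fun h => ψ h / h ^ j) (𝓝[>] 0) (𝓝 c)) (hc : c ≠ 0) :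
    ∃ η, Alt (fun h => φ h + η * ψ h) r (n + 1) := by
  obtain ⟨t, σ, ht, htI, hts⟩ := h
  have hσ : σ ≠ 0 := by
    rintro rfl
    have := hts 0
    simp at this
  -- The added multiple is `-(σ c τ)`: for small `τ` it does not disturb the old signs.
  have h1 : ∀ i : Fin (n + 1), ∀ᶠ τ in 𝓝[>] (0 : ℝ),
      0 < σ * (-1) ^ (i : ℕ) * (φ (t i) + -(σ * c * τ) * ψ (t i)) := by
    intro i
    have hcont : ContinuousAt (fun τ : ℝ => σ * (-1) ^ (i : ℕ) *
        (φ (t i) + -(σ * c * τ) * ψ (t i))) 0 := by fun_prop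
    refine nhdsWithin_le_nhds (hcont.eventually (lt_mem_nhds ?_))
    simpa using hts i
  obtain ⟨τ, hτ, hτ0⟩ := ((eventually_all.2 h1).and self_mem_nhdsWithin).exists
  have hτ0 : 0 < τ := hτ0
  refine ⟨-(σ * c * τ), ?_⟩
  -- Close to `0` the sum behaves like `-σ c² τ h^j`, opposite in sign to the first old value.
  have h2 : Tendsto (fun h => -σ * ((φ h + -(σ * c * τ) * ψ h) / h ^ j)) (𝓝[>] 0)
      (𝓝 (-σ * (0 + -(σ * c * τ) * c))) := by
    refine ((hφ.add (hψ.const_mul (-(σ * c * τ)))).congr fun h => ?_).const_mul (-σ)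
    ring
  have h3 : 0 < -σ * (0 + -(σ * c * τ) * c) := by
    have : -σ * (0 + -(σ * c * τ) * c) = (σ * c) ^ 2 * τ := by ring
    rw [this]
    positivity
  obtain ⟨x, hx, hx0⟩ := ((h2.eventually (lt_mem_nhds h3)).and
    (Ioo_mem_nhdsGT (htI 0).1)).exists
  have hxp : 0 < x ^ j := pow_pos hx0.1 _
  refine ⟨Fin.cons x t, -σ, ?_, ?_, ?_⟩
  · rw [Fin.strictMono_iff_lt_succ]
    intro i
    refine Fin.cases ?_ (fun i => ?_) i
    · simpa using hx0.2
    · simpa using ht i.castSucc_lt_succ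
  · refine Fin.cases ?_ (fun i => ?_)
    · simpa using ⟨hx0.1, hx0.2.trans (htI 0).2⟩
    · simpa using htI i
  · refine Fin.cases ?_ (fun i => ?_)
    · have := mul_pos hx hxp
      rw [mul_assoc, div_mul_cancel₀ _ hxp.ne'] at this
      simpa using this
    · have := hτ i
      simp only [Fin.val_succ, Fin.cons_succ, pow_succ]
      linarith

/-- The functions are added in descending order of `j`, so that each new one dominates at `0`
everything added before. -/
lemma exists_alt_sum {ψ : ℕ → ℝ → ℝ} {m : ℕ}
    (hψ : ∀ j < m, ∃ c ≠ 0, Tendsto (fun h => ψ j h / h ^ (j + 1)) (𝓝[>] 0) (𝓝 c)) {φ : ℝ → ℝ}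
    {r : ℝ} {n : ℕ} (hφ : Tendsto (fun h => φ h / h ^ m) (𝓝[>] 0) (𝓝 0)) (h : Alt φ r n) :
    ∃ e : ℕ → ℝ, Alt (fun h => φ h + ∑ j ∈ Finset.range m, e j * ψ j h) r (n + m) := by
  induction m generalizing φ n with
  | zero => exact ⟨0, by simpa using h⟩
  | succ m ih =>
    obtain ⟨c, hc, hcψ⟩ := hψ m (Nat.lt_succ_self m)
    obtain ⟨η, hη⟩ := h.step hφ hcψ hc
    obtain ⟨e, he⟩ := ih (fun j hj => hψ j (hj.trans (Nat.lt_succ_self m)))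
      (φ := fun h => φ h + η * ψ m h) (n := n + 1) (by
        have h1 : Tendsto (fun h : ℝ => h * (φ h / h ^ (m + 1) + η * (ψ m h / h ^ (m + 1))))
            (𝓝[>] 0) (𝓝 (0 * (0 + η * c))) :=
          (tendsto_id.mono_left nhdsWithin_le_nhds).mul (hφ.add (hcψ.const_mul η))
        rw [zero_mul] at h1
        refine h1.congr' ?_
        filter_upwards [self_mem_nhdsWithin] with x hx
        have hx : 0 < x := hx
        field_simp
        ring) hη
    refine ⟨fun j => if j = m then η else e j, ?_⟩
    have e1 : (fun h => φ h + ∑ j ∈ Finset.range (m + 1), (if j = m then η else e j) * ψ j h) =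
        fun h => φ h + η * ψ m h + ∑ j ∈ Finset.range m, e j * ψ j h := by
      funext x
      rw [Finset.sum_range_succ, if_pos rfl, Finset.sum_congr rfl fun j hj => by
        rw [if_neg (Finset.mem_range.1 hj).ne]]
      ring
    rw [e1, show n + (m + 1) = n + 1 + m by ring]
    exact he

end

/-! ### Bases of Chebyshev systems -/

section

open scoped Polynomial

/-- `F` is the sum of a function of `U` and an odd term with the leading part
`κ x^(2m+1) + r x^(2m+3)`, for all parameters of the Hamiltonian. -/
def Expands (F : ℝ → ℝ[X]) (m : ℕ) (κ r : ℝ → ℝ) : Prop :=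
  ∃ P R : ℝ → ℝ → ℝ, (∀ b, ContDiff ℝ ∞ (P b)) ∧ ContDiff ℝ ∞ (fun z : ℝ × ℝ => R z.1 z.2) ∧
    (∀ b, R b 0 = r b) ∧
    ∀ b x, (F b).eval x = P b (potential b x) + x ^ (2 * m + 1) * (κ b + x ^ 2 * R b x)

/-- A primitive of order `3`, or `4` if `a = -8 / 3`. -/
def e4 : ℝ[X] := Polynomial.C 3 * Polynomial.X ^ 4 - Polynomial.C 8 * Polynomial.X ^ 5

/-- The sixth power, a primitive of order `3`. -/
def x6 : ℝ[X] := Polynomial.X ^ 6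

/-- A primitive of order `4`. -/
def e5 (b : ℝ) : ℝ[X] := Polynomial.C 9 * Polynomial.X ^ 4 - Polynomial.C 24 * Polynomial.X ^ 5 +
  Polynomial.C (16 + 6 * b) * Polynomial.X ^ 6

/-- A primitive of order `5`, or `6` if `a = -8 / 9`. -/
def e6 (b : ℝ) : ℝ[X] := Polynomial.C (1584 + 243 * b) * Polynomial.X ^ 4 -
  Polynomial.C (4224 + 648 * b) * Polynomial.X ^ 5 +
  Polynomial.C (2816 + 2016 * b + 162 * b ^ 2) * Polynomial.X ^ 6 -
  Polynomial.C (2112 * b) * Polynomial.X ^ 7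

/-- The powers of `U` in `P` are fitted to the even powers of `x` up to `x⁸`, and `12 U²` cancels
`x⁵` as well. The first surviving coefficient, that of `x⁷`, is zero exactly at `b = -8 / 3`. -/
lemma e4_expands : Expands (fun _ => e4) 3 (fun b => -64 / 3 - 8 * b)
    (fun b => 11264 / 81 + 896 / 9 * b + 8 * b ^ 2) := by
  refine ⟨fun b u =>
    (12) * u ^ 2 + (-128 / 3 - 24 * b) * u ^ 3 + (4096 / 9 + 384 * b + 60 * b ^ 2) * u ^ 4, fun b x =>
    (11264 / 81 + 896 / 9 * b + 8 * b ^ 2) +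
    (-8192 / 27 - 896 / 3 * b - 76 * b ^ 2 - 21 / 4 * b ^ 3) * x ^ 1 +
    (65536 / 243 + 4096 / 9 * b + 2000 / 9 * b ^ 2 + 27 * b ^ 3) * x ^ 2 +
    (-65536 / 729 - 10240 / 27 * b - 8384 / 27 * b ^ 2 - 226 / 3 * b ^ 3 -
      21 / 4 * b ^ 4) * x ^ 3 +
    (32768 / 243 * b + 2048 / 9 * b ^ 2 + 1024 / 9 * b ^ 3 + 15 * b ^ 4) * x ^ 4 +
    (-2048 / 27 * b ^ 2 - 704 / 9 * b ^ 3 - 22 * b ^ 4 - 15 / 8 * b ^ 5) * x ^ 5 +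
    (512 / 27 * b ^ 3 + 16 * b ^ 4 + 5 / 2 * b ^ 5) * x ^ 6 +
    (-16 / 9 * b ^ 4 - 3 / 2 * b ^ 5 - 15 / 64 * b ^ 6) * x ^ 7,
    fun b => by fun_prop, by fun_prop, fun b => by ring, fun b x => ?_⟩
  simp only [e4, Polynomial.eval_sub, Polynomial.eval_mul, Polynomial.eval_C,
    Polynomial.eval_pow, Polynomial.eval_X, potential]
  ring

/-- Subtracting `8 U³` leaves `4 x⁷ + …`. The coefficient of `x⁵` is identically zero, so the order
is `3`. -/
lemma x6_expands : Expands (fun _ => x6) 2 (fun b => 0 * b) (fun b => 4 + 0 * b) := by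
  refine ⟨fun b u =>
    (8) * u ^ 3, fun b x =>
    (4) + (-16 / 3 - 3 / 2 * b) * x ^ 1 + (64 / 27 + 4 * b) * x ^ 2 +
    (-8 / 3 * b - 3 / 4 * b ^ 2) * x ^ 3 + (1 * b ^ 2) * x ^ 4 + (-1 / 8 * b ^ 3) * x ^ 5,
    fun b => by fun_prop, by fun_prop, fun b => by ring, fun b x => ?_⟩
  simp only [x6, Polynomial.eval_pow, Polynomial.eval_X, potential]
  ring

/-- With the coefficient `16 + 6 b` of `x⁶`, the powers of `U` that remove the even terms also
remove `x⁵` and `x⁷`, for every `b`. What survives is `x⁹`, with a coefficient that vanishes only at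
`b = 0`. -/
lemma e5_expands : Expands e5 3 (fun b => 0 * b) (fun b => 704 / 9 * b) := by
  refine ⟨fun b u =>
    (36) * u ^ 2 + (-24 * b) * u ^ 3 + (256 * b + 36 * b ^ 2) * u ^ 4, fun b x =>
    (704 / 9 * b) + (-512 / 3 * b - 48 * b ^ 2 - 9 / 4 * b ^ 3) * x ^ 1 +
    (4096 / 27 * b + 448 / 3 * b ^ 2 + 15 * b ^ 3) * x ^ 2 +
    (-4096 / 81 * b - 1600 / 9 * b ^ 2 - 48 * b ^ 3 - 3 * b ^ 4) * x ^ 3 +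
    (2048 / 27 * b ^ 2 + 224 / 3 * b ^ 3 + 9 * b ^ 4) * x ^ 4 +
    (-128 / 3 * b ^ 3 - 14 * b ^ 4 - 9 / 8 * b ^ 5) * x ^ 5 +
    (32 / 3 * b ^ 4 + 3 / 2 * b ^ 5) * x ^ 6 + (-1 * b ^ 5 - 9 / 64 * b ^ 6) * x ^ 7,
    fun b => by fun_prop, by fun_prop, fun b => by ring, fun b x => ?_⟩
  simp only [e5, Polynomial.eval_add, Polynomial.eval_sub, Polynomial.eval_mul, Polynomial.eval_C,
    Polynomial.eval_pow, Polynomial.eval_X, potential]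
  ring

/-- The coefficients of `e6` are such that the powers of `U` cancel all terms below `x¹¹`. The
coefficient of `x¹¹` is `-2496 b² (b + 8 / 9)`. -/
lemma e6_expands : Expands e6 5 (fun b => -6656 / 3 * b ^ 2 - 2496 * b ^ 3)
    (fun b => 401408 / 9 * b ^ 2 + 57856 * b ^ 3 + 5376 * b ^ 4) := by
  refine ⟨fun b u =>
    (6336 + 972 * b) * u ^ 2 + (-648 * b ^ 2) * u ^ 3 + (576 * b ^ 2 + 972 * b ^ 3) * u ^ 4 +
    (-12288 * b ^ 2 - 16128 * b ^ 3 - 1944 * b ^ 4) * u ^ 5 +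
    (3866624 / 9 * b ^ 2 + 598016 * b ^ 3 + 104832 * b ^ 4 + 4536 * b ^ 5) * u ^ 6, fun b x =>
    (401408 / 9 * b ^ 2 + 57856 * b ^ 3 + 5376 * b ^ 4) +
    (-1556480 / 9 * b ^ 2 - 2259968 / 9 * b ^ 3 - 56448 * b ^ 4 - 4104 * b ^ 5 -
      729 / 8 * b ^ 6) * x ^ 1 +
    (76939264 / 243 * b ^ 2 + 15282176 / 27 * b ^ 3 + 745472 / 3 * b ^ 4 + 29664 * b ^ 5 +
      1701 / 2 * b ^ 6) * x ^ 2 +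
    (-77332480 / 243 * b ^ 2 - 21544960 / 27 * b ^ 3 - 5328640 / 9 * b ^ 4 - 118080 * b ^ 5 -
      33939 / 4 * b ^ 6 - 12393 / 64 * b ^ 7) * x ^ 3 +
    (123731968 / 729 * b ^ 2 + 6422528 / 9 * b ^ 3 + 7540736 / 9 * b ^ 4 + 902656 / 3 * b ^ 5 +
      35760 * b ^ 6 + 1215 * b ^ 7) * x ^ 4 +
    (-247463936 / 6561 * b ^ 2 - 270270464 / 729 * b ^ 3 - 58376192 / 81 * b ^ 4 -
      4209664 / 9 * b ^ 5 - 91000 * b ^ 6 - 13275 / 2 * b ^ 7 - 10125 / 64 * b ^ 8) * x ^ 5 +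
    (61865984 / 729 * b ^ 3 + 3211264 / 9 * b ^ 4 + 3780608 / 9 * b ^ 5 + 152416 * b ^ 6 +
      18690 * b ^ 7 + 10935 / 16 * b ^ 8) * x ^ 6 +
    (-19333120 / 243 * b ^ 4 - 1802240 / 9 * b ^ 5 - 450880 / 3 * b ^ 6 - 31428 * b ^ 7 -
      19719 / 8 * b ^ 8 - 4131 / 64 * b ^ 9) * x ^ 7 +
    (9666560 / 243 * b ^ 5 + 1948160 / 27 * b ^ 6 + 99200 / 3 * b ^ 7 + 4515 * b ^ 8 +
      2835 / 16 * b ^ 9) * x ^ 8 +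
    (-302080 / 27 * b ^ 6 - 16832 * b ^ 7 - 4482 * b ^ 8 - 1701 / 4 * b ^ 9 -
      1701 / 128 * b ^ 10) * x ^ 9 +
    (15104 / 9 * b ^ 7 + 2336 * b ^ 8 + 819 / 2 * b ^ 9 + 567 / 32 * b ^ 10) * x ^ 10 +
    (-944 / 9 * b ^ 8 - 146 * b ^ 9 - 819 / 32 * b ^ 10 - 567 / 512 * b ^ 11) * x ^ 11,
    fun b => by fun_prop, by fun_prop, fun b => by ring, fun b x => ?_⟩
  simp only [e6, Polynomial.eval_add, Polynomial.eval_sub, Polynomial.eval_mul, Polynomial.eval_C,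
    Polynomial.eval_pow, Polynomial.eval_X, potential]
  ring

end

/-! ### Spaces of Abelian integrals of bounded degree -/

section

open scoped Polynomial

variable {a : ℝ}

lemma Expands.hasOrder {F : ℝ → ℝ[X]} {m : ℕ} {κ r : ℝ → ℝ} (h : Expands F m κ r) (hκ : κ a ≠ 0) :
    HasOrder a (F a) m := by
  obtain ⟨P, R, hP, hR, -, hF⟩ := h
  have hRa : ContDiff ℝ ∞ (R a) := hR.comp (by fun_prop : ContDiff ℝ ∞ fun x : ℝ => (a, x))
  exact ⟨P a, fun x => κ a + x ^ 2 * R a x, hP a, by fun_prop, by simpa using hκ, hF a⟩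

lemma Expands.hasOrder_succ {F : ℝ → ℝ[X]} {m : ℕ} {κ r : ℝ → ℝ} (h : Expands F m κ r)
    (hκ : κ a = 0) (hr : r a ≠ 0) : HasOrder a (F a) (m + 1) := by
  obtain ⟨P, R, hP, hR, hR0, hF⟩ := h
  have hRa : ContDiff ℝ ∞ (R a) := hR.comp (by fun_prop : ContDiff ℝ ∞ fun x : ℝ => (a, x))
  refine ⟨P a, R a, hP a, hRa, by rwa [hR0], fun x => ?_⟩
  rw [hF, hκ]
  ring

lemma hasOrder_pow (a : ℝ) (j : ℕ) : HasOrder a (Polynomial.X ^ (2 * j + 1)) j :=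
  ⟨fun _ => 0, fun _ => 1, contDiff_const, contDiff_const, one_ne_zero, fun x => by simp⟩

/-- Near a parameter where the leading coefficient `κ` vanishes, the integral has a zero if the two
leading coefficients have opposite signs. -/
lemma Expands.exists_alt {F : ℝ → ℝ[X]} {m : ℕ} {κ r : ℝ → ℝ} (h : Expands F m κ r)
    (hκc : ContinuousAt κ a) (hκ : κ a = 0) (hr : r a ≠ 0) {ρ : ℝ} (hρ : 0 < ρ) :
    ∀ᶠ b in 𝓝 a, r a * κ b < 0 → Alt (mel b (F b).derivative) ρ 1 := by
  obtain ⟨P, R, hP, hR, hR0, hF⟩ := h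
  obtain ⟨A₁, hA₁, ⟨W₁, hW₁, hA₁0⟩, hm₁⟩ := exists_expansion (R := fun _ _ => 1)
    continuous_const a m
  obtain ⟨A₂, hA₂, ⟨W₂, hW₂, hA₂0⟩, hm₂⟩ := exists_expansion (R := R) hR.continuous a (m + 1)
  rw [hR0] at hA₂0
  rw [mul_one] at hA₁0
  obtain ⟨ρ₀, hρ₀, hl⟩ := exists_levels a
  have hexp : ∀ b, ∀ h ∈ levels b, mel b (F b).derivative h =
      h ^ (m + 1) * (κ b * A₁ (h, b) + h * A₂ (h, b)) := by
    intro b h hh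
    have h1 := hm₁ b h hh (Polynomial.X ^ (2 * m + 1)) (fun _ => 0) continuous_const
      (fun x => by simp)
    have h2 := hm₂ b h hh (F b - Polynomial.C (κ b) * Polynomial.X ^ (2 * m + 1)) (P b)
      (hP b).continuous (fun x => by
        simp only [Polynomial.eval_sub, Polynomial.eval_mul, Polynomial.eval_C,
          Polynomial.eval_pow, Polynomial.eval_X, hF]
        ring)
    have h3 : (F b).derivative = Polynomial.C (κ b) *
        (Polynomial.X ^ (2 * m + 1) : ℝ[X]).derivative +
        (F b - Polynomial.C (κ b) * Polynomial.X ^ (2 * m + 1)).derivative := by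
      rw [Polynomial.derivative_sub, Polynomial.derivative_C_mul]; ring
    rw [h3, mel_add _ _ hh, mel_C_mul _ _ hh, h1, h2]
    ring
  -- Multiplication by `r a` treats both signs of `r a` together.
  set σ := r a with hσ
  have hσ2 : 0 < σ ^ 2 := by positivity
  have e1 : ∀ᶠ z in 𝓝 ((0 : ℝ), a), W₁ / 2 < A₁ z :=
    hA₁.eventually (lt_mem_nhds (by rw [hA₁0]; linarith))
  have e2 : ∀ᶠ z in 𝓝 ((0 : ℝ), a), A₁ z < 2 * W₁ :=
    hA₁.eventually (gt_mem_nhds (by rw [hA₁0]; linarith))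
  have e3 : ∀ᶠ z in 𝓝 ((0 : ℝ), a), W₂ * σ ^ 2 / 2 < σ * A₂ z :=
    (hA₂.const_mul σ).eventually (lt_mem_nhds (by
      change _ < σ * A₂ (0, a)
      rw [hA₂0]; nlinarith [mul_pos hW₂ hσ2]))
  have e4 : ∀ᶠ z in 𝓝 ((0 : ℝ), a), σ * A₂ z < 2 * (W₂ * σ ^ 2) :=
    (hA₂.const_mul σ).eventually (gt_mem_nhds (by
      change σ * A₂ (0, a) < _
      rw [hA₂0]; nlinarith [mul_pos hW₂ hσ2]))
  have hall := (e1.and e2).and (e3.and e4)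
  rw [nhds_prod_eq, Filter.Eventually, Filter.mem_prod_iff] at hall
  obtain ⟨s, hs, t, ht, hst⟩ := hall
  obtain ⟨ρ₁, hρ₁, hs⟩ := Metric.mem_nhds_iff.1 hs
  have hin : ∀ b ∈ t, ∀ h, 0 < h → h < ρ₁ → (W₁ / 2 < A₁ (h, b) ∧ A₁ (h, b) < 2 * W₁) ∧
      W₂ * σ ^ 2 / 2 < σ * A₂ (h, b) ∧ σ * A₂ (h, b) < 2 * (W₂ * σ ^ 2) := fun b hb h h0 h1 =>
    hst (mk_mem_prod (hs (by rwa [mem_ball_zero_iff, Real.norm_of_nonneg h0.le])) hb)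
  -- An energy fixed before `b`: there the second term wins as soon as `κ b` is small enough.
  set x₂ := min ρ₁ (min ρ₀ ρ) / 2 with hx₂
  have hmin : 0 < min ρ₁ (min ρ₀ ρ) := lt_min hρ₁ (lt_min hρ₀ hρ)
  have hx₂0 : 0 < x₂ := by positivity
  have hx₂1 : x₂ < min ρ₁ (min ρ₀ ρ) := by linarith
  have hx₂ρ₁ : x₂ < ρ₁ := hx₂1.trans_le (min_le_left _ _)
  have hx₂ρ₀ : x₂ < ρ₀ := hx₂1.trans_le ((min_le_right _ _).trans (min_le_left _ _))
  have hx₂ρ : x₂ < ρ := hx₂1.trans_le ((min_le_right _ _).trans (min_le_right _ _))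
  have hκs : ∀ᶠ b in 𝓝 a, -(x₂ * (W₂ * σ ^ 2 / 2)) < σ * κ b * (2 * W₁) := by
    have : ContinuousAt (fun b => σ * κ b * (2 * W₁)) a :=
      (continuousAt_const.mul hκc).mul continuousAt_const
    refine this.eventually (lt_mem_nhds ?_)
    change _ < σ * κ a * _
    rw [hκ]
    have : 0 < x₂ * (W₂ * σ ^ 2 / 2) := by positivity
    linarith
  filter_upwards [ht, hl, hκs] with b hb hlb hκb hneg
  -- An energy so small compared with `κ b` that the leading term wins.
  set x₁ := min x₂ (-(σ * κ b) * W₁ / (4 * (W₂ * σ ^ 2))) / 2 with hx₁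
  have hq : 0 < -(σ * κ b) * W₁ / (4 * (W₂ * σ ^ 2)) := by
    have : 0 < -(σ * κ b) := by linarith
    positivity
  have hx₁0 : 0 < x₁ := by
    have := lt_min hx₂0 hq
    positivity
  have hx₁x₂ : x₁ < x₂ := by
    have := min_le_left x₂ (-(σ * κ b) * W₁ / (4 * (W₂ * σ ^ 2)))
    linarith
  have hx₁q : x₁ * (4 * (W₂ * σ ^ 2)) < -(σ * κ b) * W₁ := by
    rw [← lt_div_iff₀ (by positivity)]
    have := min_le_right x₂ (-(σ * κ b) * W₁ / (4 * (W₂ * σ ^ 2)))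
    linarith
  obtain ⟨⟨b1, b2⟩, b3, b4⟩ := hin b hb x₁ hx₁0 (hx₁x₂.trans hx₂ρ₁)
  obtain ⟨⟨c1, c2⟩, c3, c4⟩ := hin b hb x₂ hx₂0 hx₂ρ₁
  refine ⟨![x₁, x₂], -σ, ?_, ?_, ?_⟩
  · rw [Fin.strictMono_iff_lt_succ]
    intro i
    fin_cases i
    simpa using hx₁x₂
  · intro i
    fin_cases i
    · exact ⟨hx₁0, hx₁x₂.trans hx₂ρ⟩
    · exact ⟨hx₂0, hx₂ρ⟩
  · intro i
    fin_cases i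
    · change 0 < -σ * (-1) ^ 0 * mel b (F b).derivative x₁
      rw [hexp b x₁ (hlb ⟨hx₁0, hx₁x₂.trans hx₂ρ₀⟩)]
      have hp : 0 < x₁ ^ (m + 1) := by positivity
      have : 0 < -(σ * κ b * A₁ (x₁, b) + x₁ * (σ * A₂ (x₁, b))) := by
        nlinarith [mul_lt_mul_of_pos_left b1 (show 0 < -(σ * κ b) by linarith),
          mul_lt_mul_of_pos_left b4 hx₁0]
      calc 0 < x₁ ^ (m + 1) * -(σ * κ b * A₁ (x₁, b) + x₁ * (σ * A₂ (x₁, b))) := mul_pos hp this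
        _ = _ := by ring
    · change 0 < -σ * (-1) ^ 1 * mel b (F b).derivative x₂
      rw [hexp b x₂ (hlb ⟨hx₂0, hx₂ρ₀⟩)]
      have hp : 0 < x₂ ^ (m + 1) := by positivity
      have : 0 < σ * κ b * A₁ (x₂, b) + x₂ * (σ * A₂ (x₂, b)) := by
        nlinarith [mul_lt_mul_of_pos_left c2 (show 0 < -(σ * κ b) by linarith),
          mul_lt_mul_of_pos_left c3 hx₂0]
      calc 0 < x₂ ^ (m + 1) * (σ * κ b * A₁ (x₂, b) + x₂ * (σ * A₂ (x₂, b))) := mul_pos hp this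
        _ = _ := by ring

/-- The polynomial `U'`. -/
def dUp (a : ℝ) : ℝ[X] :=
  Polynomial.X - Polynomial.C 2 * Polynomial.X ^ 2 + Polynomial.C a * Polynomial.X ^ 3

lemma up_dUp (a : ℝ) : up (dUp a) = dU a := by
  simp only [up, dUp, dU, map_add, map_sub, map_mul, map_pow, Polynomial.aeval_X,
    Polynomial.aeval_C, MvPolynomial.algebraMap_eq]
  rw [map_ofNat MvPolynomial.C 2]

/-- On an oval `U' dx = -y dy`, so `U' y dx` is the differential of `-y³ / 3`. -/
lemma mel_dUp {h : ℝ} (hh : h ∈ levels a) : mel a (dUp a) h = 0 := by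
  have := Lam_bracket hh (MvPolynomial.C (-1 / 3) * MvPolynomial.X 1 ^ 3)
  rw [mel, up_dUp, ← this]
  congr 1
  apply MvPolynomial.funext
  intro v
  simp [dU, MvPolynomial.pderiv_X, Derivation.leibniz_pow]
  ring

/-- A polynomial of degree at most `d` that is not a multiple of `U'` gives a nontrivial element of
a Chebyshev system with `n` elements, uniformly for parameters near `a`. -/
def ChebDeg (a : ℝ) (d n : ℕ) : Prop :=
  ∃ ρ > 0, ∀ᶠ b in 𝓝 a, Ioo 0 ρ ⊆ levels b ∧
    ∀ p : ℝ[X], p.natDegree ≤ d → (∀ c, p ≠ Polynomial.C c * dUp b) →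
      ∃ F e, p = F.derivative + Polynomial.C e * dUp b ∧ Cheb b ρ n F

lemma ChebDeg.of_basis {d n : ℕ} {B : Fin n → ℝ → ℝ[X]}
    (hB : ∀ j, ContDiff ℝ ∞ fun z : ℝ × ℝ => (B j z.1).eval z.2) (ho : ∀ j, HasOrder a (B j a) j)
    (hd : ∀ᶠ b in 𝓝 a, ∀ p : ℝ[X], p.natDegree ≤ d → ∃ (c : Fin n → ℝ) (e : ℝ),
      p = (∑ j, Polynomial.C (c j) * B j b).derivative + Polynomial.C e * dUp b) :
    ChebDeg a d n := by
  obtain ⟨ρ, hρ, h⟩ := exists_cheb hB ho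
  refine ⟨ρ, hρ, ?_⟩
  filter_upwards [h, hd] with b hb hdb
  refine ⟨hb.1, fun p hp hne => ?_⟩
  obtain ⟨c, e, hce⟩ := hdb p hp
  refine ⟨_, e, hce, hb.2 c ?_⟩
  rintro rfl
  exact hne e (by simpa using hce)

/-- A polynomial of degree at most `d` is determined by its values. -/
lemma exists_eval_eq {d : ℕ} {p : ℝ[X]} (hp : p.natDegree ≤ d) :
    ∀ x, p.eval x = ∑ i ∈ Finset.range (d + 1), p.coeff i * x ^ i := fun x => by
  exact Polynomial.eval_eq_sum_range' (Nat.lt_succ_of_le hp) x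

/-- The basis for the degree `4`. -/
def basis4 : Fin 4 → ℝ → ℝ[X] := ![fun _ => Polynomial.X ^ (2 * 0 + 1),
  fun _ => Polynomial.X ^ (2 * 1 + 1), fun _ => Polynomial.X ^ (2 * 2 + 1), fun _ => e4]

/-- The basis for the degree `4` with the seventh power added. -/
def basis4' : Fin 5 → ℝ → ℝ[X] := ![fun _ => Polynomial.X ^ (2 * 0 + 1),
  fun _ => Polynomial.X ^ (2 * 1 + 1), fun _ => Polynomial.X ^ (2 * 2 + 1),
  fun _ => Polynomial.X ^ (2 * 3 + 1), fun _ => e4]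

/-- The basis for the degree `5`. -/
def basis5 : Fin 5 → ℝ → ℝ[X] := ![fun _ => Polynomial.X ^ (2 * 0 + 1),
  fun _ => Polynomial.X ^ (2 * 1 + 1), fun _ => Polynomial.X ^ (2 * 2 + 1), fun _ => x6, e5]

/-- The basis for the degree `6`. -/
def basis6 : Fin 6 → ℝ → ℝ[X] := ![fun _ => Polynomial.X ^ (2 * 0 + 1),
  fun _ => Polynomial.X ^ (2 * 1 + 1), fun _ => Polynomial.X ^ (2 * 2 + 1),
  fun _ => Polynomial.X ^ (2 * 3 + 1), e5, e6]

/-- The basis for the degree `6` with the eleventh power added. -/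
def basis6' : Fin 7 → ℝ → ℝ[X] := ![fun _ => Polynomial.X ^ (2 * 0 + 1),
  fun _ => Polynomial.X ^ (2 * 1 + 1), fun _ => Polynomial.X ^ (2 * 2 + 1),
  fun _ => Polynomial.X ^ (2 * 3 + 1), e5, fun _ => Polynomial.X ^ (2 * 5 + 1), e6]

lemma smooth_pow (n : ℕ) :
    ContDiff ℝ ∞ fun z : ℝ × ℝ => ((fun _ => Polynomial.X ^ n : ℝ → ℝ[X]) z.1).eval z.2 := by
  simp only [Polynomial.eval_pow, Polynomial.eval_X]
  fun_prop

lemma smooth_e4 : ContDiff ℝ ∞ fun z : ℝ × ℝ => ((fun _ => e4 : ℝ → ℝ[X]) z.1).eval z.2 := by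
  simp only [e4, Polynomial.eval_sub, Polynomial.eval_mul, Polynomial.eval_C,
    Polynomial.eval_pow, Polynomial.eval_X]
  fun_prop

lemma smooth_e5 : ContDiff ℝ ∞ fun z : ℝ × ℝ => (e5 z.1).eval z.2 := by
  simp only [e5, Polynomial.eval_add, Polynomial.eval_sub, Polynomial.eval_mul, Polynomial.eval_C,
    Polynomial.eval_pow, Polynomial.eval_X]
  fun_prop

lemma smooth_e6 : ContDiff ℝ ∞ fun z : ℝ × ℝ => (e6 z.1).eval z.2 := by
  simp only [e6, Polynomial.eval_add, Polynomial.eval_sub, Polynomial.eval_mul, Polynomial.eval_C,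
    Polynomial.eval_pow, Polynomial.eval_X]
  fun_prop

/-- Primitives of degree at most `5` modulo `U`: the multiple `2 f2` of `U` removes `x²`, and `e4`
carries `x⁴`. Its order is `3` because `a ≠ -8 / 3`. -/
lemma chebDeg_four (h : a ≠ -8 / 3) : ChebDeg a 4 4 := by
  refine ChebDeg.of_basis (B := basis4) ?_ ?_ (Eventually.of_forall fun b p hp => ?_)
  · intro j
    fin_cases j
    exacts [smooth_pow _, smooth_pow _, smooth_pow _, smooth_e4]
  · intro j
    fin_cases j
    exacts [hasOrder_pow a 0, hasOrder_pow a 1, hasOrder_pow a 2,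
      e4_expands.hasOrder (by intro h'; exact h (by linarith))]
  · have he := exists_eval_eq hp
    set f2 := p.coeff 1 / 2 with hf2
    set c3 := (p.coeff 3 / 4 - b / 2 * f2) / 3 with hc3
    refine ⟨![p.coeff 0, p.coeff 2 / 3 + 4 / 3 * f2, p.coeff 4 / 5 + 8 * c3, c3], 2 * f2, ?_⟩
    refine Polynomial.funext fun x => ?_
    rw [he]
    simp [Fin.sum_univ_succ, Finset.sum_range_succ, basis4, e4, dUp, Polynomial.derivative_mul]
    rw [hc3, hf2]
    ring

/-- At this parameter `e4` moves up to order `4`. The power `x⁷` fills the vacant order `3`; it is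
not needed to represent `p` and gets the coefficient `0`. -/
lemma chebDeg_four' (h : a = -8 / 3) : ChebDeg a 4 5 := by
  refine ChebDeg.of_basis (B := basis4') ?_ ?_ (Eventually.of_forall fun b p hp => ?_)
  · intro j
    fin_cases j
    exacts [smooth_pow _, smooth_pow _, smooth_pow _, smooth_pow _, smooth_e4]
  · intro j
    fin_cases j
    exacts [hasOrder_pow a 0, hasOrder_pow a 1, hasOrder_pow a 2, hasOrder_pow a 3,
      e4_expands.hasOrder_succ (by rw [h]; norm_num) (by rw [h]; norm_num)]
  · have he := exists_eval_eq hp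
    set f2 := p.coeff 1 / 2 with hf2
    set c3 := (p.coeff 3 / 4 - b / 2 * f2) / 3 with hc3
    refine ⟨![p.coeff 0, p.coeff 2 / 3 + 4 / 3 * f2, p.coeff 4 / 5 + 8 * c3, 0, c3], 2 * f2, ?_⟩
    refine Polynomial.funext fun x => ?_
    rw [he]
    simp [Fin.sum_univ_succ, Finset.sum_range_succ, basis4', e4, dUp, Polynomial.derivative_mul]
    rw [hc3, hf2]
    ring

lemma hasOrder_x6 (a : ℝ) : HasOrder a x6 3 :=
  x6_expands.hasOrder_succ (by norm_num) (by norm_num)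

lemma hasOrder_e5 (ha : a ≠ 0) : HasOrder a (e5 a) 4 :=
  e5_expands.hasOrder_succ (by norm_num) (by simpa using ha)

/-- After the multiple of `U` has removed `x²`, the elements `x6` and `e5`, of orders `3` and `4`,
carry the remaining even powers `x⁴` and `x⁶`. -/
lemma chebDeg_five (h : a ≠ 0) : ChebDeg a 5 5 := by
  refine ChebDeg.of_basis (B := basis5) ?_ ?_ (Eventually.of_forall fun b p hp => ?_)
  · intro j
    fin_cases j
    exacts [smooth_pow _, smooth_pow _, smooth_pow _, smooth_pow 6, smooth_e5]
  · intro j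
    fin_cases j
    exacts [hasOrder_pow a 0, hasOrder_pow a 1, hasOrder_pow a 2, hasOrder_x6 a, hasOrder_e5 h]
  · have he := exists_eval_eq hp
    set f2 := p.coeff 1 / 2 with hf2
    set c4 := (p.coeff 3 / 4 - b / 2 * f2) / 9 with hc4
    refine ⟨![p.coeff 0, p.coeff 2 / 3 + 4 / 3 * f2, p.coeff 4 / 5 + 24 * c4,
      p.coeff 5 / 6 - (16 + 6 * b) * c4, c4], 2 * f2, ?_⟩
    refine Polynomial.funext fun x => ?_
    rw [he]
    simp [Fin.sum_univ_succ, Finset.sum_range_succ, basis5, x6, e5, dUp,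
      Polynomial.derivative_mul]
    rw [hc4, hf2]
    ring

lemma e6_kappa_ne_zero (h0 : a ≠ 0) (h : a ≠ -8 / 9) : -6656 / 3 * a ^ 2 - 2496 * a ^ 3 ≠ 0 := by
  have e : -6656 / 3 * a ^ 2 - 2496 * a ^ 3 = -2496 * a ^ 2 * (a - -8 / 9) := by ring
  rw [e]
  exact mul_ne_zero (mul_ne_zero (by norm_num) (pow_ne_zero _ h0)) (sub_ne_zero.2 h)

lemma chebDeg_six (h0 : a ≠ 0) (h : a ≠ -8 / 9) : ChebDeg a 6 6 := by
  refine ChebDeg.of_basis (B := basis6) ?_ ?_ ?_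
  · intro j
    fin_cases j
    exacts [smooth_pow _, smooth_pow _, smooth_pow _, smooth_pow _, smooth_e5, smooth_e6]
  · intro j
    fin_cases j
    exacts [hasOrder_pow a 0, hasOrder_pow a 1, hasOrder_pow a 2, hasOrder_pow a 3,
      hasOrder_e5 h0, e6_expands.hasOrder (e6_kappa_ne_zero h0 h)]
  · filter_upwards [isOpen_ne.mem_nhds h0] with b hb p hp
    have hb : b ≠ 0 := hb
    have he := exists_eval_eq hp
    set f2 := p.coeff 1 / 2 with hf2
    set f4 := p.coeff 3 / 4 - b / 2 * f2 with hf4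
    -- Cramer's rule for the coefficients of `x⁴` and `x⁶` in `e5` and `e6`; the determinant is
    -- `4752 b`.
    set c5 := (9 * (p.coeff 5 / 6) - (16 + 6 * b) * f4) / (4752 * b) with hc5
    set c4 := (f4 - (1584 + 243 * b) * c5) / 9 with hc4
    refine ⟨![p.coeff 0, p.coeff 2 / 3 + 4 / 3 * f2, p.coeff 4 / 5 + 24 * c4 +
      (4224 + 648 * b) * c5, p.coeff 6 / 7 + 2112 * b * c5, c4, c5], 2 * f2, ?_⟩
    refine Polynomial.funext fun x => ?_
    rw [he]
    have h5 : c5 * (4752 * b) = 9 * (p.coeff 5 / 6) - (16 + 6 * b) * f4 := by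
      rw [hc5]; field_simp
    have h6 : p.coeff 5 = (16 + 6 * b) * c4 * 6 + (2816 + 2016 * b + 162 * b ^ 2) * c5 * 6 := by
      rw [hc4]; linear_combination -(2 / 3) * h5
    simp [Fin.sum_univ_succ, Finset.sum_range_succ, basis6, e5, e6, dUp,
      Polynomial.derivative_mul, Polynomial.derivative_pow]
    rw [h6, hc4, hf4, hf2]
    ring

/-- Here `e6` moves up to order `6`, and `x¹¹` fills the order `5`, again with the coefficient `0`
in the representation of `p`. -/
lemma chebDeg_six' (h : a = -8 / 9) : ChebDeg a 6 7 := by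
  have h0 : a ≠ 0 := by rw [h]; norm_num
  refine ChebDeg.of_basis (B := basis6') ?_ ?_ ?_
  · intro j
    fin_cases j
    exacts [smooth_pow _, smooth_pow _, smooth_pow _, smooth_pow _, smooth_e5, smooth_pow _,
      smooth_e6]
  · intro j
    fin_cases j
    exacts [hasOrder_pow a 0, hasOrder_pow a 1, hasOrder_pow a 2, hasOrder_pow a 3,
      hasOrder_e5 h0, hasOrder_pow a 5,
      e6_expands.hasOrder_succ (by rw [h]; norm_num) (by rw [h]; norm_num)]
  · filter_upwards [isOpen_ne.mem_nhds h0] with b hb p hp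
    have hb : b ≠ 0 := hb
    have he := exists_eval_eq hp
    set f2 := p.coeff 1 / 2 with hf2
    set f4 := p.coeff 3 / 4 - b / 2 * f2 with hf4
    set c5 := (9 * (p.coeff 5 / 6) - (16 + 6 * b) * f4) / (4752 * b) with hc5
    set c4 := (f4 - (1584 + 243 * b) * c5) / 9 with hc4
    refine ⟨![p.coeff 0, p.coeff 2 / 3 + 4 / 3 * f2, p.coeff 4 / 5 + 24 * c4 +
      (4224 + 648 * b) * c5, p.coeff 6 / 7 + 2112 * b * c5, c4, 0, c5], 2 * f2, ?_⟩
    refine Polynomial.funext fun x => ?_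
    rw [he]
    have h5 : c5 * (4752 * b) = 9 * (p.coeff 5 / 6) - (16 + 6 * b) * f4 := by
      rw [hc5]; field_simp
    have h6 : p.coeff 5 = (16 + 6 * b) * c4 * 6 + (2816 + 2016 * b + 162 * b ^ 2) * c5 * 6 := by
      rw [hc4]; linear_combination -(2 / 3) * h5
    simp [Fin.sum_univ_succ, Finset.sum_range_succ, basis6', e5, e6, dUp,
      Polynomial.derivative_mul, Polynomial.derivative_pow]
    rw [h6, hc4, hf4, hf2]
    ring

/-- The integrals of degree at most `6` are independent modulo `U'`. -/
lemma eq_of_mel_eq_zero (h0 : a ≠ 0) {p : ℝ[X]} (hp : p.natDegree ≤ 6)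
    (h : ∀ h ∈ levels a, mel a p h = 0) : ∃ c, p = Polynomial.C c * dUp a := by
  by_contra hcon
  push Not at hcon
  -- A polynomial that is no multiple of `U'` gives a nontrivial element of a Chebyshev system,
  -- which cannot vanish identically near the equilibrium. The size of the system does not matter,
  -- so the exceptional parameter `-8 / 9` is covered as well.
  have key : ∀ n, ChebDeg a 6 (n + 1) → False := by
    rintro n ⟨ρ, hρ, hc⟩
    obtain ⟨hl, hc⟩ := hc.self_of_nhds
    obtain ⟨F, e, hF, hch⟩ := hc p hp hcon
    obtain ⟨x, hx, hne⟩ := hch.exists_ne_zero hρ hl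
    refine hne ?_
    have := h x hx
    rwa [hF, mel_add _ _ hx, mel_C_mul _ _ hx, mel_dUp hx, mul_zero, add_zero] at this
  by_cases h9 : a = -8 / 9
  · exact key 6 (chebDeg_six' h9)
  · exact key 5 (chebDeg_six h0 h9)

lemma HasOrder.alt {G : ℝ[X]} {m : ℕ} (hG : HasOrder a G m) {r : ℝ} (hr : 0 < r) :
    Alt (mel a G.derivative) r 0 := by
  obtain ⟨c, hc, ht⟩ := hG.tendsto
  obtain ⟨x, hx, hxr⟩ := ((ht.eventually_ne hc).and (Ioo_mem_nhdsGT hr)).exists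
  have hne : mel a G.derivative x ≠ 0 := by
    intro h0
    rw [h0, zero_div] at hx
    exact hx rfl
  refine ⟨fun _ => x, mel a G.derivative x, fun i j h => absurd h (by omega), fun _ => hxr,
    fun i => ?_⟩
  have hi : (i : ℕ) = 0 := by omega
  simpa [hi] using mul_self_pos.2 hne

/-- Adding small multiples of functions of lower orders creates zeros. -/
lemma exists_alt_add {B : ℕ → ℝ[X]} {G : ℝ[X]} {m n d : ℕ} {r : ℝ}
    (hB : ∀ j < m, HasOrder a (B j) j) (hBd : ∀ j < m, (B j).natDegree ≤ d + 1)
    (hG : HasOrder a G m) (hGd : G.natDegree ≤ d + 1)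
    (hl : Ioo 0 r ⊆ levels a) (hA : Alt (mel a G.derivative) r n) :
    ∃ F : ℝ[X], F.derivative.natDegree ≤ d ∧ Alt (mel a F.derivative) r (n + m) := by
  have hφ : Tendsto (fun h => mel a G.derivative h / h ^ m) (𝓝[>] 0) (𝓝 0) := by
    obtain ⟨c, -, ht⟩ := hG.tendsto
    have h1 := (tendsto_id.mono_left nhdsWithin_le_nhds : Tendsto (fun h : ℝ => h) (𝓝[>] 0)
      (𝓝 0)).mul ht
    rw [zero_mul] at h1
    refine h1.congr' ?_
    filter_upwards [self_mem_nhdsWithin] with x hx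
    have hx : 0 < x := hx
    field_simp
    simp only [id]
    ring
  obtain ⟨e, t, σ, h1, h2, h3⟩ := exists_alt_sum (ψ := fun j => mel a (B j).derivative)
    (fun j hj => (hB j hj).tendsto) hφ hA
  refine ⟨G + ∑ j ∈ Finset.range m, Polynomial.C (e j) * B j, ?_, t, σ, h1,
    h2, fun i => ?_⟩
  · refine (Polynomial.natDegree_derivative_le _).trans ?_
    rw [Nat.sub_le_iff_le_add]
    refine (Polynomial.natDegree_add_le _ _).trans (max_le hGd ?_)
    exact Polynomial.natDegree_sum_le_of_forall_le _ _ fun j hj =>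
      (Polynomial.natDegree_C_mul_le _ _).trans (hBd j (Finset.mem_range.1 hj))
  · have hti : t i ∈ levels a := hl (h2 i)
    have e1 : mel a (G + ∑ j ∈ Finset.range m, Polynomial.C (e j) * B j).derivative (t i) =
        mel a G.derivative (t i) + ∑ j ∈ Finset.range m, e j * mel a (B j).derivative (t i) := by
      rw [Polynomial.derivative_add, Polynomial.derivative_sum, mel_add _ _ hti]
      simp only [Polynomial.derivative_C_mul]
      rw [mel_sum _ _ _ hti]
    rw [e1]
    exact h3 i

lemma natDegree_e4 : e4.natDegree ≤ 5 := by
  unfold e4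
  compute_degree

lemma natDegree_e5 (b : ℝ) : (e5 b).natDegree ≤ 6 := by
  unfold e5
  compute_degree

lemma natDegree_e6 (b : ℝ) : (e6 b).natDegree ≤ 7 := by
  unfold e6
  compute_degree

lemma exists_alt_four (h : a ≠ -8 / 3) {n : ℕ} {r : ℝ} (hl : Ioo 0 r ⊆ levels a)
    (hA : Alt (mel a e4.derivative) r n) :
    ∃ F : ℝ[X], F.derivative.natDegree ≤ 4 ∧ Alt (mel a F.derivative) r (n + 3) :=
  exists_alt_add (B := fun j => Polynomial.X ^ (2 * j + 1)) (fun j _ => hasOrder_pow a j)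
    (fun j hj => by rw [Polynomial.natDegree_X_pow]; omega)
    (e4_expands.hasOrder (by intro h'; exact h (by linarith))) natDegree_e4 hl hA

lemma exists_alt_five (h : a ≠ 0) {r : ℝ} (hr : 0 < r) (hl : Ioo 0 r ⊆ levels a) :
    ∃ F : ℝ[X], F.derivative.natDegree ≤ 5 ∧ Alt (mel a F.derivative) r 4 := by
  have := exists_alt_add (a := a) (B := fun j => if j = 3 then x6 else Polynomial.X ^ (2 * j + 1))
    (m := 4) (d := 5) (n := 0) (fun j _ => ?_) (fun j hj => ?_)
    (hasOrder_e5 h) (natDegree_e5 a) hl ((hasOrder_e5 h).alt hr)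
  · simpa using this
  · split_ifs with hj
    · rw [hj]; exact hasOrder_x6 a
    · exact hasOrder_pow a j
  · split_ifs with hj
    · simp [x6]
    · rw [Polynomial.natDegree_X_pow]; omega

lemma exists_alt_six (h0 : a ≠ 0) (h : a ≠ -8 / 9) {n : ℕ}
    {r : ℝ} (hl : Ioo 0 r ⊆ levels a) (hA : Alt (mel a (e6 a).derivative) r n) :
    ∃ F : ℝ[X], F.derivative.natDegree ≤ 6 ∧ Alt (mel a F.derivative) r (n + 5) := by
  refine exists_alt_add (a := a) (B := fun j => if j = 4 then e5 a else Polynomial.X ^ (2 * j + 1))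
    (m := 5) (d := 6) (fun j _ => ?_) (fun j hj => ?_)
    (e6_expands.hasOrder (e6_kappa_ne_zero h0 h)) (natDegree_e6 a) hl hA
  · split_ifs with hj
    · rw [hj]; exact hasOrder_e5 h0
    · exact hasOrder_pow a j
  · split_ifs with hj
    · exact (natDegree_e5 a).trans (by norm_num)
    · rw [Polynomial.natDegree_X_pow]; omega

end

/-! ### Normal form and Françoise chains of cubic perturbations -/

section

open scoped Polynomial

variable {a : ℝ}

lemma eval_up' (v : Fin 2 → ℝ) (p : ℝ[X]) : MvPolynomial.eval v (up p) = p.eval (v 0) := by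
  have : v = ![v 0, v 1] := by ext i; fin_cases i <;> rfl
  rw [this, eval_up]
  rfl

lemma pderiv_zero_up (p : ℝ[X]) : MvPolynomial.pderiv 0 (up p) = up p.derivative := by
  unfold up
  induction p using Polynomial.induction_on' with
  | add p q hp hq => simp [hp, hq]
  | monomial n c =>
    simp [Polynomial.aeval_monomial, Polynomial.derivative_monomial, Derivation.leibniz_pow,
      MvPolynomial.algebraMap_eq]
    ring

lemma pderiv_one_up (p : ℝ[X]) : MvPolynomial.pderiv 1 (up p) = 0 := by
  unfold up
  induction p using Polynomial.induction_on' with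
  | add p q hp hq => simp [hp, hq]
  | monomial n c =>
    simp [Polynomial.aeval_monomial, Derivation.leibniz_pow, MvPolynomial.algebraMap_eq,
      MvPolynomial.pderiv_X]

lemma exists_derivative_eq (p : ℝ[X]) :
    ∃ P : ℝ[X], P.derivative = p ∧ P.eval 0 = 0 ∧ P.natDegree ≤ p.natDegree + 1 := by
  refine ⟨∑ i ∈ Finset.range (p.natDegree + 1),
    Polynomial.C (p.coeff i / (i + 1)) * Polynomial.X ^ (i + 1), ?_, ?_, ?_⟩
  · conv_rhs => rw [p.as_sum_range_C_mul_X_pow]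
    rw [Polynomial.derivative_sum]
    refine Finset.sum_congr rfl fun i _ => ?_
    rw [Polynomial.derivative_C_mul_X_pow]
    congr 2
    push_cast
    field_simp
  · rw [Polynomial.eval_finsetSum]
    exact Finset.sum_eq_zero fun i _ => by simp
  · exact Polynomial.natDegree_sum_le_of_forall_le _ _ fun i hi =>
      (Polynomial.natDegree_C_mul_X_pow_le _ _).trans (by simpa using Finset.mem_range.1 hi)

/-- `M_{k+1}` is the Abelian integral of `p`. -/
def Gen (a : ℝ) (f g : MvPolynomial (Fin 2) ℝ) (k : ℕ) (p : ℝ[X]) : Prop :=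
  ∃ q Q, Chain a f g k q Q ∧ ∀ h ∈ levels a, Lam a h (q k * omg a f g) = mel a p h

lemma Gen.isCoeff {f g : MvPolynomial (Fin 2) ℝ} {k : ℕ} {p : ℝ[X]} (h : Gen a f g k p) :
    IsCoeff a f g (k + 1) fun h => mel a p h := by
  obtain ⟨q, Q, c, hc⟩ := h
  convert! c.isCoeff using 1
  funext h
  exact (hc h h.2).symm

lemma Gen.isMel {f g : MvPolynomial (Fin 2) ℝ} {k : ℕ} {p F : ℝ[X]} (h : Gen a f g k p)
    (hF : ∀ h ∈ levels a, mel a p h = mel a F.derivative h) : IsMel a f g (k + 1) F := by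
  obtain ⟨q, Q, c, hc⟩ := h
  exact c.isMel fun h hh => (hc h hh).trans (hF h hh)

/-- Only the even part of the integrand matters, modulo derivatives along the field. -/
lemma Lam_eq_mel {J P : MvPolynomial (Fin 2) ℝ} {p : ℝ[X]} {h : ℝ} (hh : h ∈ levels a)
    (H : ∀ x y, MvPolynomial.eval ![x, y] (J - (MvPolynomial.pderiv 0 P * MvPolynomial.X 1 -
        MvPolynomial.pderiv 1 P * up (dUp a))) +
      MvPolynomial.eval ![x, -y] (J - (MvPolynomial.pderiv 0 P * MvPolynomial.X 1 -
        MvPolynomial.pderiv 1 P * up (dUp a))) = 2 * (p.eval x * y ^ 2)) :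
    Lam a h J = mel a p h := by
  rw [up_dUp] at H
  set K := MvPolynomial.pderiv 0 P * MvPolynomial.X 1 - MvPolynomial.pderiv 1 P * dU a with hK
  have e : J = K + (up p * MvPolynomial.X 1 ^ 2 +
      (J - K - up p * MvPolynomial.X 1 ^ 2)) := by ring
  rw [e, Lam_add hh, Lam_add hh, hK, Lam_bracket hh, ← hK, Lam_odd (p := _ - _), zero_add, add_zero,
    mel]
  intro x y
  have := H x y
  rw [map_sub (MvPolynomial.eval ![x, -y]) (J - K), map_sub (MvPolynomial.eval ![x, y]) (J - K)]
  simp only [map_mul, eval_up', map_pow, MvPolynomial.eval_X, Matrix.cons_val_zero,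
    Matrix.cons_val_one]
  linear_combination this

/-- The coefficients of the normal form of a cubic perturbation. -/
structure NF where
  E0 : ℝ[X]
  B : ℝ[X]
  E1 : ℝ[X]
  B3 : ℝ[X]
  e8 : ℝ
  q : ℝ[X]
  A : ℝ[X]
  A3 : ℝ

namespace NF

/-- The first component of the perturbation. -/
def f (d : NF) : MvPolynomial (Fin 2) ℝ :=
  -(up d.B + MvPolynomial.C 2 * (up d.E1 * MvPolynomial.X 1) +
    MvPolynomial.C 3 * (up d.B3 * MvPolynomial.X 1 ^ 2) +
    MvPolynomial.C (4 * d.e8) * MvPolynomial.X 1 ^ 3) - up d.q * MvPolynomial.X 1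

/-- The second component of the perturbation. -/
def g (d : NF) : MvPolynomial (Fin 2) ℝ :=
  up d.E0.derivative + up d.B.derivative * MvPolynomial.X 1 +
    up d.E1.derivative * MvPolynomial.X 1 ^ 2 + up d.B3.derivative * MvPolynomial.X 1 ^ 3 +
    up d.A * MvPolynomial.X 1 + MvPolynomial.C (d.A3 / 3) * MvPolynomial.X 1 ^ 3

/-- The Hamiltonian part of the perturbation. -/
def Q (d : NF) : MvPolynomial (Fin 2) ℝ :=
  up d.E0 + up d.B * MvPolynomial.X 1 + up d.E1 * MvPolynomial.X 1 ^ 2 +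
    up d.B3 * MvPolynomial.X 1 ^ 3 + MvPolynomial.C d.e8 * MvPolynomial.X 1 ^ 4

/-- The normal forms of the cubic perturbations. -/
structure IsCubic (d : NF) : Prop where
  E0 : d.E0.natDegree ≤ 4
  B : d.B.natDegree ≤ 3
  E1 : d.E1.natDegree ≤ 2
  B3 : d.B3.natDegree ≤ 1
  q : d.q.natDegree ≤ 2
  q_zero : d.q.eval 0 = 0
  A : d.A.natDegree ≤ 2

variable {d : NF}

lemma totalDegree_up_mul {p : ℝ[X]} {m n : ℕ} (h : p.natDegree + n ≤ m) :
    (up p * MvPolynomial.X 1 ^ n).totalDegree ≤ m := by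
  refine (MvPolynomial.totalDegree_mul _ _).trans ?_
  refine (Nat.add_le_add ?_ (MvPolynomial.totalDegree_X_pow _ _).le).trans h
  rw [up, Polynomial.aeval_eq_sum_range]
  refine MvPolynomial.totalDegree_finsetSum_le fun i hi => ?_
  refine (MvPolynomial.totalDegree_smul_le _ _).trans ?_
  rw [MvPolynomial.totalDegree_X_pow]
  exact Nat.lt_succ_iff.1 (Finset.mem_range.1 hi)

lemma IsCubic.totalDegree_f (h : d.IsCubic) : d.f.totalDegree ≤ 3 := by
  have e : d.f = up (-d.B) * MvPolynomial.X 1 ^ 0 +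
      up (-(Polynomial.C 2 * d.E1 + d.q)) * MvPolynomial.X 1 ^ 1 +
      up (-(Polynomial.C 3 * d.B3)) * MvPolynomial.X 1 ^ 2 +
      up (Polynomial.C (-(4 * d.e8))) * MvPolynomial.X 1 ^ 3 := by
    apply MvPolynomial.funext
    intro v
    simp [f, eval_up']
    ring
  rw [e]
  have := h.B
  have := h.B3
  refine (MvPolynomial.totalDegree_add _ _).trans (max_le ((MvPolynomial.totalDegree_add _ _).trans
    (max_le ((MvPolynomial.totalDegree_add _ _).trans (max_le ?_ ?_)) ?_)) ?_) <;>
    refine totalDegree_up_mul ?_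
  · simpa using h.B
  · rw [Polynomial.natDegree_neg]
    have := Polynomial.natDegree_add_le_of_degree_le
      ((Polynomial.natDegree_C_mul_le (2 : ℝ) d.E1).trans h.E1) h.q
    omega
  · rw [Polynomial.natDegree_neg]
    have := (Polynomial.natDegree_C_mul_le (3 : ℝ) d.B3).trans h.B3
    omega
  · rw [Polynomial.natDegree_C]

lemma natDegree_derivative_le_of {p : ℝ[X]} {n : ℕ} (h : p.natDegree ≤ n + 1) :
    p.derivative.natDegree ≤ n :=
  (Polynomial.natDegree_derivative_le p).trans (by omega)

lemma IsCubic.totalDegree_g (h : d.IsCubic) : d.g.totalDegree ≤ 3 := by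
  have e : d.g = up d.E0.derivative * MvPolynomial.X 1 ^ 0 +
      up (d.B.derivative + d.A) * MvPolynomial.X 1 ^ 1 +
      up d.E1.derivative * MvPolynomial.X 1 ^ 2 +
      up (d.B3.derivative + Polynomial.C (d.A3 / 3)) * MvPolynomial.X 1 ^ 3 := by
    apply MvPolynomial.funext
    intro v
    simp [g, eval_up']
    ring
  rw [e]
  refine (MvPolynomial.totalDegree_add _ _).trans (max_le ((MvPolynomial.totalDegree_add _ _).trans
    (max_le ((MvPolynomial.totalDegree_add _ _).trans (max_le ?_ ?_)) ?_)) ?_) <;>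
    refine totalDegree_up_mul ?_
  · exact natDegree_derivative_le_of h.E0
  · have := Polynomial.natDegree_add_le_of_degree_le (natDegree_derivative_le_of h.B) h.A
    omega
  · have := natDegree_derivative_le_of h.E1
    omega
  · have := Polynomial.natDegree_add_le_of_degree_le (natDegree_derivative_le_of h.B3)
      (Polynomial.natDegree_C (d.A3 / 3)).le
    omega

end NF

lemma exists_up_of_totalDegree {f : MvPolynomial (Fin 2) ℝ} (hf : f.totalDegree ≤ 3) :
    ∃ F : ℕ → ℝ[X], (∀ i ≤ 3, (F i).natDegree + i ≤ 3) ∧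
      f = ∑ i ∈ Finset.range 4, up (F i) * MvPolynomial.X 1 ^ i := by
  suffices H : ∀ s : Finset (Fin 2 →₀ ℕ), s ⊆ f.support → ∃ F : ℕ → ℝ[X],
      (∀ i ≤ 3, (F i).natDegree + i ≤ 3) ∧
      ∑ m ∈ s, MvPolynomial.monomial m (f.coeff m) =
        ∑ i ∈ Finset.range 4, up (F i) * MvPolynomial.X 1 ^ i by
    obtain ⟨F, h1, h2⟩ := H _ subset_rfl
    exact ⟨F, h1, by rw [← h2]; exact f.as_sum⟩
  intro s
  induction s using Finset.induction_on with
  | empty => exact fun _ => ⟨fun _ => 0, fun i hi => by simpa using hi, by simp [up]⟩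
  | insert m s hm ih =>
    intro hs
    obtain ⟨F, h1, h2⟩ := ih fun x hx => hs (Finset.mem_insert_of_mem hx)
    have hdeg : m 0 + m 1 ≤ 3 := by
      have := (MvPolynomial.le_totalDegree (hs (Finset.mem_insert_self m s))).trans hf
      rwa [Finsupp.sum_fintype _ _ (fun _ => rfl), Fin.sum_univ_two] at this
    refine ⟨fun i => F i + if i = m 1 then Polynomial.C (f.coeff m) * Polynomial.X ^ m 0 else 0,
      fun i hi => ?_, ?_⟩
    · have := h1 i hi
      have h3 : (F i + if i = m 1 then Polynomial.C (f.coeff m) * Polynomial.X ^ m 0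
          else 0).natDegree ≤ 3 - i := by
        refine Polynomial.natDegree_add_le_of_degree_le (by omega) ?_
        split_ifs with hi'
        · exact (Polynomial.natDegree_C_mul_X_pow_le _ _).trans (by omega)
        · simp
      simp only
      omega
    · rw [Finset.sum_insert hm, h2, add_comm]
      simp only [up_add, add_mul, Finset.sum_add_distrib]
      congr 1
      rw [Finset.sum_eq_single (m 1)]
      · simp only [if_true, up_mul, up_C]
        rw [MvPolynomial.monomial_eq, Finsupp.prod_fintype _ _ (fun _ => pow_zero _),
          Fin.prod_univ_two]
        simp [up, mul_assoc]
      · intro i _ hi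
        simp [hi, up]
      · intro hi
        exact absurd (Finset.mem_range.2 (by omega)) hi

/-- Every cubic perturbation has a normal form. -/
lemma exists_NF {f g : MvPolynomial (Fin 2) ℝ} (hf : f.totalDegree ≤ 3) (hg : g.totalDegree ≤ 3) :
    ∃ d : NF, d.IsCubic ∧ d.f = f ∧ d.g = g := by
  obtain ⟨F, hF, rfl⟩ := exists_up_of_totalDegree hf
  obtain ⟨G, hG, rfl⟩ := exists_up_of_totalDegree hg
  obtain ⟨E0, hE0, -, hE0d⟩ := exists_derivative_eq (G 0)
  obtain ⟨E1, hE1, hE1z, hE1d⟩ := exists_derivative_eq (G 2)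
  have F0 := hF 0 (by norm_num)
  have F1 := hF 1 (by norm_num)
  have F2 := hF 2 (by norm_num)
  have F3 := hF 3 (by norm_num)
  have G0 := hG 0 (by norm_num)
  have G1 := hG 1 (by norm_num)
  have G2 := hG 2 (by norm_num)
  have G3 := hG 3 (by norm_num)
  obtain ⟨c, hc⟩ := Polynomial.natDegree_eq_zero.1 (show (F 3).natDegree = 0 by omega)
  obtain ⟨c', hc'⟩ := Polynomial.natDegree_eq_zero.1 (show (G 3).natDegree = 0 by omega)
  obtain ⟨c'', hc''⟩ := Polynomial.natDegree_eq_zero.1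
    (show (F 2).derivative.natDegree = 0 by
      have := NF.natDegree_derivative_le_of (n := 0) (p := F 2) (by omega)
      omega)
  -- The Hamiltonian part takes over all of `f` except the term linear in `y`, and all of the even
  -- part of `g`. The constant in `E1` is fixed by the normalization `q(0) = 0`; `A` and `A3` are
  -- what remains of `g` in the degrees `1` and `3` of `y`.
  refine ⟨⟨E0, -F 0, E1 - Polynomial.C ((F 1).eval 0 / 2), Polynomial.C (-1 / 3) * F 2, -c / 4,
    -F 1 - Polynomial.C 2 * (E1 - Polynomial.C ((F 1).eval 0 / 2)), G 1 + (F 0).derivative,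
    3 * c' + c''⟩, ⟨?_, ?_, ?_, ?_, ?_, ?_, ?_⟩, ?_, ?_⟩
  · simp only; omega
  · simp only [Polynomial.natDegree_neg]; omega
  · simp only [Polynomial.natDegree_sub_C]; omega
  · exact (Polynomial.natDegree_C_mul_le _ _).trans (by omega)
  · have h1 : (-F 1).natDegree ≤ 2 := by rw [Polynomial.natDegree_neg]; omega
    have h2 : (E1 - Polynomial.C ((F 1).eval 0 / 2)).natDegree ≤ 2 := by
      rw [Polynomial.natDegree_sub_C]; omega
    exact (Polynomial.natDegree_sub_le_of_le h1
      ((Polynomial.natDegree_C_mul_le _ _).trans h2)).trans (by norm_num)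
  · simp [hE1z]
    ring
  · exact Polynomial.natDegree_add_le_of_degree_le (by omega)
      (NF.natDegree_derivative_le_of (by omega))
  · apply MvPolynomial.funext
    intro v
    simp [NF.f, eval_up', Finset.sum_range_succ, ← hc]
    ring
  · apply MvPolynomial.funext
    intro v
    simp [NF.g, eval_up', Finset.sum_range_succ, ← hc', ← hc'', hE0, hE1]
    ring

end

/-! ### The first coefficients -/

section

open scoped Polynomial

set_option linter.unusedSimpArgs false

variable {a : ℝ}

/-- The polynomial `U`. -/
def potP (a : ℝ) : ℝ[X] :=
  Polynomial.C (1 / 2) * Polynomial.X ^ 2 - Polynomial.C (2 / 3) * Polynomial.X ^ 3 +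
    Polynomial.C (a / 4) * Polynomial.X ^ 4

lemma derivative_potP (a : ℝ) : (potP a).derivative = dUp a := by
  apply Polynomial.funext
  intro x
  simp [potP, dUp, Polynomial.derivative_mul]
  ring

lemma pderiv_zero_X_one : MvPolynomial.pderiv (R := ℝ) 0 (MvPolynomial.X (1 : Fin 2)) = 0 :=
  MvPolynomial.pderiv_X_of_ne (by decide)

/-- The Hamiltonian as a polynomial. -/
def hamP (a : ℝ) : MvPolynomial (Fin 2) ℝ :=
  MvPolynomial.C (1 / 2) * MvPolynomial.X 1 ^ 2 + up (potP a)

lemma dU_eq (a : ℝ) : dU a = up (dUp a) := (up_dUp a).symm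

lemma pderiv_mul' (i : Fin 2) (p q : MvPolynomial (Fin 2) ℝ) :
    MvPolynomial.pderiv i (p * q) = p * MvPolynomial.pderiv i q + q * MvPolynomial.pderiv i p := by
  rw [MvPolynomial.pderiv_mul]; ring

lemma pderiv_sq (i : Fin 2) (p : MvPolynomial (Fin 2) ℝ) :
    MvPolynomial.pderiv i (p ^ 2) = MvPolynomial.C 2 * (p * MvPolynomial.pderiv i p) := by
  rw [sq, pderiv_mul', show (MvPolynomial.C 2 : MvPolynomial (Fin 2) ℝ) = 2 from map_ofNat _ 2]
  ring

lemma pderiv_cube (i : Fin 2) (p : MvPolynomial (Fin 2) ℝ) :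
    MvPolynomial.pderiv i (p ^ 3) = MvPolynomial.C 3 * (p ^ 2 * MvPolynomial.pderiv i p) := by
  rw [pow_succ, pderiv_mul', pderiv_sq, map_ofNat MvPolynomial.C 2, map_ofNat MvPolynomial.C 3]
  ring

lemma pderiv_fourth (i : Fin 2) (p : MvPolynomial (Fin 2) ℝ) :
    MvPolynomial.pderiv i (p ^ 4) = MvPolynomial.C 4 * (p ^ 3 * MvPolynomial.pderiv i p) := by
  rw [pow_succ, pderiv_mul', pderiv_cube, map_ofNat MvPolynomial.C 3, map_ofNat MvPolynomial.C 4]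
  ring

lemma pderiv_fifth (i : Fin 2) (p : MvPolynomial (Fin 2) ℝ) :
    MvPolynomial.pderiv i (p ^ 5) = MvPolynomial.C 5 * (p ^ 4 * MvPolynomial.pderiv i p) := by
  rw [pow_succ, pderiv_mul', pderiv_fourth, map_ofNat MvPolynomial.C 4, map_ofNat MvPolynomial.C 5]
  ring

lemma Chain.zero' (a : ℝ) (f g : MvPolynomial (Fin 2) ℝ) : Chain a f g 0 (fun _ => 1) fun _ => 0 :=
  ⟨rfl, fun j hj => absurd hj (by omega), fun j hj => absurd hj (by omega)⟩

namespace NF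

variable {d : NF}

/-- Here `ω = d(Q - N) + q dH + (A + A3 y²/3) y dx` with `N' = q U'`. The first two terms integrate
to zero over ovals, and integration by parts turns `∮ y³ dx` into `3 ∮ x U' y dx`. -/
lemma gen_zero (d : NF) :
    Gen a d.f d.g 0 (d.A + Polynomial.C d.A3 * (Polynomial.X * dUp a)) := by
  obtain ⟨N, hN, -⟩ := exists_derivative_eq (d.q * dUp a)
  refine ⟨_, _, Chain.zero' a d.f d.g, fun h hh => ?_⟩
  refine Lam_eq_mel (P := d.Q - up N + MvPolynomial.C (d.A3 / 3) *
    (up Polynomial.X * MvPolynomial.X 1 ^ 3)) hh fun x y => ?_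
  simp only [omg, f, g, Q, dU_eq, map_add, map_sub, map_mul, map_neg, map_pow, pderiv_mul',
    pderiv_sq, pderiv_cube, pderiv_fourth, pderiv_fifth, pderiv_zero_up,
    pderiv_one_up, pderiv_zero_X_one, MvPolynomial.pderiv_X_self, MvPolynomial.pderiv_C,
    MvPolynomial.eval_C, MvPolynomial.eval_X, eval_up', hN, Polynomial.eval_mul,
    Polynomial.eval_add, Polynomial.eval_C, Polynomial.eval_X, Matrix.cons_val_zero,
    Matrix.cons_val_one, map_zero, map_one, Polynomial.derivative_X, Polynomial.eval_one]
  ring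

/-- The first step of the chain. -/
lemma pderiv_Q (hA : d.A = 0) (hA3 : d.A3 = 0) {N : ℝ[X]} (hN : N.derivative = d.q * dUp a) :
    MvPolynomial.pderiv 0 (d.Q - up N) = d.g - up d.q * dU a ∧
      MvPolynomial.pderiv 1 (d.Q - up N) = -d.f - up d.q * MvPolynomial.X 1 := by
  constructor <;> apply MvPolynomial.funext <;> intro v <;>
  simp only [f, g, Q, dU_eq, map_add, map_sub, map_mul, map_neg, map_pow, pderiv_mul',
    pderiv_sq, pderiv_cube, pderiv_fourth, pderiv_fifth, pderiv_zero_up,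
    pderiv_one_up, pderiv_zero_X_one, MvPolynomial.pderiv_X_self, MvPolynomial.pderiv_C,
    MvPolynomial.eval_C, MvPolynomial.eval_X, eval_up', hN, Polynomial.eval_mul, hA, hA3,
    Polynomial.eval_add, Polynomial.eval_C, Polynomial.eval_X, Polynomial.eval_zero,
    map_zero, map_one, Polynomial.derivative_X, Polynomial.eval_one] <;>
  ring

/-- A chain from its terms. -/
lemma _root_.CubicPert.Chain.succ {f g : MvPolynomial (Fin 2) ℝ} {k : ℕ}
    {q Q : ℕ → MvPolynomial (Fin 2) ℝ} (h : Chain a f g k q Q) {q' Q' : MvPolynomial (Fin 2) ℝ}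
    (h1 : MvPolynomial.pderiv 0 Q' = q k * g - q' * dU a)
    (h2 : MvPolynomial.pderiv 1 Q' = -(q k * f) - q' * MvPolynomial.X 1) :
    Chain a f g (k + 1) (Function.update q (k + 1) q') (Function.update Q k Q') := by
  refine ⟨?_, fun j hj => ?_, fun j hj => ?_⟩
  · rw [Function.update_of_ne (by omega), h.zero]
  · rcases (Nat.lt_succ_iff.1 hj).eq_or_lt with rfl | hj
    · rw [Function.update_self, Function.update_self, Function.update_of_ne (by omega), h1]
    · rw [Function.update_of_ne (by omega), Function.update_of_ne (by omega),
        Function.update_of_ne (by omega), h.dx j hj]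
  · rcases (Nat.lt_succ_iff.1 hj).eq_or_lt with rfl | hj
    · rw [Function.update_self, Function.update_self, Function.update_of_ne (by omega), h2]
    · rw [Function.update_of_ne (by omega), Function.update_of_ne (by omega),
        Function.update_of_ne (by omega), h.dy j hj]

lemma chain_one (hA : d.A = 0) (hA3 : d.A3 = 0) :
    ∃ q Q, Chain a d.f d.g 1 q Q ∧ q 1 = up d.q := by
  obtain ⟨N, hN, -⟩ := exists_derivative_eq (d.q * dUp a)
  obtain ⟨h1, h2⟩ := pderiv_Q hA hA3 hN
  refine ⟨_, _, (Chain.zero' a d.f d.g).succ (q' := up d.q) (Q' := d.Q - up N) (by rw [h1, one_mul])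
    (by rw [h2, one_mul]), Function.update_self ..⟩

lemma omg_eq (hA : d.A = 0) (hA3 : d.A3 = 0) {N : ℝ[X]} (hN : N.derivative = d.q * dUp a) :
    omg a d.f d.g = MvPolynomial.pderiv 0 (d.Q - up N) * MvPolynomial.X 1 -
      MvPolynomial.pderiv 1 (d.Q - up N) * up (dUp a) := by
  obtain ⟨h1, h2⟩ := pderiv_Q hA hA3 hN
  rw [h1, h2, omg, dU_eq]
  ring

/-- The integral is `∮ q d(Q - N) = -∮ (Q - N) q' dx`. Only the terms `B y` and `B3 y³` of `Q`, odd
in `y`, contribute; the second is integrated by parts through the primitive `c` of `q' B3`. -/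
lemma gen_one (hA : d.A = 0) (hA3 : d.A3 = 0) {c : ℝ[X]}
    (hc : c.derivative = d.q.derivative * d.B3) :
    Gen a d.f d.g 1 (-(d.q.derivative * d.B + Polynomial.C 3 * (c * dUp a))) := by
  obtain ⟨q, Q', hch, hq⟩ := chain_one (a := a) hA hA3
  obtain ⟨N, hN, -⟩ := exists_derivative_eq (d.q * dUp a)
  refine ⟨q, Q', hch, fun h hh => ?_⟩
  refine Lam_eq_mel (P := up d.q * (d.Q - up N) - up c * MvPolynomial.X 1 ^ 3) hh fun x y => ?_
  rw [hq, omg_eq hA hA3 hN]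
  simp only [Q, map_add, map_sub, map_mul, map_neg, map_pow, pderiv_mul',
    pderiv_sq, pderiv_cube, pderiv_fourth, pderiv_fifth, pderiv_zero_up,
    pderiv_one_up, pderiv_zero_X_one, MvPolynomial.pderiv_X_self, MvPolynomial.pderiv_C,
    MvPolynomial.eval_C, MvPolynomial.eval_X, eval_up', hN, hc, Polynomial.eval_mul,
    Polynomial.eval_neg, Matrix.cons_val_zero, Matrix.cons_val_one,
    Polynomial.eval_add, Polynomial.eval_C, Polynomial.eval_X, map_zero, map_one]
  ring

/-- Hamiltonian perturbations. -/
lemma gen_hamiltonian (hA : d.A = 0) (hA3 : d.A3 = 0) (hq : d.q = 0) {k : ℕ} (hk : k ≠ 0) :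
    Gen a d.f d.g k 0 := by
  obtain ⟨h1, h2⟩ := pderiv_Q (a := a) (N := 0) hA hA3 (by simp [hq])
  simp only [hq, up, map_zero, zero_mul, sub_zero] at h1 h2
  refine ⟨fun j => if j = 0 then 1 else 0, fun j => if j = 0 then d.Q else 0, ⟨rfl, fun j _ => ?_,
    fun j _ => ?_⟩, fun h hh => ?_⟩
  · rcases eq_or_ne j 0 with rfl | hj
    · simpa using h1
    · simp [hj]
  · rcases eq_or_ne j 0 with rfl | hj
    · simpa using h2
    · simp [hj]
  · simp [hk, mel, up, Lam]

/-- The second coefficient of the chain if `M₂ = 0`. -/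
def q2 (a : ℝ) (d : NF) (α : ℝ) (D W : ℝ[X]) : MvPolynomial (Fin 2) ℝ :=
  up d.q ^ 2 + up D + MvPolynomial.C (8 * d.e8) * (hamP a * up d.q - up W) -
    MvPolynomial.C α * MvPolynomial.X 1

/-- Modulo exact forms `q ω` equals `q² dH - Q q' dx`. Each term of `Q` gives a multiple of `dH`:
the condition on `q' B` turns `-q' B y dx` into `-α y dH`, while `y² = 2 (H - U)` turns the terms
with `E1` and `e8` into `D dH` and `8 e8 (H q - W) dH`. -/
lemma chain_two (hA : d.A = 0) (hA3 : d.A3 = 0) (hB3 : d.B3 = 0) {α : ℝ} {D W : ℝ[X]}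
    (hα : d.q.derivative * d.B = Polynomial.C α * dUp a)
    (hD : D.derivative = Polynomial.C 2 * (d.q.derivative * d.E1))
    (hW : W.derivative = d.q.derivative * potP a) :
    ∃ q Q, Chain a d.f d.g 2 q Q ∧ q 2 = d.q2 a α D W := by
  obtain ⟨q, Q', hch, hq⟩ := chain_one (a := a) hA hA3
  obtain ⟨Z, hZ, -⟩ := exists_derivative_eq (d.q * d.E0.derivative - dUp a * (d.q ^ 2 + D +
    Polynomial.C (8 * d.e8) * (potP a * d.q - W)))
  have hαe : ∀ x, d.q.derivative.eval x * d.B.eval x = α * (dUp a).eval x := fun x => by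
    simpa using congrArg (Polynomial.eval x) hα
  refine ⟨_, _, hch.succ (q' := d.q2 a α D W) (Q' := up d.q * up d.B * MvPolynomial.X 1 +
    MvPolynomial.C (α / 3) * MvPolynomial.X 1 ^ 3 + MvPolynomial.C (1 / 2) *
    (MvPolynomial.X 1 ^ 2 * (MvPolynomial.C 2 * (up d.q * up d.E1) - up D -
    MvPolynomial.C (8 * d.e8) * (up (potP a) * up d.q - up W))) + up Z) ?_ ?_,
    Function.update_self ..⟩ <;> rw [hq] <;> apply MvPolynomial.funext <;> intro v <;>
  simp only [q2, hamP, f, g, dU_eq, map_add, map_sub, map_mul, map_neg, map_pow, pderiv_mul',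
    pderiv_sq, pderiv_cube, pderiv_fourth, pderiv_fifth, pderiv_zero_up,
    pderiv_one_up, pderiv_zero_X_one, MvPolynomial.pderiv_X_self, MvPolynomial.pderiv_C,
    MvPolynomial.eval_C, MvPolynomial.eval_X, eval_up', hZ, hD, hW, derivative_potP,
    Polynomial.eval_mul, hA, hA3, hB3, Polynomial.eval_sub, Polynomial.eval_pow,
    Polynomial.eval_add, Polynomial.eval_C, Polynomial.eval_X, Polynomial.eval_zero,
    map_zero, map_one]
  · linear_combination (v 1) * hαe (v 0)
  · ring

/-- Write `q₂ = e - α y` with `e` even in `y`. On an oval `∮ e dQ = -∮ Q de` involves only the term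
`B y` of `Q`, and `q' B = α U'` makes it a multiple of `α`. The part `-α y` is integrated against
the even terms of `Q - N`. The contributions of `e8` are exact. -/
lemma gen_two (hA : d.A = 0) (hA3 : d.A3 = 0) (hB3 : d.B3 = 0) {α : ℝ}
    (hα : d.q.derivative * d.B = Polynomial.C α * dUp a) :
    Gen a d.f d.g 2 (-(Polynomial.C α *
      (d.q * dUp a + d.E0.derivative + Polynomial.C 3 * (d.E1 * dUp a)))) := by
  obtain ⟨D, hD, -⟩ := exists_derivative_eq (Polynomial.C 2 * (d.q.derivative * d.E1))
  obtain ⟨W, hW, -⟩ := exists_derivative_eq (d.q.derivative * potP a)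
  obtain ⟨q, Q', hch, hq⟩ := chain_two (a := a) hA hA3 hB3 hα hD hW
  obtain ⟨N, hN, -⟩ := exists_derivative_eq (d.q * dUp a)
  have hαe : ∀ x, d.q.derivative.eval x * d.B.eval x = α * (dUp a).eval x := fun x => by
    simpa using congrArg (Polynomial.eval x) hα
  refine ⟨q, Q', hch, fun h hh => ?_⟩
  refine Lam_eq_mel (P := d.q2 a α D W * (d.Q - up N) -
    MvPolynomial.C α * (MvPolynomial.X 1 * (up N - up d.E0)) +
    MvPolynomial.C (α * d.e8) * MvPolynomial.X 1 ^ 5) hh fun x y => ?_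
  rw [hq, omg_eq hA hA3 hN]
  simp only [Q, q2, hamP, map_add, map_sub, map_mul, map_neg, map_pow, pderiv_mul',
    pderiv_sq, pderiv_cube, pderiv_fourth, pderiv_fifth, pderiv_zero_up,
    pderiv_one_up, pderiv_zero_X_one, MvPolynomial.pderiv_X_self, MvPolynomial.pderiv_C,
    MvPolynomial.eval_C, MvPolynomial.eval_X, eval_up', hN, hD, hW, hB3, derivative_potP,
    Polynomial.eval_mul, Polynomial.eval_neg, Matrix.cons_val_zero, Matrix.cons_val_one,
    Polynomial.eval_add, Polynomial.eval_C, Polynomial.eval_X, Polynomial.eval_zero, map_zero,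
    map_one]
  linear_combination -2 * y ^ 2 * (2 * d.q.eval x + 2 * d.E1.eval x + 4 * d.e8 * y ^ 2) * hαe x

end NF

end

/-! ### The fourth coefficient -/

section

open scoped Polynomial

set_option linter.unusedSimpArgs false

variable {a : ℝ}

namespace NF

variable {d : NF}

/-- Reversible perturbations. -/
lemma gen_three_of_even (hA : d.A = 0) (hA3 : d.A3 = 0) (hB3 : d.B3 = 0) (hB : d.B = 0) :
    Gen a d.f d.g 3 0 := by
  obtain ⟨D, hD, -⟩ := exists_derivative_eq (Polynomial.C 2 * (d.q.derivative * d.E1))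
  obtain ⟨W, hW, -⟩ := exists_derivative_eq (d.q.derivative * potP a)
  obtain ⟨q, Q', hch, hq⟩ := chain_two (a := a) (α := 0) hA hA3 hB3 (by simp [hB]) hD hW
  -- By reversibility everything is expressed in `x` and `H`: from `y² = 2 (H - U)` and `y dy = dH -
  -- U' dx` one gets `q₂ = e0 + H e1` and `ω = (r0 + H r1) dx + (…) dH`.
  set e0 := d.q ^ 2 + D - Polynomial.C (8 * d.e8) * W with he0
  set e1 := Polynomial.C (8 * d.e8) * d.q with he1
  set r0 := d.E0.derivative - Polynomial.C 2 * (potP a * d.E1.derivative) -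
    dUp a * (Polynomial.C 2 * d.E1 + d.q) + Polynomial.C (8 * d.e8) * (potP a * dUp a) with hr0
  set r1 := Polynomial.C 2 * d.E1.derivative - Polynomial.C (8 * d.e8) * dUp a with hr1
  -- Primitives in `x` of the coefficients of the powers of `H` in `(e0 + H e1) (r0 + H r1)`.
  obtain ⟨T0, hT0, -⟩ := exists_derivative_eq (e0 * r0)
  obtain ⟨T1, hT1, -⟩ := exists_derivative_eq (e0 * r1 + e1 * r0)
  obtain ⟨T2, hT2, -⟩ := exists_derivative_eq (e1 * r1)
  refine ⟨_, _, hch.succ (q' := (up e0 + hamP a * up e1) * (MvPolynomial.C 2 * up d.E1 +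
      MvPolynomial.C (4 * d.e8) * MvPolynomial.X 1 ^ 2 + up d.q) - up T1 -
      MvPolynomial.C 2 * (hamP a * up T2))
    (Q' := up T0 + hamP a * up T1 + hamP a ^ 2 * up T2) ?_ ?_, fun h hh => ?_⟩
  · rw [hq]
    apply MvPolynomial.funext
    intro v
    simp only [q2, hamP, f, g, dU_eq, map_add, map_sub, map_mul, map_neg, map_pow, pderiv_mul',
      pderiv_sq, pderiv_cube, pderiv_fourth, pderiv_fifth, pderiv_zero_up,
      pderiv_one_up, pderiv_zero_X_one, MvPolynomial.pderiv_X_self, MvPolynomial.pderiv_C,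
      MvPolynomial.eval_C, MvPolynomial.eval_X, eval_up', hT0, hT1, hT2, he0, he1, hr0, hr1, hD, hW,
      derivative_potP, Polynomial.eval_mul, hA, hA3, hB3, hB, Polynomial.eval_sub,
      Polynomial.eval_pow, Polynomial.eval_add, Polynomial.eval_C, Polynomial.eval_X,
      Polynomial.eval_zero, Polynomial.derivative_zero, map_zero, map_one]
    ring
  · rw [hq]
    apply MvPolynomial.funext
    intro v
    simp only [q2, hamP, f, g, dU_eq, map_add, map_sub, map_mul, map_neg, map_pow, pderiv_mul',
      pderiv_sq, pderiv_cube, pderiv_fourth, pderiv_fifth, pderiv_zero_up,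
      pderiv_one_up, pderiv_zero_X_one, MvPolynomial.pderiv_X_self, MvPolynomial.pderiv_C,
      MvPolynomial.eval_C, MvPolynomial.eval_X, eval_up', he0, he1, hr0, hr1,
      derivative_potP, Polynomial.eval_mul, hA, hA3, hB3, hB, Polynomial.eval_sub,
      Polynomial.eval_pow, Polynomial.eval_add, Polynomial.eval_C, Polynomial.eval_X,
      Polynomial.eval_zero, Polynomial.derivative_zero, map_zero, map_one]
    ring
  -- The next coefficient is even in `y` and `omg` is odd, so the integral vanishes by symmetry.
  · rw [Function.update_self]
    refine Lam_eq_mel (P := 0) hh fun x y => ?_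
    simp only [omg, hamP, f, g, dU_eq, map_add, map_sub, map_mul, map_neg, map_pow,
      MvPolynomial.eval_C, MvPolynomial.eval_X, eval_up', hA, hA3, hB3, hB,
      Polynomial.eval_zero, Polynomial.derivative_zero, map_zero, Matrix.cons_val_zero,
      Matrix.cons_val_one]
    ring

/-- The parts even in `y` are expanded in powers of `H` as in `gen_three_of_even`. In addition `-α
y` of `q₂` meets the term `B y` of `Q`: modulo an exact form, `-α y d(B y)` is `α B dH - α B U' dx`,
whence the summand `α B` in `q3` and the extra term in `T0`. With `U'` written as `V q'`, all
identities become polynomial. -/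
lemma gen_three (hA : d.A = 0) (hA3 : d.A3 = 0) (hB3 : d.B3 = 0) {α β γ g1 : ℝ} {V : ℝ[X]}
    (hV : V * d.q.derivative = dUp a) (hB : d.B = Polynomial.C α * V)
    (hE0 : d.E0 = Polynomial.C β * potP a + Polynomial.C γ)
    (hE1 : d.E1 = Polynomial.C g1 - Polynomial.C (1 / 3) * d.q) :
    Gen a d.f d.g 3 (-(Polynomial.C α * (d.B * d.B.derivative))) := by
  set D := Polynomial.C (2 * g1) * d.q - Polynomial.C (1 / 3) * d.q ^ 2 with hDd
  have hD : D.derivative = Polynomial.C 2 * (d.q.derivative * d.E1) := by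
    apply Polynomial.funext
    intro x
    simp only [hDd, hE1, Polynomial.derivative_sub, Polynomial.derivative_C_mul,
      Polynomial.derivative_pow, Polynomial.eval_mul, Polynomial.eval_sub, Polynomial.eval_C,
      Polynomial.eval_pow]
    push_cast
    ring
  obtain ⟨W, hW, -⟩ := exists_derivative_eq (d.q.derivative * potP a)
  obtain ⟨N, hN, -⟩ := exists_derivative_eq (d.q * dUp a)
  obtain ⟨q, Q', hch, hq⟩ := chain_two (a := a) (α := α) hA hA3 hB3
    (by rw [hB, ← hV]; ring) hD hW
  set e0 := Polynomial.C (2 / 3) * d.q ^ 2 + Polynomial.C (2 * g1) * d.q -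
    Polynomial.C (8 * d.e8) * W with he0
  set e1 := Polynomial.C (8 * d.e8) * d.q with he1
  set r1 := -(Polynomial.C 2 * (Polynomial.C (1 / 3) * d.q.derivative +
    Polynomial.C (4 * d.e8) * dUp a)) with hr1
  set r0 := Polynomial.C (β - 2 * g1) * dUp a - Polynomial.C (1 / 3) * (d.q * dUp a) +
    Polynomial.C 2 * (potP a * (Polynomial.C (1 / 3) * d.q.derivative +
    Polynomial.C (4 * d.e8) * dUp a)) with hr0
  obtain ⟨T0, hT0, -⟩ := exists_derivative_eq (e0 * r0 - Polynomial.C α * (dUp a * d.B))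
  obtain ⟨T1, hT1, -⟩ := exists_derivative_eq (e0 * r1 + e1 * r0)
  obtain ⟨T2, hT2, -⟩ := exists_derivative_eq (e1 * r1)
  -- The next coefficient is split by parity in `y`: `q3` is its even part, and `s0` is the
  -- coefficient of `y` in its odd part.
  set s0 := -(Polynomial.C α * (Polynomial.C β + Polynomial.C (4 / 3) * d.q +
    Polynomial.C (2 * g1)) + Polynomial.C (8 * d.e8) * (d.q * d.B)) with hs0
  set q3 := MvPolynomial.C α * up d.B + (up e0 + hamP a * up e1) * (MvPolynomial.C (2 * g1) +
      up (Polynomial.C (1 / 3) * d.q) + MvPolynomial.C (4 * d.e8) * MvPolynomial.X 1 ^ 2) - up T1 -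
      MvPolynomial.C 2 * (hamP a * up T2) with hq3
  refine ⟨_, _, hch.succ (q' := q3 + up s0 * MvPolynomial.X 1 -
      MvPolynomial.C (4 * d.e8 * α) * MvPolynomial.X 1 ^ 3)
    (Q' := up T0 + hamP a * up T1 + hamP a ^ 2 * up T2 -
      MvPolynomial.C α * (MvPolynomial.X 1 ^ 2 * up d.B) +
      MvPolynomial.X 1 * (up e0 + up (potP a) * up e1) * up d.B +
      MvPolynomial.X 1 ^ 3 * (MvPolynomial.C (4 * d.e8) * (up d.q * up d.B) +
        MvPolynomial.C (α / 3) * (up d.q + MvPolynomial.C β)))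
    ?_ ?_, fun h hh => ?_⟩
  · rw [hq]
    apply MvPolynomial.funext
    intro v
    simp only [q2, hamP, f, g, dU_eq, map_add, map_sub, map_mul, map_neg, map_pow, pderiv_mul',
      pderiv_sq, pderiv_cube, pderiv_fourth, pderiv_fifth, pderiv_zero_up,
      pderiv_one_up, pderiv_zero_X_one, MvPolynomial.pderiv_X_self, MvPolynomial.pderiv_C, hq3, hs0,
      MvPolynomial.eval_C, MvPolynomial.eval_X, eval_up', hT0, hT1, hT2, he0, he1, hr0, hr1, hD, hW,
      derivative_potP, Polynomial.eval_mul, hA, hA3, hB3, Polynomial.eval_sub, hDd, hE0, hE1,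
      Polynomial.derivative_add, Polynomial.derivative_sub, Polynomial.derivative_mul,
      Polynomial.derivative_C, Polynomial.derivative_sq, hB, ← hV, Polynomial.eval_neg,
      Polynomial.eval_pow, Polynomial.eval_add, Polynomial.eval_C, Polynomial.eval_X,
      Polynomial.eval_zero, Polynomial.derivative_zero, map_zero, map_one]
    ring
  · rw [hq]
    apply MvPolynomial.funext
    intro v
    simp only [q2, hamP, f, g, dU_eq, map_add, map_sub, map_mul, map_neg, map_pow, pderiv_mul',
      pderiv_sq, pderiv_cube, pderiv_fourth, pderiv_fifth, pderiv_zero_up,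
      pderiv_one_up, pderiv_zero_X_one, MvPolynomial.pderiv_X_self, MvPolynomial.pderiv_C, hq3, hs0,
      MvPolynomial.eval_C, MvPolynomial.eval_X, eval_up', he0, he1, hr0, hr1,
      Polynomial.eval_mul, hA, hA3, hB3, Polynomial.eval_sub, hDd, hE0, hE1,
      hB, Polynomial.eval_neg,
      Polynomial.eval_pow, Polynomial.eval_add, Polynomial.eval_C, Polynomial.eval_X,
      Polynomial.eval_zero, Polynomial.derivative_zero, map_zero, map_one]
    ring
  · rw [Function.update_self]
    refine Lam_eq_mel (P := q3 * (up d.B * MvPolynomial.X 1) + MvPolynomial.C (α / 3) *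
      (MvPolynomial.X 1 ^ 3 * (MvPolynomial.C β * (up d.q + MvPolynomial.C β) +
        (up e0 + hamP a * up e1)))) hh fun x y => ?_
    rw [omg_eq hA hA3 hN]
    simp only [Q, hamP, dU_eq, map_add, map_sub, map_mul, map_neg, map_pow, pderiv_mul',
      pderiv_sq, pderiv_cube, pderiv_fourth, pderiv_fifth, pderiv_zero_up,
      pderiv_one_up, pderiv_zero_X_one, MvPolynomial.pderiv_X_self, MvPolynomial.pderiv_C, hq3, hs0,
      MvPolynomial.eval_C, MvPolynomial.eval_X, eval_up', hT1, hT2, he0, he1, hr0, hr1, hN, hW,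
      derivative_potP, Polynomial.eval_mul, hB3, Polynomial.eval_sub, hE0, hE1,
      Polynomial.derivative_add, Polynomial.derivative_sub, Polynomial.derivative_mul,
      Polynomial.derivative_C, Polynomial.derivative_sq, hB, ← hV, Polynomial.eval_neg,
      Polynomial.eval_pow, Polynomial.eval_add, Polynomial.eval_C, Polynomial.eval_X,
      Polynomial.eval_zero, Polynomial.derivative_zero, map_zero, map_one, Matrix.cons_val_zero,
      Matrix.cons_val_one]
    ring

end NF

end

/-! ### The spaces of coefficients -/

section

open scoped Polynomial

variable {a : ℝ}

lemma coeff_dUp_two (a : ℝ) : (dUp a).coeff 2 = -2 := by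
  simp [dUp, Polynomial.coeff_X, Polynomial.coeff_X_pow]

lemma coeff_dUp_three (a : ℝ) : (dUp a).coeff 3 = a := by
  simp [dUp, Polynomial.coeff_X, Polynomial.coeff_X_pow]

lemma coeff_dUp_of_lt (a : ℝ) {n : ℕ} (hn : 3 < n) : (dUp a).coeff n = 0 := by
  simp [dUp, Polynomial.coeff_X, Polynomial.coeff_X_pow, show ¬ 1 = n by omega,
    show ¬ n = 2 by omega, show ¬ n = 3 by omega]

lemma natDegree_dUp_le (a : ℝ) : (dUp a).natDegree ≤ 3 := by
  unfold dUp
  compute_degree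

lemma natDegree_dUp (ha : a ≠ 0) : (dUp a).natDegree = 3 :=
  le_antisymm (natDegree_dUp_le a)
    (Polynomial.le_natDegree_of_ne_zero (by rwa [coeff_dUp_three]))

lemma dUp_ne_zero (a : ℝ) : dUp a ≠ 0 := by
  intro h
  have := coeff_dUp_two a
  rw [h] at this
  norm_num at this

lemma Gen.eq_C_mul (ha : a ≠ 0) {f g : MvPolynomial (Fin 2) ℝ} {k : ℕ} {p : ℝ[X]}
    (h : Gen a f g k p) (hp : p.natDegree ≤ 6) (h0 : IsCoeff a f g (k + 1) 0) :
    ∃ c, p = Polynomial.C c * dUp a :=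
  eq_of_mel_eq_zero ha hp fun x hx => congrFun (h.isCoeff.unique h0) ⟨x, hx⟩

lemma IsCoeff.le {f g : MvPolynomial (Fin 2) ℝ} {k : ℕ} {M : levels a → ℝ}
    (h : IsCoeff a f g (k + 1) M) {j : ℕ} (hj : j ≤ k) : IsCoeff a f g j 0 := by
  induction k generalizing M with
  | zero =>
    obtain rfl : j = 0 := by omega
    exact h.of_succ
  | succ k ih =>
    rcases hj.eq_or_lt with rfl | hj
    · exact h.of_succ
    · exact ih h.of_succ (by omega)

namespace NF

variable {d : NF}

/-- As `A` has degree at most `2`, the coefficient of `x⁴` forces `A3 = 0`; then that of `x³`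
excludes a nonzero multiple of `U'`. -/
lemma A_eq_zero (ha : a ≠ 0) (hd : d.IsCubic) (h : IsCoeff a d.f d.g 1 0) :
    d.A = 0 ∧ d.A3 = 0 := by
  have hA := hd.A
  obtain ⟨c, hc⟩ := (gen_zero (a := a) d).eq_C_mul ha (by
    refine Polynomial.natDegree_add_le_of_degree_le (by omega)
      ((Polynomial.natDegree_C_mul_le _ _).trans ?_)
    refine Polynomial.natDegree_mul_le.trans ?_
    rw [Polynomial.natDegree_X]
    have := natDegree_dUp_le a
    omega) h
  have h4 := congrArg (fun p : ℝ[X] => p.coeff 4) hc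
  have h3 := congrArg (fun p : ℝ[X] => p.coeff 3) hc
  simp only [Polynomial.coeff_add, Polynomial.coeff_C_mul, Polynomial.coeff_X_mul,
    coeff_dUp_three, coeff_dUp_of_lt a (show 3 < 4 by norm_num), mul_zero,
    Polynomial.coeff_eq_zero_of_natDegree_lt (show d.A.natDegree < 4 by omega), zero_add] at h4
  have hA3 : d.A3 = 0 := (mul_eq_zero.1 h4).resolve_right ha
  simp only [Polynomial.coeff_add, Polynomial.coeff_C_mul, coeff_dUp_three, hA3, zero_mul,
    Polynomial.coeff_eq_zero_of_natDegree_lt (show d.A.natDegree < 3 by omega), zero_add] at h3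
  have hc0 : c = 0 := (mul_eq_zero.1 h3.symm).resolve_right ha
  rw [hA3, hc0] at hc
  exact ⟨by simpa using hc, hA3⟩

lemma natDegree_p2 (hd : d.IsCubic) {c : ℝ[X]}
    (hcd : c.natDegree ≤ (d.q.derivative * d.B3).natDegree + 1) :
    (-(d.q.derivative * d.B + Polynomial.C 3 * (c * dUp a))).natDegree ≤ 6 := by
  rw [Polynomial.natDegree_neg]
  have hq := natDegree_derivative_le_of (n := 1) hd.q
  have hB := hd.B
  have hB3 := hd.B3
  have hU := natDegree_dUp_le a
  have h1 := Polynomial.natDegree_mul_le (p := d.q.derivative) (q := d.B)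
  have h2 := Polynomial.natDegree_mul_le (p := d.q.derivative) (q := d.B3)
  have h3 := Polynomial.natDegree_mul_le (p := c) (q := dUp a)
  exact Polynomial.natDegree_add_le_of_degree_le (by omega)
    ((Polynomial.natDegree_C_mul_le _ _).trans (by omega))

/-- The perturbations with `M₂ = 0`. -/
lemma eq_zero_or (ha : a ≠ 0) (hd : d.IsCubic) (hA : d.A = 0) (hA3 : d.A3 = 0)
    (h : IsCoeff a d.f d.g 2 0) : d.q = 0 ∨ d.q.derivative ≠ 0 ∧ d.B3 = 0 ∧
      ∃ α, d.q.derivative * d.B = Polynomial.C α * dUp a := by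
  by_cases hq : d.q.derivative = 0
  · left
    have := Polynomial.derivative_eq_zero.1 hq
    obtain ⟨x, hx⟩ := Polynomial.natDegree_eq_zero.1 this
    have h0 := hd.q_zero
    rw [← hx, Polynomial.eval_C] at h0
    rw [← hx, h0, map_zero]
  right
  obtain ⟨c, hc, -, hcd⟩ := exists_derivative_eq (d.q.derivative * d.B3)
  obtain ⟨γ, hγ⟩ := (gen_one (a := a) hA hA3 hc).eq_C_mul ha (natDegree_p2 hd hcd) h
  set R := Polynomial.C 3 * c + Polynomial.C γ with hR
  have hRU : R * dUp a = -(d.q.derivative * d.B) := by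
    rw [hR]; linear_combination -hγ
  have hR' : R.derivative = Polynomial.C 3 * (d.q.derivative * d.B3) := by
    rw [hR, Polynomial.derivative_add, Polynomial.derivative_C_mul, hc, Polynomial.derivative_C,
      add_zero]
  have hB3 : d.B3 = 0 := by
    by_contra hB3
    have hR'0 : R.derivative ≠ 0 := by
      rw [hR']
      exact mul_ne_zero (by simp) (mul_ne_zero hq hB3)
    have hR0 : R ≠ 0 := by
      rintro h0
      rw [h0, Polynomial.derivative_zero] at hR'0
      exact hR'0 rfl
    -- Comparison of degrees: `R` has larger degree than `q' B3`, so `R U'` has degree at least `deg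
    -- q' + 4`, whereas `q' B` has degree at most `deg q' + 3`.
    have e1 : (R * dUp a).natDegree = R.natDegree + 3 := by
      rw [Polynomial.natDegree_mul hR0 (dUp_ne_zero a), natDegree_dUp ha]
    have e2 : R.derivative.natDegree = d.q.derivative.natDegree + d.B3.natDegree := by
      rw [hR', Polynomial.natDegree_C_mul (by norm_num), Polynomial.natDegree_mul hq hB3]
    have e3 : R.derivative.natDegree + 1 ≤ R.natDegree := by
      have := Polynomial.natDegree_derivative_lt (p := R) (by
        intro h0
        exact hR'0 (Polynomial.derivative_of_natDegree_zero h0))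
      omega
    have e4 : (R * dUp a).natDegree ≤ d.q.derivative.natDegree + d.B.natDegree := by
      rw [hRU, Polynomial.natDegree_neg]
      exact Polynomial.natDegree_mul_le
    have := hd.B
    omega
  have hRc : R.derivative = 0 := by rw [hR', hB3, mul_zero, mul_zero]
  obtain ⟨x, hx⟩ := Polynomial.natDegree_eq_zero.1
    (Polynomial.derivative_eq_zero.1 hRc)
  refine ⟨hq, hB3, -x, ?_⟩
  rw [← hx] at hRU
  rw [Polynomial.C_neg]
  linear_combination hRU

lemma natDegree_p3 (hd : d.IsCubic) (α : ℝ) : (-(Polynomial.C α *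
    (d.q * dUp a + d.E0.derivative + Polynomial.C 3 * (d.E1 * dUp a)))).natDegree ≤ 5 := by
  rw [Polynomial.natDegree_neg]
  refine (Polynomial.natDegree_C_mul_le _ _).trans ?_
  have hq := hd.q
  have hE0 := natDegree_derivative_le_of (n := 3) hd.E0
  have hE1 := hd.E1
  have hU := natDegree_dUp_le a
  have h1 := Polynomial.natDegree_mul_le (p := d.q) (q := dUp a)
  have h2 := Polynomial.natDegree_mul_le (p := d.E1) (q := dUp a)
  exact Polynomial.natDegree_add_le_of_degree_le
    (Polynomial.natDegree_add_le_of_degree_le (by omega) (by omega))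
    ((Polynomial.natDegree_C_mul_le _ _).trans (by omega))

/-- The perturbations with `M₃ = 0`. -/
lemma exists_of_third (ha : a ≠ 0) (hd : d.IsCubic) (hA : d.A = 0) (hA3 : d.A3 = 0)
    (hB3 : d.B3 = 0) {α : ℝ} (hα : d.q.derivative * d.B = Polynomial.C α * dUp a) (hα0 : α ≠ 0)
    (h : IsCoeff a d.f d.g 3 0) : ∃ β γ g1, d.E0 = Polynomial.C β * potP a + Polynomial.C γ ∧
      d.E1 = Polynomial.C g1 - Polynomial.C (1 / 3) * d.q := by
  obtain ⟨c, hc⟩ := (gen_two hA hA3 hB3 hα).eq_C_mul ha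
    ((natDegree_p3 hd α).trans (by norm_num)) h
  set S := Polynomial.C (-c / α) - d.q - Polynomial.C 3 * d.E1 with hS
  have hSU : d.E0.derivative = S * dUp a := by
    have hαα : Polynomial.C (-1 / α) * Polynomial.C α = (-1 : ℝ[X]) := by
      rw [← Polynomial.C_mul, div_mul_cancel₀ _ hα0, Polynomial.C_neg, Polynomial.C_1]
    have hcc : Polynomial.C (-c / α) = Polynomial.C (-1 / α) * Polynomial.C c := by
      rw [← Polynomial.C_mul]; congr 1; ring
    rw [hS, hcc]
    linear_combination Polynomial.C (-1 / α) * hc + (d.q * dUp a + d.E0.derivative +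
      Polynomial.C 3 * (d.E1 * dUp a)) * hαα
  -- The degree of `E0'` is at most `3`, that of `U'`, so the quotient is constant.
  have hS0 : S.natDegree = 0 := by
    rcases eq_or_ne S 0 with h0 | h0
    · rw [h0, Polynomial.natDegree_zero]
    · have h1 : (S * dUp a).natDegree = S.natDegree + 3 := by
        rw [Polynomial.natDegree_mul h0 (dUp_ne_zero a), natDegree_dUp ha]
      have h2 := natDegree_derivative_le_of (n := 3) hd.E0
      rw [hSU, h1] at h2
      omega
  obtain ⟨s, hs⟩ := Polynomial.natDegree_eq_zero.1 hS0
  have h3 : (d.E0 - Polynomial.C s * potP a).derivative = 0 := by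
    rw [Polynomial.derivative_sub, Polynomial.derivative_C_mul, derivative_potP, hSU, ← hs, sub_self]
  obtain ⟨γ, hγ⟩ := Polynomial.natDegree_eq_zero.1
    (Polynomial.derivative_eq_zero.1 h3)
  refine ⟨s, γ, (-c / α - s) / 3, by rw [hγ]; ring, ?_⟩
  apply Polynomial.funext
  intro x
  have := congrArg (Polynomial.eval x) (hs.trans hS)
  simp only [Polynomial.eval_sub, Polynomial.eval_mul, Polynomial.eval_C] at this ⊢
  linear_combination (1 / 3) * this

end NF

/-- The coefficients `M_{k+1}` are the integrals of the polynomials of degree at most `d`. -/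
structure Realizes (a : ℝ) (k d : ℕ) : Prop where
  gen : ∀ f g : MvPolynomial (Fin 2) ℝ, f.totalDegree ≤ 3 → g.totalDegree ≤ 3 →
    ∀ M, IsCoeff a f g (k + 1) M → ∃ p : ℝ[X], p.natDegree ≤ d ∧ Gen a f g k p
  surj : ∀ p : ℝ[X], p.natDegree ≤ d → ∃ f g : MvPolynomial (Fin 2) ℝ, f.totalDegree ≤ 3 ∧
    g.totalDegree ≤ 3 ∧ ∃ c, Gen a f g k (p + Polynomial.C c * dUp a)

lemma natDegree_le_of_coeff {p : ℝ[X]} {n : ℕ} (h : p.natDegree ≤ n + 1)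
    (h0 : p.coeff (n + 1) = 0) : p.natDegree ≤ n := by
  rw [Polynomial.natDegree_le_iff_coeff_eq_zero]
  intro m hm
  rcases (Nat.succ_le_of_lt hm).eq_or_lt with rfl | hm
  · exact h0
  · exact Polynomial.coeff_eq_zero_of_natDegree_lt (by omega)

lemma realizes_zero (ha : a ≠ 0) : Realizes a 0 4 := by
  refine ⟨fun f g hf hg M hM => ?_, fun p hp => ?_⟩
  · obtain ⟨d, hd, rfl, rfl⟩ := exists_NF hf hg
    refine ⟨_, ?_, d.gen_zero⟩
    have hA := hd.A
    refine Polynomial.natDegree_add_le_of_degree_le (by omega)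
      ((Polynomial.natDegree_C_mul_le _ _).trans ?_)
    refine Polynomial.natDegree_mul_le.trans ?_
    rw [Polynomial.natDegree_X]
    have := natDegree_dUp_le a
    omega
  -- `A3` removes the coefficient of `x⁴` and `c` that of `x³`; the remaining quadratic polynomial
  -- is `A`.
  · set A3 := p.coeff 4 / a with hA3
    set c := -(p.coeff 3 + 2 * A3) / a with hc
    set A := p + Polynomial.C c * dUp a - Polynomial.C A3 * (Polynomial.X * dUp a) with hA
    have h4 : A.natDegree ≤ 4 := by
      have hU := natDegree_dUp_le a
      have h1 := Polynomial.natDegree_mul_le (p := Polynomial.X) (q := dUp a)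
      rw [Polynomial.natDegree_X] at h1
      exact (Polynomial.natDegree_sub_le_of_le (Polynomial.natDegree_add_le_of_degree_le hp
        ((Polynomial.natDegree_C_mul_le _ _).trans (by omega)))
        ((Polynomial.natDegree_C_mul_le _ _).trans (by omega : _ ≤ 4))).trans (by norm_num)
    have h3 : A.natDegree ≤ 3 := natDegree_le_of_coeff h4 (by
      simp only [hA, Polynomial.coeff_sub, Polynomial.coeff_add, Polynomial.coeff_C_mul,
        Polynomial.coeff_X_mul, coeff_dUp_three, coeff_dUp_of_lt a (show 3 < 3 + 1 by norm_num)]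
      rw [hA3]; field_simp; ring)
    have h2 : A.natDegree ≤ 2 := natDegree_le_of_coeff h3 (by
      simp only [hA, Polynomial.coeff_sub, Polynomial.coeff_add, Polynomial.coeff_C_mul,
        Polynomial.coeff_X_mul, coeff_dUp_two]
      rw [coeff_dUp_three]
      rw [hc]; field_simp; ring)
    let d : NF := ⟨0, 0, 0, 0, 0, 0, A, A3⟩
    have hd : d.IsCubic := ⟨by simp [d], by simp [d], by simp [d], by simp [d], by simp [d],
      by simp [d], h2⟩
    refine ⟨d.f, d.g, hd.totalDegree_f, hd.totalDegree_g, c, ?_⟩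
    have := d.gen_zero (a := a)
    rwa [show d.A + Polynomial.C d.A3 * (Polynomial.X * dUp a) = p + Polynomial.C c * dUp a by
      change A + _ = _; rw [hA]; ring] at this

/-- A point that is not critical for `U`, with the coefficients needed to divide. -/
lemma exists_eval_dUp_ne_zero (a : ℝ) : ∃ t, (dUp a).eval t ≠ 0 := by
  by_contra! h
  exact dUp_ne_zero a (Polynomial.funext fun x => by rw [h x, Polynomial.eval_zero])

lemma realizes_one (ha : a ≠ 0) : Realizes a 1 6 := by
  refine ⟨fun f g hf hg M hM => ?_, fun p hp => ?_⟩
  · obtain ⟨d, hd, rfl, rfl⟩ := exists_NF hf hg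
    obtain ⟨hA, hA3⟩ := NF.A_eq_zero ha hd (hM.le le_rfl)
    obtain ⟨c, hc, -, hcd⟩ := exists_derivative_eq (d.q.derivative * d.B3)
    exact ⟨_, NF.natDegree_p2 hd hcd, NF.gen_one hA hA3 hc⟩
  -- The ansatz is `q' = x - t`. In `R = p - (K + k0) U'` the numbers `k3` and `k2` cancel `x⁶` and
  -- `x⁵`, and `k1` makes `K'` divisible by `x - t`. Finally `k0` makes `R` divisible by `x - t`,
  -- which is possible since `U'(t) ≠ 0`. The two quotients provide `B3` and `B`.
  · obtain ⟨t, ht⟩ := exists_eval_dUp_ne_zero a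
    set k3 := p.coeff 6 / a with hk3
    set k2 := (p.coeff 5 + 2 * k3) / a with hk2
    set k1 := -(3 * k3 * t ^ 2 + 2 * k2 * t) with hk1
    set k0 := p.eval t / (dUp a).eval t - (k3 * t ^ 3 + k2 * t ^ 2 + k1 * t) with hk0
    set K : ℝ[X] := Polynomial.C k3 * Polynomial.X ^ 3 + Polynomial.C k2 * Polynomial.X ^ 2 +
      Polynomial.C k1 * Polynomial.X with hK
    set R := p - (K + Polynomial.C k0) * dUp a with hR
    have hKe : ∀ x, K.eval x = k3 * x ^ 3 + k2 * x ^ 2 + k1 * x := fun x => by simp [hK]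
    have hroot : R.IsRoot t := by
      rw [Polynomial.IsRoot, hR, Polynomial.eval_sub, Polynomial.eval_mul, Polynomial.eval_add, hKe,
        Polynomial.eval_C, hk0]
      field_simp
      ring
    obtain ⟨B, hB⟩ := Polynomial.dvd_iff_isRoot.2 hroot
    have hR6 : R.natDegree ≤ 6 := by
      have hKd : (K + Polynomial.C k0).natDegree ≤ 3 := by
        rw [hK]; compute_degree
      have h1 := Polynomial.natDegree_mul_le (p := K + Polynomial.C k0) (q := dUp a)
      have hU := natDegree_dUp_le a
      exact (Polynomial.natDegree_sub_le_of_le hp (by omega : _ ≤ 6)).trans (by norm_num)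
    have hexp : R = p - (Polynomial.C (k3 * a) * Polynomial.X ^ 6 +
        Polynomial.C (k2 * a - 2 * k3) * Polynomial.X ^ 5 +
        Polynomial.C (k1 * a - 2 * k2 + k3) * Polynomial.X ^ 4 +
        Polynomial.C (k0 * a - 2 * k1 + k2) * Polynomial.X ^ 3 +
        Polynomial.C (-2 * k0 + k1) * Polynomial.X ^ 2 + Polynomial.C k0 * Polynomial.X) := by
      apply Polynomial.funext
      intro x
      simp only [hR, hK, dUp, Polynomial.eval_sub, Polynomial.eval_add, Polynomial.eval_mul,
        Polynomial.eval_C, Polynomial.eval_pow, Polynomial.eval_X]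
      ring
    have hR5 : R.natDegree ≤ 5 := natDegree_le_of_coeff hR6 (by
      rw [hexp]
      simp only [Polynomial.coeff_sub, Polynomial.coeff_add, Polynomial.coeff_C_mul,
        Polynomial.coeff_X_pow, Polynomial.coeff_X]
      norm_num
      rw [hk3]; field_simp; ring)
    have hR4 : R.natDegree ≤ 4 := natDegree_le_of_coeff hR5 (by
      rw [hexp]
      simp only [Polynomial.coeff_sub, Polynomial.coeff_add, Polynomial.coeff_C_mul,
        Polynomial.coeff_X_pow, Polynomial.coeff_X]
      norm_num
      rw [hk2]; field_simp; ring)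
    have hBd : B.natDegree ≤ 3 := by
      rcases eq_or_ne B 0 with h0 | h0
      · simp [h0]
      · rw [hB, Polynomial.natDegree_mul (Polynomial.X_sub_C_ne_zero t) h0,
          Polynomial.natDegree_X_sub_C] at hR4
        omega
    let d : NF := ⟨0, -B, 0, -(Polynomial.C k3 * Polynomial.X +
      Polynomial.C (k3 * t + 2 / 3 * k2)), 0,
      Polynomial.C (1 / 2) * Polynomial.X ^ 2 - Polynomial.C t * Polynomial.X, 0, 0⟩
    have hq' : d.q.derivative = Polynomial.X - Polynomial.C t := by
      apply Polynomial.funext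
      intro x
      simp [d, Polynomial.derivative_mul]
      ring
    have hd : d.IsCubic := by
      refine ⟨by simp [d], ?_, by simp [d], ?_, ?_, by simp [d], by simp [d]⟩
      · simpa only [d, Polynomial.natDegree_neg] using hBd
      · simp only [d, Polynomial.natDegree_neg]
        compute_degree
      · simp only [d]
        compute_degree
    refine ⟨d.f, d.g, hd.totalDegree_f, hd.totalDegree_g, -k0, ?_⟩
    have := NF.gen_one (a := a) (d := d) rfl rfl (c := -(Polynomial.C (1 / 3) * K)) (by
      rw [hq']
      apply Polynomial.funext
      intro x
      simp [d, hK, Polynomial.derivative_mul]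
      rw [hk1]
      ring)
    convert this using 1
    rw [hq']
    change p + _ = -((Polynomial.X - Polynomial.C t) * (-B) + _)
    have h3 : Polynomial.C (3 : ℝ) * Polynomial.C (1 / 3) = 1 := by
      rw [← Polynomial.C_mul]; norm_num
    rw [Polynomial.C_neg]
    linear_combination hB - hR - K * dUp a * h3

lemma realizes_two (ha : a ≠ 0) : Realizes a 2 5 := by
  refine ⟨fun f g hf hg M hM => ?_, fun p hp => ?_⟩
  · obtain ⟨d, hd, rfl, rfl⟩ := exists_NF hf hg
    obtain ⟨hA, hA3⟩ := NF.A_eq_zero ha hd (hM.le (by norm_num))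
    rcases NF.eq_zero_or ha hd hA hA3 (hM.le le_rfl) with hq | ⟨-, hB3, α, hα⟩
    · exact ⟨0, by simp, NF.gen_hamiltonian hA hA3 hq (by norm_num)⟩
    · exact ⟨_, NF.natDegree_p3 hd α, NF.gen_two hA hA3 hB3 hα⟩
  -- With `q = x`, `B = U'` and `α = 1`, the terms `k2 x² + k1 x`, realized through `E1`, remove
  -- `x⁵` and `x⁴`; the cubic remainder is realized by `E0'`.
  · set k2 := p.coeff 5 / a with hk2
    set k1 := (p.coeff 4 + 2 * k2) / a with hk1
    set R := p - (Polynomial.C k2 * Polynomial.X ^ 2 + Polynomial.C k1 * Polynomial.X) * dUp a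
      with hR
    have hexp : R = p - (Polynomial.C (k2 * a) * Polynomial.X ^ 5 +
        Polynomial.C (k1 * a - 2 * k2) * Polynomial.X ^ 4 +
        Polynomial.C (- 2 * k1 + k2) * Polynomial.X ^ 3 +
        Polynomial.C k1 * Polynomial.X ^ 2) := by
      apply Polynomial.funext
      intro x
      simp only [hR, dUp, Polynomial.eval_sub, Polynomial.eval_add, Polynomial.eval_mul,
        Polynomial.eval_C, Polynomial.eval_pow, Polynomial.eval_X]
      ring
    have hR5 : R.natDegree ≤ 5 := by
      have h1 : (Polynomial.C (k2 * a) * Polynomial.X ^ 5 +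
        Polynomial.C (k1 * a - 2 * k2) * Polynomial.X ^ 4 +
        Polynomial.C (- 2 * k1 + k2) * Polynomial.X ^ 3 +
        Polynomial.C k1 * Polynomial.X ^ 2).natDegree ≤ 5 := by compute_degree
      rw [hexp]
      exact (Polynomial.natDegree_sub_le_of_le hp h1).trans (by norm_num)
    have hR4 : R.natDegree ≤ 4 := natDegree_le_of_coeff hR5 (by
      rw [hexp]
      simp only [Polynomial.coeff_sub, Polynomial.coeff_add, Polynomial.coeff_C_mul,
        Polynomial.coeff_X_pow]
      norm_num
      rw [hk2]; field_simp; ring)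
    have hR3 : R.natDegree ≤ 3 := natDegree_le_of_coeff hR4 (by
      rw [hexp]
      simp only [Polynomial.coeff_sub, Polynomial.coeff_add, Polynomial.coeff_C_mul,
        Polynomial.coeff_X_pow]
      norm_num
      rw [hk1]; field_simp; ring)
    obtain ⟨E0, hE0, -, hE0d⟩ := exists_derivative_eq R
    let d : NF := ⟨-E0, dUp a, -(Polynomial.C (k2 / 3) * Polynomial.X ^ 2 +
      Polynomial.C ((k1 + 1) / 3) * Polynomial.X), 0, 0, Polynomial.X, 0, 0⟩
    have hd : d.IsCubic := by
      refine ⟨?_, natDegree_dUp_le a, ?_, by simp [d], ?_, by simp [d], by simp [d]⟩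
      · simp only [d, Polynomial.natDegree_neg]
        omega
      · simp only [d, Polynomial.natDegree_neg]
        compute_degree
      · simp [d]
    refine ⟨d.f, d.g, hd.totalDegree_f, hd.totalDegree_g, 0, ?_⟩
    have := NF.gen_two (a := a) (d := d) rfl rfl rfl (α := 1) (by simp [d])
    convert this using 1
    simp only [d, Polynomial.derivative_neg, hE0]
    rw [hR]
    apply Polynomial.funext
    intro x
    simp only [Polynomial.eval_sub, Polynomial.eval_add, Polynomial.eval_mul, Polynomial.eval_neg,
      Polynomial.eval_C, Polynomial.eval_pow, Polynomial.eval_X]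
    ring

end

/-! ### Dimensions and numbers of limit cycles -/

section

open scoped Polynomial

variable {a : ℝ}

/-- The integral of a polynomial as a linear map. -/
def melMap (a : ℝ) : ℝ[X] →ₗ[ℝ] (levels a → ℝ) where
  toFun p h := mel a p h
  map_add' p q := funext fun h => mel_add p q h.2
  map_smul' c p := funext fun h => by
    rw [Polynomial.smul_eq_C_mul, mel_C_mul c p h.2]; rfl

lemma melMap_C_mul_dUp (c : ℝ) : melMap a (Polynomial.C c * dUp a) = 0 :=
  funext fun h => by
    change mel a _ h = 0
    rw [mel_C_mul _ _ h.2, mel_dUp h.2, mul_zero]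

lemma mem_degreeLT_iff {p : ℝ[X]} {d : ℕ} :
    p ∈ Polynomial.degreeLT ℝ (d + 1) ↔ p.natDegree ≤ d := by
  rw [Polynomial.mem_degreeLT, Polynomial.degree_lt_iff_coeff_zero,
    Polynomial.natDegree_le_iff_coeff_eq_zero]
  exact forall_congr' fun m => by rw [Nat.succ_le_iff]

/-- Rank and nullity: the polynomials of degree at most `d` have dimension `d + 1`, and the kernel
is the line of `U'`. -/
lemma finrank_map_melMap (ha : a ≠ 0) {d : ℕ} (h3 : 3 ≤ d) (h6 : d ≤ 6) :
    Module.finrank ℝ ((Polynomial.degreeLT ℝ (d + 1)).map (melMap a)) = d := by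
  have : Module.Finite ℝ (Polynomial.degreeLT ℝ (d + 1)) :=
    Module.Finite.equiv (Polynomial.degreeLTEquiv ℝ (d + 1)).symm
  have h1 := LinearMap.finrank_range_add_finrank_ker
    ((melMap a).domRestrict (Polynomial.degreeLT ℝ (d + 1)))
  rw [(Polynomial.degreeLTEquiv ℝ (d + 1)).finrank_eq, Module.finrank_fin_fun,
    LinearMap.range_domRestrict] at h1
  have h2 : Module.finrank ℝ
      (LinearMap.ker ((melMap a).domRestrict (Polynomial.degreeLT ℝ (d + 1)))) = 1 := by
    have hU : dUp a ∈ Polynomial.degreeLT ℝ (d + 1) :=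
      mem_degreeLT_iff.2 ((natDegree_dUp_le a).trans h3)
    refine finrank_eq_one (v := (⟨⟨dUp a, hU⟩, ?_⟩ :
      LinearMap.ker ((melMap a).domRestrict (Polynomial.degreeLT ℝ (d + 1))))) ?_ ?_
    · have := melMap_C_mul_dUp (a := a) 1
      rwa [Polynomial.C_1, one_mul] at this
    · intro h
      exact dUp_ne_zero a (congrArg (fun x => (x.1 : ℝ[X])) h)
    · rintro ⟨⟨p, hp⟩, hp0⟩
      obtain ⟨c, hc⟩ := eq_of_mel_eq_zero ha ((mem_degreeLT_iff.1 hp).trans h6)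
        fun h hh => congrFun hp0 ⟨h, hh⟩
      refine ⟨c, ?_⟩
      ext1
      ext1
      change c • dUp a = p
      rw [hc, Polynomial.smul_eq_C_mul]
  omega

lemma Realizes.hasDimension (ha : a ≠ 0) {k d : ℕ} (h : Realizes a k d) (h3 : 3 ≤ d) (h6 : d ≤ 6) :
    HasDimension a (k + 1) d := by
  refine ⟨{(Polynomial.degreeLT ℝ (d + 1)).map (melMap a)}, finite_singleton _,
    singleton_nonempty _, ?_, ?_⟩
  · rintro V rfl
    exact finrank_map_melMap ha h3 h6
  · rw [biUnion_singleton]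
    ext M
    constructor
    · rintro ⟨f, g, hf, hg, hM⟩
      obtain ⟨p, hp, hG⟩ := h.gen f g hf hg M hM
      exact ⟨p, mem_degreeLT_iff.2 hp, hG.isCoeff.unique hM⟩
    · rintro ⟨p, hp, rfl⟩
      obtain ⟨f, g, hf, hg, c, hG⟩ := h.surj p (mem_degreeLT_iff.1 hp)
      refine ⟨f, g, hf, hg, ?_⟩
      have := hG.isCoeff
      change IsCoeff a f g (k + 1) (melMap a (p + _)) at this
      rwa [map_add, melMap_C_mul_dUp, add_zero] at this

lemma mel_add_dUp (p : ℝ[X]) (c : ℝ) {h : ℝ} (hh : h ∈ levels a) :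
    mel a (p + Polynomial.C c * dUp a) h = mel a p h := by
  rw [mel_add _ _ hh, mel_C_mul _ _ hh, mel_dUp hh, mul_zero, add_zero]

lemma ChebDeg.producesAtMost {k d m : ℕ} (hc : ChebDeg a d (m + 1))
    (h : ∀ᶠ b in 𝓝 a, Realizes b k d) :
    ∃ ρ > 0, ∀ᶠ b in 𝓝 a, ProducesAtMost b (k + 1) m ρ := by
  obtain ⟨ρ, hρ, hc⟩ := hc
  refine ⟨ρ, hρ, ?_⟩
  filter_upwards [hc, h] with b hb hR
  refine producesAtMost_of hb.1 fun f g hf hg M hM hM0 => ?_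
  obtain ⟨p, hp, hG⟩ := hR.gen f g hf hg M hM
  obtain ⟨F, e, hF, hch⟩ := hb.2 p hp (by
    rintro c rfl
    exact hM0 (hM.unique hG.isCoeff |>.trans (melMap_C_mul_dUp c)))
  exact ⟨F, hG.isMel fun h hh => by rw [hF, mel_add_dUp _ _ hh], hch⟩

/-- The number `m` is not tied to `d`: near the exceptional parameters the Chebyshev system has one
element more than the dimension of the space of coefficients. -/
lemma Realizes.canProduce {k d m : ℕ} (h : Realizes a k d) {ρ₀ ρ : ℝ}
    (hl : Ioo 0 ρ₀ ⊆ levels a) (hc : ∀ p : ℝ[X], p.natDegree ≤ d →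
      (∀ c, p ≠ Polynomial.C c * dUp a) →
      ∃ F e, p = F.derivative + Polynomial.C e * dUp a ∧ Cheb a ρ₀ (m + 1) F)
    (halt : ∃ F : ℝ[X], F.derivative.natDegree ≤ d ∧
      Alt (mel a F.derivative) (min ρ ρ₀) m) : CanProduce a (k + 1) m ρ := by
  obtain ⟨F, hFd, t, σ, ht1, ht2, ht3⟩ := halt
  have htl : ∀ i, t i ∈ levels a := fun i => hl ⟨(ht2 i).1, (ht2 i).2.trans_le (min_le_right _ _)⟩
  obtain ⟨F', e, hF', hch⟩ := hc _ hFd (by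
    intro c hc
    have := ht3 0
    rw [hc, mel_C_mul _ _ (htl 0), mel_dUp (htl 0), mul_zero, mul_zero] at this
    exact lt_irrefl _ this)
  obtain ⟨f, g, hf, hg, c, hG⟩ := h.surj _ hFd
  have hm : ∀ h ∈ levels a, mel a F.derivative h = mel a F'.derivative h := fun h hh => by
    rw [hF', mel_add_dUp _ _ hh]
  refine canProduce_of hf hg (hG.isMel fun h hh => by rw [mel_add_dUp _ _ hh, hm h hh]) hl hch
    ⟨t, σ, ht1, ht2, fun i => ?_⟩
  rw [← hm _ (htl i)]
  exact ht3 i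

lemma numberOfSmallCycles_of {k d m : ℕ} (hc : ChebDeg a d (m + 1))
    (h : ∀ᶠ b in 𝓝 a, Realizes b k d)
    (halt : ∀ r > 0, Ioo 0 r ⊆ levels a → ∃ F : ℝ[X], F.derivative.natDegree ≤ d ∧
      Alt (mel a F.derivative) r m) : NumberOfSmallCycles a (k + 1) m := by
  refine ⟨hc.producesAtMost h, fun ρ hρ => ?_⟩
  obtain ⟨ρ₀, hρ₀, hc⟩ := hc
  obtain ⟨hl, hc⟩ := hc.self_of_nhds
  exact h.self_of_nhds.canProduce hl hc
    (halt _ (lt_min hρ hρ₀) fun x hx => hl ⟨hx.1, hx.2.trans_le (min_le_right _ _)⟩)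

lemma eventually_ne_zero (ha : a ≠ 0) : ∀ᶠ b in 𝓝 a, b ≠ 0 := isOpen_ne.mem_nhds ha

lemma numberOfSmallCycles_one (ha : a ≠ 0) (h : a ≠ -8 / 3) : NumberOfSmallCycles a 1 3 :=
  numberOfSmallCycles_of (chebDeg_four h) ((eventually_ne_zero ha).mono fun _ => realizes_zero)
    fun _ hr hl => exists_alt_four h (n := 0) hl
      ((e4_expands.hasOrder (by intro h'; exact h (by linarith))).alt hr)

lemma numberOfSmallCycles_two (ha : a ≠ 0) (h : a ≠ -8 / 9) : NumberOfSmallCycles a 2 5 :=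
  numberOfSmallCycles_of (chebDeg_six ha h) ((eventually_ne_zero ha).mono fun _ => realizes_one)
    fun _ hr hl => exists_alt_six ha h (n := 0) hl
      ((e6_expands.hasOrder (e6_kappa_ne_zero ha h)).alt hr)

lemma numberOfSmallCycles_three (ha : a ≠ 0) : NumberOfSmallCycles a 3 4 :=
  numberOfSmallCycles_of (chebDeg_five ha) ((eventually_ne_zero ha).mono fun _ => realizes_two)
    fun _ hr hl => exists_alt_five ha hr hl

/-- A property that holds on a one-sided neighbourhood. -/
lemma exists_Ioo_of_eventually {a : ℝ} {p : ℝ → Prop} (h : ∀ᶠ b in 𝓝 a, b < a → p b) :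
    ∃ δ : ℝ, 0 < δ ∧ ∀ b ∈ Ioo (a - δ) a, p b := by
  obtain ⟨δ, hδ, h⟩ := Metric.eventually_nhds_iff.1 h
  refine ⟨δ, hδ, fun b hb => h ?_ hb.2⟩
  rw [Real.dist_eq, abs_lt]
  constructor <;> linarith [hb.1, hb.2]

/-- The enlarged system at `-8 / 3` bounds the zeros by four and makes four of them simple. For `b <
-8 / 3` the leading coefficient of `e4` is positive and the next one negative, which yields one
zero; the three lower odd powers yield three more. -/
theorem canProduce_four {ρ : ℝ} (hρ : 0 < ρ) :
    ∀ᶠ a in 𝓝 (-8 / 3 : ℝ), a < -8 / 3 → CanProduce a 1 4 ρ := by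
  obtain ⟨ρ₀, hρ₀, hc⟩ := chebDeg_four' (a := -8 / 3) rfl
  have halt := e4_expands.exists_alt (a := -8 / 3)
    ((by fun_prop : Continuous fun b : ℝ => -64 / 3 - 8 * b).continuousAt) (by norm_num)
    (by norm_num) (lt_min hρ hρ₀)
  filter_upwards [hc, halt] with b hb hA hlt
  have hb0 : b ≠ 0 := by intro h; linarith
  refine (realizes_zero hb0).canProduce hb.1 hb.2 ?_
  refine exists_alt_four hlt.ne (n := 1)
    (fun x hx => hb.1 ⟨hx.1, hx.2.trans_le (min_le_right _ _)⟩) (hA ?_)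
  refine mul_neg_of_neg_of_pos (by norm_num) ?_
  linarith

/-- The same mechanism at `-8 / 9`: one zero comes from `e6`, whose leading coefficient is small and
positive for `b < -8 / 9`, and five from the basis elements of lower order. -/
theorem canProduce_six {ρ : ℝ} (hρ : 0 < ρ) :
    ∀ᶠ a in 𝓝 (-8 / 9 : ℝ), a < -8 / 9 → CanProduce a 2 6 ρ := by
  obtain ⟨ρ₀, hρ₀, hc⟩ := chebDeg_six' (a := -8 / 9) rfl
  have halt := e6_expands.exists_alt (a := -8 / 9)
    ((by fun_prop : Continuous fun b : ℝ => -6656 / 3 * b ^ 2 - 2496 * b ^ 3).continuousAt)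
    (by norm_num) (by norm_num) (lt_min hρ hρ₀)
  filter_upwards [hc, halt] with b hb hA hlt
  have hb0 : b ≠ 0 := by intro h; linarith
  refine (realizes_one hb0).canProduce hb.1 hb.2 ?_
  refine exists_alt_six hb0 hlt.ne (n := 1)
    (fun x hx => hb.1 ⟨hx.1, hx.2.trans_le (min_le_right _ _)⟩) (hA ?_)
  refine mul_neg_of_neg_of_pos (by norm_num) ?_
  have : 0 < b ^ 2 := by positivity
  nlinarith

end

/-! ### The lines of fourth coefficients -/

section

open scoped Polynomial

variable {a : ℝ}

/-- The polynomial `U' / x`. -/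
def slopeP (a : ℝ) : ℝ[X] := 1 - Polynomial.C 2 * Polynomial.X + Polynomial.C a * Polynomial.X ^ 2

/-- The divisor `x (a x - κ)` of `U'`. -/
def quadP (a κ : ℝ) : ℝ[X] := Polynomial.X * (Polynomial.C a * Polynomial.X - Polynomial.C κ)

/-- The divisors of `U'` of degree at least `2`, up to factors. -/
def lines (a : ℝ) : Set ℝ[X] := {dUp a, slopeP a} ∪ quadP a '' {κ | κ ^ 2 - 2 * κ + a = 0}

lemma finite_lines (a : ℝ) : (lines a).Finite := by
  refine (toFinite {dUp a, slopeP a}).union (Finite.image _ ?_)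
  refine (toFinite {1 + √(1 - a), 1 - √(1 - a)}).subset fun κ (hκ : _ = _) => ?_
  have h0 : 0 ≤ 1 - a := by nlinarith [sq_nonneg (κ - 1)]
  have h1 : (κ - (1 + √(1 - a))) * (κ - (1 - √(1 - a))) = 0 := by
    linear_combination hκ - Real.sq_sqrt h0
  rcases mul_eq_zero.1 h1 with h | h
  · exact Or.inl (by linarith)
  · exact Or.inr (by simp only [mem_singleton_iff]; linarith)

lemma X_mul_slopeP (a : ℝ) : Polynomial.X * slopeP a = dUp a := by
  rw [slopeP, dUp]
  ring

lemma quadP_mul {κ : ℝ} (ha : a ≠ 0) (hκ : κ ^ 2 - 2 * κ + a = 0) :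
    κ ≠ 0 ∧ quadP a κ * (Polynomial.X - Polynomial.C κ⁻¹) = dUp a := by
  have h0 : κ ≠ 0 := by
    rintro rfl
    exact ha (by simpa using hκ)
  refine ⟨h0, Polynomial.funext fun x => ?_⟩
  simp only [quadP, dUp, Polynomial.eval_mul, Polynomial.eval_sub, Polynomial.eval_add,
    Polynomial.eval_pow, Polynomial.eval_X, Polynomial.eval_C]
  field_simp
  linear_combination (-x ^ 2) * hκ

lemma exists_factor (ha : a ≠ 0) {V : ℝ[X]} (hV : V ∈ lines a) :
    ∃ w, V * w = dUp a ∧ w.natDegree ≤ 1 ∧ V.natDegree ≤ 3 := by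
  rcases hV with (rfl | rfl) | ⟨κ, hκ, rfl⟩
  · exact ⟨1, mul_one _, by simp, natDegree_dUp_le a⟩
  · refine ⟨Polynomial.X, by rw [mul_comm, X_mul_slopeP], by simp, ?_⟩
    unfold slopeP
    compute_degree!
  · refine ⟨_, (quadP_mul ha hκ).2, by simp, ?_⟩
    have : quadP a κ = Polynomial.C a * Polynomial.X ^ 2 - Polynomial.C κ * Polynomial.X := by
      rw [quadP]; ring
    rw [this]
    compute_degree!

/-- The cofactor `w` is constant, or linear with the root `0`, or linear with a root `t` of `1 - 2 t
+ a t²`. In the last case `κ = 1 / t`. -/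
lemma exists_line {V w : ℝ[X]} (h : V * w = dUp a) (hw : w.natDegree ≤ 1) :
    ∃ V₀ ∈ lines a, ∃ s, V = Polynomial.C s * V₀ := by
  obtain ⟨w1, w0, rfl⟩ := Polynomial.exists_eq_X_add_C_of_natDegree_le_one hw
  rcases eq_or_ne w1 0 with rfl | h1
  · have h0 : w0 ≠ 0 := by
      rintro rfl
      refine dUp_ne_zero a ?_
      rw [← h]
      simp
    refine ⟨dUp a, Or.inl (Or.inl rfl), w0⁻¹, ?_⟩
    rw [← h]
    have : Polynomial.C w0⁻¹ * Polynomial.C w0 = (1 : ℝ[X]) := by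
      rw [← Polynomial.C_mul, inv_mul_cancel₀ h0, Polynomial.C_1]
    rw [Polynomial.C_0]
    linear_combination -V * this
  set t := -w0 / w1 with ht
  have hw0 : w0 = -(w1 * t) := by rw [ht]; field_simp
  have hcc : Polynomial.C w1⁻¹ * Polynomial.C w1 = (1 : ℝ[X]) := by
    rw [← Polynomial.C_mul, inv_mul_cancel₀ h1, Polynomial.C_1]
  have hfac : (Polynomial.X - Polynomial.C t) * (Polynomial.C w1 * V) = dUp a := by
    rw [← h, hw0, Polynomial.C_neg, Polynomial.C_mul]
    ring
  have key : ∀ V₀, (Polynomial.X - Polynomial.C t) * V₀ = dUp a → V = Polynomial.C w1⁻¹ * V₀ := by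
    intro V₀ hV₀
    have := mul_left_cancel₀ (Polynomial.X_sub_C_ne_zero t) (hfac.trans hV₀.symm)
    rw [← this]
    linear_combination -V * hcc
  rcases eq_or_ne t 0 with h0 | h0
  · refine ⟨slopeP a, Or.inl (Or.inr rfl), w1⁻¹, key _ ?_⟩
    rw [h0, Polynomial.C_0, sub_zero, X_mul_slopeP]
  · have hr := congrArg (Polynomial.eval t) hfac
    simp only [dUp, Polynomial.eval_mul, Polynomial.eval_sub, Polynomial.eval_add,
      Polynomial.eval_pow, Polynomial.eval_X, Polynomial.eval_C, sub_self, zero_mul] at hr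
    have hr' : 1 - 2 * t + a * t ^ 2 = 0 := by
      refine (mul_eq_zero.1 ?_).resolve_left h0
      linear_combination -hr
    refine ⟨quadP a t⁻¹, Or.inr ⟨t⁻¹, ?_, rfl⟩, w1⁻¹, key _ (Polynomial.funext fun x => ?_)⟩
    · simp only [mem_ofPred_eq]
      field_simp
      linear_combination hr'
    · simp only [quadP, dUp, Polynomial.eval_mul, Polynomial.eval_sub, Polynomial.eval_add,
        Polynomial.eval_pow, Polynomial.eval_X, Polynomial.eval_C]
      field_simp
      linear_combination (-x ^ 2) * hr'

/-- Hamiltonian and reversible perturbations give the zero function, which lies on every line.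
Otherwise `B / α` is a divisor of `U'` with the cofactor `q'` of degree at most `1`. -/
lemma exists_gen_three (ha : a ≠ 0) {f g : MvPolynomial (Fin 2) ℝ} (hf : f.totalDegree ≤ 3)
    (hg : g.totalDegree ≤ 3) {M : levels a → ℝ} (hM : IsCoeff a f g 4 M) :
    ∃ V ∈ lines a, ∃ c, Gen a f g 3 (Polynomial.C c * (V * V.derivative)) := by
  obtain ⟨d, hd, rfl, rfl⟩ := exists_NF hf hg
  obtain ⟨hA, hA3⟩ := NF.A_eq_zero ha hd (hM.le (by norm_num))
  rcases NF.eq_zero_or ha hd hA hA3 (hM.le (by norm_num)) with hq | ⟨hq, hB3, α, hα⟩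
  · refine ⟨dUp a, Or.inl (Or.inl rfl), 0, ?_⟩
    rw [Polynomial.C_0, zero_mul]
    exact NF.gen_hamiltonian hA hA3 hq (by norm_num)
  rcases eq_or_ne α 0 with rfl | hα0
  · refine ⟨dUp a, Or.inl (Or.inl rfl), 0, ?_⟩
    rw [Polynomial.C_0, zero_mul] at hα ⊢
    exact NF.gen_three_of_even hA hA3 hB3 ((mul_eq_zero.1 hα).resolve_left hq)
  obtain ⟨β, γ, g1, hE0, hE1⟩ := NF.exists_of_third ha hd hA hA3 hB3 hα hα0 (hM.le le_rfl)
  have hcc : Polynomial.C α⁻¹ * Polynomial.C α = (1 : ℝ[X]) := by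
    rw [← Polynomial.C_mul, inv_mul_cancel₀ hα0, Polynomial.C_1]
  have hV : Polynomial.C α⁻¹ * d.B * d.q.derivative = dUp a := by
    linear_combination Polynomial.C α⁻¹ * hα + dUp a * hcc
  have hB : d.B = Polynomial.C α * (Polynomial.C α⁻¹ * d.B) := by
    linear_combination -d.B * hcc
  obtain ⟨V₀, hV₀, s, hs⟩ := exists_line hV (NF.natDegree_derivative_le_of (n := 1) hd.q)
  refine ⟨V₀, hV₀, -α ^ 3 * s ^ 2, ?_⟩
  have := NF.gen_three hA hA3 hB3 hV hB hE0 hE1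
  convert this using 1
  rw [hB, hs]
  simp only [Polynomial.derivative_C_mul, Polynomial.C_mul, Polynomial.C_neg, Polynomial.C_pow]
  ring

lemma exists_perturbation_three (ha : a ≠ 0) {V : ℝ[X]} (hV : V ∈ lines a) (c : ℝ) :
    ∃ f g : MvPolynomial (Fin 2) ℝ, f.totalDegree ≤ 3 ∧ g.totalDegree ≤ 3 ∧
      Gen a f g 3 (Polynomial.C c * (V * V.derivative)) := by
  rcases eq_or_ne c 0 with rfl | hc
  · let d : NF := ⟨0, 0, 0, 0, 0, 0, 0, 0⟩
    have hd : d.IsCubic := ⟨by simp [d], by simp [d], by simp [d], by simp [d], by simp [d],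
      by simp [d], by simp [d]⟩
    refine ⟨d.f, d.g, hd.totalDegree_f, hd.totalDegree_g, ?_⟩
    rw [Polynomial.C_0, zero_mul]
    exact NF.gen_hamiltonian rfl rfl rfl (by norm_num)
  obtain ⟨w, hw, hwd, hVd⟩ := exists_factor ha hV
  obtain ⟨q, hq, hq0, hqd⟩ := exists_derivative_eq (Polynomial.C (-c) * w)
  have hqd2 : q.natDegree ≤ 2 := by
    have := Polynomial.natDegree_C_mul_le (-c) w
    omega
  -- With `q' = -c w` one has `α = -c`. The choice `E1 = -q / 3`, `E0 = 0` makes the third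
  -- coefficient vanish.
  let d : NF := ⟨0, V, -(Polynomial.C (1 / 3) * q), 0, 0, q, 0, 0⟩
  have hd : d.IsCubic := by
    refine ⟨by simp [d], hVd, ?_, by simp [d], hqd2, hq0, by simp [d]⟩
    simp only [d, Polynomial.natDegree_neg]
    exact (Polynomial.natDegree_C_mul_le _ _).trans hqd2
  have hcc : Polynomial.C (-c)⁻¹ * Polynomial.C (-c) = (1 : ℝ[X]) := by
    rw [← Polynomial.C_mul, inv_mul_cancel₀ (neg_ne_zero.2 hc), Polynomial.C_1]
  refine ⟨d.f, d.g, hd.totalDegree_f, hd.totalDegree_g, ?_⟩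
  have := NF.gen_three (a := a) (d := d) rfl rfl rfl (α := -c) (β := 0) (γ := 0) (g1 := 0)
    (V := Polynomial.C (-c)⁻¹ * V)
    (by
      change _ * q.derivative = _
      rw [hq]
      linear_combination hw + V * w * hcc)
    (by
      change V = _
      linear_combination -V * hcc)
    (by simp [d]) (by simp [d])
  convert this using 1
  rw [Polynomial.C_neg]
  ring

end

/-! ### Nonvanishing of the fourth coefficients near the equilibrium. -/

section

open scoped Polynomial

variable {a : ℝ}

lemma exists_ball_prod {p : ℝ × ℝ → Prop} (h : ∀ᶠ z in 𝓝 ((0 : ℝ), a), p z) :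
    ∃ ρ > 0, ∀ᶠ b in 𝓝 a, ∀ h ∈ Ioo 0 ρ, p (h, b) := by
  rw [nhds_prod_eq, Filter.Eventually, Filter.mem_prod_iff] at h
  obtain ⟨s, hs, t, ht, hst⟩ := h
  obtain ⟨ρ, hρ, hs⟩ := Metric.mem_nhds_iff.1 hs
  refine ⟨ρ, hρ, ?_⟩
  filter_upwards [ht] with b hb h hh
  exact hst (mk_mem_prod (hs (by rw [mem_ball_zero_iff, Real.norm_of_nonneg hh.1.le]; exact hh.2)) hb)

lemma exists_mel_ne_zero {R P : ℝ → ℝ → ℝ} {F : ℝ → ℝ[X]} {j : ℕ}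
    (hR : Continuous fun z : ℝ × ℝ => R z.1 z.2) (hR0 : R a 0 ≠ 0) (hP : ∀ b, Continuous (P b))
    (hF : ∀ b x, (F b).eval x = P b (potential b x) + x ^ (2 * j + 1) * R b x) :
    ∃ ρ > 0, ∀ᶠ b in 𝓝 a, ∀ h ∈ Ioo 0 ρ, h ∈ levels b → mel b (F b).derivative h ≠ 0 := by
  obtain ⟨A, hA, ⟨W, hW, hA0⟩, hm⟩ := exists_expansion hR a j
  obtain ⟨ρ, hρ, h⟩ := exists_ball_prod (hA.eventually_ne
    (by rw [hA0]; exact mul_ne_zero hW.ne' hR0 : A (0, a) ≠ 0))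
  refine ⟨ρ, hρ, ?_⟩
  filter_upwards [h] with b hb h hh hhl
  rw [hm b h hhl (F b) (P b) (hP b) (hF b)]
  exact mul_ne_zero (pow_ne_zero _ hh.1.ne') (hb h hh)

lemma derivative_half_sq (V : ℝ[X]) :
    (Polynomial.C (1 / 2) * V ^ 2).derivative = V * V.derivative := by
  rw [Polynomial.derivative_C_mul, Polynomial.derivative_sq, ← mul_assoc, ← mul_assoc,
    ← Polynomial.C_mul]
  norm_num

/-- The primitive `V² / 2 = 1 / 2 - 2 x + …` has order `0`. -/
lemma exists_mel_slopeP (a : ℝ) : ∃ ρ > 0, ∀ᶠ b in 𝓝 a, ∀ h ∈ Ioo 0 ρ, h ∈ levels b →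
    mel b (slopeP b * (slopeP b).derivative) h ≠ 0 := by
  simp only [← derivative_half_sq]
  refine exists_mel_ne_zero (F := fun b => Polynomial.C (1 / 2) * slopeP b ^ 2) (j := 0)
    (R := fun b x => -2 + (2 + b) * x - 2 * b * x ^ 2 + b ^ 2 / 2 * x ^ 3) (P := fun _ _ => 1 / 2)
    (by fun_prop) (by norm_num) (fun _ => continuous_const) fun b x => ?_
  simp only [slopeP, Polynomial.eval_mul, Polynomial.eval_sub, Polynomial.eval_add,
    Polynomial.eval_pow, Polynomial.eval_X, Polynomial.eval_C, Polynomial.eval_one]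
  ring

/-- The primitive `U'² / 2 = U - (4 / 3) x³ + …` has order `1`. -/
lemma exists_mel_dUp (a : ℝ) : ∃ ρ > 0, ∀ᶠ b in 𝓝 a, ∀ h ∈ Ioo 0 ρ, h ∈ levels b →
    mel b (dUp b * (dUp b).derivative) h ≠ 0 := by
  simp only [← derivative_half_sq]
  refine exists_mel_ne_zero (F := fun b => Polynomial.C (1 / 2) * dUp b ^ 2) (j := 1)
    (R := fun b x => -4 / 3 + (2 + 3 * b / 4) * x - 2 * b * x ^ 2 + b ^ 2 / 2 * x ^ 3)
    (P := fun _ u => u) (by fun_prop) (by norm_num) (fun _ => continuous_id) fun b x => ?_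
  simp only [dUp, potential, Polynomial.eval_mul, Polynomial.eval_sub, Polynomial.eval_add,
    Polynomial.eval_pow, Polynomial.eval_X, Polynomial.eval_C]
  ring

/-- Modulo `U'` the polynomial `V V'` is `c` times the derivative of `x³ - (3 / 4) (2 - κ) x⁴`, with
`c = κ² (κ - 4 / 3)`. By the equation of `κ`, this factor vanishes only for the parameters `0` and
`8 / 9`; here the hypothesis `a ≠ 8 / 9` enters. A bound on `κ` in terms of `a` makes the estimate
uniform over both roots and over nearby parameters. -/
lemma exists_mel_quadP (h0 : a ≠ 0) (h1 : a ≠ 8 / 9) :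
    ∃ ρ > 0, ∀ᶠ b in 𝓝 a, ∀ h ∈ Ioo 0 ρ, h ∈ levels b → ∀ κ, κ ^ 2 - 2 * κ + b = 0 →
      mel b (quadP b κ * (quadP b κ).derivative) h ≠ 0 := by
  obtain ⟨A₁, hA₁, ⟨W, hW, hA₁0⟩, hm₁⟩ := exists_expansion (R := fun _ _ => 1)
    continuous_const a 1
  obtain ⟨A₂, hA₂, ⟨W₂, -, hA₂0⟩, hm₂⟩ := exists_expansion (R := fun _ x => x)
    continuous_snd a 1
  rw [mul_one] at hA₁0
  rw [mul_zero] at hA₂0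
  have e1 : ∀ᶠ z in 𝓝 ((0 : ℝ), a), W / 2 < A₁ z :=
    hA₁.eventually (lt_mem_nhds (by rw [hA₁0]; linarith))
  have e2 : ∀ᶠ z in 𝓝 ((0 : ℝ), a), (3 + |a|) * |A₂ z| < W / 2 :=
    (hA₂.abs.const_mul (3 + |a|)).eventually (gt_mem_nhds (by
      change (3 + |a|) * |A₂ (0, a)| < _
      rw [hA₂0, abs_zero, mul_zero]; linarith))
  obtain ⟨ρ, hρ, h⟩ := exists_ball_prod (e1.and e2)
  refine ⟨ρ, hρ, ?_⟩
  have hba : ∀ᶠ b in 𝓝 a, a - 1 < b := lt_mem_nhds (by linarith)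
  filter_upwards [h, hba, eventually_ne_zero h0, isOpen_ne.mem_nhds h1] with
    b hb hba hb0 hb1 h hh hhl κ hκ
  obtain ⟨hb₁, hb₂⟩ := hb h hh
  have hb1 : b ≠ 8 / 9 := hb1
  have hbκ : b = 2 * κ - κ ^ 2 := by linarith
  have hk : |2 - κ| ≤ 3 + |a| := by
    have ha := abs_nonneg a
    have hsq : (κ - 1) ^ 2 ≤ (2 + |a|) ^ 2 := by nlinarith [neg_abs_le a]
    have := abs_le.1 (abs_le_of_sq_le_sq hsq (by linarith))
    rw [abs_le]
    constructor <;> linarith [this.1, this.2]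
  set c := κ ^ 2 * (κ - 4 / 3) with hc
  have hc0 : c ≠ 0 := by
    refine mul_ne_zero (pow_ne_zero _ ?_) (sub_ne_zero.2 ?_)
    · rintro rfl
      exact hb0 (by linarith)
    · rintro rfl
      exact hb1 (by linarith)
  have hexp : quadP b κ * (quadP b κ).derivative = Polynomial.C c *
      ((Polynomial.X ^ 3 : ℝ[X]).derivative + Polynomial.C (-(3 / 4) * (2 - κ)) *
        (Polynomial.X ^ 4 : ℝ[X]).derivative) + Polynomial.C (κ ^ 2) * dUp b := by
    apply Polynomial.funext
    intro x
    simp only [quadP, dUp, Polynomial.derivative_mul, Polynomial.derivative_sub,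
      Polynomial.derivative_X, Polynomial.derivative_C, Polynomial.derivative_X_pow,
      Polynomial.eval_mul, Polynomial.eval_sub, Polynomial.eval_add, Polynomial.eval_pow,
      Polynomial.eval_X, Polynomial.eval_C, Polynomial.eval_one, Polynomial.eval_zero]
    push_cast
    rw [hc, hbκ]
    ring
  rw [hexp, mel_add_dUp _ _ hhl, mel_C_mul _ _ hhl, mel_add _ _ hhl, mel_C_mul _ _ hhl,
    hm₁ b h hhl (Polynomial.X ^ 3) (fun _ => 0) continuous_const (fun x => by simp),
    hm₂ b h hhl (Polynomial.X ^ 4) (fun _ => 0) continuous_const (fun x => by simp; ring)]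
  have hpos : 0 < A₁ (h, b) + -(3 / 4) * (2 - κ) * A₂ (h, b) := by
    have h2 : |(2 - κ) * A₂ (h, b)| ≤ (3 + |a|) * |A₂ (h, b)| := by
      rw [abs_mul]
      exact mul_le_mul_of_nonneg_right hk (abs_nonneg _)
    have h3 := le_abs_self ((2 - κ) * A₂ (h, b))
    nlinarith
  have : c * (h ^ (1 + 1) * A₁ (h, b) + -(3 / 4) * (2 - κ) * (h ^ (1 + 1) * A₂ (h, b))) =
      c * h ^ 2 * (A₁ (h, b) + -(3 / 4) * (2 - κ) * A₂ (h, b)) := by ring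
  rw [this]
  exact mul_ne_zero (mul_ne_zero hc0 (pow_ne_zero _ hh.1.ne')) hpos.ne'

/-- The fourth coefficients have no zeros of small energy. -/
lemma exists_mel_lines (h0 : a ≠ 0) (h1 : a ≠ 8 / 9) :
    ∃ ρ > 0, ∀ᶠ b in 𝓝 a, Ioo 0 ρ ⊆ levels b ∧ ∀ V ∈ lines b, ∀ h ∈ Ioo 0 ρ,
      mel b (V * V.derivative) h ≠ 0 := by
  obtain ⟨r0, hr0, H0⟩ := exists_levels a
  obtain ⟨r1, hr1, H1⟩ := exists_mel_slopeP a
  obtain ⟨r2, hr2, H2⟩ := exists_mel_dUp a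
  obtain ⟨r3, hr3, H3⟩ := exists_mel_quadP h0 h1
  refine ⟨min (min r0 r1) (min r2 r3), lt_min (lt_min hr0 hr1) (lt_min hr2 hr3), ?_⟩
  filter_upwards [H0, H1, H2, H3] with b B0 B1 B2 B3
  have hlt : ∀ h ∈ Ioo 0 (min (min r0 r1) (min r2 r3)), h ∈ levels b ∧ h ∈ Ioo 0 r1 ∧
      h ∈ Ioo 0 r2 ∧ h ∈ Ioo 0 r3 := by
    rintro h ⟨hp, hh⟩
    simp only [lt_min_iff] at hh
    exact ⟨B0 ⟨hp, hh.1.1⟩, ⟨hp, hh.1.2⟩, ⟨hp, hh.2.1⟩, ⟨hp, hh.2.2⟩⟩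
  refine ⟨fun h hh => (hlt h hh).1, ?_⟩
  rintro V ((rfl | rfl) | ⟨κ, hκ, rfl⟩) h hh <;> obtain ⟨l0, l1, l2, l3⟩ := hlt h hh
  · exact B2 h l2 l0
  · exact B1 h l1 l0
  · exact B3 h l3 l0 κ hκ

lemma hasDimension_four (h0 : a ≠ 0) (h1 : a ≠ 8 / 9) : HasDimension a 4 1 := by
  refine ⟨(fun V : ℝ[X] => Submodule.span ℝ {melMap a (V * V.derivative)}) '' lines a,
    (finite_lines a).image _, ⟨_, mem_image_of_mem _ (Or.inl (Or.inl rfl))⟩, ?_, ?_⟩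
  · rintro _ ⟨V, hV, rfl⟩
    refine finrank_span_singleton fun hz => ?_
    obtain ⟨ρ, hρ, H⟩ := exists_mel_lines h0 h1
    obtain ⟨hl, H⟩ := H.self_of_nhds
    have hm : ρ / 2 ∈ Ioo 0 ρ := ⟨by linarith, by linarith⟩
    exact H V hV _ hm (congrFun hz ⟨ρ / 2, hl hm⟩)
  · rw [biUnion_image]
    ext M
    simp only [mem_iUnion, SetLike.mem_coe, Submodule.mem_span_singleton]
    have hcm : ∀ (c : ℝ) (V : ℝ[X]), (fun h : levels a => mel a (Polynomial.C c *
        (V * V.derivative)) h) = c • melMap a (V * V.derivative) := fun c V => by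
      rw [← map_smul, Polynomial.smul_eq_C_mul]
      rfl
    constructor
    · rintro ⟨f, g, hf, hg, hM⟩
      obtain ⟨V, hV, c, hG⟩ := exists_gen_three h0 hf hg hM
      exact ⟨V, hV, c, by rw [← hcm]; exact hG.isCoeff.unique hM⟩
    · rintro ⟨V, hV, c, rfl⟩
      obtain ⟨f, g, hf, hg, hG⟩ := exists_perturbation_three h0 hV c
      exact ⟨f, g, hf, hg, by rw [← hcm]; exact hG.isCoeff⟩

lemma canProduce_zero_four (h0 : a ≠ 0) (h1 : a ≠ 8 / 9) (ρ : ℝ) : CanProduce a 4 0 ρ := by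
  have hV : dUp a ∈ lines a := Or.inl (Or.inl rfl)
  obtain ⟨f, g, hf, hg, hG⟩ := exists_perturbation_three h0 hV 1
  rw [Polynomial.C_1, one_mul] at hG
  refine ⟨f, g, hf, hg, _, hG.isCoeff, fun hz => ?_, Fin.elim0, fun i => i.elim0,
    fun i => i.elim0, fun η _ => Eventually.of_forall fun ε => ⟨Fin.elim0, fun i => i.elim0,
      fun i => i.elim0⟩⟩
  obtain ⟨r, hr, H⟩ := exists_mel_lines h0 h1
  obtain ⟨hl, H⟩ := H.self_of_nhds
  have hm : r / 2 ∈ Ioo 0 r := ⟨by linarith, by linarith⟩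
  exact H _ hV _ hm (congrFun hz ⟨r / 2, hl hm⟩)

lemma numberOfSmallCycles_four (h0 : a ≠ 0) (h1 : a ≠ 8 / 9) : NumberOfSmallCycles a 4 0 := by
  refine ⟨?_, fun ρ _ => canProduce_zero_four h0 h1 ρ⟩
  obtain ⟨ρ, hρ, H⟩ := exists_mel_lines h0 h1
  refine ⟨ρ, hρ, ?_⟩
  filter_upwards [H, eventually_ne_zero h0] with b hb hb0
  refine producesAtMost_of hb.1 fun f g hf hg M hM hM0 => ?_
  obtain ⟨V, hV, c, hG⟩ := exists_gen_three hb0 hf hg hM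
  have hc : c ≠ 0 := by
    rintro rfl
    refine hM0 (hM.unique hG.isCoeff |>.trans ?_)
    rw [Polynomial.C_0, zero_mul]
    exact map_zero (melMap b)
  have hF : (Polynomial.C c * (Polynomial.C (1 / 2) * V ^ 2)).derivative =
      Polynomial.C c * (V * V.derivative) := by
    rw [Polynomial.derivative_C_mul, derivative_half_sq]
  refine ⟨_, hG.isMel (F := Polynomial.C c * (Polynomial.C (1 / 2) * V ^ 2))
    fun h _ => by rw [hF], fun ξ hξ => ⟨0, fun hz => ?_⟩⟩
  have hx := hb.1 (hξ 0)
  have := mel_eq_osc (Polynomial.C c * (Polynomial.C (1 / 2) * V ^ 2)) hx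
  have hz' : osc (pol b (Polynomial.C c * (Polynomial.C (1 / 2) * V ^ 2))) 0 (ξ 0) = 0 := hz
  rw [hz', mul_zero, hF, mel_C_mul _ _ hx] at this
  exact mul_ne_zero hc (hb.2 V hV _ (hξ 0)) this

end

end

end CubicPert

theorem theorem5 :
    (∀ ρ : ℝ, 0 < ρ → ∃ δ : ℝ, 0 < δ ∧
      ∀ a ∈ Set.Ioo (-8 / 3 - δ) (-8 / 3 : ℝ), CubicPert.CanProduce a 1 4 ρ) ∧
    (∀ ρ : ℝ, 0 < ρ → ∃ δ : ℝ, 0 < δ ∧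
      ∀ a ∈ Set.Ioo (-8 / 9 - δ) (-8 / 9 : ℝ), CubicPert.CanProduce a 2 6 ρ) ∧
    (∀ a : ℝ, a ≠ 0 → a ≠ 8 / 9 → ∀ k n : ℕ,
      (k = 1 ∧ n = 4 ∧ a ≠ -8 / 3) ∨ (k = 2 ∧ n = 6 ∧ a ≠ -8 / 9) ∨
        (k = 3 ∧ n = 5) ∨ (k = 4 ∧ n = 1) →
      CubicPert.HasDimension a k n ∧ CubicPert.NumberOfSmallCycles a k (n - 1)) := by
  refine ⟨fun ρ hρ => CubicPert.exists_Ioo_of_eventually (CubicPert.canProduce_four hρ),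
    fun ρ hρ => CubicPert.exists_Ioo_of_eventually (CubicPert.canProduce_six hρ), ?_⟩
  rintro a h0 h1 k n (⟨rfl, rfl, h⟩ | ⟨rfl, rfl, h⟩ | ⟨rfl, rfl⟩ | ⟨rfl, rfl⟩)
  · exact ⟨(CubicPert.realizes_zero h0).hasDimension h0 (by norm_num) (by norm_num),
      CubicPert.numberOfSmallCycles_one h0 h⟩
  · exact ⟨(CubicPert.realizes_one h0).hasDimension h0 (by norm_num) (by norm_num),
      CubicPert.numberOfSmallCycles_two h0 h⟩
  · exact ⟨(CubicPert.realizes_two h0).hasDimension h0 (by norm_num) (by norm_num),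
      CubicPert.numberOfSmallCycles_three h0⟩
  · exact ⟨CubicPert.hasDimension_four h0 h1, CubicPert.numberOfSmallCycles_four h0 h1⟩
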